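/- Let $\Bbbk$ be a field of characteristic zero and let $\mathcal C$ be a coaugmented dg cooperad over $\Bbbk$ (in unbounded cochain complexes) with $\mathcal C(0)=0$. Assume that the cokernel $\mathcal C_\circ$ of the coaugmentation carries an ascending filtration by dg $S_n$-submodules $0=\mathcal F^0\mathcal C_\circ\subset\mathcal F^1\mathcal C_\circ\subset\mathcal F^2\mathcal C_\circ\subset\cdots$ with $\bigcup_m\mathcal F^m\mathcal C_\circ=\mathcal C_\circ$ which is compatible with the pseudo-cooperad structure: for every labeled tree $\mathbf t$ with $n$ labeled leaves, whose vertices have $r_1,\dots,r_k$ inputs, the comultiplication satisfies $$\Delta_{\mathbf t}\big(\mathcal F^m\mathcal C_\circ(n)\big)\subset\bigoplus_{m_1+\dots+m_k=m}\mathcal F^{m_1}\mathcal C_\circ(r_1)\otimes\cdots\otimes\mathcal F^{m_k}\mathcal C_\circ(r_k).$$ For a cochain complex $A$ let $\mathcal C(A)=\bigoplus_n\big(\mathcal C(n)\otimes A^{\otimes n}\big)_{S_n}$ be the cofree $\mathcal C$-coalgebra, with comultiplications $\Delta_m:\mathcal C(A)\to(\mathcal C(m)\otimes\mathcal C(A)^{\otimes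 m})^{S_m}$, with the differential $\partial$ coming from $A$ and $\mathcal C$, the projection $p_A:\mathcal C(A)\to A$ and the inclusion $A\subset\mathcal C(A)$. A homotopy algebra of type $\mathcal C$ (a $\mathrm{Cobar}(\mathcal C)$-algebra) is a cochain complex $A$ with a degree $1$ coderivation $Q_A$ of $\mathcal C(A)$ such that $Q_A|_A=0$ and $(\partial+Q_A)^2=0$. An $\infty$-morphism $F:A\to B$ is a homomorphism of dg $\mathcal C$-coalgebras $(\mathcal C(A),\partial+Q_A)\to(\mathcal C(B),\partial+Q_B)$; put $F'=p_B\circ F$. It is an $\infty$ quasi-isomorphism if its linear term $F'|_A:A\to B$ is a quasi-isomorphism. Let $\mathbf{map}(A,B)$ be the graded vector space $\mathrm{Hom}(\mathcal C(A),B)$ with the degree $1$ brackets $$\{f\}=\partial_B\circ f-(-1)^{|f|}f\circ(\partial+Q_A)+p_B\circ Q_B\circ(1\otimes f)\circ\Delta_1,$$ $$\{f_1,\dots,f_m\}=p_B\circ Q_B\circ(1\otimes f_1\otimes\cdots\otimes f_m)\circ\Delta_m\quad(m\ge2),$$ with the arity filtration $$\mathcal F^{\mathrm{ari}}_m\mathbf{map}(A,B)=\{f\mid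 f|_{(\mathcal C(n)\otimes A^{\otimes n})_{S_n}}=0\ \ \forall n<m\}.$$ For homotopy algebras $B_1,B_2,B_3$ of type $\mathcal C$, the composition morphism $\mathcal U:\mathbf{map}(B_2,B_3)\oplus\mathbf{map}(B_1,B_2)\to\mathbf{map}(B_1,B_3)$ has the components $$\mathcal U'(g_1\oplus f_1,\dots,g_n\oplus f_n)=\sum_i\pm\,g_i\circ(1\otimes f_1\otimes\cdots\widehat{f_i}\cdots\otimes f_n)\circ\Delta_{n-1},$$ with the Koszul sign. The twist of $\mathcal U$ by a Maurer–Cartan element $\alpha$ has the components $\sum_{r\ge0}\frac1{r!}\,\mathcal U'(\alpha,\dots,\alpha,x_1,\dots,x_n)$, with $r$ copies of $\alpha$. Let $A_1,A_2,A_3$ be homotopy algebras of type $\mathcal C$ and let $F:A_1\to A_2$ be an $\infty$-morphism. Let $$\mathcal U_{A_3A_1A_2}:\mathbf{map}(A_3,A_1)\to\mathbf{map}(A_3,A_2)\quad\text{and}\quad \mathcal U_{A_1A_2A_3}:\mathbf{map}(A_2,A_3)\to\mathbf{map}(A_1,A_3)$$ be obtained by twisting $\mathcal U$ by $F'\oplus0$,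 respectively by $0\oplus F'$, and restricting to $0\oplus\mathbf{map}(A_3,A_1)$, respectively to $\mathbf{map}(A_2,A_3)\oplus0$. Then both are morphisms of $\mathfrak S\mathsf{Lie}_\infty$-algebras (shifted $L_\infty$-algebras), and they are compatible with the arity filtrations: their components map $\mathcal F^{\mathrm{ari}}_{m_1}\times\cdots\times\mathcal F^{\mathrm{ari}}_{m_n}$ into $\mathcal F^{\mathrm{ari}}_{m_1+\cdots+m_n}$. If moreover $F$ is an $\infty$ quasi-isomorphism, then for every $m\ge1$ they restrict to $\mathfrak S\mathsf{Lie}_\infty$ quasi-isomorphisms (morphisms of $\mathfrak S\mathsf{Lie}_\infty$-algebras whose linear terms are quasi-isomorphisms of complexes) $$\mathcal F^{\mathrm{ari}}_m\mathbf{map}(A_3,A_1)\to\mathcal F^{\mathrm{ari}}_m\mathbf{map}(A_3,A_2)\quad\text{and}\quad\mathcal F^{\mathrm{ari}}_m\mathbf{map}(A_2,A_3)\to\mathcal F^{\mathrm{ari}}_m\mathbf{map}(A_1,A_3).$$ -/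

import Mathlib

open scoped TensorProduct DirectSum

noncomputable section

namespace HoAlgebra

universe u

/-! ### Graded and differential graded vector spaces, Koszul signs -/

/-- The raw data of a `ℤ`-graded cochain complex: a vector space, its homogeneous pieces `gr n`, the
projections `par b` onto the parts of even (`b = 0`) and odd (`b = 1`) degree, and the differential.
The laws are in `DGVect`; the constructions below (tensor products, cofree coalgebras) are first made
on this level. -/
structure DGData (k : Type u) [Field k] where
  carrier : Type u
  [acg : AddCommGroup carrier]
  [mod : Module k carrier]
  gr : ℤ → Submodule k carrier
  par : ZMod 2 → carrier →ₗ[k] carrier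
  d : carrier →ₗ[k] carrier

attribute [instance] DGData.acg DGData.mod

instance (k : Type u) [Field k] : CoeSort (DGData k) (Type u) := ⟨DGData.carrier⟩

/-- A (possibly unbounded) cochain complex of `k`-vector spaces. -/
structure DGVect (k : Type u) [Field k] extends DGData k where
  isInternal : DirectSum.IsInternal gr
  par_apply : ∀ (n : ℤ) (x : carrier), x ∈ gr n →
    ∀ b : ZMod 2, par b x = if (n : ZMod 2) = b then x else 0
  d_mem : ∀ (n : ℤ) (x : carrier), x ∈ gr n → d x ∈ gr (n + 1)
  d_d : ∀ x : carrier, d (d x) = 0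

instance (k : Type u) [Field k] : CoeSort (DGVect k) (Type u) := ⟨fun V => V.carrier⟩

variable {k : Type u} [Field k]

variable (k) in
/-- `(-1)^x` for `x : ℤ/2`. -/
def ksign (x : ZMod 2) : k := if x = 0 then 1 else -1

/-- The exponent of the Koszul sign for sorting a word of homogeneous letters, the `i`-th of parity
`t i`, by the values of `p` (letters with the same value keep their order). -/
def invParity {J K : Type} [Fintype J] [LinearOrder J] [LinearOrder K]
    (p : J → K) (t : J → ZMod 2) : ZMod 2 :=
  ∑ j, ∑ j', if j < j' ∧ p j' < p j then t j * t j' else 0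

/-- The exponent of the sign for moving, for every `l : K`, a letter of parity `s l` to the left past
all the letters of parity `t j` with `q j < l`. -/
def crossParity {J K : Type} [Fintype J] [Fintype K] [LinearOrder K]
    (q : J → K) (s : K → ZMod 2) (t : J → ZMod 2) : ZMod 2 :=
  ∑ j, ∑ l, if q j < l then s l * t j else 0

/-- The operator `x ↦ (-1)^(n |x|) x`. -/
def DGData.tw (V : DGData k) (n : ℤ) : V →ₗ[k] V := V.par 0 + ksign k (n : ZMod 2) • V.par 1

/-- The map `∑ᵢ 1 ⊗ ⋯ ⊗ D i ⊗ ⋯ ⊗ 1` on a tensor product, for maps `D i` of degree one: it takes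
`x₁ ⊗ ⋯ ⊗ xₘ` to `∑ᵢ (-1)^(|x₁| + ⋯ + |xᵢ₋₁|) x₁ ⊗ ⋯ ⊗ D i xᵢ ⊗ ⋯ ⊗ xₘ`. -/
def koszulDer {J : Type} [Fintype J] [LinearOrder J] (M : J → DGData k)
    (D : ∀ j, M j →ₗ[k] M j) : (⨂[k] j, M j) →ₗ[k] ⨂[k] j, M j :=
  ∑ i, PiTensorProduct.map fun j => if j < i then (M j).tw 1 else if j = i then D j else LinearMap.id

/-- The tensor product of two complexes. -/
abbrev DGData.tensor (V W : DGData k) : DGData k where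
  carrier := V ⊗[k] W
  gr n := Submodule.span k {z | ∃ (i j : ℤ) (x : V) (y : W),
    i + j = n ∧ x ∈ V.gr i ∧ y ∈ W.gr j ∧ z = x ⊗ₜ y}
  par b := ∑ c : ZMod 2, TensorProduct.map (V.par c) (W.par (b - c))
  d := TensorProduct.map V.d LinearMap.id + TensorProduct.map (V.tw 1) W.d

/-- The tensor product of a finite linearly ordered family of complexes. -/
abbrev DGData.pi {J : Type} [Fintype J] [LinearOrder J] (M : J → DGData k) : DGData k where
  carrier := ⨂[k] j, M j
  gr n := Submodule.span k {z | ∃ (e : J → ℤ) (x : ∀ j, M j),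
    ∑ j, e j = n ∧ (∀ j, x j ∈ (M j).gr (e j)) ∧ z = PiTensorProduct.tprod k x}
  par b := ∑ s : J → ZMod 2, if ∑ j, s j = b then PiTensorProduct.map fun j => (M j).par (s j) else 0
  d := koszulDer M fun j => (M j).d

/-- Maps of complexes (of degree zero). -/
def IsChainMap (V W : DGData k) (f : V →ₗ[k] W) : Prop :=
  (∀ n, ∀ x ∈ V.gr n, f x ∈ W.gr n) ∧ ∀ x, f (V.d x) = W.d (f x)

/-- The reordering of tensor factors along a bijection `e`, with the Koszul sign:
`⨂ xⱼ ↦ ± ⨂ x_{e⁻¹ j'}`. -/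
def reorder {J J' : Type} [Fintype J] [LinearOrder J] [LinearOrder J'] (e : J ≃ J')
    (M : J → DGData k) : (⨂[k] j, M j) →ₗ[k] ⨂[k] j' : J', M (e.symm j') :=
  (PiTensorProduct.reindex k (fun j => (M j).carrier) e).toLinearMap ∘ₗ
    ∑ s : J → ZMod 2, ksign k (invParity e s) • PiTensorProduct.map fun j => (M j).par (s j)

/-- Replacing one letter of a word replaces one letter of one of its groups along `q`. -/
theorem group_update {J K : Type} [DecidableEq J] [DecidableEq K] (N : J → DGData k) (q : J → K)
    (x : ∀ j, N j) (j : J) (w : N j) :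
    (fun l => PiTensorProduct.tprod k fun i : {i // q i = l} => Function.update x j w i.1) =
      Function.update (fun l => PiTensorProduct.tprod k fun i : {i // q i = l} => x i.1) (q j)
        (PiTensorProduct.tprod k
          (Function.update (fun i : {i // q i = q j} => x i.1) ⟨j, rfl⟩ w)) := by
  funext l
  by_cases h : l = q j
  · subst h
    rw [Function.update_self]
    congr 1
    funext ⟨i, hi⟩
    by_cases hij : i = j
    · subst hij
      simp
    · have : (⟨i, hi⟩ : {i // q i = q j}) ≠ ⟨j, rfl⟩ := fun h' => hij (congrArg Subtype.val h')
      simp [hij, this]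
  · rw [Function.update_of_ne h]
    congr 1
    funext ⟨i, hi⟩
    have hij : i ≠ j := by
      rintro rfl
      exact h hi.symm
    simp [hij]

/-- The grouping of tensor factors along `q : J → K`, without signs:
`⨂ⱼ xⱼ ↦ ⨂ₗ ⨂_{q j = l} xⱼ`. -/
def nest {J K : Type} (N : J → DGData k) (q : J → K) :
    (⨂[k] j, N j) →ₗ[k] ⨂[k] l : K, ⨂[k] j : {j // q j = l}, N j.1 :=
  PiTensorProduct.lift
    { toFun := fun x => PiTensorProduct.tprod k fun l =>
        PiTensorProduct.tprod k fun j : {j // q j = l} => x j.1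
      map_update_add' := by
        intro _ x j y z
        classical
        simp only [group_update, MultilinearMap.map_update_add]
      map_update_smul' := by
        intro _ x j c y
        classical
        simp only [group_update, MultilinearMap.map_update_smul] }

/-- The canonical isomorphism (with its Koszul sign)
`(⨂ₗ Mₗ) ⊗ (⨂ⱼ Nⱼ) → ⨂ₗ (Mₗ ⊗ ⨂_{q j = l} Nⱼ)` of the symmetric monoidal category of graded vector
spaces, for `q : J → K`. -/
def regroup {J K : Type} [Fintype J] [LinearOrder J] [Fintype K] [LinearOrder K]
    (M : K → DGData k) (N : J → DGData k) (q : J → K) :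
    ((⨂[k] l, M l) ⊗[k] (⨂[k] j, N j)) →ₗ[k]
      ⨂[k] l : K, (M l ⊗[k] (⨂[k] j : {j // q j = l}, N j.1)) :=
  TensorProduct.lift (PiTensorProduct.map₂ fun l => TensorProduct.mk k (M l) _) ∘ₗ
    TensorProduct.map LinearMap.id (nest N q) ∘ₗ
      ∑ s : K → ZMod 2, ∑ t : J → ZMod 2, ksign k (invParity q t + crossParity q s t) •
        TensorProduct.map (PiTensorProduct.map fun l => (M l).par (s l))
          (PiTensorProduct.map fun j => (N j).par (t j))

/-! ### Cooperads -/

/-- The bijection between a fibre of the restriction of `p` to a fibre of `q ∘ p` and a fibre of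
`p`. -/
def fibreEquiv {I J K : Type} (p : I → J) (q : J → K) (l : K) (j : {j // q j = l}) :
    {i : {i // q (p i) = l} // (⟨p i.1, i.2⟩ : {j // q j = l}) = j} ≃ {i // p i = j.1} where
  toFun i := ⟨i.1.1, congrArg Subtype.val i.2⟩
  invFun i := ⟨⟨i.1, by rw [i.2]; exact j.2⟩, Subtype.ext i.2⟩
  left_inv _ := rfl
  right_inv _ := rfl

/-- A coaugmented dg cooperad, in the coordinate-free form: a functor `obj` from finite sets and
bijections to cochain complexes (so `obj (Fin n)`, with its action of the symmetric group, is the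
`n`-th space `C(n)`), together with comultiplications along the two-level trees, i.e. for every map
`p : I → J` of finite sets (leaves to vertices of the upper level), `J` being linearly ordered, a map
`C(I) → C(J) ⊗ ⨂ⱼ C(p⁻¹(j))`. -/
structure Cooperad (k : Type u) [Field k] where
  obj : (I : Type) → [Finite I] → DGVect k
  map : {I J : Type} → [Finite I] → [Finite J] → (I ≃ J) → obj I →ₗ[k] obj J
  map_refl : ∀ (I : Type) [Finite I], map (Equiv.refl I) = LinearMap.id
  map_trans : ∀ {I J K : Type} [Finite I] [Finite J] [Finite K] (e : I ≃ J) (f : J ≃ K),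
    map (e.trans f) = map f ∘ₗ map e
  map_chain : ∀ {I J : Type} [Finite I] [Finite J] (e : I ≃ J),
    IsChainMap (obj I).toDGData (obj J).toDGData (map e)
  /-- The comultiplication. -/
  decomp : {I J : Type} → [Finite I] → [Fintype J] → [LinearOrder J] → (p : I → J) →
    obj I →ₗ[k] (obj J ⊗[k] (⨂[k] j, obj {i // p i = j}))
  decomp_chain : ∀ {I J : Type} [Finite I] [Fintype J] [LinearOrder J] (p : I → J),
    IsChainMap (obj I).toDGData
      ((obj J).toDGData.tensor (DGData.pi fun j => (obj {i // p i = j}).toDGData)) (decomp p)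
  /-- Naturality with respect to relabelling the leaves. -/
  decomp_leaves : ∀ {I I' J : Type} [Finite I] [Finite I'] [Fintype J] [LinearOrder J]
    (e : I ≃ I') (p : I' → J),
    decomp p ∘ₗ map e =
      TensorProduct.map LinearMap.id (PiTensorProduct.map fun j =>
        map (e.subtypeEquiv (p := fun i => p (e i) = j) (q := fun i => p i = j)
          fun _ => Iff.rfl)) ∘ₗ decomp (fun i => p (e i))
  /-- Naturality with respect to relabelling (and reordering) the vertices of the upper level. -/
  decomp_vertices : ∀ {I J J' : Type} [Finite I] [Fintype J] [LinearOrder J] [Fintype J']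
    [LinearOrder J'] (p : I → J) (f : J ≃ J'),
    decomp (fun i => f (p i)) =
      TensorProduct.map (map f)
        ((PiTensorProduct.map fun j' : J' =>
            map (Equiv.subtypeEquivRight (p := fun i => p i = f.symm j') (q := fun i => f (p i) = j')
              fun _ => f.eq_symm_apply)) ∘ₗ
          reorder f fun j => (obj {i // p i = j}).toDGData) ∘ₗ decomp p
  /-- Coassociativity, for the three-level tree given by `p : I → J` and `q : J → K`. -/
  coassoc : ∀ {I J K : Type} [Finite I] [Fintype J] [LinearOrder J] [Fintype K] [LinearOrder K]
    (p : I → J) (q : J → K),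
    TensorProduct.map LinearMap.id
        (regroup (fun l => (obj {j // q j = l}).toDGData) (fun j => (obj {i // p i = j}).toDGData) q) ∘ₗ
      (TensorProduct.assoc k _ _ _).toLinearMap ∘ₗ
        TensorProduct.map (decomp q) LinearMap.id ∘ₗ decomp p =
    TensorProduct.map LinearMap.id (PiTensorProduct.map fun l =>
        TensorProduct.map LinearMap.id (PiTensorProduct.map fun j : {j // q j = l} =>
          map (fibreEquiv p q l j)) ∘ₗ
        decomp (fun i : {i // q (p i) = l} => (⟨p i.1, i.2⟩ : {j // q j = l}))) ∘ₗ
      decomp (fun i => q (p i))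
  /-- The counit `C(1) → k`. -/
  counit : obj (Fin 1) →ₗ[k] k
  counit_deg : ∀ n : ℤ, n ≠ 0 → ∀ x ∈ (obj (Fin 1)).gr n, counit x = 0
  counit_d : ∀ x, counit ((obj (Fin 1)).d x) = 0
  /-- The counit at the root. -/
  counit_left : ∀ {I : Type} [Finite I] (x : obj I),
    TensorProduct.lid k _ (TensorProduct.map counit
      ((map (Equiv.subtypeUnivEquiv (p := fun i : I => (fun _ => (0 : Fin 1)) i = 0)
          fun _ => rfl)) ∘ₗ
        (PiTensorProduct.subsingletonEquiv (0 : Fin 1)).toLinearMap)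
      (decomp (fun _ : I => (0 : Fin 1)) x)) = x
  /-- The counit at the upper level. -/
  counit_right : ∀ {I : Type} [Fintype I] [LinearOrder I] (x : obj I),
    TensorProduct.rid k _ (TensorProduct.map LinearMap.id
      (PiTensorProduct.lift (MultilinearMap.mkPiRing k I 1 |>.compLinearMap fun i =>
        counit ∘ₗ map (Equiv.ofUnique {i' // i' = i} (Fin 1))))
      (decomp (fun i : I => i) x)) = x
  /-- The coaugmentation: the image in `C(1)` of `1 ∈ k`. -/
  unit : obj (Fin 1)
  unit_deg : unit ∈ (obj (Fin 1)).gr 0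
  unit_d : (obj (Fin 1)).d unit = 0
  counit_unit : counit unit = 1
  decomp_unit : decomp (fun i : Fin 1 => i) unit =
    unit ⊗ₜ PiTensorProduct.tprod k fun i : Fin 1 =>
      map (Equiv.ofUnique (Fin 1) {i' // i' = i}) unit
  decomp_unit_of_card_ne : ∀ {J : Type} [Fintype J] [LinearOrder J] (p : Fin 1 → J),
    Fintype.card J ≠ 1 → decomp p unit = 0

/-- The cooperad is reduced: `C(0) = 0`. -/
def Cooperad.IsReduced (C : Cooperad k) : Prop :=
  ∀ (I : Type) [Finite I] [IsEmpty I] (x : C.obj I), x = 0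

/-- The image of the coaugmentation in `C(I)`: a line if `I` has one element, zero otherwise. -/
def Cooperad.coaug (C : Cooperad k) (I : Type) [Finite I] : Submodule k (C.obj I) :=
  Submodule.span k {x | ∃ e : Fin 1 ≃ I, x = C.map e C.unit}

/-- A cocomplete ascending filtration `0 = F⁰ ⊆ F¹ ⊆ F² ⊆ ⋯` on the cokernel of the coaugmentation,
by subcomplexes stable under bijections and compatible with the pseudo-cooperad structure. The
filtration is given by the preimages `fil m I` of its terms in `C(I)`; thus `fil 0` is the image of
the coaugmentation. A vertex of a two-level tree which is decorated by the coaugmentation can be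
erased, so that the condition `decomp_mem` is the compatibility with the comultiplications of the
cokernel along all trees obtained in this way. -/
structure Cooperad.Filtration (C : Cooperad k) where
  fil : ℕ → (I : Type) → [Finite I] → Submodule k (C.obj I)
  fil_zero : ∀ (I : Type) [Finite I], fil 0 I = C.coaug I
  fil_mono : ∀ (m : ℕ) (I : Type) [Finite I], fil m I ≤ fil (m + 1) I
  cocomplete : ∀ (I : Type) [Finite I] (x : C.obj I), ∃ m, x ∈ fil m I
  fil_graded : ∀ (m : ℕ) (I : Type) [Finite I], fil m I ≤ ⨆ n : ℤ, fil m I ⊓ (C.obj I).gr n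
  d_mem : ∀ (m : ℕ) (I : Type) [Finite I], ∀ x ∈ fil m I, (C.obj I).d x ∈ fil m I
  map_mem : ∀ (m : ℕ) {I J : Type} [Finite I] [Finite J] (e : I ≃ J),
    ∀ x ∈ fil m I, C.map e x ∈ fil m J
  decomp_mem : ∀ (m : ℕ) {I J : Type} [Finite I] [Fintype J] [LinearOrder J] (p : I → J),
    ∀ x ∈ fil m I, C.decomp p x ∈ Submodule.span k
      {z | ∃ (m₀ : ℕ) (m' : J → ℕ) (y : C.obj J) (y' : ∀ j, C.obj {i // p i = j}),
        m₀ + ∑ j, m' j = m ∧ y ∈ fil m₀ J ∧ (∀ j, y' j ∈ fil (m' j) {i // p i = j}) ∧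
        z = y ⊗ₜ PiTensorProduct.tprod k y'}

/-! ### The cofree coalgebra `C(A)` -/

theorem DGVect.induction_gr (V : DGVect k) {P : V → Prop} (h : ∀ n, ∀ x ∈ V.gr n, P x)
    (h0 : P 0) (hadd : ∀ x y, P x → P y → P (x + y)) (x : V) : P x := by
  have hx : x ∈ ⨆ n, V.gr n := by
    rw [V.isInternal.submodule_iSup_eq_top]
    trivial
  exact Submodule.iSup_induction V.gr (motive := P) hx h h0 hadd

theorem DGVect.par_par (V : DGVect k) (b c : ZMod 2) (x : V) :
    V.par b (V.par c x) = if b = c then V.par c x else 0 := by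
  induction x using V.induction_gr with
  | h n x hx =>
    rw [V.par_apply n x hx c]
    by_cases hc : (n : ZMod 2) = c
    · rw [if_pos hc, V.par_apply n x hx b, hc]
      by_cases hb : b = c
      · rw [if_pos hb, if_pos hb.symm]
      · rw [if_neg hb, if_neg (Ne.symm hb)]
    · rw [if_neg hc, map_zero, ite_self]
  | h0 => simp
  | hadd x y hx hy =>
    rw [map_add, map_add, hx, hy]
    split_ifs <;> simp

theorem DGVect.par_sum (V : DGVect k) (x : V) : ∑ b : ZMod 2, V.par b x = x := by
  induction x using V.induction_gr with
  | h n x hx => simp [V.par_apply n x hx]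
  | h0 => simp
  | hadd x y hx hy => simp only [map_add, Finset.sum_add_distrib, hx, hy]

theorem reorder_tprod {J J' : Type} [Fintype J] [LinearOrder J] [LinearOrder J'] (e : J ≃ J')
    (M : J → DGData k) (x : ∀ j, M j) :
    reorder e M (PiTensorProduct.tprod k x) = ∑ s : J → ZMod 2, ksign k (invParity e s) •
      PiTensorProduct.tprod k fun j' => (M (e.symm j')).par (s (e.symm j')) (x (e.symm j')) := by
  simp [reorder, PiTensorProduct.map_tprod, PiTensorProduct.reindex_tprod]

theorem tprod_eq_sum_par {J : Type} [Fintype J] [DecidableEq J] (A : DGVect k) (x : J → A) :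
    PiTensorProduct.tprod k x =
      ∑ s : J → ZMod 2, PiTensorProduct.tprod k fun j => A.par (s j) (x j) := by
  rw [← MultilinearMap.map_sum (PiTensorProduct.tprod k) fun j b => A.par b (x j)]
  congr 1
  funext j
  exact (A.par_sum (x j)).symm

theorem ksign_add (x y : ZMod 2) : ksign k (x + y) = ksign k x * ksign k y := by
  have h : ∀ x : ZMod 2, x = 0 ∨ x = 1 := by decide
  have h2 : (1 : ZMod 2) + 1 = 0 := by decide
  rcases h x with rfl | rfl <;> rcases h y with rfl | rfl <;> simp [ksign, h2]

theorem reorder_refl (A : DGVect k) (n : ℕ) :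
    reorder (Equiv.refl (Fin n)) (fun _ => A.toDGData) = LinearMap.id := by
  refine PiTensorProduct.ext (MultilinearMap.ext fun x => ?_)
  have h : ∀ s : Fin n → ZMod 2, invParity (Equiv.refl (Fin n)) s = 0 := fun s =>
    Finset.sum_eq_zero fun j _ => Finset.sum_eq_zero fun j' _ =>
      if_neg fun h => lt_asymm h.1 h.2
  simp only [LinearMap.compMultilinearMap_apply, reorder_tprod, h]
  simp only [ksign, if_true, one_smul, LinearMap.id_apply]
  exact (tprod_eq_sum_par A x).symm

theorem sum_sum_symmetrize {J : Type} [Fintype J] [LinearOrder J] (g : J → J → ZMod 2)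
    (h : ∀ j, g j j = 0) :
    ∑ j, ∑ j', g j j' = ∑ j, ∑ j', if j < j' then g j j' + g j' j else 0 := by
  have h1 : ∀ j j', g j j' = (if j < j' then g j j' else 0) + if j' < j then g j j' else 0 := by
    intro j j'
    rcases lt_trichotomy j j' with hj | rfl | hj
    · simp [hj, hj.not_gt]
    · simp [h]
    · simp [hj, hj.not_gt]
  have h2 : ∑ j, ∑ j', (if j' < j then g j j' else 0) =
      ∑ j, ∑ j', if j < j' then g j' j else 0 := Finset.sum_comm
  calc ∑ j, ∑ j', g j j'
      = ∑ j, ∑ j', ((if j < j' then g j j' else 0) + if j' < j then g j j' else 0) :=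
        Finset.sum_congr rfl fun j _ => Finset.sum_congr rfl fun j' _ => h1 j j'
    _ = ∑ j, ∑ j', if j < j' then g j j' + g j' j else 0 := by
        simp only [Finset.sum_add_distrib]
        rw [h2]
        simp only [← Finset.sum_add_distrib]
        refine Finset.sum_congr rfl fun j _ => Finset.sum_congr rfl fun j' _ => ?_
        split_ifs <;> simp

theorem invParity_trans {J : Type} [Fintype J] [LinearOrder J] (e f : J ≃ J) (t : J → ZMod 2) :
    invParity (e.trans f) t = invParity e t + invParity f (fun j => t (e.symm j)) := by
  have h : invParity f (fun j => t (e.symm j)) =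
      ∑ j, ∑ j', if e j < e j' ∧ f (e j') < f (e j) then t j * t j' else 0 := by
    rw [invParity, ← e.sum_comp]
    refine Finset.sum_congr rfl fun j _ => ?_
    rw [← e.sum_comp]
    simp
  rw [h, sum_sum_symmetrize (fun j j' => if e j < e j' ∧ f (e j') < f (e j) then t j * t j' else 0)
    (by simp), invParity, invParity, ← Finset.sum_add_distrib]
  refine Finset.sum_congr rfl fun j _ => ?_
  rw [← Finset.sum_add_distrib]
  refine Finset.sum_congr rfl fun j' _ => ?_
  have h2 : ∀ x : ZMod 2, x + x = 0 := by decide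
  by_cases hj : j < j'
  · have hne : e j ≠ e j' := fun h' => hj.ne (e.injective h')
    have hne' : f (e j) ≠ f (e j') := fun h' => hne (f.injective h')
    rcases lt_or_gt_of_ne hne with h3 | h3 <;> rcases lt_or_gt_of_ne hne' with h4 | h4 <;>
      simp [hj, h3, h4, h3.not_gt, h4.not_gt, mul_comm (t j') (t j), h2]
  · simp [hj]

theorem reorder_trans (A : DGVect k) (n : ℕ) (e f : Fin n ≃ Fin n) :
    reorder (e.trans f) (fun _ => A.toDGData) =
      reorder f (fun _ => A.toDGData) ∘ₗ reorder e (fun _ => A.toDGData) := by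
  refine PiTensorProduct.ext (MultilinearMap.ext fun x => ?_)
  simp only [LinearMap.compMultilinearMap_apply, LinearMap.comp_apply, reorder_tprod, map_sum,
    map_smul]
  refine Finset.sum_congr rfl fun s _ => ?_
  rw [Finset.sum_eq_single fun j => s (e.symm j)]
  · rw [invParity_trans, ksign_add, mul_smul]
    congr 2
    refine congrArg _ (funext fun j => ?_)
    rw [A.par_par, if_pos rfl]
    rfl
  · intro t _ ht
    obtain ⟨j, hj⟩ := Function.ne_iff.1 ht
    rw [MultilinearMap.map_coord_zero _ (f j), smul_zero]
    rw [A.par_par, if_neg]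
    simpa using hj
  · exact fun h => absurd (Finset.mem_univ _) h

/-- The action of the symmetric group on `C(n) ⊗ A^{⊗ n}`. -/
def act (C : Cooperad k) (A : DGVect k) (n : ℕ) :
    Representation k (Equiv.Perm (Fin n)) (C.obj (Fin n) ⊗[k] (⨂[k] _ : Fin n, A)) where
  toFun e := TensorProduct.map (C.map e) (reorder e fun _ => A.toDGData)
  map_one' := by
    change TensorProduct.map (C.map (Equiv.refl _)) (reorder (Equiv.refl _) _) = _
    rw [C.map_refl, reorder_refl, TensorProduct.map_id]
    rfl
  map_mul' e f := by
    change TensorProduct.map (C.map (f.trans e)) (reorder (f.trans e) _) = _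
    rw [C.map_trans, reorder_trans, TensorProduct.map_comp]
    rfl

/-- The underlying space of the cofree coalgebra, `C(A) = ⨁ₙ (C(n) ⊗ A^{⊗ n})_{Sₙ}`. -/
abbrev Cofree (C : Cooperad k) (A : DGVect k) : Type u :=
  ⨁ n : ℕ, (act C A n).Coinvariants

section Cofree

variable (C : Cooperad k) (A : DGVect k)

/-- The inclusion of the part of arity `n` into `C(A)`. -/
abbrev arity (n : ℕ) : (act C A n).Coinvariants →ₗ[k] Cofree C A :=
  DirectSum.lof k ℕ (fun n => (act C A n).Coinvariants) n

/-- The class in `C(A)` of an element of `C(n) ⊗ A^{⊗ n}`. -/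
def cls (n : ℕ) : (C.obj (Fin n) ⊗[k] (⨂[k] _ : Fin n, A)) →ₗ[k] Cofree C A :=
  arity C A n ∘ₗ Representation.Coinvariants.mk (act C A n)

/-- The class in `C(A)` of an element of `C(I) ⊗ A^{⊗ I}`, for a finite linearly ordered set `I`. -/
def clsOn (I : Type) [Fintype I] [LinearOrder I] :
    (C.obj I ⊗[k] (⨂[k] _ : I, A)) →ₗ[k] Cofree C A :=
  cls C A (Fintype.card I) ∘ₗ
    TensorProduct.map (C.map (Fintype.orderIsoFinOfCardEq I rfl).symm.toEquiv)
      (PiTensorProduct.reindex k (fun _ : I => A.carrier)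
        (Fintype.orderIsoFinOfCardEq I rfl).symm.toEquiv).toLinearMap

/-- The identification of coinvariants with invariants, `[x] ↦ (1 / n!) ∑ σ x`. It is the section
of the projection to the coinvariants. -/
def symmetrize (n : ℕ) : (act C A n).Coinvariants →ₗ[k] (C.obj (Fin n) ⊗[k] (⨂[k] _ : Fin n, A)) :=
  Representation.Coinvariants.lift (act C A n) ((n.factorial : k)⁻¹ • (act C A n).norm) (by
    intro e
    rw [LinearMap.smul_comp, Representation.norm_comp_self])

variable {C A} in
/-- The linear map on `C(A)` given on classes by the maps `φ n` (which are constant on the orbits of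
the symmetric group wherever this is used). -/
def descend {Z : Type u} [AddCommGroup Z] [Module k Z]
    (φ : ∀ n : ℕ, (C.obj (Fin n) ⊗[k] (⨂[k] _ : Fin n, A)) →ₗ[k] Z) : Cofree C A →ₗ[k] Z :=
  DirectSum.toModule k ℕ Z fun n => φ n ∘ₗ symmetrize C A n

/-- The complex `C(n) ⊗ A^{⊗ n}`. -/
abbrev tensorPower (n : ℕ) : DGData k :=
  (C.obj (Fin n)).toDGData.tensor (DGData.pi fun _ : Fin n => A.toDGData)

/-- `C(A)` as a complex, with the differential `∂` that comes from those of `C` and of `A`. -/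
abbrev cofree : DGData k where
  carrier := Cofree C A
  gr i := ⨆ n : ℕ, ((tensorPower C A n).gr i).map (cls C A n)
  par b := descend fun n => cls C A n ∘ₗ (tensorPower C A n).par b
  d := descend fun n => cls C A n ∘ₗ (tensorPower C A n).d

/-- The `m`-th comultiplication `Δₘ : C(A) → C(m) ⊗ C(A)^{⊗ m}` of the cofree coalgebra: the sum over
all `p : Fin n → Fin m` of the maps
`(γ; a₁, …, aₙ) ↦ ± (γ₀; (γ₁; a_{p⁻¹(1)}), …, (γₘ; a_{p⁻¹(m)}))`, where
`γ₀ ⊗ γ₁ ⊗ ⋯ ⊗ γₘ` stands for the comultiplication of `γ` along `p`. -/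
def comul (m : ℕ) : Cofree C A →ₗ[k] (C.obj (Fin m) ⊗[k] (⨂[k] _ : Fin m, Cofree C A)) :=
  descend fun n => ∑ p : Fin n → Fin m,
    TensorProduct.map LinearMap.id
      ((PiTensorProduct.map fun j => clsOn C A {i // p i = j}) ∘ₗ
        regroup (fun j => (C.obj {i // p i = j}).toDGData) (fun _ => A.toDGData) p) ∘ₗ
    (TensorProduct.assoc k _ _ _).toLinearMap ∘ₗ
    TensorProduct.map (C.decomp p) LinearMap.id

/-- The canonical projection `p_A : C(A) → A`. -/
def proj : Cofree C A →ₗ[k] A :=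
  descend fun n => match n with
    | 1 => (TensorProduct.lid k A).toLinearMap ∘ₗ
        TensorProduct.map C.counit (PiTensorProduct.subsingletonEquiv (0 : Fin 1)).toLinearMap
    | _ => 0

/-- The inclusion `A → C(A)` given by the coaugmentation. -/
def incl : A →ₗ[k] Cofree C A :=
  cls C A 1 ∘ₗ TensorProduct.mk k _ _ C.unit ∘ₗ
    (PiTensorProduct.subsingletonEquiv (R := k) (s := fun _ : Fin 1 => A.carrier) 0).symm.toLinearMap

end Cofree

/-! ### Homotopy algebras and infinity-morphisms -/

/-- A homotopy algebra of type `C`: a cochain complex `A` with a coderivation `Q` of degree one of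
the cofree coalgebra `C(A)` which vanishes on `A` and satisfies the Maurer-Cartan equation
`(∂ + Q)² = 0`. -/
structure HoAlg (C : Cooperad k) where
  A : DGVect k
  Q : Cofree C A →ₗ[k] Cofree C A
  Q_deg : ∀ n : ℤ, ∀ x ∈ (cofree C A).gr n, Q x ∈ (cofree C A).gr (n + 1)
  Q_coder : ∀ m : ℕ, comul C A m ∘ₗ Q =
    TensorProduct.map ((C.obj (Fin m)).tw 1) (koszulDer (fun _ : Fin m => cofree C A) fun _ => Q) ∘ₗ
      comul C A m
  Q_incl : Q ∘ₗ incl C A = 0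
  Q_mc : ((cofree C A).d + Q) ∘ₗ ((cofree C A).d + Q) = 0

/-- The total differential `∂ + Q` on `C(A)`. -/
def HoAlg.D {C : Cooperad k} (A : HoAlg C) : Cofree C A.A →ₗ[k] Cofree C A.A :=
  (cofree C A.A).d + A.Q

/-- An infinity-morphism of homotopy algebras: a homomorphism of dg `C`-coalgebras
`(C(A), ∂ + Q_A) → (C(B), ∂ + Q_B)`. -/
structure InftyHom {C : Cooperad k} (A B : HoAlg C) where
  F : Cofree C A.A →ₗ[k] Cofree C B.A
  F_deg : ∀ n : ℤ, ∀ x ∈ (cofree C A.A).gr n, F x ∈ (cofree C B.A).gr n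
  F_comul : ∀ m : ℕ, comul C B.A m ∘ₗ F =
    TensorProduct.map LinearMap.id (PiTensorProduct.map fun _ : Fin m => F) ∘ₗ comul C A.A m
  F_diff : F ∘ₗ A.D = B.D ∘ₗ F

/-- `F' = p_B ∘ F`. -/
def InftyHom.proj {C : Cooperad k} {A B : HoAlg C} (F : InftyHom A B) : Cofree C A.A →ₗ[k] B.A :=
  HoAlgebra.proj C B.A ∘ₗ F.F

/-- The linear term `p_B ∘ F |_A : A → B`. -/
def InftyHom.linearTerm {C : Cooperad k} {A B : HoAlg C} (F : InftyHom A B) : A.A →ₗ[k] B.A :=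
  F.proj ∘ₗ incl C A.A

/-- A map `φ` (its value on elements of degree `n` is `φ n`) between cochain complexes with
homogeneous parts `gV n`, `gW n` and differentials `dV n`, `dW n` on them is a map of complexes and
induces isomorphisms in cohomology. -/
def IsQuasiIso {V W : Type u} [AddCommGroup V] [Module k V] [AddCommGroup W] [Module k W]
    (gV : ℤ → Submodule k V) (dV : ℤ → V → V) (gW : ℤ → Submodule k W) (dW : ℤ → W → W)
    (φ : ℤ → V → W) : Prop :=
  (∀ n, ∀ x ∈ gV n, φ n x ∈ gW n ∧ φ (n + 1) (dV n x) = dW n (φ n x)) ∧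
  (∀ n, ∀ x ∈ gV n, dV n x = 0 → (∃ y ∈ gW (n - 1), φ n x = dW (n - 1) y) →
    ∃ z ∈ gV (n - 1), x = dV (n - 1) z) ∧
  (∀ n, ∀ y ∈ gW n, dW n y = 0 →
    ∃ x ∈ gV n, dV n x = 0 ∧ ∃ z ∈ gW (n - 1), y = φ n x + dW (n - 1) z)

/-- An infinity quasi-isomorphism: the linear term is a quasi-isomorphism of complexes. -/
def InftyHom.IsInftyQuasiIso {C : Cooperad k} {A B : HoAlg C} (F : InftyHom A B) : Prop :=
  IsQuasiIso A.A.gr (fun _ => A.A.d) B.A.gr (fun _ => B.A.d) (fun _ => F.linearTerm)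

/-! ### Shifted L-infinity algebras -/

/-- The data of a shifted L-infinity algebra: a graded vector space, with homogeneous parts `gr n`
(only they matter), and brackets; `br n d x` is the bracket of the elements `x i` of degrees
`d i`. -/
structure SLieData (k : Type u) [Field k] where
  carrier : Type u
  [acg : AddCommGroup carrier]
  [mod : Module k carrier]
  gr : ℤ → Submodule k carrier
  br : ∀ n : ℕ, (Fin n → ℤ) → (Fin n → carrier) → carrier

attribute [instance] SLieData.acg SLieData.mod

instance (k : Type u) [Field k] : CoeSort (SLieData k) (Type u) := ⟨SLieData.carrier⟩

/-- The operations `b n`, `n ≥ 1`, are multilinear, of degree `e`, and graded symmetric. -/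
def IsGradedSymmetric {V W : Type u} [AddCommGroup V] [Module k V] [AddCommGroup W] [Module k W]
    (gV : ℤ → Submodule k V) (gW : ℤ → Submodule k W) (e : ℤ)
    (b : ∀ n : ℕ, (Fin n → ℤ) → (Fin n → V) → W) : Prop :=
  ∀ (n : ℕ), 1 ≤ n → ∀ (d : Fin n → ℤ) (x : Fin n → V), (∀ i, x i ∈ gV (d i)) →
    b n d x ∈ gW (e + ∑ i, d i) ∧
    (∀ i, ∀ y ∈ gV (d i), ∀ c : k, b n d (Function.update x i (c • x i + y)) =
      c • b n d x + b n d (Function.update x i y)) ∧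
    (∀ σ : Equiv.Perm (Fin n), b n (fun i => d (σ i)) (fun i => x (σ i)) =
      ksign k (invParity σ fun i => (d (σ i) : ZMod 2)) • b n d x)

/-- The subword of `x` with letters in positions `S`. -/
def subword {X : Type*} {n : ℕ} (S : Finset (Fin n)) (x : Fin n → X) : Fin S.card → X :=
  fun i => x (S.orderEmbOfFin rfl i)

/-- The sum over all non-empty `S` of
`± f (br (x_S), x_{Sᶜ})`, with the Koszul sign for moving the letters in `S` to the front. -/
def bracketInside (L : SLieData k) {W : Type u} [AddCommGroup W] [Module k W]
    (f : ∀ n : ℕ, (Fin n → ℤ) → (Fin n → L) → W) (n : ℕ) (d : Fin n → ℤ) (x : Fin n → L) : W :=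
  ∑ S : Finset (Fin n), if S.Nonempty then
    ksign k (invParity (fun i => if i ∈ S then (0 : Fin 2) else 1) fun i => (d i : ZMod 2)) •
      f (Sᶜ.card + 1)
        (Fin.cons (1 + ∑ i ∈ S, d i) (subword Sᶜ d) : Fin (Sᶜ.card + 1) → ℤ)
        (Fin.cons (L.br S.card (subword S d) (subword S x)) (subword Sᶜ x) : Fin (Sᶜ.card + 1) → L)
    else 0

/-- A shifted L-infinity algebra: all brackets are graded symmetric of degree one, and the Jacobi
relations `∑ ± {{x_S}, x_{Sᶜ}} = 0` hold. -/
def SLieData.IsSLieInfty (L : SLieData k) : Prop :=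
  IsGradedSymmetric L.gr L.gr 1 L.br ∧
  ∀ (n : ℕ), 1 ≤ n → ∀ (d : Fin n → ℤ) (x : Fin n → L), (∀ i, x i ∈ L.gr (d i)) →
    bracketInside L L.br n d x = 0

/-- `U` is a morphism of shifted L-infinity algebras from `L` to `L'`, given by its components
`U n : S^n(L) → L'`, `n ≥ 1`, of degree zero: with `Q` and `Q'` the codifferentials of the coalgebras
`S(L)` and `S(L')`, the homomorphism of coalgebras with these components commutes with the
codifferentials. In components this says
`∑ ± U ({x_S}, x_{Sᶜ}) = ∑ᵣ (1 / r!) ∑ₚ ± {U (x_{p⁻¹(1)}), …, U (x_{p⁻¹(r)})}'`,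
where `p` ranges over the surjections `{1, …, n} → {1, …, r}`. -/
def IsSLieHom (L L' : SLieData k) (U : ∀ n : ℕ, (Fin n → ℤ) → (Fin n → L) → L') : Prop :=
  L.IsSLieInfty ∧ L'.IsSLieInfty ∧ IsGradedSymmetric L.gr L'.gr 0 U ∧
  ∀ (n : ℕ), 1 ≤ n → ∀ (d : Fin n → ℤ) (x : Fin n → L), (∀ i, x i ∈ L.gr (d i)) →
    bracketInside L U n d x =
      ∑ r ∈ Finset.Icc 1 n, (r.factorial : k)⁻¹ • ∑ p : Fin n → Fin r,
        if Function.Surjective p then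
          ksign k (invParity p fun i => (d i : ZMod 2)) •
            L'.br r (fun j => ∑ i ∈ Finset.univ.filter (p · = j), d i)
              (fun j => U _ (subword (Finset.univ.filter (p · = j)) d)
                (subword (Finset.univ.filter (p · = j)) x))
        else 0

/-- A quasi-isomorphism of shifted L-infinity algebras: a morphism whose linear term is a
quasi-isomorphism of complexes. -/
def IsSLieQuasiIso (L L' : SLieData k) (U : ∀ n : ℕ, (Fin n → ℤ) → (Fin n → L) → L') : Prop :=
  IsSLieHom L L' U ∧
  IsQuasiIso L.gr (fun d x => L.br 1 (fun _ => d) fun _ => x)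
    L'.gr (fun d x => L'.br 1 (fun _ => d) fun _ => x) (fun d x => U 1 (fun _ => d) fun _ => x)

/-- The same brackets on the graded subspace cut out by `S`. -/
def SLieData.restrict (L : SLieData k) (S : Submodule k L) : SLieData k where
  carrier := L
  gr d := L.gr d ⊓ S
  br := L.br

/-- The direct sum of shifted L-infinity algebras. -/
def SLieData.prod (L L' : SLieData k) : SLieData k where
  carrier := L × L'
  gr d := (L.gr d).prod (L'.gr d)
  br n d x := (L.br n d fun i => (x i).1, L'.br n d fun i => (x i).2)

/-! ### The mapping spaces -/

section Map

variable {C : Cooperad k}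

/-- The map `1 ⊗ f₁ ⊗ ⋯ ⊗ fₘ`, with the Koszul sign, for maps `fᵢ : C(A) → B` of degrees `dᵢ`. -/
def tensorMaps (A B : DGVect k) (m : ℕ) (d : Fin m → ℤ) (f : Fin m → (Cofree C A →ₗ[k] B)) :
    (C.obj (Fin m) ⊗[k] (⨂[k] _ : Fin m, Cofree C A)) →ₗ[k]
      (C.obj (Fin m) ⊗[k] (⨂[k] _ : Fin m, B)) :=
  TensorProduct.map ((C.obj (Fin m)).tw (∑ i, d i))
    (PiTensorProduct.map fun i => f i ∘ₗ (cofree C A).tw (∑ j ∈ Finset.Ioi i, d j))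

/-- The convolution algebra `map(A, B) = Hom(C(A), B)`, with the brackets
`{f₁, …, fₘ} = p_B ∘ Q_B ∘ (1 ⊗ f₁ ⊗ ⋯ ⊗ fₘ) ∘ Δₘ`, to which for `m = 1` the differential
`∂_B ∘ f - (-1)^|f| f ∘ (∂ + Q_A)` of `Hom(C(A), B)` is added. -/
abbrev mapSp (A B : HoAlg C) : SLieData k where
  carrier := Cofree C A.A →ₗ[k] B.A
  gr d :=
    { carrier := {f | ∀ n : ℤ, ∀ x ∈ (cofree C A.A).gr n, f x ∈ B.A.gr (n + d)}
      add_mem' := fun hf hg n x hx => Submodule.add_mem _ (hf n x hx) (hg n x hx)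
      zero_mem' := fun _ _ _ => Submodule.zero_mem _
      smul_mem' := fun c _ hf n x hx => Submodule.smul_mem _ c (hf n x hx) }
  br m d f :=
    (if h : m = 1 then
      B.A.d ∘ₗ f ⟨0, by omega⟩ - ksign k (d ⟨0, by omega⟩ : ZMod 2) • f ⟨0, by omega⟩ ∘ₗ A.D
      else 0) +
    proj C B.A ∘ₗ B.Q ∘ₗ cls C B.A m ∘ₗ tensorMaps A.A B.A m d f ∘ₗ comul C A.A m

/-- The filtration by arity on `map(A, B)`: `f` is in its `m`-th term if it vanishes on the parts of
arity less than `m` of `C(A)`. -/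
def ariFil (A B : HoAlg C) (m : ℕ) : Submodule k (mapSp A B) where
  carrier := {f : Cofree C A.A →ₗ[k] B.A | ∀ n < m, f ∘ₗ arity C A.A n = 0}
  add_mem' := fun hf hg n hn => by
    rw [LinearMap.add_comp, hf n hn, hg n hn, add_zero]
  zero_mem' := fun n _ => LinearMap.zero_comp _
  smul_mem' := fun c f hf n hn => by
    rw [LinearMap.smul_comp, hf n hn, smul_zero]

/-- The components of the composition morphism
`map(A₂, A₃) ⊕ map(A₁, A₂) → map(A₁, A₃)`: the value on `g₁ ⊕ f₁, …, gₙ ⊕ fₙ` is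
`∑ᵢ ± gᵢ ∘ (1 ⊗ f₁ ⊗ ⋯ f̂ᵢ ⋯ ⊗ fₙ) ∘ Δₙ₋₁`. -/
def compU (A₁ A₂ A₃ : HoAlg C) : ∀ n : ℕ, (Fin n → ℤ) →
    (Fin n → (mapSp A₂ A₃).prod (mapSp A₁ A₂)) → mapSp A₁ A₃
  | 0, _, _ => 0
  | n + 1, d, x => ∑ i : Fin (n + 1), ksign k ((d i * ∑ j ∈ Finset.Iio i, d j : ℤ) : ZMod 2) •
      ((x i).1 ∘ₗ cls C A₂.A n ∘ₗ
        tensorMaps A₁.A A₂.A n (fun j => d (i.succAbove j)) (fun j => (x (i.succAbove j)).2) ∘ₗ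
          comul C A₁.A n)

/-- The components `∑ᵣ (1 / r!) U(α, …, α, x₁, …, xₙ)` of the twist of a morphism `U` to a mapping
space by an element `α` of degree zero. The sum converges in the arity filtration of the mapping
space: it is formed on every part of fixed arity, where almost all terms vanish. -/
def twist {L : SLieData k} {A B : HoAlg C} (U : ∀ n : ℕ, (Fin n → ℤ) → (Fin n → L) → mapSp A B)
    (α : L) (n : ℕ) (d : Fin n → ℤ) (x : Fin n → L) : mapSp A B :=
  DirectSum.toModule k ℕ B.A fun N => ∑ᶠ r : ℕ, (r.factorial : k)⁻¹ •
    ((U (r + n) (Fin.append (fun _ => 0) d) (Fin.append (fun _ => α) x) :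
      Cofree C A.A →ₗ[k] B.A) ∘ₗ arity C A.A N)

/-- The morphism `map(A₃, A₁) → map(A₃, A₂)` induced by an infinity-morphism `F : A₁ → A₂`: the
composition morphism, twisted by `F' ⊕ 0` and restricted to `map(A₃, A₁)`. -/
def postcomp {A₁ A₂ : HoAlg C} (F : InftyHom A₁ A₂) (A₃ : HoAlg C) (n : ℕ) (d : Fin n → ℤ)
    (g : Fin n → mapSp A₃ A₁) : mapSp A₃ A₂ :=
  twist (L := (mapSp A₁ A₂).prod (mapSp A₃ A₁)) (compU A₃ A₁ A₂) (F.proj, 0) n d fun i => (0, g i)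

/-- The morphism `map(A₂, A₃) → map(A₁, A₃)` induced by an infinity-morphism `F : A₁ → A₂`: the
composition morphism, twisted by `0 ⊕ F'` and restricted to `map(A₂, A₃)`. -/
def precomp {A₁ A₂ : HoAlg C} (F : InftyHom A₁ A₂) (A₃ : HoAlg C) (n : ℕ) (d : Fin n → ℤ)
    (h : Fin n → mapSp A₂ A₃) : mapSp A₁ A₃ :=
  twist (L := (mapSp A₂ A₃).prod (mapSp A₁ A₂)) (compU A₁ A₂ A₃) (0, F.proj) n d fun i => (h i, 0)

/-- Compatibility of the components of a morphism with the arity filtrations. -/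
def IsFiltered {A B A' B' : HoAlg C}
    (U : ∀ n : ℕ, (Fin n → ℤ) → (Fin n → mapSp A B) → mapSp A' B') : Prop :=
  ∀ (n : ℕ), 1 ≤ n → ∀ (d : Fin n → ℤ) (m : Fin n → ℕ) (x : Fin n → mapSp A B),
    (∀ i, x i ∈ (mapSp A B).gr (d i) ⊓ ariFil A B (m i)) → U n d x ∈ ariFil A' B' (∑ i, m i)

end Map

end HoAlgebra

end

open scoped TensorProduct DirectSum

noncomputable section

namespace HoAlgebra

universe u

variable {k : Type u} [Field k]

/-! ### Signs -/

/-! Everything goes through `ang`, which sends maps f₁, …, fₙ : C(A) → B to cls ∘ (1 ⊗ f₁ ⊗ ⋯ ⊗ fₙ)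
∘ Δₙ : C(A) → C(B). It is graded symmetric, hence a linear map from S(map(A, B)) to Hom(C(A), C(B)),
and coassociativity of C(A) computes Δ ∘ `ang` by distributing the fᵢ over the outputs
(`comulOn_ang`). Since C(B) is cofree, coderivations and homomorphisms into it are rebuilt from
their projections to the cogenerators (`reconstruct`, `HoAlg.Q_eq`, `InftyHom.F_eq`), with the
coefficients 1/m! of an exponential. Combining the two facts, inserting brackets into `ang` in all
ways gives the commutator of `ang` with the total differentials D = ∂ + Q (`bracketInside_ang`), and
composing an infinity-morphism with `ang` gives a sum over surjections which group the letters
(`InftyHom.comp_ang`).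

Every bracket is p_B applied to such a commutator (`mapSp_br_eq`), so the Jacobi relations express
D² = 0. For infinity-morphisms E : A' → A and G : B → B' the operations G' ∘ ang(f₁, …, fₙ) ∘ E
(`conj`) form a morphism, because both sides of the morphism relation are p_B' applied to the
commutator of D with G ∘ ang(f₁, …, fₙ) ∘ E (`conj_isSLieHom`). The twisted composition morphisms
are the cases E = id and G = id. In the first exactly one copy of F' can be inserted; in the second
the sum over all numbers of copies of F' reassembles F (`postcomp_eq_conj`, `precomp_eq_conj`).
Compatibility with arity is a pigeonhole argument on the leaves, and C(0) = 0 makes all the sums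
finite on every element.

For the quasi-isomorphisms, the filtration of C induces a coradical filtration of C(A) whose first
nonzero term is A. The maps vanishing on its terms form a complete filtration of each term of the
arity filtration. Since Q vanishes on A, it strictly lowers the coradical filtration; so to leading
order the differential of map(A, B) involves only the ∂'s (`mapDiff_lt_succ`), and an
infinity-morphism acts through its linear term φ (`conjOne_id_left_apply`,
`InftyHom.F_sub_map_mem_lt`). Over a field φ has a homotopy inverse (`exists_homotopy_inverse`), and
a homotopy on A induces one on C(A) by averaging over the symmetric groups (`Cofree.htp_d`). The
linear terms are therefore homotopy equivalences up to higher filtration, and successive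
approximation in the complete filtration makes them quasi-isomorphisms
(`FiltCx.IsFiltMap.isQuasiIso_of_homotopy`). -/

theorem ksign_zero : ksign k 0 = 1 := if_pos rfl

theorem ksign_one : ksign k 1 = -1 := if_neg (by decide)

theorem zmod2_add_self (x : ZMod 2) : x + x = 0 := CharTwo.add_self_eq_zero x

theorem ksign_mul_self (x : ZMod 2) : ksign k x * ksign k x = 1 := by
  rw [← ksign_add, zmod2_add_self, ksign_zero]

theorem ksign_smul_smul {W : Type*} [AddCommGroup W] [Module k W] (x y : ZMod 2) (w : W) :
    ksign k x • ksign k y • w = ksign k (x + y) • w := by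
  rw [smul_smul, ksign_add]

theorem ksign_sum {J : Type*} (s : Finset J) (f : J → ZMod 2) :
    ksign k (∑ j ∈ s, f j) = ∏ j ∈ s, ksign k (f j) := by
  classical
  induction s using Finset.induction_on with
  | empty => simp [ksign_zero]
  | insert a s ha ih => rw [Finset.sum_insert ha, Finset.prod_insert ha, ksign_add, ih]

/-! ### Graded spaces -/

/-- The homogeneous parts span, and the parity projections are the ones given by the grading. -/
structure DGData.IsGraded (V : DGData k) : Prop where
  iSup_gr : ⨆ n, V.gr n = ⊤
  par_apply : ∀ (n : ℤ) (x : V), x ∈ V.gr n →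
    ∀ b : ZMod 2, V.par b x = if (n : ZMod 2) = b then x else 0

theorem DGVect.isGraded (V : DGVect k) : V.toDGData.IsGraded :=
  ⟨V.isInternal.submodule_iSup_eq_top, V.par_apply⟩

theorem DGData.IsGraded.tw_apply {V : DGData k} (hV : V.IsGraded) (m : ℤ) {n : ℤ} {x : V}
    (hx : x ∈ V.gr n) : V.tw m x = ksign k ((m : ZMod 2) * n) • x := by
  have h : ∀ x : ZMod 2, x = 0 ∨ x = 1 := by decide
  rw [DGData.tw, LinearMap.add_apply, LinearMap.smul_apply, hV.par_apply n x hx,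
    hV.par_apply n x hx]
  rcases h n with hn | hn <;> simp [hn, ksign_zero]

/-- Spanning is all that is needed to test linear identities on homogeneous elements. Independence
of the homogeneous parts plays no role, so for tensor products and cofree coalgebras only `IsGraded`
is established. -/
theorem DGData.IsGraded.eq_top {V : DGData k} (hV : V.IsGraded) (S : Submodule k V)
    (h : ∀ n, ∀ x ∈ V.gr n, x ∈ S) : S = ⊤ := by
  rw [eq_top_iff, ← hV.iSup_gr]
  exact iSup_le h

theorem DGData.IsGraded.ext {V : DGData k} (hV : V.IsGraded) {Z : Type*} [AddCommGroup Z]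
    [Module k Z] {f g : V →ₗ[k] Z} (h : ∀ n, ∀ x ∈ V.gr n, f x = g x) : f = g := by
  have := hV.eq_top (LinearMap.eqLocus f g) h
  exact LinearMap.ext fun x => (this ▸ Submodule.mem_top : x ∈ LinearMap.eqLocus f g)

theorem span_tmul_gr {V W : DGData k} (hV : V.IsGraded) (hW : W.IsGraded)
    (S : Submodule k (V ⊗[k] W))
    (h : ∀ m n, ∀ x ∈ V.gr m, ∀ y ∈ W.gr n, x ⊗ₜ[k] y ∈ S) : S = ⊤ := by
  rw [eq_top_iff, ← TensorProduct.span_tmul_eq_top, Submodule.span_le]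
  rintro _ ⟨x, y, rfl⟩
  have h1 : ∀ n, ∀ y ∈ W.gr n, ∀ x, x ⊗ₜ[k] y ∈ S := fun n y hy x => by
    have := hV.eq_top (S.comap ((TensorProduct.mk k V W).flip y)) fun m x hx => h m n x hx y hy
    exact (this ▸ Submodule.mem_top : x ∈ S.comap ((TensorProduct.mk k V W).flip y))
  have := hW.eq_top (S.comap (TensorProduct.mk k V W x)) fun n y hy => h1 n y hy x
  exact (this ▸ Submodule.mem_top : y ∈ S.comap (TensorProduct.mk k V W x))

theorem tensor_ext_gr {V W : DGData k} (hV : V.IsGraded) (hW : W.IsGraded) {Z : Type*}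
    [AddCommGroup Z] [Module k Z] {f g : V ⊗[k] W →ₗ[k] Z}
    (h : ∀ m n, ∀ x ∈ V.gr m, ∀ y ∈ W.gr n, f (x ⊗ₜ y) = g (x ⊗ₜ y)) : f = g := by
  have := span_tmul_gr hV hW (LinearMap.eqLocus f g) h
  exact LinearMap.ext fun x => (this ▸ Submodule.mem_top : x ∈ LinearMap.eqLocus f g)

theorem span_tprod_gr {J : Type} [Finite J] {M : J → DGData k} (hM : ∀ j, (M j).IsGraded)
    (S : Submodule k (⨂[k] j, M j))
    (h : ∀ (n : J → ℤ) (x : ∀ j, M j), (∀ j, x j ∈ (M j).gr (n j)) →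
      PiTensorProduct.tprod k x ∈ S) : S = ⊤ := by
  classical
  -- Here `s` is the set of positions whose letters may still be inhomogeneous; one position at a
  -- time is decomposed by linearity in that slot.
  have key : ∀ s : Finset J, ∀ x : ∀ j, M j, (∀ j, j ∉ s → ∃ n, x j ∈ (M j).gr n) →
      PiTensorProduct.tprod k x ∈ S := by
    intro s
    induction s using Finset.induction_on with
    | empty =>
      intro x hx
      choose n hn using fun j => hx j (Finset.notMem_empty j)
      exact h n x hn
    | insert a s ha ih =>
      intro x hx
      have := (hM a).eq_top (S.comap ((PiTensorProduct.tprod k).toLinearMap x a)) fun n y hy => by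
        refine ih _ fun j hj => ?_
        by_cases hja : j = a
        · subst hja
          exact ⟨n, by simpa using hy⟩
        · rw [Function.update_of_ne hja]
          exact hx j (by simp [hja, hj])
      have h2 : x a ∈ S.comap ((PiTensorProduct.tprod k).toLinearMap x a) :=
        this ▸ Submodule.mem_top
      simpa using h2
  have := Fintype.ofFinite J
  rw [eq_top_iff, ← PiTensorProduct.span_tprod_eq_top, Submodule.span_le]
  rintro _ ⟨x, rfl⟩
  exact key Finset.univ x fun j hj => absurd (Finset.mem_univ j) hj

theorem pi_ext_gr {J : Type} [Finite J] {M : J → DGData k} (hM : ∀ j, (M j).IsGraded)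
    {Z : Type*} [AddCommGroup Z] [Module k Z] {f g : (⨂[k] j, M j) →ₗ[k] Z}
    (h : ∀ (n : J → ℤ) (x : ∀ j, M j), (∀ j, x j ∈ (M j).gr (n j)) →
      f (PiTensorProduct.tprod k x) = g (PiTensorProduct.tprod k x)) : f = g := by
  have := span_tprod_gr hM (LinearMap.eqLocus f g) h
  exact LinearMap.ext fun x => (this ▸ Submodule.mem_top : x ∈ LinearMap.eqLocus f g)

theorem DGData.tmul_mem_gr {V W : DGData k} {m n : ℤ} {x : V} {y : W} (hx : x ∈ V.gr m)
    (hy : y ∈ W.gr n) : x ⊗ₜ[k] y ∈ (V.tensor W).gr (m + n) :=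
  Submodule.subset_span ⟨m, n, x, y, rfl, hx, hy, rfl⟩

theorem DGData.tprod_mem_gr {J : Type} [Fintype J] [LinearOrder J] {M : J → DGData k}
    {n : J → ℤ} {x : ∀ j, M j} (hx : ∀ j, x j ∈ (M j).gr (n j)) :
    PiTensorProduct.tprod k x ∈ (DGData.pi M).gr (∑ j, n j) :=
  Submodule.subset_span ⟨n, x, rfl, hx, rfl⟩

theorem par_of_span {V : DGData k} (s : Set V) (n : ℤ)
    (h : ∀ x ∈ s, ∀ b : ZMod 2, V.par b x = if (n : ZMod 2) = b then x else 0) (x : V)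
    (hx : x ∈ Submodule.span k s) (b : ZMod 2) : V.par b x = if (n : ZMod 2) = b then x else 0 := by
  induction hx using Submodule.span_induction with
  | mem x hx => exact h x hx b
  | zero => simp
  | add x y _ _ hx hy => rw [map_add, hx, hy]; split_ifs <;> simp
  | smul c x _ hx => rw [map_smul, hx]; split_ifs <;> simp

theorem DGData.IsGraded.tensor {V W : DGData k} (hV : V.IsGraded) (hW : W.IsGraded) :
    (V.tensor W).IsGraded where
  iSup_gr := span_tmul_gr hV hW _ fun m n x hx y hy =>
    Submodule.mem_iSup_of_mem (m + n) (DGData.tmul_mem_gr hx hy)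
  par_apply n x hx b := by
    refine par_of_span (V := V.tensor W) _ n ?_ x hx b
    rintro _ ⟨i, j, x, y, rfl, hx, hy, rfl⟩ b
    simp only [LinearMap.sum_apply, TensorProduct.map_tmul, hV.par_apply i x hx,
      hW.par_apply j y hy]
    rw [Finset.sum_eq_single (i : ZMod 2)]
    · have : ((j : ZMod 2) = b - i) ↔ (((i + j : ℤ) : ZMod 2) = b) := by
        push_cast
        rw [eq_sub_iff_add_eq, add_comm]
      simp only [this, if_true]
      split_ifs <;> simp
    · intro c _ hc
      rw [if_neg (Ne.symm hc), TensorProduct.zero_tmul]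
    · exact fun h => absurd (Finset.mem_univ _) h

/-- This collapses the sums over parities in `DGData.pi`, `reorder` and `regroup`: on a homogeneous
tensor only the summand with the matching parities survives, leaving a single Koszul sign. -/
theorem map_par_tprod {J : Type} [Fintype J] {M : J → DGData k} (hM : ∀ j, (M j).IsGraded)
    {n : J → ℤ} {x : ∀ j, M j} (hx : ∀ j, x j ∈ (M j).gr (n j)) (s : J → ZMod 2) :
    (PiTensorProduct.map fun j => (M j).par (s j)) (PiTensorProduct.tprod k x) =
      if s = (fun j => (n j : ZMod 2)) then PiTensorProduct.tprod k x else 0 := by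
  rw [PiTensorProduct.map_tprod]
  split_ifs with h
  · subst h
    congr 1
    funext j
    rw [(hM j).par_apply _ _ (hx j), if_pos rfl]
  · obtain ⟨j, hj⟩ := Function.ne_iff.1 h
    exact MultilinearMap.map_coord_zero _ j (by rw [(hM j).par_apply _ _ (hx j), if_neg (Ne.symm hj)])

theorem DGData.IsGraded.pi {J : Type} [Fintype J] [LinearOrder J] {M : J → DGData k}
    (hM : ∀ j, (M j).IsGraded) : (DGData.pi M).IsGraded where
  iSup_gr := span_tprod_gr hM _ fun n x hx =>
    Submodule.mem_iSup_of_mem (∑ j, n j) (DGData.tprod_mem_gr hx)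
  par_apply n x hx b := by
    refine par_of_span (V := DGData.pi M) _ n ?_ x hx b
    rintro _ ⟨n, x, rfl, hx, rfl⟩ b
    simp only [LinearMap.sum_apply]
    rw [Finset.sum_eq_single (fun j => (n j : ZMod 2))]
    · push_cast
      split_ifs
      · rw [map_par_tprod hM hx, if_pos rfl]
      · rfl
    · intro s _ hs
      split_ifs
      · rw [map_par_tprod hM hx, if_neg hs]
      · rfl
    · exact fun h => absurd (Finset.mem_univ _) h

/-- Linear maps of degree `e`. -/
def HasDegree (V W : DGData k) (e : ℤ) (f : V →ₗ[k] W) : Prop :=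
  ∀ n, ∀ x ∈ V.gr n, f x ∈ W.gr (n + e)

theorem HasDegree.comp {V W X : DGData k} {e e' : ℤ} {g : W →ₗ[k] X} {f : V →ₗ[k] W}
    (hg : HasDegree W X e' g) (hf : HasDegree V W e f) : HasDegree V X (e + e') (g ∘ₗ f) :=
  fun n x hx => by
    rw [← add_assoc]
    exact hg _ _ (hf n x hx)

theorem HasDegree.of_eq {V W : DGData k} {e e' : ℤ} {f : V →ₗ[k] W} (hf : HasDegree V W e f)
    (h : e = e') : HasDegree V W e' f := h ▸ hf

theorem HasDegree.id (V : DGData k) : HasDegree V V 0 LinearMap.id := fun n x hx => by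
  simpa using hx

theorem HasDegree.tw {V W : DGData k} (hV : V.IsGraded) (hW : W.IsGraded) {e : ℤ}
    {f : V →ₗ[k] W} (hf : HasDegree V W e f) (m : ℤ) :
    W.tw m ∘ₗ f = ksign k ((m : ZMod 2) * e) • f ∘ₗ V.tw m := by
  refine hV.ext fun n x hx => ?_
  simp only [LinearMap.comp_apply, LinearMap.smul_apply, hV.tw_apply m hx,
    hW.tw_apply m (hf n x hx), map_smul, ksign_smul_smul]
  congr 2
  push_cast
  ring

theorem HasDegree.tw_zero {V W : DGData k} (hV : V.IsGraded) (hW : W.IsGraded)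
    {f : V →ₗ[k] W} (hf : HasDegree V W 0 f) (m : ℤ) : W.tw m ∘ₗ f = f ∘ₗ V.tw m := by
  rw [HasDegree.tw hV hW hf]
  simp [ksign_zero]

theorem DGData.IsGraded.tw_eq_id {V : DGData k} (hV : V.IsGraded) {m : ℤ} (hm : (m : ZMod 2) = 0) :
    V.tw m = LinearMap.id :=
  hV.ext fun n x hx => by rw [hV.tw_apply m hx, hm, zero_mul, ksign_zero, one_smul,
    LinearMap.id_apply]

theorem HasDegree.of_span {V W : DGData k} {e n : ℤ} {s : Set V} {f : V →ₗ[k] W}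
    (h : ∀ x ∈ s, f x ∈ W.gr (n + e)) (x : V) (hx : x ∈ Submodule.span k s) : f x ∈ W.gr (n + e) :=
  (Submodule.span_le (p := (W.gr (n + e)).comap f)).2 h hx

theorem HasDegree.tensor {V W V' W' : DGData k} {e e' : ℤ} {f : V →ₗ[k] V'} {g : W →ₗ[k] W'}
    (hf : HasDegree V V' e f) (hg : HasDegree W W' e' g) :
    HasDegree (V.tensor W) (V'.tensor W') (e + e') (TensorProduct.map f g) := by
  intro n x hx
  refine HasDegree.of_span (V := V.tensor W) (W := V'.tensor W') ?_ x hx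
  rintro _ ⟨i, j, x, y, rfl, hx, hy, rfl⟩
  have := DGData.tmul_mem_gr (hf i x hx) (hg j y hy)
  rw [TensorProduct.map_tmul]
  convert this using 2
  ring

theorem HasDegree.pi {J : Type} [Fintype J] [LinearOrder J] {M M' : J → DGData k} {e : J → ℤ}
    {f : ∀ j, M j →ₗ[k] M' j} (hf : ∀ j, HasDegree (M j) (M' j) (e j) (f j)) :
    HasDegree (DGData.pi M) (DGData.pi M') (∑ j, e j) (PiTensorProduct.map f) := by
  intro n x hx
  refine HasDegree.of_span (V := DGData.pi M) (W := DGData.pi M') ?_ x hx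
  rintro _ ⟨n, x, rfl, hx, rfl⟩
  rw [PiTensorProduct.map_tprod, ← Finset.sum_add_distrib]
  exact DGData.tprod_mem_gr fun j => hf j _ _ (hx j)

/-! ### The canonical isomorphisms on homogeneous tensors -/

theorem reorder_apply {J J' : Type} [Fintype J] [LinearOrder J] [LinearOrder J'] (e : J ≃ J')
    {M : J → DGData k} (hM : ∀ j, (M j).IsGraded) {n : J → ℤ} {x : ∀ j, M j}
    (hx : ∀ j, x j ∈ (M j).gr (n j)) :
    reorder e M (PiTensorProduct.tprod k x) = ksign k (invParity e fun j => (n j : ZMod 2)) •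
      PiTensorProduct.tprod k fun j' => x (e.symm j') := by
  rw [reorder, LinearMap.comp_apply, LinearMap.sum_apply,
    Finset.sum_eq_single (fun j => (n j : ZMod 2))]
  · rw [LinearMap.smul_apply, map_par_tprod hM hx, if_pos rfl, map_smul]
    congr 1
    exact PiTensorProduct.reindex_tprod e x
  · intro s _ hs
    rw [LinearMap.smul_apply, map_par_tprod hM hx, if_neg hs, smul_zero]
  · exact fun h => absurd (Finset.mem_univ _) h

theorem nest_tprod {J K : Type} (N : J → DGData k) (q : J → K) (x : ∀ j, N j) :
    nest N q (PiTensorProduct.tprod k x) = PiTensorProduct.tprod k fun l =>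
      PiTensorProduct.tprod k fun j : {j // q j = l} => x j.1 :=
  PiTensorProduct.lift.tprod x

theorem regroup_apply {J K : Type} [Fintype J] [LinearOrder J] [Fintype K] [LinearOrder K]
    {M : K → DGData k} {N : J → DGData k} (hM : ∀ l, (M l).IsGraded) (hN : ∀ j, (N j).IsGraded)
    (q : J → K) {m : K → ℤ} {y : ∀ l, M l} (hy : ∀ l, y l ∈ (M l).gr (m l))
    {n : J → ℤ} {x : ∀ j, N j} (hx : ∀ j, x j ∈ (N j).gr (n j)) :
    regroup M N q (PiTensorProduct.tprod k y ⊗ₜ PiTensorProduct.tprod k x) =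
      ksign k (invParity q (fun j => (n j : ZMod 2)) +
          crossParity q (fun l => (m l : ZMod 2)) (fun j => (n j : ZMod 2))) •
        PiTensorProduct.tprod k fun l =>
          y l ⊗ₜ PiTensorProduct.tprod k fun j : {j // q j = l} => x j.1 := by
  simp only [regroup, LinearMap.comp_apply, LinearMap.sum_apply]
  rw [Finset.sum_eq_single (fun l => (m l : ZMod 2)),
    Finset.sum_eq_single (fun j => (n j : ZMod 2))]
  · rw [LinearMap.smul_apply, TensorProduct.map_tmul, map_par_tprod hM hy, map_par_tprod hN hx,
      if_pos rfl, if_pos rfl, map_smul, map_smul, TensorProduct.map_tmul, nest_tprod,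
      TensorProduct.lift.tmul, LinearMap.id_apply, PiTensorProduct.map₂_tprod_tprod]
    rfl
  · intro s _ hs
    rw [LinearMap.smul_apply, TensorProduct.map_tmul, map_par_tprod hN hx, if_neg hs,
      TensorProduct.tmul_zero, smul_zero]
  · exact fun h => absurd (Finset.mem_univ _) h
  · intro s _ hs
    refine Finset.sum_eq_zero fun t _ => ?_
    rw [LinearMap.smul_apply, TensorProduct.map_tmul, map_par_tprod hM hy, if_neg hs,
      TensorProduct.zero_tmul, smul_zero]
  · exact fun h => absurd (Finset.mem_univ _) h

/-- The map `1 ⊗ ⨂ⱼ fⱼ` with its Koszul sign, for maps `fⱼ` of degree `d j`. -/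
def koszulMap {J : Type} [Fintype J] [LinearOrder J] (X : DGData k) (V W : J → DGData k)
    (d : J → ℤ) (f : ∀ j, V j →ₗ[k] W j) : (X ⊗[k] (⨂[k] j, V j)) →ₗ[k] X ⊗[k] (⨂[k] j, W j) :=
  TensorProduct.map (X.tw (∑ i, d i))
    (PiTensorProduct.map fun i => f i ∘ₗ (V i).tw (∑ j with i < j, d j))

theorem tprod_ksign_smul {J : Type} [Fintype J] {V : J → Type*} [∀ j, AddCommMonoid (V j)]
    [∀ j, Module k (V j)] (s : J → ZMod 2) (x : ∀ j, V j) : (PiTensorProduct.tprod k fun j => ksign k (s j) • x j) =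
      ksign k (∑ j, s j) • PiTensorProduct.tprod k x := by
  rw [MultilinearMap.map_smul_univ, ksign_sum]

/-- The exponent of the sign in `koszulMap`. -/
def mapParity {J : Type} [Fintype J] [LinearOrder J] (d : J → ZMod 2) (s : ZMod 2)
    (t : J → ZMod 2) : ZMod 2 :=
  (∑ j, d j * s) + ∑ i, ∑ j, if i < j then d j * t i else 0

theorem koszulMap_apply {J : Type} [Fintype J] [LinearOrder J] {X : DGData k} (hX : X.IsGraded)
    {V W : J → DGData k} (hV : ∀ j, (V j).IsGraded) (d : J → ℤ) (f : ∀ j, V j →ₗ[k] W j)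
    {m : ℤ} {c : X} (hc : c ∈ X.gr m) {n : J → ℤ} {x : ∀ j, V j}
    (hx : ∀ j, x j ∈ (V j).gr (n j)) :
    koszulMap X V W d f (c ⊗ₜ PiTensorProduct.tprod k x) =
      ksign k (mapParity (fun j => (d j : ZMod 2)) m fun j => (n j : ZMod 2)) •
        (c ⊗ₜ PiTensorProduct.tprod k fun j => f j (x j)) := by
  have h : ∀ i, (f i ∘ₗ (V i).tw (∑ j with i < j, d j)) (x i) =
      ksign k (∑ j, if i < j then (d j : ZMod 2) * n i else 0) • f i (x i) := fun i => by
    rw [LinearMap.comp_apply, (hV i).tw_apply _ (hx i), map_smul, Finset.sum_filter, Int.cast_sum,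
      Finset.sum_mul]
    congr 2
    refine Finset.sum_congr rfl fun j _ => ?_
    split_ifs <;> simp
  rw [koszulMap, TensorProduct.map_tmul, hX.tw_apply _ hc, PiTensorProduct.map_tprod]
  simp only [h]
  rw [tprod_ksign_smul, TensorProduct.smul_tmul_smul, ← ksign_add, Int.cast_sum, Finset.sum_mul]
  rfl

/-! ### Sums over fibres and sign identities -/

section SignIdentities

theorem lt_cases {α : Type*} [LinearOrder α] (a b : α) : (a < b ∧ ¬ b < a ∧ a ≠ b ∧ b ≠ a) ∨
    a = b ∨ (b < a ∧ ¬ a < b ∧ a ≠ b ∧ b ≠ a) := by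
  rcases lt_trichotomy a b with h | h | h
  · exact Or.inl ⟨h, h.not_gt, h.ne, h.ne'⟩
  · exact Or.inr (Or.inl h)
  · exact Or.inr (Or.inr ⟨h, h.not_gt, h.ne', h.ne⟩)

theorem sum_fiber {J K R : Type*} [Fintype J] [Fintype K] [DecidableEq K] [AddCommMonoid R]
    (q : J → K) (g : J → R) : ∑ l, ∑ j : {j // q j = l}, g j.1 = ∑ j, g j := by
  rw [← Fintype.sum_sigma', ← (Equiv.sigmaFiberEquiv q).sum_comp]
  rfl

theorem sum_fiber_dep {J K R : Type*} [Fintype J] [Fintype K] [DecidableEq K] [AddCommMonoid R]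
    (q : J → K) (g : K → J → R) : ∑ l, ∑ j : {j // q j = l}, g l j.1 = ∑ j, g (q j) j := by
  rw [← sum_fiber q]
  refine Finset.sum_congr rfl fun l _ => Finset.sum_congr rfl fun j _ => ?_
  rw [j.2]

theorem sum_fiber_ite {J K R : Type*} [Fintype J] [Fintype K] [DecidableEq K] [AddCommMonoid R]
    (q : J → K) (g : J → R) (l : K) :
    ∑ j : {j // q j = l}, g j.1 = ∑ j, if q j = l then g j else 0 := by
  rw [← Finset.sum_filter]
  exact (Finset.sum_subtype (Finset.univ.filter (q · = l)) (by simp) g).symm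

theorem sum_fiber_pair {J K R : Type*} [Fintype J] [Fintype K] [DecidableEq K] [AddCommMonoid R]
    (q : J → K) (g : J → J → R) :
    ∑ l, ∑ j : {j // q j = l}, ∑ j' : {j // q j = l}, g j.1 j'.1 =
      ∑ j, ∑ j', if q j = q j' then g j j' else 0 := by
  simp only [sum_fiber_ite q (g _)]
  rw [sum_fiber_dep q fun l j => ∑ j', if q j' = l then g j j' else 0]
  simp only [eq_comm]

/-- The bilinear form polarizing `invParity`. -/
def invPair {J K : Type} [Fintype J] [LinearOrder J] [LinearOrder K]
    (p : J → K) (s t : J → ZMod 2) : ZMod 2 :=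
  ∑ j, ∑ j', if (j < j' ∧ p j' < p j) ∨ (j' < j ∧ p j < p j') then s j * t j' else 0

theorem invParity_add {J K : Type} [Fintype J] [LinearOrder J] [LinearOrder K]
    (p : J → K) (s t : J → ZMod 2) :
    invParity p (fun j => s j + t j) = invParity p s + invParity p t + invPair p s t := by
  have h : invPair p s t = (∑ j, ∑ j', if j < j' ∧ p j' < p j then s j * t j' else 0) +
      ∑ j, ∑ j', if j < j' ∧ p j' < p j then s j' * t j else 0 := by
    rw [invPair, Finset.sum_comm (f := fun j j' => if j < j' ∧ p j' < p j then s j' * t j else 0)]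
    simp only [← Finset.sum_add_distrib]
    refine Finset.sum_congr rfl fun j _ => Finset.sum_congr rfl fun j' _ => ?_
    rcases lt_trichotomy j j' with h | rfl | h
    · simp [h, h.not_gt]
    · simp
    · simp [h, h.not_gt]
  rw [h, invParity, invParity, invParity]
  simp only [← Finset.sum_add_distrib]
  refine Finset.sum_congr rfl fun j _ => Finset.sum_congr rfl fun j' _ => ?_
  split_ifs
  · ring
  · simp

/-- A group of letters moves as a block, so its crossings are counted letter by letter. Two letters
of the same group never contribute, since `p i < p i'` is required. -/
theorem invParity_fiber {I J K : Type} [Fintype I] [Fintype J] [LinearOrder J] [LinearOrder K]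
    (p : I → J) (q : J → K) (t : I → ZMod 2) :
    invParity q (fun j => ∑ i : {i // p i = j}, t i.1) =
      ∑ i, ∑ i', if p i < p i' ∧ q (p i') < q (p i) then t i * t i' else 0 := by
  have h : ∀ j j' : J, (if j < j' ∧ q j' < q j then
      (∑ i : {i // p i = j}, t i.1) * (∑ i : {i // p i = j'}, t i.1) else 0) =
      (∑ i' : {i // p i = j'}, (if j < j' ∧ q j' < q j then
        ∑ i : {i // p i = j}, t i.1 else 0) * t i'.1) := fun j j' => by
    rw [← Finset.mul_sum]
    split_ifs <;> simp
  rw [invParity]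
  simp only [h]
  have h2 : ∀ j : J, ∑ j', ∑ i' : {i // p i = j'}, (if j < j' ∧ q j' < q j then
        ∑ i : {i // p i = j}, t i.1 else 0) * t i'.1 =
      ∑ i : {i // p i = j}, ∑ i', if j < p i' ∧ q (p i') < q j then t i.1 * t i' else 0 := by
    intro j
    rw [sum_fiber_dep p fun j' i' => (if j < j' ∧ q j' < q j then
        ∑ i : {i // p i = j}, t i.1 else 0) * t i', Finset.sum_comm]
    refine Finset.sum_congr rfl fun i' _ => ?_
    split_ifs
    · rw [Finset.sum_mul]
    · simp
  simp only [h2]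
  exact sum_fiber_dep p fun j i => ∑ i', if j < p i' ∧ q (p i') < q j then t i * t i' else 0

theorem invPair_fiber {I J K : Type} [Fintype I] [Fintype J] [LinearOrder J] [LinearOrder K]
    (p : I → J) (q : J → K) (s : J → ZMod 2) (t : I → ZMod 2) :
    invPair q s (fun j => ∑ i : {i // p i = j}, t i.1) =
      ∑ i, ∑ j, if (j < p i ∧ q (p i) < q j) ∨ (p i < j ∧ q j < q (p i)) then s j * t i else 0 := by
  rw [Finset.sum_comm, invPair]
  refine Finset.sum_congr rfl fun j _ => ?_
  rw [← sum_fiber_dep p fun j' i => if (j < j' ∧ q j' < q j) ∨ (j' < j ∧ q j < q j') then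
    s j * t i else 0]
  refine Finset.sum_congr rfl fun j' _ => ?_
  split_ifs
  · rw [Finset.mul_sum]
  · simp

theorem crossParity_fiber {I J K : Type} [Fintype I] [Fintype J] [LinearOrder J] [Fintype K] [LinearOrder K]
    (p : I → J) (q : J → K) (s : K → ZMod 2) (t : I → ZMod 2) :
    crossParity q s (fun j => ∑ i : {i // p i = j}, t i.1) = crossParity (fun i => q (p i)) s t := by
  rw [crossParity, crossParity, ← sum_fiber_dep p fun j i => ∑ l, if q j < l then s l * t i else 0]
  refine Finset.sum_congr rfl fun j _ => ?_
  rw [Finset.sum_comm]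
  refine Finset.sum_congr rfl fun l _ => ?_
  split_ifs
  · rw [Finset.mul_sum]
  · simp

theorem crossParity_add_left {J K : Type} [Fintype J] [Fintype K] [LinearOrder K]
    (q : J → K) (s s' : K → ZMod 2) (t : J → ZMod 2) :
    crossParity q (fun l => s l + s' l) t = crossParity q s t + crossParity q s' t := by
  simp only [crossParity, ← Finset.sum_add_distrib]
  refine Finset.sum_congr rfl fun j _ => Finset.sum_congr rfl fun j' _ => ?_
  split_ifs
  · ring
  · simp

theorem crossParity_add_right {J K : Type} [Fintype J] [Fintype K] [LinearOrder K]
    (q : J → K) (s : K → ZMod 2) (t t' : J → ZMod 2) :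
    crossParity q s (fun l => t l + t' l) = crossParity q s t + crossParity q s t' := by
  simp only [crossParity, ← Finset.sum_add_distrib]
  refine Finset.sum_congr rfl fun j _ => Finset.sum_congr rfl fun j' _ => ?_
  split_ifs
  · ring
  · simp

theorem crossParity_fiber_left {I J K : Type} [Fintype I] [Fintype J] [Fintype K] [LinearOrder K]
    (p : I → J) (q : J → K) (s : J → ZMod 2) (t : I → ZMod 2) :
    crossParity (fun i => q (p i)) (fun l => ∑ j : {j // q j = l}, s j.1) t =
      ∑ i, ∑ j, if q (p i) < q j then s j * t i else 0 := by
  refine Finset.sum_congr rfl fun i _ => ?_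
  rw [← sum_fiber_dep q fun l j => if q (p i) < l then s j * t i else 0]
  refine Finset.sum_congr rfl fun l _ => ?_
  split_ifs
  · rw [Finset.sum_mul]
  · simp

/-- Permuting the letters and then grouping them produces the same word as grouping first and
permuting inside the groups. The equality is checked on each pair of letters, the two crossings of
one pair cancelling modulo 2. -/
theorem invParity_leaves {I I' J : Type} [Fintype I] [LinearOrder I] [Fintype I'] [LinearOrder I']
    [Fintype J] [LinearOrder J] (e : I ≃ I') (p : I' → J) (t : I → ZMod 2) :
    invParity e t + invParity p (fun i => t (e.symm i)) =
      invParity (fun i => p (e i)) t + ∑ j,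
        invParity (e.subtypeEquiv (p := fun i => p (e i) = j) (q := fun i => p i = j)
          fun _ => Iff.rfl) (fun i => t i.1) := by
  have h1 : invParity p (fun i => t (e.symm i)) =
      ∑ i, ∑ i', if e i < e i' ∧ p (e i') < p (e i) then t i * t i' else 0 := by
    rw [invParity, ← e.sum_comp]
    refine Finset.sum_congr rfl fun j _ => ?_
    rw [← e.sum_comp]
    simp
  have h2 := sum_fiber_pair (fun i => p (e i)) fun i i' =>
    if i < i' ∧ e i' < e i then t i * t i' else 0
  have h3 : (∑ j, invParity (e.subtypeEquiv (p := fun i => p (e i) = j) (q := fun i => p i = j)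
          fun _ => Iff.rfl) (fun i => t i.1)) = _ := h2
  rw [h1, h3, sum_sum_symmetrize (fun i i' => if e i < e i' ∧ p (e i') < p (e i) then
    t i * t i' else 0) (by simp)]
  simp only [invParity, ← Finset.sum_add_distrib]
  refine Finset.sum_congr rfl fun i _ => Finset.sum_congr rfl fun i' _ => ?_
  by_cases hi : i < i'
  · rcases lt_trichotomy (e i) (e i') with h | h | h
    · rcases lt_cases (p (e i)) (p (e i')) with h' | h' | h' <;>
        simp [hi, h, h', h.not_gt]
    · exact absurd (e.injective h) hi.ne
    · rcases lt_cases (p (e i)) (p (e i')) with h' | h' | h' <;>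
        simp [hi, h, h', h.not_gt, mul_comm (t i') (t i), zmod2_add_self]
  · simp [hi]

/-- Here `s` gives the parities of the decorations and `t` those of the letters. On the left the
decorations are reordered by `f` before the letters are sorted into the groups; on the right the
decorated groups are formed first and permuted as blocks. Pairs of a decoration and a letter (`h2`)
and pairs of letters (`h3`) are compared separately. -/
theorem invParity_vertices {I J J' : Type} [Fintype I] [LinearOrder I] [Fintype J] [LinearOrder J]
    [Fintype J'] [LinearOrder J'] (p : I → J) (f : J ≃ J') (s : J → ZMod 2) (t : I → ZMod 2) :
    invParity f s + (invParity (fun i => f (p i)) t +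
        crossParity (fun i => f (p i)) (fun j => s (f.symm j)) t) =
      invParity p t + crossParity p s t +
        invParity f (fun j => s j + ∑ i : {i // p i = j}, t i.1) := by
  have h1 : crossParity (fun i => f (p i)) (fun j => s (f.symm j)) t =
      ∑ i, ∑ j, if f (p i) < f j then s j * t i else 0 := by
    refine Finset.sum_congr rfl fun i _ => ?_
    rw [← f.sum_comp]
    simp
  have h2 : crossParity p s t + invPair f s (fun j => ∑ i : {i // p i = j}, t i.1) =
      ∑ i, ∑ j, if f (p i) < f j then s j * t i else 0 := by
    rw [invPair_fiber, crossParity]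
    simp only [← Finset.sum_add_distrib]
    refine Finset.sum_congr rfl fun i _ => Finset.sum_congr rfl fun j _ => ?_
    rcases lt_trichotomy (p i) j with h | rfl | h
    · rcases lt_trichotomy (f (p i)) (f j) with h' | h' | h'
      · simp [h, h', h.not_gt, h'.not_gt]
      · exact absurd (f.injective h') h.ne
      · simp [h, h', h.not_gt, h'.not_gt, zmod2_add_self]
    · simp
    · simp [h, h.not_gt]
  have h3 : invParity (fun i => f (p i)) t = invParity p t +
      invParity f (fun j => ∑ i : {i // p i = j}, t i.1) := by
    rw [invParity_fiber, sum_sum_symmetrize (fun i i' => if p i < p i' ∧ f (p i') < f (p i) then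
      t i * t i' else 0) (by simp)]
    simp only [invParity, ← Finset.sum_add_distrib]
    refine Finset.sum_congr rfl fun i _ => Finset.sum_congr rfl fun i' _ => ?_
    by_cases hi : i < i'
    · rcases lt_trichotomy (p i) (p i') with h | h | h
      · rcases lt_trichotomy (f (p i)) (f (p i')) with h' | h' | h'
        · simp [hi, h, h', h.not_gt, h'.not_gt]
        · exact absurd (f.injective h') h.ne
        · simp [hi, h, h', h.not_gt, h'.not_gt]
      · simp [h]
      · rcases lt_trichotomy (f (p i)) (f (p i')) with h' | h' | h'
        · simp [hi, h, h', h.not_gt, h'.not_gt, mul_comm (t i') (t i), zmod2_add_self]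
        · exact absurd (f.injective h') h.ne'
        · simp [hi, h, h', h.not_gt, h'.not_gt]
    · simp [hi]
  rw [invParity_add, h1, h3, ← h2]
  ring

/-- The two ways of sorting a root-level, a middle-level and a leaf-level word into nested groups
agree. Pairs of a middle decoration and a leaf are compared in `h3`, pairs of leaves in `h4`; the
remaining pairs match by additivity of `crossParity` over fibres. -/
theorem parity_coassoc {I J K : Type} [Fintype I] [LinearOrder I] [Fintype J] [LinearOrder J]
    [Fintype K] [LinearOrder K] (p : I → J) (q : J → K) (c : K → ZMod 2) (s : J → ZMod 2)
    (t : I → ZMod 2) :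
    (invParity p t + crossParity p s t) +
        (invParity q (fun j => s j + ∑ i : {i // p i = j}, t i.1) +
          crossParity q c (fun j => s j + ∑ i : {i // p i = j}, t i.1)) =
      (invParity q s + crossParity q c s) +
        ((invParity (fun i => q (p i)) t + crossParity (fun i => q (p i))
          (fun l => c l + ∑ j : {j // q j = l}, s j.1) t) +
        ∑ l, (invParity (fun i : {i // q (p i) = l} => (⟨p i.1, i.2⟩ : {j // q j = l}))
            (fun i => t i.1) +
          crossParity (fun i : {i // q (p i) = l} => (⟨p i.1, i.2⟩ : {j // q j = l}))
            (fun j => s j.1) (fun i => t i.1))) := by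
  have h1 : (∑ l, invParity (fun i : {i // q (p i) = l} => (⟨p i.1, i.2⟩ : {j // q j = l}))
      (fun i => t i.1)) = _ :=
    sum_fiber_pair (fun i => q (p i)) fun i i' => if i < i' ∧ p i' < p i then t i * t i' else 0
  have h2 : (∑ l, crossParity (fun i : {i // q (p i) = l} => (⟨p i.1, i.2⟩ : {j // q j = l}))
      (fun j => s j.1) (fun i => t i.1)) =
      ∑ i, ∑ j, if q j = q (p i) then (if p i < j then s j * t i else 0) else 0 := by
    have : ∀ l, crossParity (fun i : {i // q (p i) = l} => (⟨p i.1, i.2⟩ : {j // q j = l}))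
        (fun j => s j.1) (fun i => t i.1) =
        ∑ i : {i // q (p i) = l}, ∑ j, if q j = l then (if p i < j then s j * t i else 0) else 0 :=
      fun l => Finset.sum_congr rfl fun i _ =>
        sum_fiber_ite q (fun j => if p i.1 < j then s j * t i.1 else 0) l
    simp only [this]
    exact sum_fiber_dep (fun i => q (p i)) fun l i =>
      ∑ j, if q j = l then (if p i < j then s j * t i else 0) else 0
  have h3 : crossParity p s t + invPair q s (fun j => ∑ i : {i // p i = j}, t i.1) =
      crossParity (fun i => q (p i)) (fun l => ∑ j : {j // q j = l}, s j.1) t +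
      ∑ i, ∑ j, if q j = q (p i) then (if p i < j then s j * t i else 0) else 0 := by
    rw [invPair_fiber, crossParity, crossParity_fiber_left]
    simp only [← Finset.sum_add_distrib]
    refine Finset.sum_congr rfl fun i _ => Finset.sum_congr rfl fun j _ => ?_
    rcases lt_trichotomy (p i) j with h | rfl | h
    · rcases lt_cases (q (p i)) (q j) with h' | h' | h' <;>
        simp [h, h', h.not_gt, zmod2_add_self]
    · simp
    · rcases lt_cases (q (p i)) (q j) with h' | h' | h' <;>
        simp [h, h', h.not_gt]
  have h4 : invParity p t + invParity q (fun j => ∑ i : {i // p i = j}, t i.1) =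
      invParity (fun i => q (p i)) t + ∑ i, ∑ i', if q (p i) = q (p i') then
        (if i < i' ∧ p i' < p i then t i * t i' else 0) else 0 := by
    rw [invParity_fiber, sum_sum_symmetrize (fun i i' => if p i < p i' ∧ q (p i') < q (p i) then
      t i * t i' else 0) (by simp)]
    simp only [invParity, ← Finset.sum_add_distrib]
    refine Finset.sum_congr rfl fun i _ => Finset.sum_congr rfl fun i' _ => ?_
    by_cases hi : i < i'
    · rcases lt_trichotomy (p i) (p i') with h | h | h
      · rcases lt_cases (q (p i)) (q (p i')) with h' | h' | h' <;>
          simp [hi, h, h', h.not_gt]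
      · simp [h]
      · rcases lt_cases (q (p i)) (q (p i')) with h' | h' | h' <;>
          simp [hi, h, h', h.not_gt, mul_comm (t i') (t i), zmod2_add_self]
    · simp [hi]
  rw [Finset.sum_add_distrib, h1, h2, invParity_add, crossParity_add_right, crossParity_add_left,
    crossParity_fiber]
  linear_combination h3 + h4

/-- Applying maps of parities `d` to the letters and then grouping is compared with grouping the
maps and the letters first. The extra sign `invParity q d` is the cost of sorting the maps
themselves. The crossings of maps with decorations are in `h5`, those of maps with letters in `h6`.
-/
theorem parity_regroup_map {J K : Type} [Fintype J] [LinearOrder J]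
    [Fintype K] [LinearOrder K] (q : J → K) (d : J → ZMod 2) (c₀ : ZMod 2) (c : K → ZMod 2)
    (s : J → ZMod 2) :
    mapParity d (c₀ + ∑ l, c l) s + (invParity q (fun j => s j + d j) +
        crossParity q c (fun j => s j + d j)) =
      invParity q d + ((invParity q s + crossParity q c s) +
        (mapParity (fun l => ∑ j : {j // q j = l}, d j.1) c₀
            (fun l => c l + ∑ j : {j // q j = l}, s j.1) +
          ∑ l, mapParity (fun j : {j // q j = l} => d j.1) (c l) (fun j => s j.1))) := by
  have h1 : (∑ l, ∑ i : {j // q j = l}, ∑ j : {j // q j = l}, if i < j then d j.1 * s i.1 else 0) =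
      _ := sum_fiber_pair q fun i j => if i < j then d j * s i else 0
  have h2 : (∑ l, ∑ j : {j // q j = l}, d j.1 * c l) = ∑ j, d j * c (q j) :=
    sum_fiber_dep q fun l j => d j * c l
  have h3 : (∑ l, ∑ l', if l < l' then (∑ j : {j // q j = l'}, d j.1) * c l else 0) =
      ∑ j, ∑ l, if l < q j then d j * c l else 0 := by
    rw [Finset.sum_comm, ← sum_fiber_dep q fun l' j => ∑ l, if l < l' then d j * c l else 0]
    refine Finset.sum_congr rfl fun l' _ => ?_
    rw [Finset.sum_comm]
    refine Finset.sum_congr rfl fun l _ => ?_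
    split_ifs
    · rw [Finset.sum_mul]
    · simp
  have h4 : (∑ l, ∑ l', if l < l' then (∑ j : {j // q j = l'}, d j.1) *
      (∑ j : {j // q j = l}, s j.1) else 0) = ∑ i, ∑ j, if q i < q j then d j * s i else 0 := by
    rw [← sum_fiber_dep q fun l i => ∑ j, if l < q j then d j * s i else 0]
    refine Finset.sum_congr rfl fun l _ => ?_
    rw [Finset.sum_comm, ← sum_fiber_dep q fun l' j => ∑ i : {i // q i = l},
      if l < l' then d j * s i.1 else 0]
    refine Finset.sum_congr rfl fun l' _ => ?_
    split_ifs
    · rw [Finset.sum_mul]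
      exact Finset.sum_congr rfl fun j _ => Finset.mul_sum _ _ _
    · simp
  have h5 : (∑ j, d j * ∑ l, c l) + crossParity q c d =
      (∑ j, d j * c (q j)) + ∑ j, ∑ l, if l < q j then d j * c l else 0 := by
    simp only [crossParity, ← Finset.sum_add_distrib, Finset.mul_sum]
    refine Finset.sum_congr rfl fun j _ => ?_
    have : d j * c (q j) = ∑ l, if l = q j then d j * c l else 0 := by simp
    rw [this, ← Finset.sum_add_distrib]
    refine Finset.sum_congr rfl fun l _ => ?_
    rcases lt_trichotomy l (q j) with h | rfl | h
    · simp [h, h.not_gt, h.ne]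
    · simp
    · simp [h, h.not_gt, h.ne', mul_comm (c l), zmod2_add_self]
  have h6 : (∑ i, ∑ j, if i < j then d j * s i else 0) + invPair q s d =
      (∑ i, ∑ j, if q i < q j then d j * s i else 0) +
        ∑ i, ∑ j, if q i = q j then (if i < j then d j * s i else 0) else 0 := by
    simp only [invPair, ← Finset.sum_add_distrib]
    refine Finset.sum_congr rfl fun i _ => Finset.sum_congr rfl fun j _ => ?_
    rcases lt_trichotomy i j with h | rfl | h
    · rcases lt_cases (q i) (q j) with h' | h' | h' <;>
        simp [h, h', h.not_gt, mul_comm (s i), zmod2_add_self]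
    · simp
    · rcases lt_cases (q i) (q j) with h' | h' | h' <;>
        simp [h, h', h.not_gt, mul_comm (s i)]
  have h7 : (∑ l, (∑ j : {j // q j = l}, d j.1) * c₀) = ∑ j, d j * c₀ := by
    rw [← Finset.sum_mul, sum_fiber, Finset.sum_mul]
  have h8 : (∑ l, ∑ l', if l < l' then (∑ j : {j // q j = l'}, d j.1) *
      (c l + ∑ j : {j // q j = l}, s j.1) else 0) =
      (∑ l, ∑ l', if l < l' then (∑ j : {j // q j = l'}, d j.1) * c l else 0) +
      (∑ l, ∑ l', if l < l' then (∑ j : {j // q j = l'}, d j.1) *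
      (∑ j : {j // q j = l}, s j.1) else 0) := by
    simp only [← Finset.sum_add_distrib]
    refine Finset.sum_congr rfl fun i _ => Finset.sum_congr rfl fun j _ => ?_
    split_ifs
    · ring
    · simp
  simp only [mapParity]
  rw [Finset.sum_add_distrib, h8, h7, h1, h2, h3, h4, invParity_add, crossParity_add_right]
  simp only [mul_add, Finset.sum_add_distrib]
  linear_combination h5 + h6

end SignIdentities

/-! ### The cofree coalgebra as a graded space -/

theorem invParity_of_monotone {J J' : Type} [Fintype J] [LinearOrder J] [LinearOrder J']
    {e : J → J'} (he : Monotone e) (t : J → ZMod 2) : invParity e t = 0 :=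
  Finset.sum_eq_zero fun _ _ => Finset.sum_eq_zero fun _ _ =>
    if_neg fun h => h.2.not_ge (he h.1.le)

theorem HasDegree.reorder {J J' : Type} [Fintype J] [LinearOrder J] [Fintype J'] [LinearOrder J']
    (e : J ≃ J') {M : J → DGData k} (hM : ∀ j, (M j).IsGraded) :
    HasDegree (DGData.pi M) (DGData.pi fun j' => M (e.symm j')) 0 (reorder e M) := by
  intro n x hx
  refine HasDegree.of_span (V := DGData.pi M) (W := DGData.pi fun j' => M (e.symm j')) ?_ x hx
  rintro _ ⟨n, x, rfl, hx, rfl⟩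
  rw [reorder_apply e hM hx, add_zero, ← e.symm.sum_comp]
  exact Submodule.smul_mem _ _ (DGData.tprod_mem_gr fun j' => hx (e.symm j'))

theorem Cooperad.map_mem (C : Cooperad k) {I J : Type} [Finite I] [Finite J] (e : I ≃ J) :
    HasDegree (C.obj I).toDGData (C.obj J).toDGData 0 (C.map e) := fun n x hx => by
  rw [add_zero]
  exact (C.map_chain e).1 n x hx

theorem Cooperad.decomp_deg (C : Cooperad k) {I J : Type} [Finite I] [Fintype J] [LinearOrder J]
    (p : I → J) : HasDegree (C.obj I).toDGData
      ((C.obj J).toDGData.tensor (DGData.pi fun j => (C.obj {i // p i = j}).toDGData)) 0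
      (C.decomp p) := fun n x hx => by
  rw [add_zero]
  exact (C.decomp_chain p).1 n x hx

section Cofree

variable (C : Cooperad k) (A : DGVect k)

theorem act_deg (n : ℕ) (e : Equiv.Perm (Fin n)) :
    HasDegree (tensorPower C A n) (tensorPower C A n) 0 (act C A n e) :=
  ((C.map_mem e).tensor (HasDegree.reorder e fun _ => A.isGraded)).of_eq (add_zero 0)

theorem tensorPower_isGraded (n : ℕ) : (tensorPower C A n).IsGraded :=
  (C.obj (Fin n)).isGraded.tensor (DGData.IsGraded.pi fun _ => A.isGraded)

theorem cls_act (n : ℕ) (e : Equiv.Perm (Fin n)) (x) :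
    cls C A n (act C A n e x) = cls C A n x := by
  rw [cls, LinearMap.comp_apply, LinearMap.comp_apply, Representation.Coinvariants.mk_self_apply]

variable {C A} in
theorem Cofree.induction {P : Cofree C A → Prop} (h : ∀ n x, P (cls C A n x)) (h0 : P 0)
    (hadd : ∀ x y, P x → P y → P (x + y)) (x : Cofree C A) : P x := by
  induction x using DirectSum.induction_on with
  | zero => exact h0
  | of n x =>
    obtain ⟨y, rfl⟩ := Representation.Coinvariants.mk_surjective _ x
    exact h n y
  | add x y hx hy => exact hadd x y hx hy

variable {C A} in
theorem Cofree.ext {Z : Type*} [AddCommGroup Z] [Module k Z] {f g : Cofree C A →ₗ[k] Z}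
    (h : ∀ n x, f (cls C A n x) = g (cls C A n x)) : f = g :=
  LinearMap.ext fun x => Cofree.induction (P := fun x => f x = g x) h (by simp)
    (fun x y hx hy => by rw [map_add, map_add, hx, hy]) x

variable {C A} in
theorem descend_cls_eq {Z : Type u} [AddCommGroup Z] [Module k Z]
    (φ : ∀ n : ℕ, (C.obj (Fin n) ⊗[k] (⨂[k] _ : Fin n, A)) →ₗ[k] Z) (n : ℕ) (x) :
    descend φ (cls C A n x) =
      φ n ((n.factorial : k)⁻¹ • ∑ e : Equiv.Perm (Fin n), act C A n e x) := by
  rw [descend, cls, LinearMap.comp_apply, arity, DirectSum.toModule_lof, LinearMap.comp_apply,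
    symmetrize]
  congr 1
  change ((n.factorial : k)⁻¹ • (act C A n).norm) x = _
  simp [Representation.norm, LinearMap.sum_apply]

variable {C A} in
-- `descend` averages over the orbit, so an invariant `φ` is recovered on the nose. Characteristic
-- zero enters here, through the invertibility of n!.
theorem descend_cls [CharZero k] {Z : Type u} [AddCommGroup Z] [Module k Z]
    {φ : ∀ n : ℕ, (C.obj (Fin n) ⊗[k] (⨂[k] _ : Fin n, A)) →ₗ[k] Z} {n : ℕ}
    (h : ∀ e : Equiv.Perm (Fin n), ∀ x, φ n (act C A n e x) = φ n x) (x) :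
    descend φ (cls C A n x) = φ n x := by
  rw [descend_cls_eq, map_smul, map_sum]
  simp only [h, Finset.sum_const, Finset.card_univ, Fintype.card_perm, Fintype.card_fin]
  rw [← Nat.cast_smul_eq_nsmul k, smul_smul, inv_mul_cancel₀, one_smul]
  exact_mod_cast n.factorial_ne_zero

theorem cls_mem_gr {n : ℕ} {i : ℤ} {x} (hx : x ∈ (tensorPower C A n).gr i) :
    cls C A n x ∈ (cofree C A).gr i :=
  Submodule.mem_iSup_of_mem n (Submodule.mem_map_of_mem hx)

theorem par_act (n : ℕ) (e : Equiv.Perm (Fin n)) (b : ZMod 2) (x) :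
    (tensorPower C A n).par b (act C A n e x) = act C A n e ((tensorPower C A n).par b x) := by
  refine LinearMap.congr_fun (f := (tensorPower C A n).par b ∘ₗ act C A n e)
    (g := act C A n e ∘ₗ (tensorPower C A n).par b)
    ((tensorPower_isGraded C A n).ext fun i x hx => ?_) x
  have := act_deg C A n e i x hx
  rw [add_zero] at this
  rw [LinearMap.comp_apply, LinearMap.comp_apply, (tensorPower_isGraded C A n).par_apply i _ this,
    (tensorPower_isGraded C A n).par_apply i _ hx]
  split_ifs <;> simp

theorem cofree_isGraded [CharZero k] : (cofree C A).IsGraded where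
  iSup_gr := by
    rw [eq_top_iff]
    intro x _
    refine Cofree.induction (P := fun x => x ∈ ⨆ n, (cofree C A).gr n) (fun n x => ?_)
      (Submodule.zero_mem _) (fun _ _ => Submodule.add_mem _) x
    have := (tensorPower_isGraded C A n).eq_top ((⨆ n, (cofree C A).gr n).comap (cls C A n))
      fun i y hy => Submodule.mem_iSup_of_mem i (cls_mem_gr C A hy)
    exact (this ▸ Submodule.mem_top : x ∈ (⨆ n, (cofree C A).gr n).comap (cls C A n))
  par_apply i x hx b := by
    let S : Submodule k (Cofree C A) := LinearMap.eqLocus ((cofree C A).par b)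
      (if (i : ZMod 2) = b then LinearMap.id else 0)
    have hS : (cofree C A).gr i ≤ S := by
      refine iSup_le fun n => ?_
      rintro _ ⟨x, hx, rfl⟩
      change (cofree C A).par b (cls C A n x) = _
      rw [descend_cls (fun e x => by
        rw [LinearMap.comp_apply, LinearMap.comp_apply, par_act, cls_act]),
        LinearMap.comp_apply, (tensorPower_isGraded C A n).par_apply i x hx]
      split_ifs <;> simp
    have h : (cofree C A).par b x =
      (if (i : ZMod 2) = b then LinearMap.id else 0 : Cofree C A →ₗ[k] Cofree C A) x := hS hx
    rw [h]
    split_ifs <;> simp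

theorem clsOn_eq {I : Type} [Fintype I] [LinearOrder I] {n : ℕ} (e : I ≃o Fin n) :
    clsOn C A I = cls C A n ∘ₗ TensorProduct.map (C.map e.toEquiv)
      (PiTensorProduct.reindex k (fun _ : I => A.carrier) e.toEquiv).toLinearMap := by
  obtain rfl : Fintype.card I = n := by rw [Fintype.card_congr e.toEquiv, Fintype.card_fin]
  have : e = (Fintype.orderIsoFinOfCardEq I rfl).symm := by
    rw [← OrderIso.symm_symm e, Subsingleton.elim e.symm]
  rw [this]
  rfl

theorem clsOn_eq_cls (n : ℕ) : clsOn C A (Fin n) = cls C A n := by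
  rw [clsOn_eq C A (OrderIso.refl (Fin n))]
  have h1 : C.map (OrderIso.refl (Fin n)).toEquiv = LinearMap.id := C.map_refl _
  have h2 : (PiTensorProduct.reindex k (fun _ : Fin n => A.carrier)
      (OrderIso.refl (Fin n)).toEquiv).toLinearMap = LinearMap.id := by
    refine PiTensorProduct.ext (MultilinearMap.ext fun x => ?_)
    exact PiTensorProduct.reindex_tprod _ _
  rw [h1, h2, TensorProduct.map_id, LinearMap.comp_id]

/-- After both index sets are transported to `Fin` by their order isomorphisms, `e` becomes a
permutation `σ`, and passing to coinvariants kills its action. Only the Koszul sign of `e` remains.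
-/
theorem clsOn_tmul {I I' : Type} [Fintype I] [LinearOrder I] [Fintype I'] [LinearOrder I']
    (e : I ≃ I') (c : C.obj I) {n : I → ℤ} {a : I → A} (ha : ∀ i, a i ∈ A.gr (n i)) :
    clsOn C A I (c ⊗ₜ PiTensorProduct.tprod k a) = ksign k (invParity e fun i => (n i : ZMod 2)) •
      clsOn C A I' (C.map e c ⊗ₜ PiTensorProduct.tprod k fun i' => a (e.symm i')) := by
  let o : I ≃o Fin (Fintype.card I) := (Fintype.orderIsoFinOfCardEq I rfl).symm
  let o' : I' ≃o Fin (Fintype.card I) :=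
    (Fintype.orderIsoFinOfCardEq I' (Fintype.card_congr e.symm)).symm
  rw [clsOn_eq C A o, clsOn_eq C A o']
  simp only [LinearMap.comp_apply, TensorProduct.map_tmul, LinearEquiv.coe_coe,
    PiTensorProduct.reindex_tprod]
  let σ : Equiv.Perm (Fin (Fintype.card I)) := o.toEquiv.symm.trans (e.trans o'.toEquiv)
  rw [← cls_act C A _ σ]
  have h : act C A _ σ (C.map o.toEquiv c ⊗ₜ PiTensorProduct.tprod k fun i => a (o.toEquiv.symm i)) =
      ksign k (invParity e fun i => (n i : ZMod 2)) • (C.map o'.toEquiv (C.map e c) ⊗ₜ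
        PiTensorProduct.tprod k fun i => a (e.symm (o'.toEquiv.symm i))) := by
    change TensorProduct.map (C.map σ) (reorder σ fun _ => A.toDGData) _ = _
    rw [TensorProduct.map_tmul, reorder_apply σ (fun _ => A.isGraded)
      (n := fun i => n (o.toEquiv.symm i)) (fun i => ha _), TensorProduct.tmul_smul]
    have h1 : C.map σ (C.map o.toEquiv c) = C.map o'.toEquiv (C.map e c) := by
      rw [← LinearMap.comp_apply, ← LinearMap.comp_apply, ← C.map_trans, ← C.map_trans]
      congr 2
      ext i
      simp [σ]
    have h2 : (fun i => a (o.toEquiv.symm (σ.symm i))) =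
        fun i => a (e.symm (o'.toEquiv.symm i)) := by
      funext i
      simp [σ]
    have h3 : invParity σ (fun i => ((n (o.toEquiv.symm i) : ℤ) : ZMod 2)) =
        invParity e fun i => (n i : ZMod 2) := by
      rw [invParity, ← o.toEquiv.sum_comp]
      refine Finset.sum_congr rfl fun i _ => ?_
      rw [← o.toEquiv.sum_comp]
      simp [σ]
    rw [h1, h2, h3]
  rw [h, map_smul]

theorem clsOn_tmul_of_monotone {I I' : Type} [Fintype I] [LinearOrder I] [Fintype I']
    [LinearOrder I'] (e : I ≃ I') (he : Monotone e) (c : C.obj I) {n : I → ℤ} {a : I → A}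
    (ha : ∀ i, a i ∈ A.gr (n i)) :
    clsOn C A I (c ⊗ₜ PiTensorProduct.tprod k a) =
      clsOn C A I' (C.map e c ⊗ₜ PiTensorProduct.tprod k fun i' => a (e.symm i')) := by
  rw [clsOn_tmul C A e c ha, invParity_of_monotone he, ksign_zero, one_smul]

theorem clsOn_map {I I' : Type} [Fintype I] [LinearOrder I] [Fintype I'] [LinearOrder I']
    (e : I ≃ I') : clsOn C A I' ∘ₗ TensorProduct.map (C.map e) (reorder e fun _ => A.toDGData) =
      clsOn C A I := by
  refine tensor_ext_gr (V := (C.obj I).toDGData) (W := DGData.pi fun _ : I => A.toDGData)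
    (C.obj I).isGraded (DGData.IsGraded.pi fun _ => A.isGraded) fun m _ c _ y _ => ?_
  have := pi_ext_gr (M := fun _ : I => A.toDGData) (fun _ => A.isGraded)
    (f := (clsOn C A I' ∘ₗ TensorProduct.map (C.map e) (reorder e fun _ => A.toDGData)) ∘ₗ
      TensorProduct.mk k _ _ c) (g := clsOn C A I ∘ₗ TensorProduct.mk k _ _ c) fun n a ha => by
    simp only [LinearMap.comp_apply, TensorProduct.mk_apply, TensorProduct.map_tmul]
    rw [reorder_apply e (fun _ => A.isGraded) ha, TensorProduct.tmul_smul, map_smul,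
      clsOn_tmul C A e c ha]
  exact LinearMap.congr_fun this y

theorem clsOn_deg (I : Type) [Fintype I] [LinearOrder I] :
    HasDegree ((C.obj I).toDGData.tensor (DGData.pi fun _ : I => A.toDGData)) (cofree C A) 0
      (clsOn C A I) := by
  rw [← clsOn_map C A (Fintype.orderIsoFinOfCardEq I rfl).symm.toEquiv, clsOn_eq_cls]
  have h1 : HasDegree (tensorPower C A (Fintype.card I)) (cofree C A) 0 (cls C A _) :=
    fun n x hx => by
      rw [add_zero]
      exact cls_mem_gr C A hx
  exact (h1.comp ((C.map_mem _).tensor (HasDegree.reorder _ fun _ => A.isGraded))).of_eq rfl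

theorem clsOn_mem_gr {I : Type} [Fintype I] [LinearOrder I] {m : ℤ} {c : C.obj I}
    (hc : c ∈ (C.obj I).gr m) {n : I → ℤ} {a : I → A} (ha : ∀ i, a i ∈ A.gr (n i)) :
    clsOn C A I (c ⊗ₜ PiTensorProduct.tprod k a) ∈ (cofree C A).gr (m + ∑ i, n i) := by
  have := clsOn_deg C A I _ _ (DGData.tmul_mem_gr hc (DGData.tprod_mem_gr
    (M := fun _ : I => A.toDGData) ha))
  rwa [add_zero] at this

/-! ### The comultiplications -/

/-- The second half of the comultiplication along `p`. -/
def collect (X : Type u) [AddCommGroup X] [Module k X] {I J : Type} [Fintype I] [LinearOrder I]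
    [Fintype J] [LinearOrder J] (p : I → J) :
    ((X ⊗[k] (⨂[k] j, C.obj {i // p i = j})) ⊗[k] (⨂[k] _ : I, A)) →ₗ[k]
      (X ⊗[k] (⨂[k] _ : J, Cofree C A)) :=
  TensorProduct.map LinearMap.id
      ((PiTensorProduct.map fun j => clsOn C A {i // p i = j}) ∘ₗ
        regroup (fun j => (C.obj {i // p i = j}).toDGData) (fun _ => A.toDGData) p) ∘ₗ
    (TensorProduct.assoc k _ _ _).toLinearMap

/-- The summand of the comultiplication which belongs to `p`. -/
def comulTree {I J : Type} [Fintype I] [LinearOrder I] [Fintype J] [LinearOrder J] (p : I → J) :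
    (C.obj I ⊗[k] (⨂[k] _ : I, A)) →ₗ[k] (C.obj J ⊗[k] (⨂[k] _ : J, Cofree C A)) :=
  collect C A (C.obj J) p ∘ₗ TensorProduct.map (C.decomp p) LinearMap.id

/-- The comultiplication of the cofree coalgebra which belongs to a finite linearly ordered set. -/
def comulOn (J : Type) [Fintype J] [LinearOrder J] :
    Cofree C A →ₗ[k] (C.obj J ⊗[k] (⨂[k] _ : J, Cofree C A)) :=
  descend fun _ => ∑ p, comulTree C A p

theorem comulOn_fin (m : ℕ) : comulOn C A (Fin m) = comul C A m := rfl

theorem collect_apply (X : Type u) [AddCommGroup X] [Module k X] {I J : Type} [Fintype I]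
    [LinearOrder I] [Fintype J] [LinearOrder J] (p : I → J) (c : X) {m : J → ℤ} {y : ∀ j, C.obj {i // p i = j}}
    (hy : ∀ j, y j ∈ (C.obj {i // p i = j}).gr (m j)) {n : I → ℤ} {a : I → A}
    (ha : ∀ i, a i ∈ A.gr (n i)) :
    collect C A X p ((c ⊗ₜ PiTensorProduct.tprod k y) ⊗ₜ PiTensorProduct.tprod k a) =
      ksign k (invParity p (fun i => (n i : ZMod 2)) +
          crossParity p (fun j => (m j : ZMod 2)) (fun i => (n i : ZMod 2))) •
        (c ⊗ₜ PiTensorProduct.tprod k fun j =>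
          clsOn C A {i // p i = j} (y j ⊗ₜ PiTensorProduct.tprod k fun i => a i.1)) := by
  rw [collect, LinearMap.comp_apply, LinearEquiv.coe_coe, TensorProduct.assoc_tmul,
    TensorProduct.map_tmul, LinearMap.comp_apply,
    regroup_apply (fun j => (C.obj {i // p i = j}).isGraded) (fun _ => A.isGraded) p hy ha,
    map_smul, PiTensorProduct.map_tprod, TensorProduct.tmul_smul]
  rfl

theorem triple_ext_gr {I J : Type} [Finite I] [Fintype J] [LinearOrder J] {X : DGData k}
    (hX : X.IsGraded)
    {M : J → DGData k} (hM : ∀ j, (M j).IsGraded) {N : I → DGData k} (hN : ∀ j, (N j).IsGraded)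
    {Z : Type*} [AddCommGroup Z] [Module k Z]
    {f g : ((X ⊗[k] (⨂[k] j, M j)) ⊗[k] (⨂[k] i, N i)) →ₗ[k] Z}
    (h : ∀ (i : ℤ) (c : X), c ∈ X.gr i → ∀ (m : J → ℤ) (y : ∀ j, M j), (∀ j, y j ∈ (M j).gr (m j)) →
      ∀ (n : I → ℤ) (x : ∀ j, N j), (∀ j, x j ∈ (N j).gr (n j)) →
      f ((c ⊗ₜ PiTensorProduct.tprod k y) ⊗ₜ PiTensorProduct.tprod k x) =
        g ((c ⊗ₜ PiTensorProduct.tprod k y) ⊗ₜ PiTensorProduct.tprod k x)) : f = g := by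
  refine TensorProduct.ext ?_
  refine tensor_ext_gr (W := DGData.pi M) hX (DGData.IsGraded.pi hM) fun i _ c hc y _ => ?_
  refine LinearMap.congr_fun (f := TensorProduct.curry f ∘ₗ TensorProduct.mk k _ _ c)
    (g := TensorProduct.curry g ∘ₗ TensorProduct.mk k _ _ c) (pi_ext_gr hM fun m y hy => ?_) y
  exact pi_ext_gr hN fun n x hx => h i c hc m y hy n x hx

/-- For a permutation `e` of `Fin n` this moves the summand of `p` to that of `p ∘ e`, so the sum
over all `p` is constant on orbits and defines a map on coinvariants. -/
theorem comulTree_leaves {I I' J : Type} [Fintype I] [LinearOrder I] [Fintype I'] [LinearOrder I']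
    [Fintype J] [LinearOrder J] (e : I ≃ I') (p : I' → J) :
    comulTree C A p ∘ₗ TensorProduct.map (C.map e) (reorder e fun _ => A.toDGData) =
      comulTree C A fun i => p (e i) := by
  have h : comulTree C A p ∘ₗ TensorProduct.map (C.map e) (reorder e fun _ => A.toDGData) =
      (collect C A (C.obj J) p ∘ₗ TensorProduct.map (TensorProduct.map LinearMap.id
        (PiTensorProduct.map fun j => C.map
          (e.subtypeEquiv (p := fun i => p (e i) = j) (q := fun i => p i = j) fun _ => Iff.rfl)))
        (reorder e fun _ => A.toDGData)) ∘ₗ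
        TensorProduct.map (C.decomp fun i => p (e i)) LinearMap.id := by
    rw [comulTree, LinearMap.comp_assoc, ← TensorProduct.map_comp, C.decomp_leaves,
      LinearMap.comp_assoc, ← TensorProduct.map_comp]
    rfl
  rw [h, comulTree]
  congr 1
  refine triple_ext_gr (C.obj J).isGraded (fun j => (C.obj _).isGraded) (fun _ => A.isGraded)
    fun i c hc m y hy n a ha => ?_
  rw [LinearMap.comp_apply, TensorProduct.map_tmul, TensorProduct.map_tmul,
    PiTensorProduct.map_tprod, LinearMap.id_apply, reorder_apply e (fun _ => A.isGraded) ha,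
    TensorProduct.tmul_smul, map_smul,
    collect_apply C A _ p c (m := m) (fun j => by simpa using C.map_mem _ _ _ (hy j))
      (n := fun i => n (e.symm i)) (fun i => ha _),
    collect_apply C A _ (fun i => p (e i)) c hy ha]
  have h2 : ∀ j, clsOn C A {i // p (e i) = j} (y j ⊗ₜ PiTensorProduct.tprod k fun i => a i.1) =
      ksign k (invParity (e.subtypeEquiv (p := fun i => p (e i) = j) (q := fun i => p i = j)
          fun _ => Iff.rfl) (fun i => (n i.1 : ZMod 2))) •
        clsOn C A {i // p i = j} (C.map (e.subtypeEquiv (p := fun i => p (e i) = j)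
          (q := fun i => p i = j) fun _ => Iff.rfl) (y j) ⊗ₜ
            PiTensorProduct.tprod k fun i => a (e.symm i.1)) :=
    fun j => clsOn_tmul C A _ _ fun i => ha i.1
  simp only [h2]
  rw [tprod_ksign_smul, TensorProduct.tmul_smul, ksign_smul_smul,
    ksign_smul_smul]
  congr 2
  have h3 : crossParity p (fun j => (m j : ZMod 2)) (fun i => ((n (e.symm i) : ℤ) : ZMod 2)) =
      crossParity (fun i => p (e i)) (fun j => (m j : ZMod 2)) (fun i => (n i : ZMod 2)) := by
    rw [crossParity, ← e.sum_comp]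
    simp [crossParity]
  have h4 := invParity_leaves e p fun i => (n i : ZMod 2)
  rw [← add_assoc, h4, h3]
  ring

/-- Summed over `p`, this gives the equivariance of the comultiplications of the cofree coalgebra in
the set of outputs, `comulOn_map`. -/
theorem comulTree_vertices [CharZero k] {I J J' : Type} [Fintype I] [LinearOrder I] [Fintype J] [LinearOrder J]
    [Fintype J'] [LinearOrder J'] (p : I → J) (f : J ≃ J') :
    comulTree C A (fun i => f (p i)) =
      TensorProduct.map (C.map f) (reorder f fun _ => cofree C A) ∘ₗ comulTree C A p := by
  have h : comulTree C A (fun i => f (p i)) =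
      (collect C A (C.obj J') (fun i => f (p i)) ∘ₗ TensorProduct.map (TensorProduct.map (C.map f)
        ((PiTensorProduct.map fun j' : J' => C.map (Equiv.subtypeEquivRight
            (p := fun i => p i = f.symm j') (q := fun i => f (p i) = j')
              fun _ => f.eq_symm_apply)) ∘ₗ reorder f fun j => (C.obj {i // p i = j}).toDGData))
        LinearMap.id) ∘ₗ TensorProduct.map (C.decomp p) LinearMap.id := by
    rw [comulTree, LinearMap.comp_assoc, ← TensorProduct.map_comp, C.decomp_vertices]
    rfl
  rw [h, comulTree, ← LinearMap.comp_assoc]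
  congr 1
  refine triple_ext_gr (C.obj J).isGraded (fun j => (C.obj _).isGraded) (fun _ => A.isGraded)
    fun i c hc m y hy n a ha => ?_
  rw [LinearMap.comp_apply, TensorProduct.map_tmul, TensorProduct.map_tmul, LinearMap.id_apply,
    LinearMap.comp_apply, reorder_apply f (fun j => (C.obj _).isGraded) hy, map_smul,
    PiTensorProduct.map_tprod, TensorProduct.tmul_smul, ← TensorProduct.smul_tmul', map_smul,
    collect_apply C A _ _ _ (m := fun j => m (f.symm j))
      (fun j => by simpa using C.map_mem _ _ _ (hy (f.symm j))) ha,
    LinearMap.comp_apply, collect_apply C A _ p c hy ha, map_smul, TensorProduct.map_tmul,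
    reorder_apply f (fun _ => cofree_isGraded C A)
      (fun j => clsOn_mem_gr C A (hy j) fun i => ha i.1),
    TensorProduct.tmul_smul, ksign_smul_smul, ksign_smul_smul]
  congr 1
  · congr 1
    push_cast
    exact invParity_vertices p f _ _
  · congr 2
    funext j'
    exact (clsOn_tmul_of_monotone C A (Equiv.subtypeEquivRight (p := fun i => p i = f.symm j')
      (q := fun i => f (p i) = j') fun _ => f.eq_symm_apply) (fun _ _ h => h) (y (f.symm j'))
      fun i => ha i.1).symm

theorem comulOn_clsOn [CharZero k] {I J : Type} [Fintype I] [LinearOrder I] [Fintype J] [LinearOrder J] :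
    comulOn C A J ∘ₗ clsOn C A I = ∑ p : I → J, comulTree C A p := by
  have h : ∀ {I I' : Type} [Fintype I] [LinearOrder I] [Fintype I'] [LinearOrder I'] (e : I ≃ I'),
      (∑ p : I' → J, comulTree C A p) ∘ₗ
        TensorProduct.map (C.map e) (reorder e fun _ => A.toDGData) =
      ∑ p : I → J, comulTree C A p := by
    intro I I' _ _ _ _ e
    refine LinearMap.ext fun x => ?_
    rw [LinearMap.comp_apply, LinearMap.sum_apply, LinearMap.sum_apply,
      ← (e.arrowCongr (Equiv.refl J)).symm.sum_comp]
    exact Finset.sum_congr rfl fun p _ => LinearMap.congr_fun (comulTree_leaves C A e p) x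
  have h2 : ∀ n, comulOn C A J ∘ₗ cls C A n = ∑ p : Fin n → J, comulTree C A p := fun n =>
    LinearMap.ext fun x => descend_cls (fun e x => LinearMap.congr_fun (h e) x) x
  rw [← clsOn_map C A (Fintype.orderIsoFinOfCardEq I rfl).symm.toEquiv, clsOn_eq_cls,
    ← LinearMap.comp_assoc, h2, h]

theorem comulOn_cls [CharZero k] (J : Type) [Fintype J] [LinearOrder J] (n : ℕ) (x) :
    comulOn C A J (cls C A n x) = ∑ p : Fin n → J, comulTree C A p x := by
  rw [← clsOn_eq_cls, ← LinearMap.comp_apply, comulOn_clsOn, LinearMap.sum_apply]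

theorem comulOn_map [CharZero k] {J J' : Type} [Fintype J] [LinearOrder J] [Fintype J'] [LinearOrder J']
    (f : J ≃ J') : comulOn C A J' =
      TensorProduct.map (C.map f) (reorder f fun _ => cofree C A) ∘ₗ comulOn C A J := by
  refine Cofree.ext fun n x => ?_
  rw [LinearMap.comp_apply, comulOn_cls, comulOn_cls, map_sum,
    ← ((Equiv.refl (Fin n)).arrowCongr f).sum_comp]
  exact Finset.sum_congr rfl fun p _ => LinearMap.congr_fun (comulTree_vertices C A p f) x

end Cofree

/-! ### Coassociativity of the cofree coalgebra -/

theorem regroup_natural {J K : Type} [Fintype J] [LinearOrder J] [Fintype K] [LinearOrder K]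
    {M M' : K → DGData k} {N : J → DGData k} (hM : ∀ l, (M l).IsGraded)
    (hM' : ∀ l, (M' l).IsGraded) (hN : ∀ j, (N j).IsGraded) (q : J → K)
    (f : ∀ l, M l →ₗ[k] M' l) (hf : ∀ l, HasDegree (M l) (M' l) 0 (f l)) :
    regroup M' N q ∘ₗ TensorProduct.map (PiTensorProduct.map f) LinearMap.id =
      (PiTensorProduct.map fun l => TensorProduct.map (f l) LinearMap.id) ∘ₗ regroup M N q := by
  refine TensorProduct.ext ?_
  refine pi_ext_gr hM fun m y hy => pi_ext_gr hN fun n x hx => ?_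
  simp only [TensorProduct.mk_apply, LinearMap.comp_apply, LinearMap.compr₂ₛₗ_apply]
  rw [TensorProduct.map_tmul, PiTensorProduct.map_tprod, LinearMap.id_apply,
    regroup_apply hM' hN q (m := m) (fun l => by simpa using hf l _ _ (hy l)) hx,
    regroup_apply hM hN q hy hx, map_smul, PiTensorProduct.map_tprod]
  rfl

theorem map_sum_tprod {K : Type} [Fintype K] [DecidableEq K] {V W : K → Type u}
    [∀ l, AddCommGroup (V l)] [∀ l, Module k (V l)] [∀ l, AddCommGroup (W l)] [∀ l, Module k (W l)]
    {ι : K → Type} [∀ l, Fintype (ι l)] (f : ∀ l, ι l → V l →ₗ[k] W l) :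
    PiTensorProduct.map (fun l => ∑ i, f l i) =
      ∑ i : ∀ l, ι l, PiTensorProduct.map fun l => f l (i l) :=
  MultilinearMap.map_sum (PiTensorProduct.mapMultilinear k V W) f

section

variable (C : Cooperad k)

/-- The restriction of a map of sets over `K` to the fibres over `l : K`. -/
abbrev overFibre {I J K : Type} (p : I → J) (q : J → K) (l : K) (i : {i // q (p i) = l}) :
    {j // q j = l} := ⟨p i.1, i.2⟩

/-- The decorations by `C` of the trees of height two which are the fibre of `p` and `q` over `l`. -/
def treeObj {I J K : Type} [Finite I] [Fintype J] [LinearOrder J] [LinearOrder K]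
    (p : I → J) (q : J → K) (l : K) : DGData k :=
  (C.obj {j // q j = l}).toDGData.tensor
    (DGData.pi fun j : {j // q j = l} => (C.obj {i // overFibre p q l i = j}).toDGData)

theorem treeObj_isGraded {I J K : Type} [Finite I] [Fintype J] [LinearOrder J] [LinearOrder K]
    (p : I → J) (q : J → K) (l : K) : (treeObj C p q l).IsGraded :=
  (C.obj _).isGraded.tensor (DGData.IsGraded.pi fun _ => (C.obj _).isGraded)

/-- The comultiplication over `l`. -/
def treeDecomp {I J K : Type} [Finite I] [Fintype J] [LinearOrder J] [LinearOrder K]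
    (p : I → J) (q : J → K) (l : K) : C.obj {i // q (p i) = l} →ₗ[k] treeObj C p q l :=
  C.decomp (overFibre p q l)

/-- The identification of the fibres of the restriction of `p` with fibres of `p`. -/
def treeRelabel {I J K : Type} [Finite I] [Fintype J] [LinearOrder J] [LinearOrder K]
    (p : I → J) (q : J → K) (l : K) :
    (C.obj {j // q j = l} ⊗[k] (⨂[k] j : {j // q j = l}, C.obj {i // p i = j.1})) →ₗ[k]
      treeObj C p q l :=
  TensorProduct.map LinearMap.id (PiTensorProduct.map fun j => C.map (fibreEquiv p q l j).symm)

/-- A map `p : I → J` is the same as the map `r = q ∘ p` together with the induced maps between the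
fibres over `K`. This matches the index sets on the two sides of coassociativity of the cofree
coalgebra. -/
theorem sum_over_fibres {I J K R : Type*} [Fintype I] [DecidableEq I] [Fintype J] [DecidableEq J]
    [Fintype K] [DecidableEq K] [AddCommMonoid R] (q : J → K)
    (E : ∀ r : I → K, ((l : K) → {i // r i = l} → {j // q j = l}) → R) :
    ∑ r, ∑ P, E r P = ∑ p : I → J, E (fun i => q (p i)) fun _ i => ⟨p i.1, i.2⟩ := by
  rw [← Fintype.sum_sigma']
  refine (Fintype.sum_bijective (fun p : I → J =>
    (⟨fun i => q (p i), fun _ i => ⟨p i.1, i.2⟩⟩ :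
      Σ r : I → K, ∀ l, {i // r i = l} → {j // q j = l})) ⟨?_, ?_⟩ _ _ fun p => rfl).symm
  · intro p p' h
    exact congrArg (fun x : Σ r : I → K, ∀ l, {i // r i = l} → {j // q j = l} =>
      fun i => (x.2 (x.1 i) ⟨i, rfl⟩).1) h
  · rintro ⟨r, P⟩
    -- The map `p` is kept as a variable so that `r` can be eliminated by substitution; the
    -- dependent families of maps on fibres then have the same type.
    have key : ∀ p : I → J, (∀ i, (P (r i) ⟨i, rfl⟩).1 = p i) →
        (⟨fun i => q (p i), fun _ i => ⟨p i.1, i.2⟩⟩ :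
          Σ r : I → K, ∀ l, {i // r i = l} → {j // q j = l}) = ⟨r, P⟩ := by
      intro p hp
      obtain rfl : r = fun i => q (p i) := funext fun i => by rw [← hp i, (P (r i) ⟨i, rfl⟩).2]
      congr 1
      funext l ⟨i, hi⟩
      subst hi
      exact Subtype.ext (hp i).symm
    exact ⟨_, key _ fun i => rfl⟩

/-- Coassociativity solved for the side which decomposes over each vertex of the lowest level: the
relabelling of fibres is invertible and is carried to the other side. -/
theorem Cooperad.coassoc_symm {I J K : Type} [Finite I] [Fintype J] [LinearOrder J] [Fintype K]
    [LinearOrder K] (p : I → J) (q : J → K) :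
    TensorProduct.map LinearMap.id (PiTensorProduct.map fun l => C.decomp (overFibre p q l)) ∘ₗ
      C.decomp (fun i => q (p i)) =
    TensorProduct.map LinearMap.id ((PiTensorProduct.map fun l => TensorProduct.map LinearMap.id
        (PiTensorProduct.map fun j : {j // q j = l} => C.map (fibreEquiv p q l j).symm)) ∘ₗ
      (regroup (fun l => (C.obj {j // q j = l}).toDGData)
          (fun j => (C.obj {i // p i = j}).toDGData) q)) ∘ₗ
      (TensorProduct.assoc k _ _ _).toLinearMap ∘ₗ
        TensorProduct.map (C.decomp q) LinearMap.id ∘ₗ C.decomp p := by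
  have h2 : ∀ l (j : {j // q j = l}), C.map (fibreEquiv p q l j).symm ∘ₗ
      C.map (fibreEquiv p q l j) = LinearMap.id := fun l j => by
    rw [← C.map_trans, Equiv.self_trans_symm, C.map_refl]
  calc _ = TensorProduct.map LinearMap.id (PiTensorProduct.map fun l => TensorProduct.map
        LinearMap.id (PiTensorProduct.map fun j : {j // q j = l} =>
          C.map (fibreEquiv p q l j).symm)) ∘ₗ
        (TensorProduct.map LinearMap.id (PiTensorProduct.map fun l =>
        TensorProduct.map LinearMap.id (PiTensorProduct.map fun j : {j // q j = l} =>
          C.map (fibreEquiv p q l j)) ∘ₗ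
        C.decomp (fun i : {i // q (p i) = l} => (⟨p i.1, i.2⟩ : {j // q j = l}))) ∘ₗ
      C.decomp (fun i => q (p i))) := by
        rw [← LinearMap.comp_assoc, ← TensorProduct.map_comp, ← PiTensorProduct.map_comp]
        simp only [← LinearMap.comp_assoc, ← TensorProduct.map_comp, ← PiTensorProduct.map_comp, h2,
          PiTensorProduct.map_id, LinearMap.id_comp, TensorProduct.map_id]
    _ = _ := by
        rw [← C.coassoc, ← LinearMap.comp_assoc, ← TensorProduct.map_comp]
        rfl

theorem treeDecomp_decomp {I J K : Type} [Finite I] [Fintype J] [LinearOrder J] [Fintype K]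
    [LinearOrder K] (p : I → J) (q : J → K) :
    TensorProduct.map LinearMap.id (PiTensorProduct.map (treeDecomp C p q)) ∘ₗ
      C.decomp (fun i => q (p i)) =
    TensorProduct.map LinearMap.id (PiTensorProduct.map (treeRelabel C p q) ∘ₗ
      regroup (fun l => (C.obj {j // q j = l}).toDGData)
          (fun j => (C.obj {i // p i = j}).toDGData) q) ∘ₗ
      (TensorProduct.assoc k _ _ _).toLinearMap ∘ₗ
        TensorProduct.map (C.decomp q) LinearMap.id ∘ₗ C.decomp p :=
  C.coassoc_symm p q

theorem quadruple_ext_gr {I J K : Type} [Finite I] [Fintype J] [LinearOrder J] [Fintype K]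
    [LinearOrder K] {X : DGData k} (hX : X.IsGraded) {L : K → DGData k} (hL : ∀ j, (L j).IsGraded)
    {M : J → DGData k} (hM : ∀ j, (M j).IsGraded) {N : I → DGData k} (hN : ∀ j, (N j).IsGraded)
    {Z : Type*} [AddCommGroup Z] [Module k Z]
    {f g : (((X ⊗[k] (⨂[k] j, L j)) ⊗[k] (⨂[k] j, M j)) ⊗[k] (⨂[k] i, N i)) →ₗ[k] Z}
    (h : ∀ (i : ℤ) (c : X), c ∈ X.gr i → ∀ (l : K → ℤ) (z : ∀ j, L j), (∀ j, z j ∈ (L j).gr (l j)) →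
      ∀ (m : J → ℤ) (y : ∀ j, M j), (∀ j, y j ∈ (M j).gr (m j)) →
      ∀ (n : I → ℤ) (x : ∀ j, N j), (∀ j, x j ∈ (N j).gr (n j)) →
      f (((c ⊗ₜ PiTensorProduct.tprod k z) ⊗ₜ PiTensorProduct.tprod k y) ⊗ₜ
          PiTensorProduct.tprod k x) =
        g (((c ⊗ₜ PiTensorProduct.tprod k z) ⊗ₜ PiTensorProduct.tprod k y) ⊗ₜ
          PiTensorProduct.tprod k x)) : f = g := by
  refine TensorProduct.ext ?_
  refine triple_ext_gr hX hL hM fun i c hc l z hz m y hy => ?_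
  exact pi_ext_gr hN fun n x hx => h i c hc l z hz m y hy n x hx

variable (A : DGVect k)

theorem collect_collect_left {I J K : Type} [Fintype I] [LinearOrder I] [Fintype J] [LinearOrder J]
    [Fintype K] [LinearOrder K] [CharZero k] (p : I → J) (q : J → K) (c : C.obj K) {m : K → ℤ}
    {z : ∀ l, C.obj {j // q j = l}} (hz : ∀ l, z l ∈ (C.obj {j // q j = l}).gr (m l))
    {s : J → ℤ} {y : ∀ j, C.obj {i // p i = j}} (hy : ∀ j, y j ∈ (C.obj {i // p i = j}).gr (s j))
    {n : I → ℤ} {a : I → A} (ha : ∀ i, a i ∈ A.gr (n i)) :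
    TensorProduct.map LinearMap.id (regroup (fun l => (C.obj {j // q j = l}).toDGData)
        (fun _ : J => cofree C A) q) (TensorProduct.assoc k _ _ _ (collect C A _ p
          (((c ⊗ₜ PiTensorProduct.tprod k z) ⊗ₜ PiTensorProduct.tprod k y) ⊗ₜ
            PiTensorProduct.tprod k a))) =
    ksign k ((invParity p (fun i => (n i : ZMod 2)) +
        crossParity p (fun j => (s j : ZMod 2)) (fun i => (n i : ZMod 2))) +
      (invParity q (fun j => (s j : ZMod 2) + ∑ i : {i // p i = j}, (n i.1 : ZMod 2)) +
        crossParity q (fun l => (m l : ZMod 2))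
          (fun j => (s j : ZMod 2) + ∑ i : {i // p i = j}, (n i.1 : ZMod 2)))) •
      (c ⊗ₜ PiTensorProduct.tprod k fun l => z l ⊗ₜ PiTensorProduct.tprod k
        fun j : {j // q j = l} => clsOn C A {i // p i = j.1}
          (y j.1 ⊗ₜ PiTensorProduct.tprod k fun i => a i.1)) := by
  rw [collect_apply C A _ p _ hy ha, map_smul, map_smul,
    TensorProduct.assoc_tmul, TensorProduct.map_tmul,
    regroup_apply (fun _ => (C.obj _).isGraded) (fun _ => cofree_isGraded C A) q hz
      (fun j => clsOn_mem_gr C A (hy j) fun i => ha i.1), TensorProduct.tmul_smul, ksign_smul_smul]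
  push_cast
  rfl

/-- The second half of the comultiplication over `l`. -/
def treeCollect {I J K : Type} [Fintype I] [LinearOrder I] [Fintype J] [LinearOrder J]
    [LinearOrder K] (p : I → J) (q : J → K) (l : K) :
    (treeObj C p q l ⊗[k] (⨂[k] _ : {i // q (p i) = l}, A)) →ₗ[k]
      (C.obj {j // q j = l} ⊗[k] (⨂[k] _ : {j // q j = l}, Cofree C A)) :=
  collect C A _ (overFibre p q l)

theorem map_fibreEquiv_tmul {I J K : Type} [Finite I] [Fintype J] [LinearOrder J]
    (p : I → J) (q : J → K) (l : K) (z : C.obj {j // q j = l}) (y : ∀ j, C.obj {i // p i = j}) :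
    TensorProduct.map LinearMap.id
      (PiTensorProduct.map fun j : {j // q j = l} => C.map (fibreEquiv p q l j).symm)
      (z ⊗ₜ[k] PiTensorProduct.tprod k fun j : {j // q j = l} => y j.1) =
    z ⊗ₜ[k] PiTensorProduct.tprod k
      fun j : {j // q j = l} => C.map (fibreEquiv p q l j).symm (y j.1) := by
  rw [TensorProduct.map_tmul, PiTensorProduct.map_tprod, LinearMap.id_apply]

theorem treeRelabel_mem_gr {I J K : Type} [Finite I] [Fintype J] [LinearOrder J]
    [LinearOrder K] (p : I → J) (q : J → K) (l : K) {m : ℤ} {z : C.obj {j // q j = l}}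
    (hz : z ∈ (C.obj {j // q j = l}).gr m)
    {s : J → ℤ} {y : ∀ j, C.obj {i // p i = j}} (hy : ∀ j, y j ∈ (C.obj {i // p i = j}).gr (s j)) :
    treeRelabel C p q l (z ⊗ₜ PiTensorProduct.tprod k fun j : {j // q j = l} => y j.1) ∈
      (treeObj C p q l).gr (m + ∑ j : {j // q j = l}, s j.1) := by
  refine (congrArg (fun w => w ∈ ((C.obj {j // q j = l}).toDGData.tensor
    (DGData.pi fun j : {j // q j = l} => (C.obj {i // overFibre p q l i = j}).toDGData)).gr _)
    (map_fibreEquiv_tmul C p q l z y)).mpr ?_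
  exact DGData.tmul_mem_gr hz (DGData.tprod_mem_gr fun j => by
      simpa using C.map_mem _ _ _ (hy j.1))

theorem treeCollect_treeRelabel {I J K : Type} [Fintype I] [LinearOrder I] [Fintype J]
    [LinearOrder J] [LinearOrder K] (p : I → J) (q : J → K) (l : K)
    (z : C.obj {j // q j = l})
    {s : J → ℤ} {y : ∀ j, C.obj {i // p i = j}} (hy : ∀ j, y j ∈ (C.obj {i // p i = j}).gr (s j))
    {n : I → ℤ} {a : I → A} (ha : ∀ i, a i ∈ A.gr (n i)) :
    treeCollect C A p q l (treeRelabel C p q l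
        (z ⊗ₜ PiTensorProduct.tprod k fun j : {j // q j = l} => y j.1) ⊗ₜ
          PiTensorProduct.tprod k fun i : {i // q (p i) = l} => a i.1) =
      ksign k (invParity (overFibre p q l) (fun i => (n i.1 : ZMod 2)) +
        crossParity (overFibre p q l) (fun j => (s j.1 : ZMod 2)) (fun i => (n i.1 : ZMod 2))) •
      (z ⊗ₜ PiTensorProduct.tprod k
        fun j : {j // q j = l} => clsOn C A {i // p i = j.1}
          (y j.1 ⊗ₜ PiTensorProduct.tprod k fun i => a i.1)) := by
  refine (congrArg (fun w => collect C A _ (overFibre p q l) (w ⊗ₜ _))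
    (map_fibreEquiv_tmul C p q l z y)).trans ?_
  refine (collect_apply C A _ (overFibre p q l) z (m := fun j => s j.1)
    (fun j => by simpa using C.map_mem _ _ _ (hy j.1)) fun i => ha i.1).trans ?_
  congr 3
  funext j
  exact (clsOn_tmul_of_monotone C A (fibreEquiv p q l j).symm (fun _ _ h => h) (y j.1)
    fun i => ha i.1).symm

theorem map_regroup_apply {I K : Type} [Fintype I] [LinearOrder I] [Fintype K] [LinearOrder K]
    {X : Type u} [AddCommGroup X] [Module k X]
    {M : K → DGData k} (hM : ∀ l, (M l).IsGraded) {N : I → DGData k} (hN : ∀ i, (N i).IsGraded)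
    {Z : K → Type u} [∀ l, AddCommGroup (Z l)] [∀ l, Module k (Z l)] (r : I → K)
    (g : ∀ l, (M l ⊗[k] (⨂[k] i : {i // r i = l}, N i.1)) →ₗ[k] Z l) (c : X)
    {m : K → ℤ} {z : ∀ l, M l} (hz : ∀ l, z l ∈ (M l).gr (m l))
    {n : I → ℤ} {a : ∀ i, N i} (ha : ∀ i, a i ∈ (N i).gr (n i)) (s : K → ZMod 2) (w : ∀ l, Z l)
    (hw : ∀ l, g l (z l ⊗ₜ PiTensorProduct.tprod k fun i => a i.1) = ksign k (s l) • w l) :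
    (TensorProduct.map LinearMap.id (PiTensorProduct.map g ∘ₗ regroup M N r) ∘ₗ
      (TensorProduct.assoc k _ _ _).toLinearMap)
        ((c ⊗ₜ[k] PiTensorProduct.tprod k z) ⊗ₜ[k] PiTensorProduct.tprod k a) =
      ksign k (invParity r (fun i => (n i : ZMod 2)) +
          crossParity r (fun l => (m l : ZMod 2)) (fun i => (n i : ZMod 2)) + ∑ l, s l) •
        (c ⊗ₜ[k] PiTensorProduct.tprod k w) := by
  rw [LinearMap.comp_apply, LinearEquiv.coe_coe, TensorProduct.assoc_tmul,
    TensorProduct.map_tmul, LinearMap.id_apply, LinearMap.comp_apply, regroup_apply hM hN _ hz ha,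
    map_smul, PiTensorProduct.map_tprod]
  simp only [hw]
  rw [tprod_ksign_smul, ksign_smul_smul, TensorProduct.tmul_smul]

theorem collect_collect_right {I J K : Type} [Fintype I] [LinearOrder I] [Fintype J]
    [LinearOrder J] [Fintype K] [LinearOrder K] (p : I → J) (q : J → K) (c : C.obj K) {m : K → ℤ}
    {z : ∀ l, C.obj {j // q j = l}} (hz : ∀ l, z l ∈ (C.obj {j // q j = l}).gr (m l))
    {s : J → ℤ} {y : ∀ j, C.obj {i // p i = j}} (hy : ∀ j, y j ∈ (C.obj {i // p i = j}).gr (s j))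
    {n : I → ℤ} {a : I → A} (ha : ∀ i, a i ∈ A.gr (n i)) :
    (TensorProduct.map LinearMap.id (PiTensorProduct.map (treeCollect C A p q) ∘ₗ
          regroup (treeObj C p q) (fun _ => A.toDGData) (fun i => q (p i))) ∘ₗ
        (TensorProduct.assoc k _ _ _).toLinearMap)
      (TensorProduct.map
        (TensorProduct.map LinearMap.id (PiTensorProduct.map (treeRelabel C p q) ∘ₗ
          (regroup (fun l => (C.obj {j // q j = l}).toDGData)
            (fun j => (C.obj {i // p i = j}).toDGData) q)) ∘ₗ
          (TensorProduct.assoc k _ _ _).toLinearMap) LinearMap.id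
        (((c ⊗ₜ PiTensorProduct.tprod k z) ⊗ₜ PiTensorProduct.tprod k y) ⊗ₜ
            PiTensorProduct.tprod k a)) =
    ksign k ((invParity p (fun i => (n i : ZMod 2)) +
        crossParity p (fun j => (s j : ZMod 2)) (fun i => (n i : ZMod 2))) +
      (invParity q (fun j => (s j : ZMod 2) + ∑ i : {i // p i = j}, (n i.1 : ZMod 2)) +
        crossParity q (fun l => (m l : ZMod 2))
          (fun j => (s j : ZMod 2) + ∑ i : {i // p i = j}, (n i.1 : ZMod 2)))) •
      (c ⊗ₜ PiTensorProduct.tprod k fun l => z l ⊗ₜ PiTensorProduct.tprod k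
        fun j : {j // q j = l} => clsOn C A {i // p i = j.1}
          (y j.1 ⊗ₜ PiTensorProduct.tprod k fun i => a i.1)) := by
  rw [TensorProduct.map_tmul, LinearMap.id_apply, map_regroup_apply (fun _ => (C.obj _).isGraded)
    (fun _ => (C.obj _).isGraded) q (treeRelabel C p q) c hz hy 0
    (fun l => treeRelabel C p q l (z l ⊗ₜ PiTensorProduct.tprod k fun j => y j.1))
    (fun l => by rw [Pi.zero_apply, ksign_zero, one_smul]), ← TensorProduct.smul_tmul', map_smul,
    map_regroup_apply (treeObj_isGraded C p q) (fun _ => A.isGraded) (fun i => q (p i))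
    (treeCollect C A p q) c (fun l => treeRelabel_mem_gr C p q l (hz l) hy) ha _ _
    (fun l => treeCollect_treeRelabel C A p q l (z l) hy ha), ksign_smul_smul, parity_coassoc]
  simp only [Pi.zero_apply, Finset.sum_const_zero, add_zero]
  push_cast
  rfl

-- Both sides factor through the iterated decomposition `(decomp q ⊗ 1) ∘ decomp p` of the cooperad,
-- by `hL` directly and by `hR` through coassociativity of `C`. What remains is an equality of
-- signed rearrangements, which on homogeneous tensors is `parity_coassoc`.
set_option maxHeartbeats 400000 in
theorem comulTree_coassoc {I J K : Type} [Fintype I] [LinearOrder I] [Fintype J] [LinearOrder J]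
    [Fintype K] [LinearOrder K] [CharZero k] (p : I → J) (q : J → K) :
    (TensorProduct.map LinearMap.id (regroup (fun l => (C.obj {j // q j = l}).toDGData)
        (fun _ : J => cofree C A) q)) ∘ₗ
      (TensorProduct.assoc k _ _ _).toLinearMap ∘ₗ
        TensorProduct.map (C.decomp q) LinearMap.id ∘ₗ comulTree C A p =
    TensorProduct.map LinearMap.id
        ((PiTensorProduct.map fun l => comulTree C A (overFibre p q l)) ∘ₗ
          regroup (fun l => (C.obj {i // q (p i) = l}).toDGData) (fun _ => A.toDGData)
            (fun i => q (p i))) ∘ₗ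
      (TensorProduct.assoc k _ _ _).toLinearMap ∘ₗ
        TensorProduct.map (C.decomp fun i => q (p i)) LinearMap.id := by
  have hL : (TensorProduct.map LinearMap.id (regroup (fun l => (C.obj {j // q j = l}).toDGData)
        (fun _ : J => cofree C A) q)) ∘ₗ
      (TensorProduct.assoc k _ _ _).toLinearMap ∘ₗ
        TensorProduct.map (C.decomp q) LinearMap.id ∘ₗ comulTree C A p =
      ((TensorProduct.map LinearMap.id (regroup (fun l => (C.obj {j // q j = l}).toDGData)
        (fun _ : J => cofree C A) q)) ∘ₗ
      (TensorProduct.assoc k _ _ _).toLinearMap ∘ₗ collect C A _ p) ∘ₗ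
        TensorProduct.map (TensorProduct.map (C.decomp q) LinearMap.id ∘ₗ C.decomp p)
          LinearMap.id := by
    refine TensorProduct.ext' fun c a => ?_
    simp only [LinearMap.comp_apply, comulTree, TensorProduct.map_tmul]
    congr 2
    generalize C.decomp p c = z
    induction z using TensorProduct.induction_on with
    | zero => simp
    | add x y hx hy => rw [TensorProduct.add_tmul, map_add, map_add, map_add, hx, hy,
        TensorProduct.add_tmul, map_add]
    | tmul x y => simp [collect, TensorProduct.map_tmul]
  have hR : TensorProduct.map LinearMap.id
        ((PiTensorProduct.map fun l => comulTree C A (overFibre p q l)) ∘ₗ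
          regroup (fun l => (C.obj {i // q (p i) = l}).toDGData) (fun _ => A.toDGData)
            (fun i => q (p i))) ∘ₗ
      (TensorProduct.assoc k _ _ _).toLinearMap ∘ₗ
        TensorProduct.map (C.decomp fun i => q (p i)) LinearMap.id =
      ((TensorProduct.map LinearMap.id (PiTensorProduct.map (treeCollect C A p q) ∘ₗ
          regroup (treeObj C p q) (fun _ => A.toDGData) (fun i => q (p i))) ∘ₗ
        (TensorProduct.assoc k _ _ _).toLinearMap) ∘ₗ
        TensorProduct.map
          (TensorProduct.map LinearMap.id (PiTensorProduct.map (treeRelabel C p q) ∘ₗ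
            (regroup (fun l => (C.obj {j // q j = l}).toDGData)
              (fun j => (C.obj {i // p i = j}).toDGData) q)) ∘ₗ
            (TensorProduct.assoc k _ _ _).toLinearMap) LinearMap.id) ∘ₗ
        TensorProduct.map (TensorProduct.map (C.decomp q) LinearMap.id ∘ₗ C.decomp p)
          LinearMap.id := by
    have h1 : (PiTensorProduct.map fun l => comulTree C A (overFibre p q l)) ∘ₗ
          regroup (fun l => (C.obj {i // q (p i) = l}).toDGData) (fun _ => A.toDGData)
            (fun i => q (p i)) =
        (PiTensorProduct.map (treeCollect C A p q) ∘ₗ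
          regroup (treeObj C p q) (fun _ => A.toDGData) (fun i => q (p i))) ∘ₗ
        TensorProduct.map (PiTensorProduct.map (treeDecomp C p q)) LinearMap.id := by
      rw [LinearMap.comp_assoc, regroup_natural (fun l => (C.obj _).isGraded)
        (treeObj_isGraded C p q) (fun _ => A.isGraded) (fun i => q (p i)) (treeDecomp C p q)
        (fun l => C.decomp_deg _), ← LinearMap.comp_assoc, ← PiTensorProduct.map_comp]
      rfl
    rw [h1]
    refine TensorProduct.ext' fun c a => ?_
    have h3 := LinearMap.congr_fun (treeDecomp_decomp C p q) c
    simp only [LinearMap.comp_apply, TensorProduct.map_tmul, LinearMap.id_apply,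
      LinearEquiv.coe_coe] at h3 ⊢
    rw [← h3]
    generalize C.decomp (fun i => q (p i)) c = z
    induction z using TensorProduct.induction_on with
    | zero => simp
    | add x y hx hy => simp only [TensorProduct.add_tmul, map_add] at hx hy ⊢; rw [hx, hy]
    | tmul x y => simp only [TensorProduct.map_tmul, TensorProduct.assoc_tmul,
        LinearMap.comp_apply, LinearMap.id_apply]
  rw [hL, hR]
  congr 1
  refine quadruple_ext_gr (C.obj K).isGraded (fun _ => (C.obj _).isGraded)
    (fun _ => (C.obj _).isGraded) (fun _ => A.isGraded) fun i c _ m z hz s y hy n a ha => ?_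
  exact (collect_collect_left C A p q c hz hy ha).trans
    (collect_collect_right C A p q c hz hy ha).symm

theorem map_comulOn_comulTree {I J K : Type} [Fintype I] [LinearOrder I] [Fintype J]
    [LinearOrder J] [Fintype K] [LinearOrder K] [CharZero k] (q : J → K) (r : I → K) :
    TensorProduct.map LinearMap.id (PiTensorProduct.map fun l => comulOn C A {j // q j = l}) ∘ₗ
      comulTree C A r =
    ∑ P : ∀ l, {i // r i = l} → {j // q j = l}, TensorProduct.map LinearMap.id
        ((PiTensorProduct.map fun l => comulTree C A (P l)) ∘ₗ
          regroup (fun l => (C.obj {i // r i = l}).toDGData) (fun _ => A.toDGData) r) ∘ₗ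
      (TensorProduct.assoc k _ _ _).toLinearMap ∘ₗ
        TensorProduct.map (C.decomp r) LinearMap.id := by
  rw [comulTree, collect, ← LinearMap.comp_assoc, ← LinearMap.comp_assoc, ← TensorProduct.map_comp,
    ← LinearMap.comp_assoc, ← PiTensorProduct.map_comp]
  have h1 : (PiTensorProduct.map fun l => comulOn C A {j // q j = l} ∘ₗ clsOn C A {i // r i = l}) =
      ∑ P : ∀ l, {i // r i = l} → {j // q j = l},
        PiTensorProduct.map fun l => comulTree C A (P l) := by
    refine Eq.trans ?_ (map_sum_tprod fun l (P : {i // r i = l} → {j // q j = l}) =>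
      comulTree C A P)
    congr 1
    funext l
    rw [comulOn_clsOn]
    exact Finset.sum_congr (by ext; simp) fun _ _ => rfl
  rw [h1]
  refine LinearMap.ext fun x => ?_
  simp only [LinearMap.comp_apply, LinearMap.sum_apply]
  generalize (TensorProduct.assoc k _ _ _).toLinearMap
    (TensorProduct.map (C.decomp r) LinearMap.id x) = z
  induction z using TensorProduct.induction_on with
  | zero => simp
  | add x y hx hy => simp only [map_add, hx, hy, Finset.sum_add_distrib]
  | tmul x y => simp [TensorProduct.map_tmul, TensorProduct.tmul_sum]

/-- The right side is a sum over `r : Fin n → K` and over maps between fibres, the left side a sum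
over `p : Fin n → J`. `sum_over_fibres` identifies the indices and `comulTree_coassoc` the summands.
-/
theorem comulOn_coassoc {J K : Type} [Fintype J] [LinearOrder J] [Fintype K] [LinearOrder K]
    [CharZero k] (q : J → K) :
    (TensorProduct.map LinearMap.id (regroup (fun l => (C.obj {j // q j = l}).toDGData)
        (fun _ : J => cofree C A) q)) ∘ₗ
      (TensorProduct.assoc k _ _ _).toLinearMap ∘ₗ
        TensorProduct.map (C.decomp q) LinearMap.id ∘ₗ comulOn C A J =
    TensorProduct.map LinearMap.id (PiTensorProduct.map fun l => comulOn C A {j // q j = l}) ∘ₗ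
      comulOn C A K := by
  refine Cofree.ext fun n x => ?_
  have hR : (TensorProduct.map LinearMap.id (PiTensorProduct.map fun l =>
      comulOn C A {j // q j = l}) ∘ₗ comulOn C A K) (cls C A n x) =
      ∑ r : Fin n → K, (TensorProduct.map LinearMap.id (PiTensorProduct.map fun l =>
        comulOn C A {j // q j = l}) ∘ₗ comulTree C A r) x := by
    rw [LinearMap.comp_apply, comulOn_cls, map_sum]
    rfl
  rw [hR]
  simp only [map_comulOn_comulTree, LinearMap.sum_apply]
  rw [sum_over_fibres q fun r P => (TensorProduct.map LinearMap.id
        ((PiTensorProduct.map fun l => comulTree C A (P l)) ∘ₗ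
          regroup (fun l => (C.obj {i // r i = l}).toDGData) (fun _ => A.toDGData) r) ∘ₗ
      (TensorProduct.assoc k _ _ _).toLinearMap ∘ₗ
        TensorProduct.map (C.decomp r) LinearMap.id) x]
  simp only [LinearMap.comp_apply, comulOn_cls, map_sum]
  exact Finset.sum_congr rfl fun p _ => LinearMap.congr_fun (comulTree_coassoc C A p q) x

end

/-! ### Maps of tensor powers with Koszul signs -/

section

variable {J : Type} [Fintype J] [LinearOrder J]

theorem map_comp_koszulMap {X : DGData k} {V W : J → DGData k} {W' : J → DGData k} (d : J → ℤ)
    (f : ∀ j, V j →ₗ[k] W j) (g : ∀ j, W j →ₗ[k] W' j) :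
    TensorProduct.map LinearMap.id (PiTensorProduct.map g) ∘ₗ koszulMap X V W d f =
      koszulMap X V W' d fun j => g j ∘ₗ f j := by
  rw [koszulMap, ← TensorProduct.map_comp, ← PiTensorProduct.map_comp, LinearMap.id_comp]
  rfl

theorem koszulMap_comp_map {X : DGData k} {V V' W : J → DGData k} (hV : ∀ j, (V j).IsGraded)
    (hV' : ∀ j, (V' j).IsGraded) (d : J → ℤ)
    (f : ∀ j, V j →ₗ[k] W j) (g : ∀ j, V' j →ₗ[k] V j) (hg : ∀ j, HasDegree (V' j) (V j) 0 (g j)) :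
    koszulMap X V W d f ∘ₗ TensorProduct.map LinearMap.id (PiTensorProduct.map g) =
      koszulMap X V' W d fun j => f j ∘ₗ g j := by
  have h : ∀ j, (f j ∘ₗ (V j).tw (∑ i with j < i, d i)) ∘ₗ g j =
      (f j ∘ₗ g j) ∘ₗ (V' j).tw (∑ i with j < i, d i) := fun j => by
    rw [LinearMap.comp_assoc, (hg j).tw_zero (hV' j) (hV j), LinearMap.comp_assoc]
  rw [koszulMap, ← TensorProduct.map_comp, ← PiTensorProduct.map_comp, LinearMap.comp_id]
  simp only [h]
  rfl

theorem koszulMap_map_left {X X' : DGData k} (hX : X.IsGraded) (hX' : X'.IsGraded)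
    {V W : J → DGData k} (d : J → ℤ) (f : ∀ j, V j →ₗ[k] W j) (g : X' →ₗ[k] X)
    (hg : HasDegree X' X 0 g) :
    koszulMap X V W d f ∘ₗ TensorProduct.map g LinearMap.id =
      TensorProduct.map g LinearMap.id ∘ₗ koszulMap X' V W d f := by
  rw [koszulMap, koszulMap, ← TensorProduct.map_comp, ← TensorProduct.map_comp,
    hg.tw_zero hX' hX, LinearMap.id_comp, LinearMap.comp_id]

theorem koszulMap_deg {X : DGData k} (hX : X.IsGraded) {V W : J → DGData k}
    (hV : ∀ j, (V j).IsGraded) {d : J → ℤ} {f : ∀ j, V j →ₗ[k] W j}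
    (hf : ∀ j, HasDegree (V j) (W j) (d j) (f j)) :
    HasDegree (X.tensor (DGData.pi V)) (X.tensor (DGData.pi W)) (∑ j, d j)
      (koszulMap X V W d f) := by
  have h : ∀ (Y : DGData k), Y.IsGraded → ∀ m, HasDegree Y Y 0 (Y.tw m) := fun Y hY m n x hx => by
    rw [hY.tw_apply m hx, add_zero]
    exact Submodule.smul_mem _ _ hx
  exact ((h X hX _).tensor (HasDegree.pi fun j => ((hf j).comp (h (V j) (hV j) _)).of_eq
    (zero_add _))).of_eq (zero_add _)

theorem koszulMap_apply_of_eq {X : DGData k} (hX : X.IsGraded) {V : J → DGData k}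
    (hV : ∀ j, (V j).IsGraded) {W : J → DGData k} (d : J → ℤ) (f : ∀ j, V j →ₗ[k] W j)
    {m : ℤ} {c : X} (hc : c ∈ X.gr m) {n : J → ℤ} {x : ∀ j, V j} (hx : ∀ j, x j ∈ (V j).gr (n j))
    (s : J → ZMod 2) (w : ∀ j, W j) (hw : ∀ j, f j (x j) = ksign k (s j) • w j) :
    koszulMap X V W d f (c ⊗ₜ PiTensorProduct.tprod k x) =
      ksign k (mapParity (fun j => (d j : ZMod 2)) m (fun j => (n j : ZMod 2)) + ∑ j, s j) •
        (c ⊗ₜ PiTensorProduct.tprod k w) := by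
  rw [koszulMap_apply hX hV d f hc hx]
  simp only [hw]
  rw [tprod_ksign_smul, TensorProduct.tmul_smul, ksign_smul_smul]

/-- The complex `Mₗ ⊗ ⨂_{q j = l} Nⱼ`. -/
def fibreObj {J K : Type} [Fintype J] [LinearOrder J] [LinearOrder K]
    (M : K → DGData k) (N : J → DGData k) (q : J → K) (l : K) : DGData k :=
  (M l).tensor (DGData.pi fun j : {j // q j = l} => N j.1)

theorem fibreObj_isGraded {J K : Type} [Fintype J] [LinearOrder J] [LinearOrder K]
    {M : K → DGData k} {N : J → DGData k} (hM : ∀ l, (M l).IsGraded) (hN : ∀ j, (N j).IsGraded)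
    (q : J → K) (l : K) : (fibreObj M N q l).IsGraded :=
  (hM l).tensor (DGData.IsGraded.pi fun j => hN j.1)

/-- The map `1 ⊗ ⨂_{q j = l} fⱼ`. -/
def fibreMap {J K : Type} [Fintype J] [LinearOrder J] [LinearOrder K]
    (M : K → DGData k) {N N' : J → DGData k} (q : J → K) (d : J → ℤ) (f : ∀ j, N j →ₗ[k] N' j)
    (l : K) : fibreObj M N q l →ₗ[k] fibreObj M N' q l :=
  koszulMap (M l) (fun j : {j // q j = l} => N j.1) (fun j => N' j.1) (fun j => d j.1) fun j => f j.1

/-- The pure tensor in `fibreObj` of the letters of a word in a fibre. -/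
def fibreTmul {J K : Type} [Fintype J] [LinearOrder J] [LinearOrder K]
    (M : K → DGData k) (N : J → DGData k) (q : J → K) (l : K) (y : M l) (x : ∀ j, N j) :
    fibreObj M N q l :=
  TensorProduct.mk k (M l) (⨂[k] j : {j // q j = l}, N j.1) y (PiTensorProduct.tprod k fun j => x j.1)

theorem fibreTmul_mem_gr {J K : Type} [Fintype J] [LinearOrder J] [LinearOrder K]
    {M : K → DGData k} {N : J → DGData k} (q : J → K) (l : K) {m : ℤ} {y : M l}
    (hy : y ∈ (M l).gr m) {n : J → ℤ} {x : ∀ j, N j} (hx : ∀ j, x j ∈ (N j).gr (n j)) :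
    fibreTmul M N q l y x ∈ (fibreObj M N q l).gr (m + ∑ j : {j // q j = l}, n j.1) :=
  DGData.tmul_mem_gr hy (DGData.tprod_mem_gr fun j : {j // q j = l} => hx j.1)

theorem fibreMap_apply {K : Type} [LinearOrder K]
    {M : K → DGData k} (hM : ∀ l, (M l).IsGraded) {N N' : J → DGData k} (hN : ∀ j, (N j).IsGraded)
    (q : J → K) (d : J → ℤ) (f : ∀ j, N j →ₗ[k] N' j) (l : K) {m : ℤ} {y : M l}
    (hy : y ∈ (M l).gr m) {n : J → ℤ} {x : ∀ j, N j} (hx : ∀ j, x j ∈ (N j).gr (n j)) :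
    fibreMap M q d f l (fibreTmul M N q l y x) =
      ksign k (mapParity (fun j : {j // q j = l} => (d j.1 : ZMod 2)) m
        fun j => (n j.1 : ZMod 2)) • fibreTmul M N' q l y fun j => f j (x j) :=
  koszulMap_apply (W := fun j : {j // q j = l} => N' j.1) (hM l)
    (V := fun j : {j // q j = l} => N j.1) (fun j => hN j.1) (fun j => d j.1) (fun j => f j.1) hy
    fun j => hx j.1

/-- The regrouping of tensor factors, with the result in `fibreObj`. -/
def regroupObj {K : Type} [Fintype K] [LinearOrder K] (X : DGData k)
    (M : K → DGData k) (N : J → DGData k) (q : J → K) :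
    ((X ⊗[k] (⨂[k] l, M l)) ⊗[k] (⨂[k] j, N j)) →ₗ[k] (X ⊗[k] (⨂[k] l, fibreObj M N q l)) :=
  TensorProduct.map LinearMap.id (regroup M N q) ∘ₗ (TensorProduct.assoc k _ _ _).toLinearMap

theorem regroupObj_apply {K : Type} [Fintype K] [LinearOrder K] {X : DGData k}
    {M : K → DGData k} {N : J → DGData k} (hM : ∀ l, (M l).IsGraded) (hN : ∀ j, (N j).IsGraded)
    (q : J → K) (c : X) {m : K → ℤ} {y : ∀ l, M l} (hy : ∀ l, y l ∈ (M l).gr (m l))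
    {n : J → ℤ} {x : ∀ j, N j} (hx : ∀ j, x j ∈ (N j).gr (n j)) :
    regroupObj X M N q ((c ⊗ₜ PiTensorProduct.tprod k y) ⊗ₜ PiTensorProduct.tprod k x) =
      ksign k (invParity q (fun j => (n j : ZMod 2)) +
          crossParity q (fun l => (m l : ZMod 2)) (fun j => (n j : ZMod 2))) •
        (c ⊗ₜ PiTensorProduct.tprod k fun l => fibreTmul M N q l (y l) x) := by
  have h : TensorProduct.map LinearMap.id (regroup M N q) (TensorProduct.assoc k _ _ _
      ((c ⊗ₜ PiTensorProduct.tprod k y) ⊗ₜ PiTensorProduct.tprod k x)) =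
      ksign k (invParity q (fun j => (n j : ZMod 2)) +
          crossParity q (fun l => (m l : ZMod 2)) (fun j => (n j : ZMod 2))) •
        (c ⊗ₜ PiTensorProduct.tprod k fun l =>
          y l ⊗ₜ PiTensorProduct.tprod k fun j : {j // q j = l} => x j.1) := by
    rw [TensorProduct.assoc_tmul, TensorProduct.map_tmul, regroup_apply hM hN q hy hx,
      TensorProduct.tmul_smul, LinearMap.id_apply]
  exact h

/-- The maps travel with the letters they act on. Each group then acts as a single map of the summed
degree, and the maps themselves have been sorted along `q`, whence the sign in front. -/
theorem regroup_koszulMap {K : Type} [Fintype K] [LinearOrder K] {X : DGData k} (hX : X.IsGraded)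
    {M : K → DGData k} (hM : ∀ l, (M l).IsGraded) {N N' : J → DGData k} (hN : ∀ j, (N j).IsGraded)
    (hN' : ∀ j, (N' j).IsGraded) (q : J → K) {d : J → ℤ} {f : ∀ j, N j →ₗ[k] N' j}
    (hf : ∀ j, HasDegree (N j) (N' j) (d j) (f j)) :
    regroupObj X M N' q ∘ₗ koszulMap (X.tensor (DGData.pi M)) N N' d f =
    ksign k (invParity q fun j => (d j : ZMod 2)) •
      (koszulMap X (fibreObj M N q) (fibreObj M N' q) (fun l => ∑ j : {j // q j = l}, d j.1)
        (fibreMap M q d f) ∘ₗ regroupObj X M N q) := by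
  refine triple_ext_gr hX hM hN fun i c hc m y hy n x hx => ?_
  rw [LinearMap.comp_apply, LinearMap.smul_apply, LinearMap.comp_apply,
    koszulMap_apply (hX.tensor (DGData.IsGraded.pi hM)) hN d f
    (DGData.tmul_mem_gr hc (DGData.tprod_mem_gr hy)) hx, map_smul,
    regroupObj_apply hM hN' q c hy (fun j => hf j _ _ (hx j)), regroupObj_apply hM hN q c hy hx,
    map_smul, koszulMap_apply_of_eq hX (fibreObj_isGraded hM hN q) _ (fibreMap M q d f) hc
    (fun l => fibreTmul_mem_gr q l (hy l) hx) _ _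
    (fun l => fibreMap_apply hM hN q d f l (hy l) hx),
    ksign_smul_smul, ksign_smul_smul, ksign_smul_smul]
  have h2 := parity_regroup_map q (fun j => (d j : ZMod 2)) i (fun l => (m l : ZMod 2))
    (fun j => (n j : ZMod 2))
  congr 2
  push_cast
  rw [h2]
  simp only [add_assoc]

/-- Composition of maps of tensor powers. -/
theorem koszulMap_comp {X : DGData k} (hX : X.IsGraded) {V V' W : J → DGData k}
    (hV : ∀ j, (V j).IsGraded) (hV' : ∀ j, (V' j).IsGraded) {d e : J → ℤ}
    {f : ∀ j, V j →ₗ[k] V' j} (hf : ∀ j, HasDegree (V j) (V' j) (d j) (f j))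
    (g : ∀ j, V' j →ₗ[k] W j) :
    koszulMap X V' W e g ∘ₗ koszulMap X V V' d f =
      ksign k (∑ i, ∑ j, if i < j then (e j * d i : ZMod 2) else 0) •
        koszulMap X V W (fun j => d j + e j) fun j => g j ∘ₗ f j := by
  refine tensor_ext_gr (W := DGData.pi V) hX (DGData.IsGraded.pi hV) fun i _ c hc x' _ => ?_
  refine LinearMap.congr_fun (f := (koszulMap X V' W e g ∘ₗ koszulMap X V V' d f) ∘ₗ
    TensorProduct.mk k _ _ c) (g := (ksign k (∑ i, ∑ j, if i < j then (e j * d i : ZMod 2) else 0) •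
        koszulMap X V W (fun j => d j + e j) fun j => g j ∘ₗ f j) ∘ₗ TensorProduct.mk k _ _ c)
    (pi_ext_gr hV fun n x hx => ?_) x'
  simp only [LinearMap.comp_apply, LinearMap.smul_apply, TensorProduct.mk_apply]
  rw [koszulMap_apply hX hV d f hc hx, map_smul,
    koszulMap_apply hX hV' e g hc (fun j => hf j _ _ (hx j)),
    koszulMap_apply hX hV _ _ hc hx, ksign_smul_smul, ksign_smul_smul]
  congr 2
  push_cast
  simp only [mapParity, add_mul, mul_add, ite_add_zero, Finset.sum_add_distrib]
  ring

end

/-! ### The maps between cofree coalgebras determined by several maps to the generators -/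

section Ang

variable (C : Cooperad k) (A B : DGVect k)

/-- The map `C(A) → C(B)` given by `1 ⊗ ⨂ⱼ fⱼ` on the comultiplication. -/
def ang (J : Type) [Fintype J] [LinearOrder J] (d : J → ℤ) (f : J → (Cofree C A →ₗ[k] B)) :
    Cofree C A →ₗ[k] Cofree C B :=
  clsOn C B J ∘ₗ koszulMap (C.obj J).toDGData (fun _ => cofree C A) (fun _ => B.toDGData) d f ∘ₗ
    comulOn C A J

/-- The classes of elements of a fibre. -/
def clsObj {J K : Type} [Fintype J] [LinearOrder J] [LinearOrder K] (q : J → K) (l : K) :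
    fibreObj (fun l => (C.obj {j // q j = l}).toDGData) (fun _ => B.toDGData) q l →ₗ[k]
      Cofree C B :=
  clsOn C B {j // q j = l}

/-- The comultiplication along a fibre. -/
def comulObj {J K : Type} [Fintype J] [LinearOrder J] [LinearOrder K] (q : J → K) (l : K) :
    Cofree C A →ₗ[k]
      fibreObj (fun l => (C.obj {j // q j = l}).toDGData) (fun _ => cofree C A) q l :=
  comulOn C A {j // q j = l}

/-- The classes of elements of all fibres. -/
def collectObj {J K : Type} [Fintype J] [LinearOrder J] [Fintype K] [LinearOrder K] (q : J → K) :
    (C.obj K ⊗[k] (⨂[k] l,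
      fibreObj (fun l => (C.obj {j // q j = l}).toDGData) (fun _ => B.toDGData) q l)) →ₗ[k]
      (C.obj K ⊗[k] (⨂[k] _ : K, Cofree C B)) :=
  TensorProduct.map LinearMap.id (PiTensorProduct.map (clsObj C B q))

theorem comulTree_eq_collectObj {J K : Type} [Fintype J] [LinearOrder J] [Fintype K]
    [LinearOrder K] (q : J → K) :
    collectObj C B q ∘ₗ regroupObj (C.obj K).toDGData (fun l => (C.obj {j // q j = l}).toDGData)
        (fun _ => B.toDGData) q ∘ₗ TensorProduct.map (C.decomp q) LinearMap.id =
      comulTree C B q := by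
  refine LinearMap.ext fun x => ?_
  have h : ∀ y, collectObj C B q (regroupObj (C.obj K).toDGData
      (fun l => (C.obj {j // q j = l}).toDGData) (fun _ => B.toDGData) q y) =
      collect C B (C.obj K) q y := fun y => by
    have h1 := TensorProduct.map_comp (LinearMap.id : C.obj K →ₗ[k] C.obj K)
      (PiTensorProduct.map fun j => clsOn C B {i // q i = j}) LinearMap.id
      (regroup (fun j => (C.obj {i // q i = j}).toDGData) (fun _ => B.toDGData) q)
    rw [LinearMap.id_comp] at h1
    rw [collect, h1]
    rfl
  exact h _

variable {C A B}

theorem comulTree_deg {I J : Type} [Fintype I] [LinearOrder I] [Fintype J] [LinearOrder J]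
    (p : I → J) : HasDegree ((C.obj I).toDGData.tensor (DGData.pi fun _ : I => A.toDGData))
      ((C.obj J).toDGData.tensor (DGData.pi fun _ : J => cofree C A)) 0 (comulTree C A p) := by
  have h : HasDegree (((C.obj J).toDGData.tensor (DGData.pi fun j =>
      (C.obj {i // p i = j}).toDGData)).tensor (DGData.pi fun _ : I => A.toDGData))
      ((C.obj J).toDGData.tensor (DGData.pi fun _ : J => cofree C A)) 0
      (collect C A (C.obj J) p) := by
    intro n x hx
    refine HasDegree.of_span (V := ((C.obj J).toDGData.tensor (DGData.pi fun j =>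
      (C.obj {i // p i = j}).toDGData)).tensor (DGData.pi fun _ : I => A.toDGData))
      (W := (C.obj J).toDGData.tensor (DGData.pi fun _ : J => cofree C A)) ?_ x hx
    rintro _ ⟨i, j, x, y, rfl, hx, hy, rfl⟩
    induction hx using Submodule.span_induction with
    | zero => simp
    | add x x' _ _ hx hx' =>
      rw [TensorProduct.add_tmul, map_add]
      exact Submodule.add_mem _ hx hx'
    | smul c x _ hx =>
      rw [← TensorProduct.smul_tmul', map_smul]
      exact Submodule.smul_mem _ _ hx
    | mem x hx =>
      obtain ⟨i, i', c, z, rfl, hc, hz, rfl⟩ := hx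
      induction hz using Submodule.span_induction with
      | zero => simp
      | add x x' _ _ hx hx' =>
        rw [TensorProduct.tmul_add, TensorProduct.add_tmul, map_add]
        exact Submodule.add_mem _ hx hx'
      | smul c x _ hx =>
        rw [TensorProduct.tmul_smul, ← TensorProduct.smul_tmul', map_smul]
        exact Submodule.smul_mem _ _ hx
      | mem z hz =>
        obtain ⟨m, z, rfl, hz, rfl⟩ := hz
        induction hy using Submodule.span_induction with
        | zero => simp
        | add x x' _ _ hx hx' =>
          rw [TensorProduct.tmul_add, map_add]
          exact Submodule.add_mem _ hx hx'
        | smul c x _ hx =>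
          rw [TensorProduct.tmul_smul, map_smul]
          exact Submodule.smul_mem _ _ hx
        | mem y hy =>
          obtain ⟨n, a, rfl, ha, rfl⟩ := hy
          rw [collect_apply C A _ p c hz ha]
          refine Submodule.smul_mem _ _ ?_
          have := DGData.tmul_mem_gr hc (DGData.tprod_mem_gr (M := fun _ => cofree C A)
            fun j => clsOn_mem_gr C A (hz j) fun i => ha i.1)
          convert this using 2
          rw [Finset.sum_add_distrib, sum_fiber p n]
          ring
  exact (h.comp ((C.decomp_deg p).tensor (HasDegree.id _))).of_eq (by simp)

variable [CharZero k]

theorem comulOn_deg (J : Type) [Fintype J] [LinearOrder J] : HasDegree (cofree C A)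
    ((C.obj J).toDGData.tensor (DGData.pi fun _ : J => cofree C A)) 0 (comulOn C A J) := by
  intro i x hx
  refine (?_ : (cofree C A).gr i ≤ (((C.obj J).toDGData.tensor
    (DGData.pi fun _ : J => cofree C A)).gr (i + 0)).comap (comulOn C A J)) hx
  refine iSup_le fun n => ?_
  rintro _ ⟨x, hx, rfl⟩
  rw [Submodule.mem_comap, comulOn_cls]
  exact Submodule.sum_mem _ fun p _ => comulTree_deg p i x hx

theorem ang_deg {J : Type} [Fintype J] [LinearOrder J] {d : J → ℤ}
    {f : J → (Cofree C A →ₗ[k] B)} (hf : ∀ j, HasDegree (cofree C A) B.toDGData (d j) (f j)) :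
    HasDegree (cofree C A) (cofree C B) (∑ j, d j) (ang C A B J d f) :=
  (((clsOn_deg C B J).comp (koszulMap_deg (C.obj J).isGraded (fun _ => cofree_isGraded C A) hf)).comp
    (comulOn_deg J)).of_eq (by ring)

/-- The comultiplication of C(B) spreads the maps `f` over the outputs in all possible ways, as the
shuffle coproduct does on a symmetric coalgebra. This is the identity behind the formulas for
coderivations and homomorphisms applied to `ang`. -/
theorem comulOn_ang {J K : Type} [Fintype J] [LinearOrder J] [Fintype K] [LinearOrder K]
    {d : J → ℤ} {f : J → (Cofree C A →ₗ[k] B)}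
    (hf : ∀ j, HasDegree (cofree C A) B.toDGData (d j) (f j)) :
    comulOn C B K ∘ₗ ang C A B J d f = ∑ q : J → K, ksign k (invParity q fun j => (d j : ZMod 2)) •
      (koszulMap (C.obj K).toDGData (fun _ => cofree C A) (fun _ => cofree C B)
        (fun l => ∑ j : {j // q j = l}, d j.1)
        (fun l => ang C A B {j // q j = l} (fun j => d j.1) fun j => f j.1) ∘ₗ comulOn C A K) := by
  rw [ang, ← LinearMap.comp_assoc, comulOn_clsOn]
  refine LinearMap.ext fun x => ?_
  rw [LinearMap.comp_apply, LinearMap.sum_apply, LinearMap.sum_apply]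
  refine Finset.sum_congr rfl fun q _ => ?_
  -- The decomposition of the root decoration has degree zero and passes the maps without sign,
  -- which leaves the regrouping of the maps to `regroup_koszulMap`.
  have h1 : comulTree C B q ∘ₗ koszulMap (C.obj J).toDGData (fun _ => cofree C A)
      (fun _ => B.toDGData) d f =
      collectObj C B q ∘ₗ
      (regroupObj (C.obj K).toDGData (fun l => (C.obj {j // q j = l}).toDGData)
        (fun _ => B.toDGData) q ∘ₗ
      koszulMap ((C.obj K).toDGData.tensor (DGData.pi fun l => (C.obj {j // q j = l}).toDGData))
        (fun _ => cofree C A) (fun _ => B.toDGData) d f) ∘ₗ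
        TensorProduct.map (C.decomp q) LinearMap.id := by
    rw [LinearMap.comp_assoc, koszulMap_map_left
      (V := fun _ => cofree C A) (W := fun _ => B.toDGData)
      ((C.obj K).isGraded.tensor (DGData.IsGraded.pi fun _ => (C.obj _).isGraded))
      (C.obj J).isGraded d f (C.decomp q) (C.decomp_deg q), ← comulTree_eq_collectObj]
    rfl
  rw [regroup_koszulMap (C.obj K).isGraded (fun _ => (C.obj _).isGraded)
    (fun _ => cofree_isGraded C A) (fun _ => B.isGraded) q hf] at h1
  have h3 := LinearMap.congr_fun h1 (comulOn C A J x)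
  -- Coassociativity of C(A) turns the regrouped tensor of `comulOn J` into comultiplications over
  -- the single outputs, so that each output receives an `ang` of its own group.
  have h4 : regroupObj (C.obj K).toDGData (fun l => (C.obj {j // q j = l}).toDGData)
      (fun _ => cofree C A) q (TensorProduct.map (C.decomp q) LinearMap.id (comulOn C A J x)) =
      TensorProduct.map LinearMap.id (PiTensorProduct.map (comulObj C A q)) (comulOn C A K x) :=
    LinearMap.congr_fun (comulOn_coassoc C A q) x
  refine h3.trans ?_
  simp only [LinearMap.comp_apply, LinearMap.smul_apply, map_smul]
  rw [h4]
  congr 1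
  have h5 := koszulMap_comp_map (X := (C.obj K).toDGData)
    (V' := fun _ => cofree C A)
    (fibreObj_isGraded (fun l => (C.obj {j // q j = l}).isGraded) (fun _ => cofree_isGraded C A) q)
    (fun _ => cofree_isGraded C A) (fun l => ∑ j : {j // q j = l}, d j.1)
    (fibreMap (fun l => (C.obj {j // q j = l}).toDGData) q d f) (comulObj C A q)
    fun l => comulOn_deg _
  have h6 := LinearMap.congr_fun h5 (comulOn C A K x)
  rw [LinearMap.comp_apply] at h6
  rw [h6]
  exact LinearMap.congr_fun (map_comp_koszulMap (X := (C.obj K).toDGData)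
    (V := fun _ => cofree C A)
    (W := fibreObj (fun l => (C.obj {j // q j = l}).toDGData) (fun _ => B.toDGData) q)
    (W' := fun _ => cofree C B) (fun l => ∑ j : {j // q j = l}, d j.1)
    (fun l => fibreMap (fun l => (C.obj {j // q j = l}).toDGData) q d f l ∘ₗ comulObj C A q l)
    (clsObj C B q)) (comulOn C A K x)

end Ang

/-! ### The counit and the arity -/

section

variable (C : Cooperad k) (A : DGVect k)

theorem cls_eq_arity {Z : Type*} [AddCommGroup Z] [Module k Z] {f : Cofree C A →ₗ[k] Z} {n : ℕ} :
    f ∘ₗ cls C A n = 0 ↔ f ∘ₗ arity C A n = 0 := by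
  constructor
  · intro h
    refine LinearMap.ext fun x => ?_
    obtain ⟨y, rfl⟩ := Representation.Coinvariants.mk_surjective _ x
    exact LinearMap.congr_fun h y
  · intro h
    rw [cls, ← LinearMap.comp_assoc, h, LinearMap.zero_comp]

theorem pi_map_eq_zero {J : Type} {V W : J → Type u} [∀ l, AddCommGroup (V l)]
    [∀ l, Module k (V l)] [∀ l, AddCommGroup (W l)] [∀ l, Module k (W l)]
    (f : ∀ l, V l →ₗ[k] W l) (j : J) (h : f j = 0) : PiTensorProduct.map f = 0 := by
  classical
  refine PiTensorProduct.ext (MultilinearMap.ext fun x => ?_)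
  rw [LinearMap.compMultilinearMap_apply, PiTensorProduct.map_tprod]
  exact MultilinearMap.map_coord_zero _ j (by rw [h, LinearMap.zero_apply])

theorem clsOn_comp_eq_zero {Z : Type*} [AddCommGroup Z] [Module k Z] {f : Cofree C A →ₗ[k] Z}
    (I : Type) [Fintype I] [LinearOrder I] (h : f ∘ₗ cls C A (Fintype.card I) = 0) :
    f ∘ₗ clsOn C A I = 0 := by
  rw [clsOn, ← LinearMap.comp_assoc, h, LinearMap.zero_comp]

theorem map_comulTree_eq_zero {I J : Type} [Fintype I] [LinearOrder I] [Fintype J] [LinearOrder J]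
    (p : I → J) {Z : J → Type u} [∀ j, AddCommGroup (Z j)] [∀ j, Module k (Z j)]
    (G : ∀ j, Cofree C A →ₗ[k] Z j) (j : J)
    (h : G j ∘ₗ cls C A (Fintype.card {i // p i = j}) = 0) (x) :
    TensorProduct.map LinearMap.id (PiTensorProduct.map G) (comulTree C A p x) = 0 := by
  have h1 : TensorProduct.map LinearMap.id (PiTensorProduct.map G) ∘ₗ collect C A (C.obj J) p =
      0 := by
    rw [collect, ← LinearMap.comp_assoc, ← TensorProduct.map_comp, ← LinearMap.comp_assoc,
      ← PiTensorProduct.map_comp, pi_map_eq_zero _ j (clsOn_comp_eq_zero C A _ h),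
      LinearMap.zero_comp, TensorProduct.map_zero_right, LinearMap.zero_comp]
  exact LinearMap.congr_fun h1 _

theorem sum_card_fiber {I J : Type} [Fintype I] [Fintype J] [DecidableEq J] (p : I → J) :
    ∑ j, Fintype.card {i // p i = j} = Fintype.card I := by
  rw [← Fintype.card_sigma]
  exact Fintype.card_congr (Equiv.sigmaFiberEquiv p)

theorem map_comulOn_eq_zero [CharZero k] {J : Type} [Fintype J] [LinearOrder J]
    {Z : J → Type u} [∀ j, AddCommGroup (Z j)] [∀ j, Module k (Z j)]
    (G : ∀ j, Cofree C A →ₗ[k] Z j) (m : J → ℕ) (h : ∀ j, ∀ n < m j, G j ∘ₗ cls C A n = 0)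
    {n : ℕ} (hn : n < ∑ j, m j) (x) :
    TensorProduct.map LinearMap.id (PiTensorProduct.map G) (comulOn C A J (cls C A n x)) = 0 := by
  rw [comulOn_cls, map_sum]
  refine Finset.sum_eq_zero fun p _ => ?_
  -- Pigeonhole: the fibres of `p` have `n` elements in all, fewer than `∑ j, m j`, so one of them
  -- is too small for its map.
  obtain ⟨j, hj⟩ : ∃ j, Fintype.card {i // p i = j} < m j := by
    by_contra! hc
    have := Finset.sum_le_sum fun j (_ : j ∈ Finset.univ) => hc j
    rw [sum_card_fiber, Fintype.card_fin] at this
    omega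
  exact map_comulTree_eq_zero C A p G j (h j _ hj) x

theorem par_cls [CharZero k] (n : ℕ) (b : ZMod 2) (x) :
    (cofree C A).par b (cls C A n x) = cls C A n ((tensorPower C A n).par b x) :=
  descend_cls (fun e x => by
    rw [LinearMap.comp_apply, par_act, cls_act, LinearMap.comp_apply]) x

theorem tw_cls [CharZero k] (n : ℕ) (m : ℤ) (x) :
    (cofree C A).tw m (cls C A n x) = cls C A n ((tensorPower C A n).tw m x) := by
  simp only [DGData.tw, LinearMap.add_apply, LinearMap.smul_apply, map_add, map_smul]
  rw [← par_cls, ← par_cls]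

variable {C A} {B : DGVect k}

theorem cls_zero (hC : C.IsReduced) : cls C A 0 = 0 := by
  refine TensorProduct.ext' fun c a => ?_
  rw [hC (Fin 0) c, TensorProduct.zero_tmul, map_zero, map_zero]

theorem ang_cls_eq_zero [CharZero k] {J : Type} [Fintype J] [LinearOrder J] (d : J → ℤ)
    {f : J → (Cofree C A →ₗ[k] B)} (m : J → ℕ) (h : ∀ j, ∀ n < m j, f j ∘ₗ cls C A n = 0)
    {n : ℕ} (hn : n < ∑ j, m j) : ang C A B J d f ∘ₗ cls C A n = 0 := by
  refine LinearMap.ext fun x => ?_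
  have h1 : koszulMap (C.obj J).toDGData (fun _ => cofree C A) (fun _ => B.toDGData) d f =
      TensorProduct.map ((C.obj J).tw (∑ i, d i)) LinearMap.id ∘ₗ
        TensorProduct.map LinearMap.id
          (PiTensorProduct.map fun i => f i ∘ₗ (cofree C A).tw (∑ j with i < j, d j)) := by
    rw [← TensorProduct.map_comp, LinearMap.comp_id, LinearMap.id_comp]
    rfl
  rw [LinearMap.comp_apply, ang, h1, LinearMap.comp_apply, LinearMap.comp_apply,
    LinearMap.comp_apply, map_comulOn_eq_zero C A _ m _ hn, map_zero, map_zero, LinearMap.zero_apply]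
  intro j n hn
  refine LinearMap.ext fun y => ?_
  rw [LinearMap.comp_apply, LinearMap.comp_apply, tw_cls]
  exact LinearMap.congr_fun (h j n hn) _

/-- Since C(0) = 0, every input of `ang` must consume at least one leaf. On a given element only
finitely many sizes of `J` contribute, which makes the exponential sums finite. -/
theorem ang_cls_of_lt_card [CharZero k] (hC : C.IsReduced) {J : Type} [Fintype J] [LinearOrder J]
    (d : J → ℤ) (f : J → (Cofree C A →ₗ[k] B)) {n : ℕ} (hn : n < Fintype.card J) :
    ang C A B J d f ∘ₗ cls C A n = 0 :=
  ang_cls_eq_zero d (fun _ => 1) (fun j n hn => by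
    obtain rfl : n = 0 := by omega
    rw [cls_zero hC, LinearMap.comp_zero]) (by simpa using hn)

variable (C A) in
/-- The part of arity at most `N` of `C(A)`. -/
def arLe (N : ℕ) : Submodule k (Cofree C A) :=
  ⨆ n : {n // n ≤ N}, LinearMap.range (cls C A n.1)

theorem cls_mem_arLe {n N : ℕ} (h : n ≤ N) (x) : cls C A n x ∈ arLe C A N :=
  Submodule.mem_iSup_of_mem (⟨n, h⟩ : {n // n ≤ N}) ⟨x, rfl⟩

theorem arLe_mono {M N : ℕ} (h : M ≤ N) : arLe C A M ≤ arLe C A N := by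
  refine iSup_le fun n => ?_
  rintro _ ⟨x, rfl⟩
  exact cls_mem_arLe (n.2.trans h) x

theorem exists_mem_arLe (x : Cofree C A) : ∃ N, x ∈ arLe C A N := by
  refine Cofree.induction (P := fun x => ∃ N, x ∈ arLe C A N) (fun n x => ⟨n, cls_mem_arLe le_rfl x⟩)
    ⟨0, Submodule.zero_mem _⟩ ?_ x
  rintro x y ⟨M, hM⟩ ⟨N, hN⟩
  exact ⟨max M N, Submodule.add_mem _ (arLe_mono (le_max_left _ _) hM)
    (arLe_mono (le_max_right _ _) hN)⟩

theorem arLe_induction {N : ℕ} {Z : Type*} [AddCommGroup Z] [Module k Z]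
    {f g : Cofree C A →ₗ[k] Z} (h : ∀ n ≤ N, ∀ y, f (cls C A n y) = g (cls C A n y))
    {x : Cofree C A} (hx : x ∈ arLe C A N) : f x = g x := by
  have : arLe C A N ≤ LinearMap.eqLocus f g := by
    refine iSup_le fun n => ?_
    rintro _ ⟨y, rfl⟩
    exact h n.1 n.2 y
  exact this hx

theorem clsOn_mem_arLe (J : Type) [Fintype J] [LinearOrder J] (x) :
    clsOn C A J x ∈ arLe C A (Fintype.card J) := cls_mem_arLe le_rfl _

theorem ang_mem_arLe {J : Type} [Fintype J] [LinearOrder J]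
    (d : J → ℤ) (f : J → (Cofree C A →ₗ[k] B)) (x : Cofree C A) :
    ang C A B J d f x ∈ arLe C B (Fintype.card J) := clsOn_mem_arLe J _

theorem ang_arLe_of_lt_card [CharZero k] (hC : C.IsReduced) {J : Type} [Fintype J] [LinearOrder J]
    (d : J → ℤ) (f : J → (Cofree C A →ₗ[k] B)) {N : ℕ} (hn : N < Fintype.card J) {x : Cofree C A}
    (hx : x ∈ arLe C A N) : ang C A B J d f x = 0 :=
  arLe_induction (g := 0) (fun _ hn' y =>
    LinearMap.congr_fun (ang_cls_of_lt_card hC d f (hn'.trans_lt hn)) y) hx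

/-! ### The projection to the cogenerators -/

theorem proj_cls_one [CharZero k] (x) : proj C A (cls C A 1 x) =
    TensorProduct.lid k A (TensorProduct.map C.counit
      (PiTensorProduct.subsingletonEquiv (0 : Fin 1)).toLinearMap x) := by
  rw [proj, descend_cls]
  · rfl
  · intro e x
    obtain rfl : e = 1 := Subsingleton.elim _ _
    rw [map_one]
    rfl

theorem proj_cls_of_ne [CharZero k] {n : ℕ} (hn : n ≠ 1) : proj C A ∘ₗ cls C A n = 0 := by
  refine LinearMap.ext fun x => ?_
  rw [LinearMap.comp_apply, proj, descend_cls]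
  · rcases n with _ | _ | n
    · rfl
    · exact absurd rfl hn
    · rfl
  · intro e x
    rcases n with _ | _ | n
    · rfl
    · exact absurd rfl hn
    · rfl

theorem proj_clsOn [CharZero k] {I : Type} [Fintype I] [LinearOrder I] (e : I ≃ Fin 1)
    (c : C.obj I) (a : I → A) :
    proj C A (clsOn C A I (c ⊗ₜ PiTensorProduct.tprod k a)) =
      C.counit (C.map e c) • a (e.symm 0) := by
  have := e.subsingleton
  let o : I ≃o Fin 1 := ⟨e, fun {i j} => by rw [Subsingleton.elim i j]; simp⟩
  rw [clsOn_eq C A o, LinearMap.comp_apply, proj_cls_one, TensorProduct.map_tmul]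
  rw [TensorProduct.map_tmul, TensorProduct.lid_tmul]
  congr 1
  simp only [LinearEquiv.coe_coe, PiTensorProduct.reindex_tprod]
  exact PiTensorProduct.subsingletonEquiv_apply_tprod _ _

end

theorem reorder_natural {J J' : Type} [Fintype J] [LinearOrder J] [LinearOrder J'] (e : J ≃ J')
    {V W : DGData k} (hV : V.IsGraded) (hW : W.IsGraded) {f : V →ₗ[k] W} (hf : HasDegree V W 0 f) :
    (PiTensorProduct.map fun _ : J' => f) ∘ₗ reorder e (fun _ => V) =
      reorder e (fun _ => W) ∘ₗ PiTensorProduct.map fun _ : J => f := by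
  refine pi_ext_gr (fun _ => hV) fun n x hx => ?_
  rw [LinearMap.comp_apply, LinearMap.comp_apply, reorder_apply e (fun _ => hV) hx, map_smul,
    PiTensorProduct.map_tprod, PiTensorProduct.map_tprod,
    reorder_apply e (fun _ => hW) (n := n) fun j => by simpa using hf _ _ (hx j)]

section

variable (C : Cooperad k) (A : DGVect k) [CharZero k]

theorem proj_deg : HasDegree (cofree C A) A.toDGData 0 (proj C A) := by
  intro i x hx
  refine (?_ : (cofree C A).gr i ≤ (A.gr (i + 0)).comap (proj C A)) hx
  refine iSup_le fun n => ?_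
  rintro _ ⟨x, hx, rfl⟩
  rw [Submodule.mem_comap]
  by_cases hn : n = 1
  · subst hn
    induction hx using Submodule.span_induction with
    | zero => simp
    | add x y _ _ hx hy => rw [map_add, map_add]; exact Submodule.add_mem _ hx hy
    | smul c x _ hx => rw [map_smul, map_smul]; exact Submodule.smul_mem _ _ hx
    | mem x hx =>
      obtain ⟨i, j, c, z, rfl, hc, hz, rfl⟩ := hx
      induction hz using Submodule.span_induction with
      | zero => simp
      | add x y _ _ hx hy =>
        rw [TensorProduct.tmul_add, map_add, map_add]; exact Submodule.add_mem _ hx hy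
      | smul c x _ hx =>
        rw [TensorProduct.tmul_smul, map_smul, map_smul]; exact Submodule.smul_mem _ _ hx
      | mem z hz =>
        obtain ⟨n, a, rfl, ha, rfl⟩ := hz
        rw [proj_cls_one, TensorProduct.map_tmul, TensorProduct.lid_tmul]
        by_cases hi : i = 0
        · subst hi
          refine Submodule.smul_mem _ _ ?_
          rw [LinearEquiv.coe_coe, PiTensorProduct.subsingletonEquiv_apply_tprod]
          simpa using ha 0
        · rw [C.counit_deg i hi c hc, zero_smul]
          exact Submodule.zero_mem _
  · rw [← LinearMap.comp_apply, proj_cls_of_ne hn]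
    exact Submodule.zero_mem _

theorem proj_clsOn_of_ne {I : Type} [Fintype I] [LinearOrder I] (h : Fintype.card I ≠ 1) :
    proj C A ∘ₗ clsOn C A I = 0 := clsOn_comp_eq_zero C A I (proj_cls_of_ne h)

variable {C A}

theorem proj_ang_of_ne {B : DGVect k} {J : Type} [Fintype J] [LinearOrder J]
    (h : Fintype.card J ≠ 1) (d : J → ℤ) (f : J → (Cofree C A →ₗ[k] B)) :
    proj C B ∘ₗ ang C A B J d f = 0 := by
  rw [ang, ← LinearMap.comp_assoc, proj_clsOn_of_ne C B h, LinearMap.zero_comp]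

/-- This is the counit axiom at the root: the projection applies the counit to the root decoration
and leaves `f 0` acting on the original word. -/
theorem proj_ang_fin_one {B : DGVect k} (d : Fin 1 → ℤ) (f : Fin 1 → (Cofree C A →ₗ[k] B)) :
    proj C B ∘ₗ ang C A B (Fin 1) d f = f 0 := by
  refine Cofree.ext fun n x => ?_
  rw [LinearMap.comp_apply, ang, LinearMap.comp_apply, LinearMap.comp_apply, comulOn_cls,
    Fintype.sum_unique, comulTree]
  have hp : (default : Fin n → Fin 1) = fun _ => 0 := Subsingleton.elim _ _
  rw [hp]
  have key : proj C B ∘ₗ clsOn C B (Fin 1) ∘ₗ koszulMap (C.obj (Fin 1)).toDGData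
        (fun _ => cofree C A) (fun _ => B.toDGData) d f ∘ₗ
        collect C A (C.obj (Fin 1)) (fun _ : Fin n => (0 : Fin 1)) =
      f 0 ∘ₗ clsOn C A (Fin n) ∘ₗ TensorProduct.map ((TensorProduct.lid k _).toLinearMap ∘ₗ
        TensorProduct.map C.counit
          (C.map (Equiv.subtypeUnivEquiv (p := fun i : Fin n => (fun _ => (0 : Fin 1)) i = 0)
          fun _ => rfl) ∘ₗ
        (PiTensorProduct.subsingletonEquiv (R := k)
          (s := fun j => (C.obj {i : Fin n // (fun _ => (0 : Fin 1)) i = j}).carrier)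
          (0 : Fin 1)).toLinearMap)) LinearMap.id := by
    refine triple_ext_gr (C.obj _).isGraded (fun _ => (C.obj _).isGraded) (fun _ => A.isGraded)
      fun i c hc m y hy n' a ha => ?_
    simp only [LinearMap.comp_apply]
    rw [collect_apply C A _ _ c hy ha, map_smul,
      koszulMap_apply (C.obj _).isGraded (fun _ => cofree_isGraded C A) d f hc
        (fun j => clsOn_mem_gr C A (hy j) fun i => ha i.1), map_smul, map_smul, map_smul, map_smul,
      proj_clsOn (Equiv.refl _), C.map_refl]
    simp only [LinearEquiv.coe_coe, TensorProduct.lid_tmul, LinearMap.id_apply,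
      LinearMap.comp_apply, TensorProduct.map_tmul]
    rw [PiTensorProduct.subsingletonEquiv_apply_tprod, ← TensorProduct.smul_tmul', map_smul,
      map_smul, Equiv.refl_symm, Equiv.refl_apply]
    -- The sign involves the degree `i` of the root decoration. The counit kills it unless `i = 0`,
    -- when the sign is trivial.
    by_cases hi : i = 0
    · have h1 : invParity (fun _ : Fin n => (0 : Fin 1)) (fun i => (n' i : ZMod 2)) = 0 :=
        invParity_of_monotone (fun _ _ _ => le_rfl) _
      have h2 : crossParity (fun _ : Fin n => (0 : Fin 1)) (fun i => (m i : ZMod 2))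
          (fun i => (n' i : ZMod 2)) = 0 := by simp [crossParity]
      subst hi
      rw [h1, h2, add_zero, ksign_zero, one_smul]
      simp only [mapParity, Int.cast_zero, mul_zero, Finset.sum_const_zero, Fin.isValue,
        Finset.univ_unique, Fin.default_eq_zero, Finset.sum_singleton, lt_irrefl, if_false, add_zero,
        ksign_zero, one_smul]
      congr 2
      exact clsOn_tmul_of_monotone C A (Equiv.subtypeUnivEquiv
        (p := fun i : Fin n => (fun _ => (0 : Fin 1)) i = 0) fun _ => rfl) (fun _ _ h => h) (y 0)
        fun i => ha i.1
    · rw [C.counit_deg i hi c hc, zero_smul, zero_smul, smul_zero, smul_zero]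
  have h1 := LinearMap.congr_fun key (TensorProduct.map (C.decomp fun _ => 0) LinearMap.id x)
  refine h1.trans ?_
  rw [LinearMap.comp_apply, LinearMap.comp_apply, ← LinearMap.comp_apply (TensorProduct.map _ _),
    ← TensorProduct.map_comp, ← clsOn_eq_cls]
  have h2 : ((TensorProduct.lid k _).toLinearMap ∘ₗ
        TensorProduct.map C.counit
          (C.map (Equiv.subtypeUnivEquiv (p := fun i : Fin n => (fun _ => (0 : Fin 1)) i = 0)
          fun _ => rfl) ∘ₗ
        (PiTensorProduct.subsingletonEquiv (R := k)
          (s := fun j => (C.obj {i : Fin n // (fun _ => (0 : Fin 1)) i = j}).carrier)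
          (0 : Fin 1)).toLinearMap)) ∘ₗ C.decomp (fun _ => 0) = LinearMap.id :=
    LinearMap.ext fun x => C.counit_left x
  rw [h2, LinearMap.id_comp, TensorProduct.map_id, LinearMap.id_apply]

theorem proj_clsOn_fibre {I J : Type} [Fintype I] [LinearOrder I] [LinearOrder J] (p : I → J)
    (j : J) (e : {i // p i = j} ≃ Fin 1) (c : C.obj {i // p i = j}) (a : I → A) :
    proj C A (clsOn C A {i // p i = j} (c ⊗ₜ PiTensorProduct.tprod k fun i => a i.1)) =
      C.counit (C.map e c) • a (e.symm 0).1 :=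
  proj_clsOn e c fun i => a i.1

/-- This is the counit axiom at the upper level: along the identity every upper vertex has one input
and is erased by the counit. -/
theorem proj_comulTree_id {I : Type} [Fintype I] [LinearOrder I] :
    TensorProduct.map LinearMap.id (PiTensorProduct.map fun _ : I => proj C A) ∘ₗ
      comulTree C A (fun i : I => i) = LinearMap.id := by
  have key : TensorProduct.map LinearMap.id (PiTensorProduct.map fun _ : I => proj C A) ∘ₗ
        collect C A (C.obj I) (fun i : I => i) =
      TensorProduct.map ((TensorProduct.rid k _).toLinearMap ∘ₗ TensorProduct.map LinearMap.id
      (PiTensorProduct.lift (MultilinearMap.mkPiRing k I 1 |>.compLinearMap fun i =>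
        C.counit ∘ₗ C.map (Equiv.ofUnique {i' // i' = i} (Fin 1))))) LinearMap.id := by
    refine triple_ext_gr (C.obj _).isGraded (fun _ => (C.obj _).isGraded) (fun _ => A.isGraded)
      fun i c hc m y hy n' a ha => ?_
    rw [LinearMap.comp_apply, collect_apply C A _ _ c hy ha, map_smul, TensorProduct.map_tmul,
      TensorProduct.map_tmul, PiTensorProduct.map_tprod]
    simp only [LinearMap.id_apply, LinearMap.comp_apply, TensorProduct.map_tmul,
      LinearEquiv.coe_coe, TensorProduct.rid_tmul, PiTensorProduct.lift.tprod,
      MultilinearMap.compLinearMap_apply, MultilinearMap.mkPiRing_apply, smul_eq_mul, mul_one]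
    have h := fun i => proj_clsOn_fibre (fun i : I => i) i (Equiv.ofUnique {i' // i' = i} (Fin 1))
      (y i) a
    simp only [h]
    rw [MultilinearMap.map_smul_univ, TensorProduct.tmul_smul, TensorProduct.smul_tmul']
    -- A nontrivial crossing sign needs an upper decoration of nonzero degree, and the counit kills
    -- such a decoration.
    by_cases hm : ∀ i, m i = 0
    · have h1 : invParity (fun i : I => i) (fun i => (n' i : ZMod 2)) = 0 :=
        invParity_of_monotone (fun _ _ h => h) _
      simp [h1, hm, crossParity, ksign_zero]
      rfl
    · push Not at hm
      obtain ⟨j, hj⟩ := hm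
      have : C.counit (C.map (Equiv.ofUnique {i' // i' = j} (Fin 1)) (y j)) = 0 :=
        C.counit_deg (m j) hj _ (by simpa using C.map_mem _ _ _ (hy j))
      rw [Finset.prod_eq_zero (Finset.mem_univ j) this, zero_smul, TensorProduct.zero_tmul,
        smul_zero, TensorProduct.zero_tmul]
  rw [comulTree, ← LinearMap.comp_assoc, key, ← TensorProduct.map_comp, LinearMap.id_comp]
  have h2 : ((TensorProduct.rid k _).toLinearMap ∘ₗ TensorProduct.map LinearMap.id
      (PiTensorProduct.lift (MultilinearMap.mkPiRing k I 1 |>.compLinearMap fun i =>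
        C.counit ∘ₗ C.map (Equiv.ofUnique {i' // i' = i} (Fin 1))))) ∘ₗ
      C.decomp (fun i : I => i) = LinearMap.id :=
    LinearMap.ext fun x => C.counit_right x
  rw [h2, TensorProduct.map_id]

/-- Projecting every output to the cogenerators kills `p` unless all its fibres are singletons. Only
bijections survive, and each of the m! of them returns the class itself, by `proj_comulTree_id` and
equivariance. -/
theorem proj_comul_cls (m n : ℕ) (x) :
    cls C A m (TensorProduct.map LinearMap.id (PiTensorProduct.map fun _ : Fin m => proj C A)
      (comul C A m (cls C A n x))) = if n = m then (m.factorial : k) • cls C A n x else 0 := by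
  rw [← comulOn_fin, comulOn_cls, map_sum, map_sum]
  have h0 : ∀ p : Fin n → Fin m, ¬ Function.Bijective p → TensorProduct.map LinearMap.id
      (PiTensorProduct.map fun _ : Fin m => proj C A) (comulTree C A p x) = 0 := by
    intro p hp
    by_contra hne
    refine hp (Function.bijective_iff_existsUnique p |>.2 fun j => ?_)
    have h1 : Fintype.card {i // p i = j} = 1 := by
      by_contra hc
      exact hne (map_comulTree_eq_zero C A p _ j (proj_cls_of_ne hc) x)
    obtain ⟨i, hi⟩ := Fintype.card_eq_one_iff.1 h1
    exact ⟨i.1, i.2, fun i' hi' => congrArg Subtype.val (hi ⟨i', hi'⟩)⟩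
  split_ifs with hnm
  · subst hnm
    have h2 : ∀ e : Equiv.Perm (Fin n), cls C A n (TensorProduct.map LinearMap.id
        (PiTensorProduct.map fun _ : Fin n => proj C A) (comulTree C A (fun i => e i) x)) =
        cls C A n x := by
      intro e
      have h3 : TensorProduct.map LinearMap.id (PiTensorProduct.map fun _ : Fin n => proj C A) ∘ₗ
          TensorProduct.map (C.map e) (reorder e fun _ => cofree C A) =
          act C A n e ∘ₗ
            TensorProduct.map LinearMap.id (PiTensorProduct.map fun _ : Fin n => proj C A) := by
        change _ = TensorProduct.map (C.map e) (reorder e fun _ => A.toDGData) ∘ₗ _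
        rw [← TensorProduct.map_comp, ← TensorProduct.map_comp, LinearMap.id_comp,
          LinearMap.comp_id, reorder_natural e (cofree_isGraded C A) A.isGraded (proj_deg C A)]
      have h4 := LinearMap.congr_fun h3 (comulTree C A (fun i => i) x)
      have h5 := LinearMap.congr_fun (proj_comulTree_id (C := C) (A := A) (I := Fin n)) x
      rw [LinearMap.comp_apply, LinearMap.comp_apply] at h4
      rw [LinearMap.comp_apply, LinearMap.id_apply] at h5
      rw [comulTree_vertices C A (fun i => i) e, LinearMap.comp_apply, h4, h5, cls_act]
    rw [← Fintype.sum_of_injective (fun e : Equiv.Perm (Fin n) => (e : Fin n → Fin n))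
      DFunLike.coe_injective (fun _ => cls C A n x) _ (fun p hp => ?_) fun e => (h2 e).symm]
    · rw [Finset.sum_const, Finset.card_univ, Fintype.card_perm, Fintype.card_fin,
        Nat.cast_smul_eq_nsmul]
    · rw [h0 p fun hb => hp ⟨Equiv.ofBijective p hb, rfl⟩, map_zero]
  · refine Finset.sum_eq_zero fun p _ => ?_
    rw [h0 p fun hp => hnm (by simpa using Fintype.card_of_bijective hp), map_zero]

end

theorem sum_linearMap_comp {V W Z ι : Type*} [AddCommGroup V] [Module k V] [AddCommGroup W]
    [Module k W] [AddCommGroup Z] [Module k Z] (s : Finset ι) (f : ι → W →ₗ[k] Z) (g : V →ₗ[k] W) :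
    (∑ i ∈ s, f i) ∘ₗ g = ∑ i ∈ s, f i ∘ₗ g :=
  LinearMap.ext fun x => by simp [LinearMap.sum_apply]

theorem linearMap_comp_sum {V W Z ι : Type*} [AddCommGroup V] [Module k V] [AddCommGroup W]
    [Module k W] [AddCommGroup Z] [Module k Z] (s : Finset ι) (f : ι → V →ₗ[k] W) (g : W →ₗ[k] Z) :
    g ∘ₗ (∑ i ∈ s, f i) = ∑ i ∈ s, g ∘ₗ f i :=
  LinearMap.ext fun x => by simp [LinearMap.sum_apply]

/-! ### Reordering and odd operators -/

/-- Reordering words and then applying reordered maps is compared with applying the maps and then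
reordering the results. The discrepancy is the sign of reordering the maps, so this is what makes
`ang` graded symmetric. -/
theorem mapParity_reorder {J J' : Type} [Fintype J] [LinearOrder J] [Fintype J'] [LinearOrder J']
    (e : J ≃ J') (d : J → ZMod 2) (s : ZMod 2) (t : J → ZMod 2) :
    invParity e t + mapParity (fun j => d (e.symm j)) s (fun j => t (e.symm j)) =
      invParity e d + (mapParity d s t + invParity e fun j => t j + d j) := by
  have h1 : mapParity (fun j => d (e.symm j)) s (fun j => t (e.symm j)) =
      (∑ j, d j * s) + ∑ i, ∑ j, if e i < e j then d j * t i else 0 := by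
    rw [mapParity, ← e.sum_comp, ← e.sum_comp]
    congr 1
    · simp
    · refine Finset.sum_congr rfl fun i _ => ?_
      rw [← e.sum_comp]
      simp
  have h2 : (∑ i, ∑ j, if e i < e j then d j * t i else 0) =
      (∑ i, ∑ j, if i < j then d j * t i else 0) + invPair e t d := by
    rw [invPair]
    simp only [← Finset.sum_add_distrib]
    refine Finset.sum_congr rfl fun i _ => Finset.sum_congr rfl fun j _ => ?_
    have h2 : ∀ x : ZMod 2, x + x = 0 := zmod2_add_self
    rcases lt_cases i j with h | rfl | h
    · rcases lt_cases (e i) (e j) with h' | h' | h'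
      · simp [h, h']
      · exact absurd (e.injective h') h.2.2.1
      · simp [h, h', mul_comm (d j), h2]
    · simp
    · rcases lt_cases (e i) (e j) with h' | h' | h'
      · simp [h, h', mul_comm (d j)]
      · exact absurd (e.injective h') h.2.2.2.symm
      · simp [h, h']
  rw [h1, h2, invParity_add, mapParity]
  linear_combination -zmod2_add_self (invParity e d)

theorem single_update_deg {J : Type} [DecidableEq J] {V : J → DGData k} {i : J} {D : V i →ₗ[k] V i}
    (hD : HasDegree (V i) (V i) 1 D) (j : J) :
    HasDegree (V j) (V j) ((Pi.single i 1 : J → ℤ) j)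
      (Function.update (fun _ => LinearMap.id : ∀ j, V j →ₗ[k] V j) i D j) := by
  by_cases h : j = i
  · subst h
    simpa using hD
  · simpa [h] using HasDegree.id (V j)

section

variable {J : Type} [Fintype J] [LinearOrder J]

theorem koszulMap_reorder {J' : Type} [Fintype J'] [LinearOrder J'] (e : J ≃ J')
    {X X' : DGData k} (hX : X.IsGraded) (hX' : X'.IsGraded) {V W : J → DGData k}
    (hV : ∀ j, (V j).IsGraded) (hW : ∀ j, (W j).IsGraded) {d : J → ℤ} {f : ∀ j, V j →ₗ[k] W j}
    (hf : ∀ j, HasDegree (V j) (W j) (d j) (f j)) {g : X →ₗ[k] X'} (hg : HasDegree X X' 0 g) :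
    koszulMap X' (fun j => V (e.symm j)) (fun j => W (e.symm j)) (fun j => d (e.symm j))
        (fun j => f (e.symm j)) ∘ₗ TensorProduct.map g (reorder e V) =
      ksign k (invParity e fun j => (d j : ZMod 2)) •
        (TensorProduct.map g (reorder e W) ∘ₗ koszulMap X V W d f) := by
  refine tensor_ext_gr (W := DGData.pi V) hX (DGData.IsGraded.pi hV) fun i _ c hc x' _ => ?_
  refine LinearMap.congr_fun (f := (koszulMap X' (fun j => V (e.symm j)) (fun j => W (e.symm j))
      (fun j => d (e.symm j)) (fun j => f (e.symm j)) ∘ₗ TensorProduct.map g (reorder e V)) ∘ₗ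
    TensorProduct.mk k _ _ c) (g := (ksign k (invParity e fun j => (d j : ZMod 2)) •
        (TensorProduct.map g (reorder e W) ∘ₗ koszulMap X V W d f)) ∘ₗ TensorProduct.mk k _ _ c)
    (pi_ext_gr hV fun n x hx => ?_) x'
  simp only [LinearMap.comp_apply, LinearMap.smul_apply, TensorProduct.mk_apply]
  have hgc := hg _ _ hc
  rw [add_zero] at hgc
  rw [TensorProduct.map_tmul, reorder_apply e hV hx, TensorProduct.tmul_smul, map_smul,
    koszulMap_apply hX' (fun j => hV _) _ _ hgc (fun j => hx (e.symm j)),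
    koszulMap_apply hX hV d f hc hx, map_smul, TensorProduct.map_tmul,
    reorder_apply e hW (fun j => hf j _ _ (hx j)), TensorProduct.tmul_smul,
    ksign_smul_smul, ksign_smul_smul, ksign_smul_smul]
  congr 2
  have := mapParity_reorder e (fun j => (d j : ZMod 2)) i (fun j => (n j : ZMod 2))
  push_cast
  rw [this]
  ring

/-- A derivation becomes a sum of `koszulMap`s with one odd entry and identities elsewhere, so its
composites with other maps are covered by the composition rule `koszulMap_comp`. -/
theorem map_tw_koszulDer {X : DGData k} {V : J → DGData k} (hV : ∀ j, (V j).IsGraded)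
    (D : ∀ j, V j →ₗ[k] V j) :
    TensorProduct.map (X.tw 1) (koszulDer V D) = ∑ i, koszulMap X V V (Pi.single i 1)
      (Function.update (fun _ => LinearMap.id) i (D i)) := by
  refine TensorProduct.ext' fun x y => ?_
  rw [TensorProduct.map_tmul, koszulDer, LinearMap.sum_apply, LinearMap.sum_apply,
    TensorProduct.tmul_sum]
  refine Finset.sum_congr rfl fun i _ => ?_
  rw [koszulMap, TensorProduct.map_tmul, Finset.sum_pi_single', if_pos (Finset.mem_univ i)]
  congr 3
  funext j
  have h0 : (V j).tw 0 = LinearMap.id := (hV j).tw_eq_id (by simp)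
  rw [Finset.sum_pi_single']
  simp only [Finset.mem_filter, Finset.mem_univ, true_and]
  rcases lt_cases j i with h | rfl | h
  · rw [if_pos h.1, if_pos h.1, Function.update_of_ne h.2.2.1, LinearMap.id_comp]
  · simp [h0]
  · rw [if_neg h.2.1, if_neg h.2.1, if_neg h.2.2.1, Function.update_of_ne h.2.2.1, h0,
      LinearMap.id_comp]

theorem koszulDer_comp_koszulMap {X : DGData k} (hX : X.IsGraded) {V W : J → DGData k}
    (hV : ∀ j, (V j).IsGraded) (hW : ∀ j, (W j).IsGraded) {d : J → ℤ} {f : ∀ j, V j →ₗ[k] W j}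
    (hf : ∀ j, HasDegree (V j) (W j) (d j) (f j)) (D : ∀ j, W j →ₗ[k] W j) :
    TensorProduct.map (X.tw 1) (koszulDer W D) ∘ₗ koszulMap X V W d f =
      ∑ i, ksign k (∑ a with a < i, (d a : ZMod 2)) •
        koszulMap X V W (d + Pi.single i 1) (Function.update f i (D i ∘ₗ f i)) := by
  rw [map_tw_koszulDer hW, sum_linearMap_comp]
  refine Finset.sum_congr rfl fun i _ => ?_
  rw [koszulMap_comp hX hV hW hf]
  congr 2
  · rw [Finset.sum_filter]
    refine Finset.sum_congr rfl fun a _ => ?_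
    rw [Finset.sum_eq_single i]
    · simp
    · intro b _ hb
      simp [hb]
    · exact fun h => absurd (Finset.mem_univ _) h
  · funext j
    by_cases h : j = i
    · subst h
      simp
    · simp [h]

theorem koszulMap_comp_koszulDer {X : DGData k} (hX : X.IsGraded) {V W : J → DGData k}
    (hV : ∀ j, (V j).IsGraded) {d : J → ℤ} {f : ∀ j, V j →ₗ[k] W j}
    {D : ∀ j, V j →ₗ[k] V j} (hD : ∀ j, HasDegree (V j) (V j) 1 (D j)) :
    koszulMap X V W d f ∘ₗ TensorProduct.map (X.tw 1) (koszulDer V D) =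
      ∑ i, ksign k (∑ a with i < a, (d a : ZMod 2)) •
        koszulMap X V W (d + Pi.single i 1) (Function.update f i (f i ∘ₗ D i)) := by
  rw [map_tw_koszulDer hV, linearMap_comp_sum]
  refine Finset.sum_congr rfl fun i _ => ?_
  rw [koszulMap_comp hX hV hV (single_update_deg (hD i))]
  congr 2
  · rw [Finset.sum_filter, Finset.sum_eq_single i]
    · simp
    · intro b _ hb
      simp [hb]
    · exact fun h => absurd (Finset.mem_univ _) h
  · funext j
    rw [Pi.add_apply, add_comm]
  · funext j
    by_cases h : j = i
    · subst h
      simp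
    · simp [h]

theorem koszulMap_comp_left {X : DGData k} (hX : X.IsGraded) {V W : J → DGData k} (d : J → ℤ)
    (f : ∀ j, V j →ₗ[k] W j) {D : X →ₗ[k] X} (hD : HasDegree X X 1 D) :
    TensorProduct.map D LinearMap.id ∘ₗ koszulMap X V W d f =
      ksign k (∑ j, (d j : ZMod 2)) •
        (koszulMap X V W d f ∘ₗ TensorProduct.map D LinearMap.id) := by
  rw [koszulMap, ← TensorProduct.map_comp, ← TensorProduct.map_comp, LinearMap.id_comp,
    LinearMap.comp_id, HasDegree.tw hX hX hD, TensorProduct.map_smul_left, smul_smul, ← ksign_add]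
  simp [zmod2_add_self, ksign_zero]

theorem koszulMap_update {X : DGData k} {V W : J → DGData k} (d : J → ℤ)
    (f : ∀ j, V j →ₗ[k] W j) (i : J) (c : k) (g h : V i →ₗ[k] W i) :
    koszulMap X V W d (Function.update f i (c • g + h)) =
      c • koszulMap X V W d (Function.update f i g) +
        koszulMap X V W d (Function.update f i h) := by
  have h1 : ∀ g : V i →ₗ[k] W i, (fun j => Function.update f i g j ∘ₗ
      (V j).tw (∑ b with j < b, d b)) = Function.update (fun j => f j ∘ₗ
      (V j).tw (∑ b with j < b, d b)) i (g ∘ₗ (V i).tw (∑ b with i < b, d b)) := by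
    intro g
    funext j
    by_cases h : j = i
    · subst h
      simp
    · simp [h]
  simp only [koszulMap, h1]
  rw [LinearMap.add_comp, LinearMap.smul_comp, PiTensorProduct.map_update_add,
    PiTensorProduct.map_update_smul, TensorProduct.map_add_right, TensorProduct.map_smul_right]

/-- The commutator of a tensor product of maps with the differentials. -/
theorem koszulMap_commutator {X : DGData k} (hX : X.IsGraded) {V W : J → DGData k}
    (hV : ∀ j, (V j).IsGraded) (hW : ∀ j, (W j).IsGraded) {d : J → ℤ} {f : ∀ j, V j →ₗ[k] W j}
    (hf : ∀ j, HasDegree (V j) (W j) (d j) (f j)) {D₀ : X →ₗ[k] X} (hD₀ : HasDegree X X 1 D₀)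
    {D : ∀ j, V j →ₗ[k] V j} (hD : ∀ j, HasDegree (V j) (V j) 1 (D j)) (D' : ∀ j, W j →ₗ[k] W j) :
    (TensorProduct.map D₀ LinearMap.id + TensorProduct.map (X.tw 1) (koszulDer W D')) ∘ₗ
        koszulMap X V W d f =
      ksign k (∑ j, (d j : ZMod 2)) • (koszulMap X V W d f ∘ₗ
        (TensorProduct.map D₀ LinearMap.id + TensorProduct.map (X.tw 1) (koszulDer V D))) +
      ∑ i, ksign k (∑ a with a < i, (d a : ZMod 2)) •
        koszulMap X V W (d + Pi.single i 1)
          (Function.update f i (D' i ∘ₗ f i - ksign k (d i : ZMod 2) • f i ∘ₗ D i)) := by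
  rw [LinearMap.add_comp, LinearMap.comp_add, koszulMap_comp_left hX d f hD₀, smul_add, add_assoc]
  congr 1
  rw [koszulDer_comp_koszulMap hX hV hW hf, koszulMap_comp_koszulDer hX hV hD, Finset.smul_sum,
    ← Finset.sum_add_distrib]
  refine Finset.sum_congr rfl fun i _ => ?_
  -- Modulo 2 the letters after `i` cancel from the total degree: the sign of moving an odd operator
  -- out on the right differs from that on the left by the parities up to and including `i`.
  have h1 : (∑ j, (d j : ZMod 2)) + ∑ a with i < a, (d a : ZMod 2) =
      (∑ a with a < i, (d a : ZMod 2)) + d i := by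
    have h2 : ∑ j, (d j : ZMod 2) = (∑ a with a < i, (d a : ZMod 2)) + d i +
        ∑ a with i < a, (d a : ZMod 2) := by
      rw [Finset.sum_filter, Finset.sum_filter, ← Finset.sum_ite_eq' Finset.univ i
        (fun a => (d a : ZMod 2)) |>.trans (if_pos (Finset.mem_univ i)), ← Finset.sum_add_distrib,
        ← Finset.sum_add_distrib]
      refine Finset.sum_congr rfl fun a _ => ?_
      rcases lt_cases a i with h | rfl | h <;> simp [*]
    rw [h2, add_assoc, zmod2_add_self, add_zero]
  have h3 : D' i ∘ₗ f i - ksign k (d i : ZMod 2) • f i ∘ₗ D i =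
      (-ksign k (d i : ZMod 2)) • (f i ∘ₗ D i) + D' i ∘ₗ f i := by
    rw [neg_smul, sub_eq_neg_add]
  rw [h3, koszulMap_update, smul_smul, ← ksign_add, h1, smul_add, smul_smul, ksign_add, mul_neg, neg_smul,
    ← add_assoc, add_neg_cancel, zero_add]

end

/-! ### Multilinearity, graded symmetry and composition of `ang`. -/

section

variable {C : Cooperad k} {A B : DGVect k}

theorem ang_update {J : Type} [Fintype J] [LinearOrder J] (d : J → ℤ)
    (f : J → (Cofree C A →ₗ[k] B)) (i : J) (c : k) (g h : Cofree C A →ₗ[k] B) :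
    ang C A B J d (Function.update f i (c • g + h)) =
      c • ang C A B J d (Function.update f i g) + ang C A B J d (Function.update f i h) := by
  simp only [ang]
  rw [koszulMap_update, LinearMap.add_comp, LinearMap.comp_add, LinearMap.smul_comp,
    LinearMap.comp_smul]

variable [CharZero k]

/-- `ang` is graded symmetric. -/
theorem ang_reindex {J J' : Type} [Fintype J] [LinearOrder J] [Fintype J'] [LinearOrder J']
    (e : J ≃ J') {d : J → ℤ} {f : J → (Cofree C A →ₗ[k] B)}
    (hf : ∀ j, HasDegree (cofree C A) B.toDGData (d j) (f j)) :
    ang C A B J' (fun j => d (e.symm j)) (fun j => f (e.symm j)) =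
      ksign k (invParity e fun j => (d j : ZMod 2)) • ang C A B J d f := by
  have h := koszulMap_reorder e (C.obj J).isGraded (C.obj J').isGraded
    (fun _ => cofree_isGraded C A) (fun _ => B.isGraded) hf (C.map_mem e)
  refine LinearMap.ext fun x => ?_
  have h1 := LinearMap.congr_fun h (comulOn C A J x)
  simp only [ang, LinearMap.comp_apply, LinearMap.smul_apply] at h1 ⊢
  rw [comulOn_map C A e, LinearMap.comp_apply, h1, map_smul, ← clsOn_map C B e]
  rfl

/-- Composition of maps of the form `ang`. -/
theorem ang_comp_ang {B' : DGVect k} {J K : Type} [Fintype J] [LinearOrder J] [Fintype K]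
    [LinearOrder K] {d : J → ℤ} {f : J → (Cofree C A →ₗ[k] B)}
    (hf : ∀ j, HasDegree (cofree C A) B.toDGData (d j) (f j)) (e : K → ℤ)
    (g : K → (Cofree C B →ₗ[k] B')) :
    ang C B B' K e g ∘ₗ ang C A B J d f = ∑ q : J → K,
      ksign k (invParity q (fun j => (d j : ZMod 2)) +
        ∑ a, ∑ b, if a < b then (e b : ZMod 2) * ∑ j : {j // q j = a}, (d j.1 : ZMod 2) else 0) •
      ang C A B' K (fun l => (∑ j : {j // q j = l}, d j.1) + e l)
        (fun l => g l ∘ₗ ang C A B {j // q j = l} (fun j => d j.1) fun j => f j.1) := by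
  have h := comulOn_ang (K := K) hf
  refine LinearMap.ext fun x => ?_
  have h1 := LinearMap.congr_fun h x
  rw [LinearMap.comp_apply] at h1
  rw [LinearMap.comp_apply, LinearMap.sum_apply, ang, LinearMap.comp_apply, LinearMap.comp_apply,
    h1, LinearMap.sum_apply, map_sum, map_sum]
  refine Finset.sum_congr rfl fun q _ => ?_
  have h2 := LinearMap.congr_fun (koszulMap_comp (C.obj K).isGraded (fun _ => cofree_isGraded C A)
    (fun _ => cofree_isGraded C B) (fun l => ang_deg (J := {j // q j = l}) fun j => hf j.1)
    (e := e) g) (comulOn C A K x)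
  simp only [LinearMap.comp_apply, LinearMap.smul_apply, map_smul] at h2 ⊢
  rw [h2, map_smul, ksign_smul_smul]
  push_cast
  rfl

end

/-! ### The differential of the cofree coalgebra -/

/-- A sorting sign requires two distinct odd letters, and here there is at most one. -/
theorem invParity_single {J K : Type} [Fintype J] [LinearOrder J] [LinearOrder K] (q : J → K)
    (i : J) : invParity q (fun j => ((Pi.single i 1 : J → ℤ) j : ZMod 2)) = 0 := by
  refine Finset.sum_eq_zero fun j _ => Finset.sum_eq_zero fun j' _ => ?_
  split_ifs with h
  · by_cases hj : j = i
    · subst hj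
      simp [h.1.ne']
    · simp [hj]
  · rfl

/-- Maps of complexes. -/
structure IsChain (V W : DGData k) (f : V →ₗ[k] W) : Prop where
  deg : HasDegree V W 0 f
  comm : f ∘ₗ V.d = W.d ∘ₗ f

theorem IsChainMap.isChain {V W : DGData k} {f : V →ₗ[k] W} (h : IsChainMap V W f) :
    IsChain V W f where
  deg n x hx := by
    rw [add_zero]
    exact h.1 n x hx
  comm := LinearMap.ext h.2

theorem IsChain.id (V : DGData k) : IsChain V V LinearMap.id :=
  ⟨HasDegree.id V, rfl⟩

theorem IsChain.tensor {V W V' W' : DGData k} (hV : V.IsGraded) (hV' : V'.IsGraded)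
    {f : V →ₗ[k] V'} {g : W →ₗ[k] W'} (hf : IsChain V V' f) (hg : IsChain W W' g) :
    IsChain (V.tensor W) (V'.tensor W') (TensorProduct.map f g) where
  deg := (hf.deg.tensor hg.deg).of_eq (add_zero 0)
  comm := by
    change TensorProduct.map f g ∘ₗ
      (TensorProduct.map V.d LinearMap.id + TensorProduct.map (V.tw 1) W.d) =
      (TensorProduct.map V'.d LinearMap.id + TensorProduct.map (V'.tw 1) W'.d) ∘ₗ
        TensorProduct.map f g
    rw [LinearMap.comp_add, LinearMap.add_comp]
    simp only [← TensorProduct.map_comp]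
    rw [hf.comm, hg.comm, hf.deg.tw_zero hV hV', LinearMap.comp_id, LinearMap.id_comp]

theorem IsChain.pi {J : Type} [Fintype J] [LinearOrder J] {V W : J → DGData k}
    (hV : ∀ j, (V j).IsGraded) (hW : ∀ j, (W j).IsGraded) {f : ∀ j, V j →ₗ[k] W j}
    (hf : ∀ j, IsChain (V j) (W j) (f j)) :
    IsChain (DGData.pi V) (DGData.pi W) (PiTensorProduct.map f) where
  deg := (HasDegree.pi fun j => (hf j).deg).of_eq (by simp)
  comm := by
    change PiTensorProduct.map f ∘ₗ koszulDer V (fun j => (V j).d) =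
      koszulDer W (fun j => (W j).d) ∘ₗ PiTensorProduct.map f
    rw [koszulDer, koszulDer, linearMap_comp_sum, sum_linearMap_comp]
    refine Finset.sum_congr rfl fun i _ => ?_
    rw [← PiTensorProduct.map_comp, ← PiTensorProduct.map_comp]
    congr 1
    funext j
    split_ifs
    · exact ((hf j).deg.tw_zero (hV j) (hW j) 1).symm
    · exact (hf j).comm
    · rfl

theorem koszulDer_add {J : Type} [Fintype J] [LinearOrder J] (M : J → DGData k)
    (D D' : ∀ j, M j →ₗ[k] M j) :
    koszulDer M (fun j => D j + D' j) = koszulDer M D + koszulDer M D' := by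
  rw [koszulDer, koszulDer, koszulDer, ← Finset.sum_add_distrib]
  refine Finset.sum_congr rfl fun i _ => ?_
  have h : ∀ E : ∀ j, M j →ₗ[k] M j,
      (fun j => if j < i then (M j).tw 1 else if j = i then E j else LinearMap.id) =
        Function.update (fun j => if j < i then (M j).tw 1 else LinearMap.id) i (E i) := by
    intro E
    funext j
    by_cases h : j = i
    · subst h
      simp
    · simp [h]
  rw [h, h, h, PiTensorProduct.map_update_add]

theorem map_reorder_comm {J J' : Type} [Fintype J] [LinearOrder J] [Fintype J'] [LinearOrder J']
    (e : J ≃ J') {X X' : DGData k} (hX : X.IsGraded) (hX' : X'.IsGraded) {V : J → DGData k}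
    (hV : ∀ j, (V j).IsGraded) (hVd : ∀ j, HasDegree (V j) (V j) 1 (V j).d) {g : X →ₗ[k] X'}
    (hg : IsChain X X' g) :
    TensorProduct.map g (reorder e V) ∘ₗ (X.tensor (DGData.pi V)).d =
      (X'.tensor (DGData.pi fun j' => V (e.symm j'))).d ∘ₗ TensorProduct.map g (reorder e V) := by
  change TensorProduct.map g (reorder e V) ∘ₗ
      (TensorProduct.map X.d LinearMap.id + TensorProduct.map (X.tw 1) (koszulDer V _)) =
      (TensorProduct.map X'.d LinearMap.id + TensorProduct.map (X'.tw 1) (koszulDer _ _)) ∘ₗ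
        TensorProduct.map g (reorder e V)
  rw [LinearMap.comp_add, LinearMap.add_comp]
  congr 1
  · rw [← TensorProduct.map_comp, ← TensorProduct.map_comp, hg.comm, LinearMap.comp_id,
      LinearMap.id_comp]
  · rw [map_tw_koszulDer hV, map_tw_koszulDer (fun j' => hV (e.symm j')), linearMap_comp_sum,
      sum_linearMap_comp, ← e.sum_comp]
    refine Finset.sum_congr rfl fun i _ => ?_
    have h := koszulMap_reorder e hX hX' hV hV (single_update_deg (hVd i)) hg.deg
    rw [invParity_single, ksign_zero, one_smul] at h
    rw [← h]
    congr 2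
    · funext j
      by_cases hj : j = e i
      · subst hj
        simp
      · rw [Pi.single_eq_of_ne hj, Pi.single_eq_of_ne fun h => hj (by rw [← h, e.apply_symm_apply])]
    · funext j
      by_cases hj : j = e i
      · subst hj
        rw [Function.update_self]
        have : ∀ j, j = i → (V j).d = Function.update
          (fun _ => LinearMap.id : ∀ j, V j →ₗ[k] V j) i (V i).d j := by
          rintro _ rfl
          rw [Function.update_self]
        exact (this _ (e.symm_apply_apply i)).symm
      · rw [Function.update_of_ne hj,
          Function.update_of_ne fun h => hj (by rw [← h, e.apply_symm_apply])]

section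

variable {J K : Type} [Fintype J] [LinearOrder J] [Fintype K] [LinearOrder K]

/-- The maps `gₗ ⊗ 1`. -/
def fibreLeft {M M' : K → DGData k} (N : J → DGData k) (q : J → K) (g : ∀ l, M l →ₗ[k] M' l)
    (l : K) : fibreObj M N q l →ₗ[k] fibreObj M' N q l := TensorProduct.map (g l) LinearMap.id

/-- The part of the differential of `fibreObj` which comes from the differentials of the `Nⱼ`. -/
def fibreDer (M : K → DGData k) (N : J → DGData k) (q : J → K) (l : K) :
    fibreObj M N q l →ₗ[k] fibreObj M N q l :=
  TensorProduct.map ((M l).tw 1) (koszulDer (fun j : {j // q j = l} => N j.1) fun j => (N j.1).d)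

/-- An odd operator on one of the letters of a word in a fibre. -/
def fibreSingle (M : K → DGData k) (N : J → DGData k) (q : J → K) (l : K) (j : {j // q j = l})
    (D : N j.1 →ₗ[k] N j.1) : fibreObj M N q l →ₗ[k] fibreObj M N q l :=
  koszulMap (M l) (fun j' : {j' // q j' = l} => N j'.1) (fun j' => N j'.1) (Pi.single j 1)
    (Function.update (fun _ => LinearMap.id) j D)

theorem fibreDer_eq_sum (M : K → DGData k) {N : J → DGData k} (hN : ∀ j, (N j).IsGraded)
    (q : J → K) (l : K) :
    fibreDer M N q l = ∑ j : {j // q j = l}, fibreSingle M N q l j (N j.1).d := by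
  have h : ∀ x, TensorProduct.map ((M l).tw 1) (koszulDer (fun j : {j // q j = l} => N j.1)
      fun j => (N j.1).d) x = ∑ j : {j // q j = l}, koszulMap (M l)
        (fun j' : {j' // q j' = l} => N j'.1) (fun j' => N j'.1) (Pi.single j 1)
        (Function.update (fun _ => LinearMap.id) j (N j.1).d) x := fun x => by
    rw [map_tw_koszulDer (V := fun j : {j // q j = l} => N j.1) fun j => hN j.1,
      LinearMap.sum_apply]
    congr!
  refine LinearMap.ext fun x => Eq.trans ?_ (LinearMap.sum_apply _ _ _).symm
  exact h x

theorem koszulDer_fibreObj (M : K → DGData k) (N : J → DGData k) (q : J → K) :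
    koszulDer (fibreObj M N q) (fun l => (fibreObj M N q l).d) =
      koszulDer (fibreObj M N q) (fibreLeft N q fun l => (M l).d) +
        koszulDer (fibreObj M N q) (fibreDer M N q) :=
  koszulDer_add _ _ _

theorem regroupObj_koszulMap_left {X : DGData k} (hX : X.IsGraded) {M M' : K → DGData k}
    (hM : ∀ l, (M l).IsGraded) (hM' : ∀ l, (M' l).IsGraded) {N : J → DGData k}
    (hN : ∀ j, (N j).IsGraded) (q : J → K) {e : K → ℤ} {g : ∀ l, M l →ₗ[k] M' l}
    (hg : ∀ l, HasDegree (M l) (M' l) (e l) (g l)) :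
    regroupObj X M' N q ∘ₗ TensorProduct.map (koszulMap X M M' e g) LinearMap.id =
      koszulMap X (fibreObj M N q) (fibreObj M' N q) e (fibreLeft N q g) ∘ₗ
        regroupObj X M N q := by
  refine triple_ext_gr hX hM hN fun i c hc m y hy n x hx => ?_
  have h1 : ∀ l, fibreLeft N q g l (fibreTmul M N q l (y l) x) =
      ksign k 0 • fibreTmul M' N q l (g l (y l)) x := fun l => by
    rw [ksign_zero, one_smul]
    exact TensorProduct.map_tmul _ _ _ _
  rw [LinearMap.comp_apply, LinearMap.comp_apply, TensorProduct.map_tmul,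
    koszulMap_apply hX hM e g hc hy, ← TensorProduct.smul_tmul', map_smul, LinearMap.id_apply,
    regroupObj_apply hM' hN q c (fun l => hg l _ _ (hy l)) hx, regroupObj_apply hM hN q c hy hx,
    map_smul, koszulMap_apply_of_eq hX (fibreObj_isGraded hM hN q) e
      (fibreLeft N q g) hc
      (fun l => fibreTmul_mem_gr q l (hy l) hx) (fun _ => 0) _ h1,
    ksign_smul_smul, ksign_smul_smul]
  congr 2
  have h2 : mapParity (fun l => (e l : ZMod 2)) i
      (fun l => ((m l + ∑ j : {j // q j = l}, n j.1 : ℤ) : ZMod 2)) =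
      mapParity (fun l => (e l : ZMod 2)) i (fun l => (m l : ZMod 2)) +
        crossParity q (fun l => (e l : ZMod 2)) (fun j => (n j : ZMod 2)) := by
    have h3 : crossParity q (fun l => (e l : ZMod 2)) (fun j => (n j : ZMod 2)) =
        ∑ a, ∑ b, if a < b then (e b : ZMod 2) * ∑ j : {j // q j = a}, (n j.1 : ZMod 2) else 0 := by
      rw [crossParity, ← sum_fiber_dep q fun a j => ∑ l, if a < l then (e l : ZMod 2) * n j else 0]
      refine Finset.sum_congr rfl fun a _ => ?_
      rw [Finset.sum_comm]
      refine Finset.sum_congr rfl fun b _ => ?_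
      split_ifs
      · rw [Finset.mul_sum]
      · simp
    rw [h3]
    push_cast
    simp only [mapParity, mul_add, ite_add_zero, Finset.sum_add_distrib, add_assoc]
  rw [h2, Finset.sum_const_zero]
  push_cast
  rw [crossParity_add_left]
  ring

theorem regroupObj_comp_left {X : DGData k} (M : K → DGData k) (N : J → DGData k) (q : J → K)
    (D : X →ₗ[k] X) :
    regroupObj X M N q ∘ₗ TensorProduct.map (TensorProduct.map D LinearMap.id) LinearMap.id =
      TensorProduct.map D LinearMap.id ∘ₗ regroupObj X M N q := by
  refine TensorProduct.ext_threefold fun c y x => ?_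
  have h : ∀ c : X, regroupObj X M N q ((c ⊗ₜ y) ⊗ₜ x) = c ⊗ₜ regroup M N q (y ⊗ₜ x) :=
    fun c => rfl
  rw [LinearMap.comp_apply, LinearMap.comp_apply, TensorProduct.map_tmul, TensorProduct.map_tmul,
    LinearMap.id_apply, LinearMap.id_apply, h, h]
  rfl

theorem koszulMap_update_sum {X : DGData k} {V W : K → DGData k} (d : K → ℤ)
    (f : ∀ j, V j →ₗ[k] W j) (i : K) {ι : Type*} (s : Finset ι) (g : ι → (V i →ₗ[k] W i)) :
    koszulMap X V W d (Function.update f i (∑ a ∈ s, g a)) =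
      ∑ a ∈ s, koszulMap X V W d (Function.update f i (g a)) := by
  classical
  have h0 : koszulMap X V W d (Function.update f i 0) = 0 := by
    have := koszulMap_update (X := X) d f i 1 0 0
    rw [smul_zero, zero_add, one_smul] at this
    exact left_eq_add.1 this
  induction s using Finset.induction_on with
  | empty => simpa using h0
  | insert a s ha ih =>
    have := koszulMap_update (X := X) d f i 1 (g a) (∑ a ∈ s, g a)
    rw [one_smul, one_smul] at this
    rw [Finset.sum_insert ha, Finset.sum_insert ha, this, ih]

end

/-- An odd operator on one letter acts, after grouping, only on the group of that letter; on every
other group both the map and its signs are trivial. -/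
theorem fibreMap_single {J K : Type} [Fintype J] [LinearOrder J] [LinearOrder K] {M : K → DGData k} (hM : ∀ l, (M l).IsGraded)
    {N : J → DGData k} (hN : ∀ j, (N j).IsGraded) (q : J → K) (j : J) (D : N j →ₗ[k] N j) :
    fibreMap M q (Pi.single j 1) (Function.update (fun _ => LinearMap.id) j D) =
      (Function.update (fun _ => LinearMap.id) (q j) (fibreSingle M N q (q j) ⟨j, rfl⟩ D) :
        ∀ l, fibreObj M N q l →ₗ[k] fibreObj M N q l) := by
  funext l
  by_cases hl : l = q j
  · subst hl
    rw [Function.update_self, fibreMap, fibreSingle]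
    congr 1
    · funext j'
      by_cases hj : j' = ⟨j, rfl⟩
      · subst hj
        simp
      · rw [Pi.single_eq_of_ne hj, Pi.single_eq_of_ne fun h => hj (Subtype.ext h)]
    · funext j'
      by_cases hj : j' = ⟨j, rfl⟩
      · subst hj
        simp
      · rw [Function.update_of_ne hj, Function.update_of_ne fun h => hj (Subtype.ext h)]
  · rw [Function.update_of_ne hl, fibreMap]
    have h1 : ∀ j' : {j' // q j' = l}, j'.1 ≠ j := fun j' h => hl (by rw [← j'.2, h])
    have h2 : ∀ j' : {j' // q j' = l}, (Pi.single j 1 : J → ℤ) j'.1 = 0 := fun j' =>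
      Pi.single_eq_of_ne (h1 j') _
    have h3 : ∀ j' : {j' // q j' = l}, Function.update
        (fun _ => LinearMap.id : ∀ j, N j →ₗ[k] N j) j D j'.1 = LinearMap.id := fun j' =>
      Function.update_of_ne (h1 j') _ _
    have h4 : ∀ j' : {j' // q j' = l}, (N j'.1).tw 0 = LinearMap.id := fun j' =>
      (hN j'.1).tw_eq_id (by simp)
    simp only [koszulMap, h2, h3, Finset.sum_const_zero, h4, LinearMap.id_comp,
      (hM l).tw_eq_id (m := 0) (by simp)]
    rw [PiTensorProduct.map_id, TensorProduct.map_id]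
    rfl

section

variable {J K : Type} [Fintype J] [LinearOrder J] [Fintype K] [LinearOrder K]

theorem regroupObj_comm {X : DGData k} (hX : X.IsGraded) {M : K → DGData k}
    (hM : ∀ l, (M l).IsGraded) (hMd : ∀ l, HasDegree (M l) (M l) 1 (M l).d) {N : J → DGData k}
    (hN : ∀ j, (N j).IsGraded) (hNd : ∀ j, HasDegree (N j) (N j) 1 (N j).d) (q : J → K) :
    regroupObj X M N q ∘ₗ ((X.tensor (DGData.pi M)).tensor (DGData.pi N)).d =
      (X.tensor (DGData.pi (fibreObj M N q))).d ∘ₗ regroupObj X M N q := by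
  have hF := fibreObj_isGraded hM hN q
  change regroupObj X M N q ∘ₗ
      (TensorProduct.map (TensorProduct.map X.d LinearMap.id +
        TensorProduct.map (X.tw 1) (koszulDer M fun l => (M l).d)) LinearMap.id +
      TensorProduct.map ((X.tensor (DGData.pi M)).tw 1) (koszulDer N fun j => (N j).d)) =
    (TensorProduct.map X.d LinearMap.id + TensorProduct.map (X.tw 1)
      (koszulDer (fibreObj M N q) fun l => (fibreObj M N q l).d)) ∘ₗ regroupObj X M N q
  rw [koszulDer_fibreObj, TensorProduct.map_add_left, TensorProduct.map_add_right, ← add_assoc,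
    LinearMap.comp_add, LinearMap.comp_add, LinearMap.add_comp, LinearMap.add_comp]
  -- The differential has three parts, from the root decoration, from the upper decorations and from
  -- the letters. They are matched separately with the parts of the differential of the grouped
  -- tensor.
  refine congrArg₂ (· + ·) (congrArg₂ (· + ·) (regroupObj_comp_left M N q X.d) ?_) ?_
  · rw [map_tw_koszulDer hM, map_tw_koszulDer hF, sum_linearMap_comp]
    have h1 : TensorProduct.map (∑ i, koszulMap X M M (Pi.single i 1)
        (Function.update (fun _ => LinearMap.id) i (M i).d)) (LinearMap.id : (⨂[k] j, N j) →ₗ[k] _) =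
        ∑ i, TensorProduct.map (koszulMap X M M (Pi.single i 1)
        (Function.update (fun _ => LinearMap.id) i (M i).d)) LinearMap.id :=
      TensorProduct.ext' fun x y => by
        simp only [TensorProduct.map_tmul, LinearMap.sum_apply, TensorProduct.sum_tmul]
    rw [h1, linearMap_comp_sum]
    refine Finset.sum_congr rfl fun i _ => ?_
    rw [regroupObj_koszulMap_left hX hM hM hN q (single_update_deg (hMd i))]
    congr 2
    funext l
    by_cases h : l = i
    · subst h
      rw [Function.update_self, fibreLeft, fibreLeft, Function.update_self]
    · rw [Function.update_of_ne h, fibreLeft, Function.update_of_ne h]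
      exact TensorProduct.map_id
  · rw [map_tw_koszulDer hN, map_tw_koszulDer hF, sum_linearMap_comp, linearMap_comp_sum]
    simp only [fibreDer_eq_sum M hN, koszulMap_update_sum]
    simp only [sum_linearMap_comp]
    rw [← Fintype.sum_sigma', ← (Equiv.sigmaFiberEquiv q).symm.sum_comp]
    refine Finset.sum_congr rfl fun j _ => ?_
    rw [regroup_koszulMap hX hM hN hN q (single_update_deg (hNd j)), invParity_single, ksign_zero,
      one_smul, fibreMap_single hM hN]
    congr 2
    funext l
    rw [sum_fiber_ite q (Pi.single j 1) l]
    rw [Finset.sum_eq_single j]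
    · by_cases h : l = q j
      · subst h
        simp
      · rw [if_neg (Ne.symm h)]
        change (0 : ℤ) = (Pi.single (q j) 1 : K → ℤ) l
        rw [Pi.single_eq_of_ne h]
    · intro b _ hb
      rw [Pi.single_eq_of_ne hb, ite_self]
    · exact fun h => absurd (Finset.mem_univ _) h

end

section

variable (C : Cooperad k) (A : DGVect k)

theorem DGVect.d_deg (V : DGVect k) : HasDegree V.toDGData V.toDGData 1 V.d := V.d_mem

theorem DGData.tensor_d_tmul {V W : DGData k} (x : V) (y : W) :
    (V.tensor W).d (x ⊗ₜ y) = V.d x ⊗ₜ y + V.tw 1 x ⊗ₜ W.d y := by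
  rw [LinearMap.add_apply, TensorProduct.map_tmul, TensorProduct.map_tmul, LinearMap.id_apply]

theorem DGData.tensor_d_deg {V W : DGData k} (hV : V.IsGraded) (hVd : HasDegree V V 1 V.d)
    (hWd : HasDegree W W 1 W.d) : HasDegree (V.tensor W) (V.tensor W) 1 (V.tensor W).d := by
  have h : HasDegree V V 0 (V.tw 1) := fun n x hx => by
    rw [hV.tw_apply 1 hx, add_zero]
    exact Submodule.smul_mem _ _ hx
  intro n x hx
  exact Submodule.add_mem _ (((hVd.tensor (HasDegree.id W)).of_eq (add_zero 1)) n x hx)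
    (((h.tensor hWd).of_eq (zero_add 1)) n x hx)

theorem DGData.pi_d_deg {J : Type} [Fintype J] [LinearOrder J] {V : J → DGData k}
    (hV : ∀ j, (V j).IsGraded) (hVd : ∀ j, HasDegree (V j) (V j) 1 (V j).d) :
    HasDegree (DGData.pi V) (DGData.pi V) 1 (DGData.pi V).d := by
  intro n x hx
  change koszulDer V (fun j => (V j).d) x ∈ _
  rw [koszulDer, LinearMap.sum_apply]
  refine Submodule.sum_mem _ fun i _ => ?_
  refine ((HasDegree.pi (e := Pi.single i 1) fun j => ?_).of_eq (by simp)) n x hx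
  split_ifs with h1 h2
  · rw [Pi.single_eq_of_ne h1.ne]
    intro n x hx
    rw [(hV j).tw_apply 1 hx, add_zero]
    exact Submodule.smul_mem _ _ hx
  · subst h2
    rw [Pi.single_eq_same]
    exact hVd j
  · rw [Pi.single_eq_of_ne h2]
    exact HasDegree.id _

theorem tensorOn_d_deg (I : Type) [Fintype I] [LinearOrder I] :
    HasDegree ((C.obj I).toDGData.tensor (DGData.pi fun _ : I => A.toDGData))
      ((C.obj I).toDGData.tensor (DGData.pi fun _ : I => A.toDGData)) 1
      ((C.obj I).toDGData.tensor (DGData.pi fun _ : I => A.toDGData)).d :=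
  DGData.tensor_d_deg (C.obj I).isGraded (C.obj I).d_deg
    (DGData.pi_d_deg (fun _ => A.isGraded) fun _ => A.d_deg)

variable [CharZero k]

theorem cofree_d_cls (n : ℕ) (x) :
    (cofree C A).d (cls C A n x) = cls C A n ((tensorPower C A n).d x) :=
  descend_cls (fun e x => by
    have h := LinearMap.congr_fun (map_reorder_comm e (C.obj (Fin n)).isGraded
      (C.obj (Fin n)).isGraded (fun _ : Fin n => A.isGraded) (fun _ => A.d_deg)
      (C.map_chain e).isChain) x
    have h1 : (tensorPower C A n).d (act C A n e x) = act C A n e ((tensorPower C A n).d x) := h.symm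
    rw [LinearMap.comp_apply, h1, cls_act, LinearMap.comp_apply]) x

theorem cofree_d_deg : HasDegree (cofree C A) (cofree C A) 1 (cofree C A).d := by
  intro i x hx
  refine (?_ : (cofree C A).gr i ≤ ((cofree C A).gr (i + 1)).comap (cofree C A).d) hx
  refine iSup_le fun n => ?_
  rintro _ ⟨x, hx, rfl⟩
  rw [Submodule.mem_comap, cofree_d_cls]
  exact cls_mem_gr C A (tensorOn_d_deg C A (Fin n) i x hx)

theorem clsOn_isChain (I : Type) [Fintype I] [LinearOrder I] :
    IsChain ((C.obj I).toDGData.tensor (DGData.pi fun _ : I => A.toDGData)) (cofree C A)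
      (clsOn C A I) where
  deg := clsOn_deg C A I
  comm := by
    let e := (Fintype.orderIsoFinOfCardEq I rfl).symm.toEquiv
    have h := map_reorder_comm e (C.obj _).isGraded
      (C.obj _).isGraded (fun _ : I => A.isGraded) (fun _ => A.d_deg)
      (C.map_chain e).isChain
    refine LinearMap.ext fun x => ?_
    have h1 := LinearMap.congr_fun h x
    rw [LinearMap.comp_apply, LinearMap.comp_apply] at h1
    rw [← clsOn_map C A e, clsOn_eq_cls, LinearMap.comp_apply, LinearMap.comp_apply, h1,
      LinearMap.comp_apply, LinearMap.comp_apply, cofree_d_cls]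

theorem comulTree_comm {I J : Type} [Fintype I] [LinearOrder I] [Fintype J] [LinearOrder J]
    (p : I → J) :
    comulTree C A p ∘ₗ ((C.obj I).toDGData.tensor (DGData.pi fun _ : I => A.toDGData)).d =
      ((C.obj J).toDGData.tensor (DGData.pi fun _ : J => cofree C A)).d ∘ₗ comulTree C A p := by
  have h1 : IsChain ((C.obj J).toDGData.tensor (DGData.pi (fibreObj
      (fun j => (C.obj {i // p i = j}).toDGData) (fun _ => A.toDGData) p)))
      ((C.obj J).toDGData.tensor (DGData.pi fun _ : J => cofree C A)) (collectObj C A p) :=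
    (IsChain.id (C.obj J).toDGData).tensor (C.obj J).isGraded (C.obj J).isGraded
      (IsChain.pi (W := fun _ => cofree C A)
        (fibreObj_isGraded (fun j => (C.obj {i // p i = j}).isGraded) (fun _ => A.isGraded) p)
        (fun _ => cofree_isGraded C A) fun j => clsOn_isChain C A {i // p i = j})
  have h2 := regroupObj_comm (C.obj J).isGraded (fun j => (C.obj {i // p i = j}).isGraded)
    (fun j => (C.obj {i // p i = j}).d_deg) (fun _ : I => A.isGraded) (fun _ => A.d_deg) p
  have h3 : IsChain ((C.obj I).toDGData.tensor (DGData.pi fun _ : I => A.toDGData))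
      (((C.obj J).toDGData.tensor (DGData.pi fun j => (C.obj {i // p i = j}).toDGData)).tensor
        (DGData.pi fun _ : I => A.toDGData)) (TensorProduct.map (C.decomp p)
      (LinearMap.id : (⨂[k] _ : I, A) →ₗ[k] ⨂[k] _ : I, A)) :=
    (C.decomp_chain p).isChain.tensor (C.obj I).isGraded
      ((C.obj J).isGraded.tensor (DGData.IsGraded.pi fun _ => (C.obj _).isGraded))
      (IsChain.id (DGData.pi fun _ : I => A.toDGData))
  rw [← comulTree_eq_collectObj]
  refine LinearMap.ext fun x => ?_
  have e1 := LinearMap.congr_fun h3.comm x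
  have e2 := LinearMap.congr_fun h2 (TensorProduct.map (C.decomp p) LinearMap.id x)
  have e3 := LinearMap.congr_fun h1.comm (regroupObj (C.obj J).toDGData
    (fun l => (C.obj {j // p j = l}).toDGData) (fun _ => A.toDGData) p
    (TensorProduct.map (C.decomp p) LinearMap.id x))
  simp only [LinearMap.comp_apply] at e1 e2 e3 ⊢
  rw [e1]
  exact (congrArg _ e2).trans e3

theorem comulOn_comm (J : Type) [Fintype J] [LinearOrder J] :
    comulOn C A J ∘ₗ (cofree C A).d =
      ((C.obj J).toDGData.tensor (DGData.pi fun _ : J => cofree C A)).d ∘ₗ comulOn C A J := by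
  refine Cofree.ext fun n x => ?_
  rw [LinearMap.comp_apply, LinearMap.comp_apply, cofree_d_cls, comulOn_cls, comulOn_cls, map_sum]
  exact Finset.sum_congr rfl fun p _ => LinearMap.congr_fun (comulTree_comm C A p) x

/-- The map `C(1) ⊗ A → A` given by the counit. -/
def counitMap : (C.obj (Fin 1) ⊗[k] (⨂[k] _ : Fin 1, A)) →ₗ[k] A :=
  (TensorProduct.lid k A).toLinearMap ∘ₗ
    TensorProduct.map C.counit (PiTensorProduct.subsingletonEquiv (0 : Fin 1)).toLinearMap

theorem counitMap_tmul (c : C.obj (Fin 1)) (a : Fin 1 → A) :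
    counitMap C A (c ⊗ₜ PiTensorProduct.tprod k a) = C.counit c • a 0 := by
  rw [counitMap, LinearMap.comp_apply, TensorProduct.map_tmul, LinearEquiv.coe_coe,
    LinearEquiv.coe_coe, PiTensorProduct.subsingletonEquiv_apply_tprod, TensorProduct.lid_tmul]

theorem koszulDer_fin_one (a : Fin 1 → A) :
    koszulDer (fun _ : Fin 1 => A.toDGData) (fun _ => A.d) (PiTensorProduct.tprod k a) =
      PiTensorProduct.tprod k fun i => A.d (a i) := by
  rw [koszulDer, Fintype.sum_unique, PiTensorProduct.map_tprod]
  congr 1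
  funext i
  rw [Subsingleton.elim i 0]
  simp

theorem counitMap_comm : counitMap C A ∘ₗ (tensorPower C A 1).d = A.d ∘ₗ counitMap C A := by
  refine tensor_ext_gr (W := DGData.pi fun _ : Fin 1 => A.toDGData) (C.obj _).isGraded
    (DGData.IsGraded.pi fun _ => A.isGraded) fun i _ c hc x' hx' => ?_
  clear hx'
  -- The sign in front of the differential of `A` is invisible to the counit, which vanishes outside
  -- degree zero.
  have h2 : C.counit ((C.obj (Fin 1)).tw 1 c) = C.counit c := by
    rw [(C.obj _).isGraded.tw_apply 1 hc, map_smul]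
    by_cases hi : i = 0
    · subst hi
      simp [ksign_zero]
    · rw [C.counit_deg i hi c hc, smul_zero]
  have h3 : ∀ a : Fin 1 → A, counitMap C A ((tensorPower C A 1).d (c ⊗ₜ PiTensorProduct.tprod k a))
      = A.d (counitMap C A (c ⊗ₜ PiTensorProduct.tprod k a)) := fun a => by
    rw [DGData.tensor_d_tmul (W := DGData.pi fun _ : Fin 1 => A.toDGData), koszulDer_fin_one,
      map_add, counitMap_tmul, counitMap_tmul, counitMap_tmul, C.counit_d, h2, zero_smul, zero_add,
      map_smul]
  rw [LinearMap.comp_apply, LinearMap.comp_apply]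
  induction x' using PiTensorProduct.induction_on with
  | smul_tprod r a => rw [TensorProduct.tmul_smul, map_smul, map_smul, h3, map_smul, map_smul]
  | add x y hx hy => rw [TensorProduct.tmul_add, map_add, map_add, hx, hy, map_add, map_add]

theorem proj_comm : proj C A ∘ₗ (cofree C A).d = A.d ∘ₗ proj C A := by
  refine Cofree.ext fun n x => ?_
  rw [LinearMap.comp_apply, LinearMap.comp_apply, cofree_d_cls]
  by_cases hn : n = 1
  · subst hn
    exact (proj_cls_one _).trans ((LinearMap.congr_fun (counitMap_comm C A) x).trans
      (congrArg A.d (proj_cls_one x).symm))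
  · rw [← LinearMap.comp_apply, proj_cls_of_ne hn, LinearMap.zero_apply,
      ← LinearMap.comp_apply (proj C A), proj_cls_of_ne hn, LinearMap.zero_apply, map_zero]

end

/-! ### Reconstruction from the cogenerators -/

section

variable {C : Cooperad k} [CharZero k]

theorem HoAlg.Q_hasDegree (A : HoAlg C) : HasDegree (cofree C A.A) (cofree C A.A) 1 A.Q := A.Q_deg

theorem HoAlg.D_deg (A : HoAlg C) : HasDegree (cofree C A.A) (cofree C A.A) 1 A.D :=
  fun n x hx => Submodule.add_mem _ (cofree_d_deg C A.A n x hx) (A.Q_deg n x hx)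

theorem HoAlg.comul_D (A : HoAlg C) (m : ℕ) : comul C A.A m ∘ₗ A.D =
    (TensorProduct.map (C.obj (Fin m)).d LinearMap.id + TensorProduct.map ((C.obj (Fin m)).tw 1)
      (koszulDer (fun _ : Fin m => cofree C A.A) fun _ => A.D)) ∘ₗ comul C A.A m := by
  have h := koszulDer_add (fun _ : Fin m => cofree C A.A) (fun _ => (cofree C A.A).d) fun _ => A.Q
  have h1 := comulOn_comm C A.A (Fin m)
  change _ = (TensorProduct.map (C.obj (Fin m)).d LinearMap.id +
    TensorProduct.map ((C.obj (Fin m)).tw 1) (koszulDer (fun _ : Fin m => cofree C A.A)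
      fun _ => (cofree C A.A).d + A.Q)) ∘ₗ comul C A.A m
  rw [h, TensorProduct.map_add_right, ← add_assoc, LinearMap.add_comp, ← A.Q_coder, HoAlg.D,
    LinearMap.comp_add]
  exact congrArg (· + _) h1

/-- The source carries its full differential `A.D`, which acts as a coderivation over the
differential of `C`. The target carries only ∂, which acts on one letter at a time; its part `Q` is
treated by `HoAlg.Q_comp_ang`. -/
theorem d_comp_ang {A : HoAlg C} {B : DGVect k} {n : ℕ} {d : Fin n → ℤ}
    {f : Fin n → (Cofree C A.A →ₗ[k] B)}
    (hf : ∀ j, HasDegree (cofree C A.A) B.toDGData (d j) (f j)) :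
    (cofree C B).d ∘ₗ ang C A.A B (Fin n) d f =
      ksign k (∑ j, (d j : ZMod 2)) • (ang C A.A B (Fin n) d f ∘ₗ A.D) +
      ∑ i, ksign k (∑ a with a < i, (d a : ZMod 2)) • ang C A.A B (Fin n) (d + Pi.single i 1)
        (Function.update f i (B.d ∘ₗ f i - ksign k (d i : ZMod 2) • f i ∘ₗ A.D)) := by
  have h := koszulMap_commutator (C.obj (Fin n)).isGraded (fun _ => cofree_isGraded C A.A)
    (fun _ => B.isGraded) hf (C.obj (Fin n)).d_deg (D := fun _ => A.D) (fun _ => A.D_deg)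
    fun _ => B.d
  have h1 := (clsOn_isChain C B (Fin n)).comm
  refine LinearMap.ext fun x => ?_
  have e1 := LinearMap.congr_fun h1 (koszulMap (C.obj (Fin n)).toDGData (fun _ => cofree C A.A)
    (fun _ => B.toDGData) d f (comulOn C A.A (Fin n) x))
  have e2 := LinearMap.congr_fun h (comulOn C A.A (Fin n) x)
  have e3 := LinearMap.congr_fun (A.comul_D n) x
  rw [LinearMap.comp_apply, LinearMap.comp_apply] at e1
  rw [LinearMap.comp_apply, LinearMap.comp_apply] at e3
  refine e1.symm.trans ((congrArg (clsOn C B (Fin n)) e2).trans ?_)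
  rw [LinearMap.add_apply _ _ (comulOn C A.A (Fin n) x), LinearMap.smul_apply,
    LinearMap.comp_apply (koszulMap _ _ _ _ _), comulOn_fin, ← e3, map_add, map_smul,
    LinearMap.add_apply, LinearMap.smul_apply]
  congr 1
  rw [LinearMap.sum_apply, LinearMap.sum_apply, map_sum]
  refine Finset.sum_congr rfl fun i _ => ?_
  rw [LinearMap.smul_apply, LinearMap.smul_apply, map_smul]
  rfl

/-- This is cofreeness in explicit form: an element is recovered from the cogenerator components of
its comultiplications. The factor 1/m! cancels the m! bijections found in `proj_comul_cls`. -/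
theorem reconstruct {A : DGVect k} {N : ℕ} {x : Cofree C A} (hx : x ∈ arLe C A N) :
    ∑ m ∈ Finset.range (N + 1), (m.factorial : k)⁻¹ • cls C A m (TensorProduct.map LinearMap.id
      (PiTensorProduct.map fun _ : Fin m => proj C A) (comul C A m x)) = x := by
  have h : ∀ x, (∑ m ∈ Finset.range (N + 1), (m.factorial : k)⁻¹ • (cls C A m ∘ₗ
      TensorProduct.map LinearMap.id (PiTensorProduct.map fun _ : Fin m => proj C A) ∘ₗ
        comul C A m)) x = ∑ m ∈ Finset.range (N + 1), (m.factorial : k)⁻¹ • cls C A m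
      (TensorProduct.map LinearMap.id
      (PiTensorProduct.map fun _ : Fin m => proj C A) (comul C A m x)) := fun x => by
    simp only [LinearMap.sum_apply, LinearMap.smul_apply, LinearMap.comp_apply]
  rw [← h]
  refine arLe_induction (g := LinearMap.id) (fun n hn y => ?_) hx
  rw [h, LinearMap.id_apply, Finset.sum_eq_single n]
  · rw [proj_comul_cls, if_pos rfl, smul_smul, inv_mul_cancel₀, one_smul]
    exact_mod_cast n.factorial_ne_zero
  · intro m _ hm
    rw [proj_comul_cls, if_neg (Ne.symm hm), smul_zero]
  · intro h
    exact absurd (Finset.mem_range.2 (by omega)) h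

/-- A map into a cofree coalgebra is determined by its values in the cogenerators. -/
theorem eq_sum_ang {A B : DGVect k} (G : Cofree C A →ₗ[k] Cofree C B)
    (E : ℕ → (Cofree C A →ₗ[k] Cofree C B))
    (hE : ∀ m x, cls C B m (TensorProduct.map LinearMap.id
      (PiTensorProduct.map fun _ : Fin m => proj C B) (comul C B m (G x))) = E m x)
    {N : ℕ} {x : Cofree C A} (h0 : ∀ m, N < m → E m x = 0) :
    G x = ∑ m ∈ Finset.range (N + 1), (m.factorial : k)⁻¹ • E m x := by
  -- The arity of `G x` is not known in advance to be at most `N`; the reconstruction is made up to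
  -- a larger bound and truncated by `h0`.
  obtain ⟨M, hM⟩ := exists_mem_arLe (G x)
  have h1 := reconstruct (arLe_mono (le_max_left M N) hM)
  simp only [hE] at h1
  rw [← h1]
  refine (Finset.sum_subset (fun m hm => ?_) fun m _ hm => ?_).symm
  · rw [Finset.mem_range] at hm ⊢
    have := le_max_right M N
    omega
  · rw [h0 m (by rw [Finset.mem_range] at hm; omega), smul_zero]

/-- A coderivation is determined by `p ∘ Q`: in the reconstruction of `Q x` the coderivation
property puts `Q` at one output and nothing at the others. -/
theorem HoAlg.Q_eq (hC : C.IsReduced) (A : HoAlg C) {N : ℕ} {x : Cofree C A.A}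
    (hx : x ∈ arLe C A.A N) :
    A.Q x = ∑ m ∈ Finset.range (N + 1), (m.factorial : k)⁻¹ • ∑ i : Fin m,
      ang C A.A A.A (Fin m) (Pi.single i 1)
        (Function.update (fun _ => proj C A.A) i (proj C A.A ∘ₗ A.Q)) x := by
  have h := eq_sum_ang A.Q (fun m => ∑ i : Fin m, ang C A.A A.A (Fin m) (Pi.single i 1)
        (Function.update (fun _ => proj C A.A) i (proj C A.A ∘ₗ A.Q))) (fun m x => ?_)
    (N := N) (x := x) fun m hm => ?_
  · simpa only [LinearMap.sum_apply] using h
  · have h1 := LinearMap.congr_fun (A.Q_coder m) x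
    rw [LinearMap.comp_apply, LinearMap.comp_apply, map_tw_koszulDer
      (fun _ => cofree_isGraded C A.A)] at h1
    rw [h1, LinearMap.sum_apply, map_sum, map_sum, LinearMap.sum_apply]
    refine Finset.sum_congr rfl fun i _ => ?_
    have h3 := LinearMap.congr_fun (map_comp_koszulMap (X := (C.obj (Fin m)).toDGData)
      (V := fun _ => cofree C A.A) (W := fun _ => cofree C A.A) (W' := fun _ => A.A.toDGData)
      (Pi.single i 1) (Function.update (fun _ => LinearMap.id) i A.Q) fun _ => proj C A.A)
      (comul C A.A m x)
    have h2 : (fun j => proj C A.A ∘ₗ Function.update (fun _ => LinearMap.id :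
        Fin m → (Cofree C A.A →ₗ[k] Cofree C A.A)) i A.Q j) =
        Function.update (fun _ => proj C A.A) i (proj C A.A ∘ₗ A.Q) := by
      funext j
      by_cases h : j = i
      · subst h
        simp
      · simp [h]
    rw [ang, clsOn_eq_cls, ← h2]
    exact congrArg (cls C A.A m) h3
  · rw [LinearMap.sum_apply]
    exact Finset.sum_eq_zero fun i _ => ang_arLe_of_lt_card hC _ _ (by simpa using hm) hx

/-- A homomorphism is the exponential of its projection `F'`: in the reconstruction of `F x` it can
be moved through the comultiplication to all outputs. -/
theorem InftyHom.F_eq (hC : C.IsReduced) {A B : HoAlg C} (F : InftyHom A B) {N : ℕ}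
    {x : Cofree C A.A} (hx : x ∈ arLe C A.A N) :
    F.F x = ∑ m ∈ Finset.range (N + 1), (m.factorial : k)⁻¹ •
      ang C A.A B.A (Fin m) (fun _ => 0) (fun _ => F.proj) x := by
  refine eq_sum_ang F.F (fun m => ang C A.A B.A (Fin m) (fun _ => 0) (fun _ => F.proj))
    (fun m x => ?_) fun m hm => ang_arLe_of_lt_card hC _ _ (by simpa using hm) hx
  have h1 := LinearMap.congr_fun (F.F_comul m) x
  rw [LinearMap.comp_apply, LinearMap.comp_apply] at h1
  rw [h1, ← LinearMap.comp_apply (TensorProduct.map _ _), ← TensorProduct.map_comp,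
    ← PiTensorProduct.map_comp, ang, clsOn_eq_cls, koszulMap]
  simp only [Finset.sum_const_zero, (cofree_isGraded C A.A).tw_eq_id (m := 0) (by simp),
    (C.obj (Fin m)).isGraded.tw_eq_id (m := 0) (by simp)]
  rfl

theorem InftyHom.F_mem_arLe (hC : C.IsReduced) {A B : HoAlg C} (F : InftyHom A B) {N : ℕ}
    {x : Cofree C A.A} (hx : x ∈ arLe C A.A N) : F.F x ∈ arLe C B.A N := by
  rw [F.F_eq hC hx]
  refine Submodule.sum_mem _ fun m hm => Submodule.smul_mem _ _ ?_
  refine arLe_mono ?_ (ang_mem_arLe _ _ x)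
  rw [Fintype.card_fin]
  rw [Finset.mem_range] at hm
  omega

theorem InftyHom.proj_deg {A B : HoAlg C} (F : InftyHom A B) :
    HasDegree (cofree C A.A) B.A.toDGData 0 F.proj :=
  ((HoAlgebra.proj_deg C B.A).comp (e := 0) fun n x hx => by
    rw [add_zero]
    exact F.F_deg n x hx).of_eq (add_zero 0)

end

/-! ### Subwords -/

section

variable {C : Cooperad k} [CharZero k] {A B : DGVect k}

/-- The map `ang` of the letters in positions `S`. -/
def angS {J : Type} [LinearOrder J] (S : Finset J) (d : J → ℤ)
    (f : J → (Cofree C A →ₗ[k] B)) : Cofree C A →ₗ[k] Cofree C B :=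
  ang C A B {j // j ∈ S} (fun j => d j) fun j => f j

theorem ang_reindex_of_monotone {J J' : Type} [Fintype J] [LinearOrder J] [Fintype J']
    [LinearOrder J'] (e : J ≃ J') (he : Monotone e) {d : J → ℤ} {f : J → (Cofree C A →ₗ[k] B)}
    {d' : J' → ℤ} {f' : J' → (Cofree C A →ₗ[k] B)}
    (hf : ∀ j, HasDegree (cofree C A) B.toDGData (d j) (f j)) (hd : ∀ j, d' (e j) = d j)
    (hff : ∀ j, f' (e j) = f j) : ang C A B J' d' f' = ang C A B J d f := by
  have h := ang_reindex e hf
  rw [invParity_of_monotone he, ksign_zero, one_smul] at h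
  rw [← h]
  congr 1
  · funext j
    rw [← hd, e.apply_symm_apply]
  · funext j
    rw [← hff, e.apply_symm_apply]

theorem angS_eq_subtype {J : Type} [LinearOrder J] (S : Finset J) (P : J → Prop)
    [Fintype {j // P j}] (h : ∀ j, P j ↔ j ∈ S) {d : J → ℤ} {f : J → (Cofree C A →ₗ[k] B)}
    (hf : ∀ j, HasDegree (cofree C A) B.toDGData (d j) (f j)) :
    angS S d f = ang C A B {j // P j} (fun j => d j) (fun j => f j) :=
  ang_reindex_of_monotone (J := {j // P j}) (J' := {j // j ∈ S})
    (Equiv.subtypeEquivRight h) (fun _ _ h => h) (d := fun j => d j)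
    (f := fun j => f j) (d' := fun j => d j) (f' := fun j => f j)
    (fun j => hf j.1) (fun _ => rfl) fun _ => rfl

theorem ang_fibre {J K : Type} [Fintype J] [LinearOrder J] [LinearOrder K] (q : J → K) (l : K)
    {d : J → ℤ} {f : J → (Cofree C A →ₗ[k] B)}
    (hf : ∀ j, HasDegree (cofree C A) B.toDGData (d j) (f j)) :
    ang C A B {j // q j = l} (fun j => d j) (fun j => f j) =
      angS (Finset.univ.filter (q · = l)) d f :=
  (angS_eq_subtype _ (q · = l) (fun j => by simp) hf).symm

theorem angS_eq_subword {n : ℕ} (S : Finset (Fin n)) {d : Fin n → ℤ}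
    {f : Fin n → (Cofree C A →ₗ[k] B)}
    (hf : ∀ j, HasDegree (cofree C A) B.toDGData (d j) (f j)) :
    angS S d f = ang C A B (Fin S.card) (subword S d) (subword S f) :=
  ang_reindex_of_monotone (S.orderIsoOfFin rfl).toEquiv (S.orderIsoOfFin rfl).monotone
    (fun _ => hf _) (fun _ => rfl) fun _ => rfl

theorem proj_angS_singleton {J : Type} [LinearOrder J] (j : J) {d : J → ℤ}
    {f : J → (Cofree C A →ₗ[k] B)}
    (hf : ∀ j, HasDegree (cofree C A) B.toDGData (d j) (f j)) :
    proj C B ∘ₗ angS {j} d f = f j := by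
  rw [angS, ang_reindex_of_monotone (J := Fin 1) (J' := {i // i ∈ ({j} : Finset J)}) (d := fun _ => d j) (f := fun _ => f j)
    (Equiv.ofUnique _ _) (fun _ _ _ => le_of_eq (Subsingleton.elim _ _)) (fun _ => hf j)
    (fun _ => congrArg d (Finset.mem_singleton.1 (Subtype.prop _)))
    (fun _ => congrArg f (Finset.mem_singleton.1 (Subtype.prop _))), proj_ang_fin_one]

theorem proj_angS_of_ne {J : Type} [LinearOrder J] {S : Finset J} (hS : S.card ≠ 1) (d : J → ℤ)
    (f : J → (Cofree C A →ₗ[k] B)) : proj C B ∘ₗ angS S d f = 0 :=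
  proj_ang_of_ne (by simpa using hS) _ _

theorem ang_eq_zero {J : Type} [Fintype J] [LinearOrder J] (d : J → ℤ)
    {f : J → (Cofree C A →ₗ[k] B)} (j : J) (hj : f j = 0) : ang C A B J d f = 0 := by
  have h := ang_update d f j 1 0 0
  rw [smul_zero, zero_add, one_smul, ← hj, Function.update_eq_self] at h
  exact left_eq_add.1 h

theorem ang_of_isEmpty (hC : C.IsReduced) {J : Type} [Fintype J] [LinearOrder J] [IsEmpty J]
    (d : J → ℤ) (f : J → (Cofree C A →ₗ[k] B)) : ang C A B J d f = 0 := by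
  have h : clsOn C B J = 0 := by
    refine TensorProduct.ext' fun c a => ?_
    rw [hC J c, TensorProduct.zero_tmul, map_zero, map_zero]
  rw [ang, h, LinearMap.zero_comp]

theorem angS_empty (hC : C.IsReduced) {J : Type} [LinearOrder J] (d : J → ℤ)
    (f : J → (Cofree C A →ₗ[k] B)) : angS (∅ : Finset J) d f = 0 :=
  ang_of_isEmpty hC _ _

theorem ang_comp_ang_finset {B' : DGVect k} {J K : Type} [Fintype J] [LinearOrder J] [Fintype K]
    [LinearOrder K] {d : J → ℤ} {f : J → (Cofree C A →ₗ[k] B)}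
    (hf : ∀ j, HasDegree (cofree C A) B.toDGData (d j) (f j)) (e : K → ℤ)
    (g : K → (Cofree C B →ₗ[k] B')) :
    ang C B B' K e g ∘ₗ ang C A B J d f = ∑ q : J → K,
      ksign k (invParity q (fun j => (d j : ZMod 2)) +
        crossParity q (fun l => (e l : ZMod 2)) fun j => (d j : ZMod 2)) •
      ang C A B' K (fun l => (∑ j with q j = l, d j) + e l)
        (fun l => g l ∘ₗ angS (Finset.univ.filter (q · = l)) d f) := by
  rw [ang_comp_ang hf]
  refine Finset.sum_congr rfl fun q _ => ?_
  congr 1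
  · congr 2
    rw [crossParity, ← sum_fiber_dep q fun a j => ∑ l, if a < l then (e l : ZMod 2) * d j else 0]
    refine Finset.sum_congr rfl fun a _ => ?_
    rw [Finset.sum_comm]
    refine Finset.sum_congr rfl fun l _ => ?_
    split_ifs
    · rw [Finset.mul_sum]
    · simp
  · congr 1
    · funext l
      rw [sum_fiber_ite q, Finset.sum_filter]
    · funext l
      rw [ang_fibre q l hf]

/-- A summand of the composition of a coderivation with `ang`: the letters in the `i`-th group along
`q` are fed into `g`, the other groups are projected. -/
def angPart {J K : Type} [Fintype J] [LinearOrder J] [Fintype K] [LinearOrder K] (d : J → ℤ)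
    (f : J → (Cofree C A →ₗ[k] B)) (g : Cofree C B →ₗ[k] B) (i : K) (q : J → K) :
    Cofree C A →ₗ[k] Cofree C B :=
  ksign k (invParity q (fun j => (d j : ZMod 2)) +
      crossParity q (fun l => ((Pi.single i 1 : K → ℤ) l : ZMod 2)) fun j => (d j : ZMod 2)) •
    ang C A B K (fun l => (∑ j with q j = l, d j) + (Pi.single i 1 : K → ℤ) l)
      (fun l => (Function.update (fun _ => proj C B) i g : K → (Cofree C B →ₗ[k] B)) l ∘ₗ
        angS (Finset.univ.filter (q · = l)) d f)

theorem angS_deg {J : Type} [LinearOrder J] (S : Finset J) {d : J → ℤ}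
    {f : J → (Cofree C A →ₗ[k] B)}
    (hf : ∀ j, HasDegree (cofree C A) B.toDGData (d j) (f j)) :
    HasDegree (cofree C A) (cofree C B) (∑ j ∈ S, d j) (angS S d f) :=
  (ang_deg (J := {j // j ∈ S}) (d := fun j => d j) (f := fun j => f j) fun j => hf j.1).of_eq (Finset.sum_coe_sort S d)

theorem angPart_entry_deg {J K : Type} [Fintype J] [LinearOrder J] [LinearOrder K]
    {d : J → ℤ} {f : J → (Cofree C A →ₗ[k] B)}
    (hf : ∀ j, HasDegree (cofree C A) B.toDGData (d j) (f j)) {g : Cofree C B →ₗ[k] B}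
    (hg : HasDegree (cofree C B) B.toDGData 1 g) (i : K) (q : J → K) (l : K) :
    HasDegree (cofree C A) B.toDGData ((∑ j with q j = l, d j) + (Pi.single i 1 : K → ℤ) l)
      ((Function.update (fun _ => proj C B) i g : K → (Cofree C B →ₗ[k] B)) l ∘ₗ
        angS (Finset.univ.filter (q · = l)) d f) := by
  refine HasDegree.comp ?_ (angS_deg _ hf)
  by_cases h : l = i
  · subst h
    simpa using hg
  · simpa [h] using proj_deg C B

/-- Renaming the groups changes the sorting sign and, through `ang_reindex`, the order of the maps.
By `invParity_vertices` the two changes cancel. -/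
theorem angPart_relabel {J K K' : Type} [Fintype J] [LinearOrder J] [Fintype K] [LinearOrder K]
    [Fintype K'] [LinearOrder K'] {d : J → ℤ} {f : J → (Cofree C A →ₗ[k] B)}
    (hf : ∀ j, HasDegree (cofree C A) B.toDGData (d j) (f j)) {g : Cofree C B →ₗ[k] B}
    (hg : HasDegree (cofree C B) B.toDGData 1 g) (i : K) (q : J → K) (e : K ≃ K') :
    angPart d f g (e i) (fun j => e (q j)) = angPart d f g i q := by
  have h := ang_reindex e (angPart_entry_deg hf hg i q)
  have h1 := invParity_vertices q e (fun l => ((Pi.single i 1 : K → ℤ) l : ZMod 2))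
    fun j => (d j : ZMod 2)
  have h2 : ∀ l, (Pi.single i 1 : K → ℤ) (e.symm l) = (Pi.single (e i) 1 : K' → ℤ) l := fun l => by
    rw [Pi.single_apply, Pi.single_apply]
    simp only [e.symm_apply_eq]
  have h3 : ∀ l, Finset.univ.filter (fun j => e (q j) = l) =
      Finset.univ.filter (q · = e.symm l) := fun l => by
    ext
    simp [e.eq_symm_apply]
  have h4 : ∀ l, (Function.update (fun _ => proj C B) (e i) g : K' → (Cofree C B →ₗ[k] B)) l =
      (Function.update (fun _ => proj C B) i g : K → (Cofree C B →ₗ[k] B)) (e.symm l) := fun l => by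
    simp only [Function.update_apply, e.symm_apply_eq]
  rw [invParity_single, zero_add] at h1
  simp only [h2] at h1 h
  simp only [angPart, h3, h4]
  rw [h, smul_smul, ← ksign_add, h1]
  congr 1
  have h5 : ∀ l, (((∑ j with q j = l, d j) + (Pi.single i 1 : K → ℤ) l : ℤ) : ZMod 2) =
      ((Pi.single i 1 : K → ℤ) l : ZMod 2) + ∑ j : {j // q j = l}, (d j.1 : ZMod 2) := fun l => by
    rw [sum_fiber_ite q fun j => (d j : ZMod 2), ← Finset.sum_filter]
    push_cast
    ring
  simp only [h5]
  rw [add_assoc, zmod2_add_self, add_zero]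

/-- The group fed into `g` must be nonempty because C(0) = 0, and every other group must be a single
letter because the projection kills `ang` of any other number of maps. -/
theorem angPart_eq_zero (hC : C.IsReduced) {J K : Type} [Fintype J] [LinearOrder J] [Fintype K]
    [LinearOrder K] (d : J → ℤ) (f : J → (Cofree C A →ₗ[k] B)) (g : Cofree C B →ₗ[k] B) (i : K)
    (q : J → K) (h : (∀ j, q j ≠ i) ∨ ∃ l, l ≠ i ∧ (Finset.univ.filter (q · = l)).card ≠ 1) :
    angPart d f g i q = 0 := by
  obtain h | ⟨l, hl, h⟩ := h
  · rw [angPart, ang_eq_zero _ i, smul_zero]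
    rw [Finset.filter_eq_empty_iff.2 fun j _ => h j, angS_empty hC, LinearMap.comp_zero]
  · rw [angPart, ang_eq_zero _ l, smul_zero]
    rw [Function.update_of_ne hl, proj_angS_of_ne h]

/-- The map collapsing `S` to the first of `|Sᶜ| + 1` points. -/
def collapse {n : ℕ} (S : Finset (Fin n)) (j : Fin n) : Fin (Sᶜ.card + 1) :=
  if h : j ∈ S then 0 else ((Sᶜ.orderIsoOfFin rfl).symm ⟨j, Finset.mem_compl.2 h⟩).succ

theorem collapse_eq_zero {n : ℕ} {S : Finset (Fin n)} {j : Fin n} : collapse S j = 0 ↔ j ∈ S := by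
  rw [collapse]
  split_ifs with h
  · simp [h]
  · simp [h]

theorem collapse_eq_succ {n : ℕ} {S : Finset (Fin n)} {j : Fin n} {t : Fin Sᶜ.card} :
    collapse S j = t.succ ↔ j = Sᶜ.orderEmbOfFin rfl t := by
  rw [collapse]
  split_ifs with h
  · refine ⟨fun h' => absurd h' (Fin.succ_ne_zero _).symm, ?_⟩
    rintro rfl
    exact absurd h (Finset.mem_compl.1 (Finset.orderEmbOfFin_mem Sᶜ rfl t))
  · rw [Fin.succ_inj, OrderIso.symm_apply_eq]
    exact Subtype.ext_iff

theorem invParity_collapse {n : ℕ} (S : Finset (Fin n)) (t : Fin n → ZMod 2) :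
    invParity (collapse S) t = invParity (fun i => if i ∈ S then (0 : Fin 2) else 1) t := by
  refine Finset.sum_congr rfl fun j _ => Finset.sum_congr rfl fun j' _ => ?_
  congr 1
  refine propext (and_congr_right fun hj => ?_)
  by_cases h : j ∈ S
  · rw [collapse_eq_zero.2 h]
    simp [h]
  · by_cases h' : j' ∈ S
    · rw [collapse_eq_zero.2 h']
      simp only [h, h', if_true, if_false]
      exact iff_of_true (Fin.pos_iff_ne_zero.2 fun h0 => h (collapse_eq_zero.1 h0)) (by decide)
    · simp only [h, h', if_false, lt_irrefl, iff_false, not_lt]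
      rw [collapse, collapse, dif_neg h, dif_neg h', Fin.succ_le_succ_iff, OrderIso.le_iff_le]
      exact hj.le

end

/-! ### Coderivations and homomorphisms on words -/

section

variable {C : Cooperad k} [CharZero k] {A B : DGVect k}

/-- When all groups but the `i`-th are singletons, `q` is determined by the subset `S` of letters in
the `i`-th group and by the labels given to `S` and to the remaining letters, which form the
bijection `e`. -/
theorem exists_collapse {n m : ℕ} {i : Fin m} {q : Fin n → Fin m} {S : Finset (Fin n)}
    (hS : Finset.univ.filter (q · = i) = S)
    (h : ∀ l, l ≠ i → (Finset.univ.filter (q · = l)).card = 1) :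
    ∃ e : Fin (Sᶜ.card + 1) ≃ Fin m, e 0 = i ∧ ∀ j, e (collapse S j) = q j := by
  have hmem : ∀ t, q (Sᶜ.orderEmbOfFin rfl t) ≠ i := fun t h => by
    refine Finset.mem_compl.1 (Finset.orderEmbOfFin_mem Sᶜ rfl t) ?_
    exact (Finset.ext_iff.1 hS _).1 (by simpa using h)
  have hb : Function.Bijective (Fin.cons i fun t => q (Sᶜ.orderEmbOfFin rfl t) :
      Fin (Sᶜ.card + 1) → Fin m) := by
    constructor
    · refine Fin.cons_injective_iff.2 ⟨?_, fun t t' htt => ?_⟩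
      · rintro ⟨t, ht⟩
        exact hmem t ht
      · obtain ⟨a, ha⟩ := Finset.card_eq_one.1 (h _ (hmem t))
        have h1 : Sᶜ.orderEmbOfFin rfl t ∈ ({a} : Finset (Fin n)) := by rw [← ha]; simp
        have h2 : Sᶜ.orderEmbOfFin rfl t' ∈ ({a} : Finset (Fin n)) := by rw [← ha]; simp [htt]
        rw [Finset.mem_singleton] at h1 h2
        exact (Sᶜ.orderEmbOfFin rfl).injective (h1.trans h2.symm)
    · intro l
      by_cases hl : l = i
      · exact ⟨0, hl.symm⟩
      · obtain ⟨a, ha⟩ := Finset.card_eq_one.1 (h l hl)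
        have h1 : a ∈ Finset.univ.filter (q · = l) := by rw [ha]; simp
        have h2 : q a = l := by simpa using h1
        have h3 : a ∈ Sᶜ := by simp [← hS, h2, hl]
        obtain ⟨t, ht⟩ : a ∈ Set.range (Sᶜ.orderEmbOfFin rfl) := by simpa using h3
        exact ⟨t.succ, by simp [ht, h2]⟩
  refine ⟨Equiv.ofBijective _ hb, rfl, fun j => ?_⟩
  obtain h0 | ⟨t, ht⟩ := Fin.eq_zero_or_eq_succ (collapse S j)
  · rw [h0]
    have : j ∈ S := collapse_eq_zero.1 h0
    exact (by simpa [← hS] using this : q j = i).symm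
  · rw [ht]
    exact congrArg q (collapse_eq_succ.1 ht).symm

theorem filter_collapse_comp {n m : ℕ} (S : Finset (Fin n)) (e : Fin (Sᶜ.card + 1) ≃ Fin m) :
    Finset.univ.filter (fun j => e (collapse S j) = e 0) = S := by
  ext j
  simp [collapse_eq_zero]

theorem collapse_perm_injective {n m : ℕ} (S : Finset (Fin n)) : Function.Injective
    fun e : Fin (Sᶜ.card + 1) ≃ Fin m => (e 0, fun j => e (collapse S j)) := by
  intro e e' h
  obtain ⟨h1, h2⟩ := Prod.ext_iff.1 h
  refine Equiv.ext fun t => ?_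
  obtain rfl | ⟨t, rfl⟩ := Fin.eq_zero_or_eq_succ t
  · exact h1
  · have := congrFun h2 (Sᶜ.orderEmbOfFin rfl t)
    simpa only [collapse_eq_succ.2 rfl] using this

/-- The surviving pairs `(i, q)` are sorted by the fibre `S` over `i`. Those with a given `S`
correspond to the m! bijections from the collapsed word to `Fin m`, and all give the same term; this
cancels the 1/m! of `HoAlg.Q_eq`. -/
theorem sum_angPart (hC : C.IsReduced) {n : ℕ} {d : Fin n → ℤ} {f : Fin n → (Cofree C A →ₗ[k] B)}
    (hf : ∀ j, HasDegree (cofree C A) B.toDGData (d j) (f j)) {g : Cofree C B →ₗ[k] B}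
    (hg : HasDegree (cofree C B) B.toDGData 1 g) (m : ℕ) :
    ∑ i : Fin m, ∑ q : Fin n → Fin m, angPart d f g i q =
      ∑ S : Finset (Fin n), if S.Nonempty ∧ Sᶜ.card + 1 = m then
        (m.factorial : k) • angPart d f g 0 (collapse S) else 0 := by
  have hne : ∀ (i : Fin m) (q : Fin n → Fin m), angPart d f g i q ≠ 0 →
      (Finset.univ.filter (q · = i)).Nonempty ∧
        ∀ l, l ≠ i → (Finset.univ.filter (q · = l)).card = 1 := by
    intro i q h
    have h1 := mt (angPart_eq_zero hC d f g i q) h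
    push Not at h1
    obtain ⟨⟨j, hj⟩, h1⟩ := h1
    exact ⟨⟨j, by simp [hj]⟩, h1⟩
  rw [← Fintype.sum_prod_type (fun x : Fin m × (Fin n → Fin m) => angPart d f g x.1 x.2),
    ← Finset.sum_fiberwise Finset.univ fun x : Fin m × (Fin n → Fin m) =>
      Finset.univ.filter (x.2 · = x.1)]
  refine Finset.sum_congr rfl fun S _ => ?_
  split_ifs with hS
  · obtain ⟨hS, rfl⟩ := hS
    rw [Finset.sum_filter, ← Fintype.sum_of_injective _ (collapse_perm_injective S)
      (fun _ => angPart d f g 0 (collapse S)) _ (fun x hx => ?_) fun e => ?_]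
    · rw [Finset.sum_const, Finset.card_univ, Fintype.card_perm, Fintype.card_fin,
        Nat.cast_smul_eq_nsmul]
    · split_ifs with hxS
      · by_contra h
        obtain ⟨e, he, he'⟩ := exists_collapse hxS (hne _ _ h).2
        exact hx ⟨e, Prod.ext he (funext he')⟩
      · rfl
    · rw [if_pos (filter_collapse_comp S e)]
      exact (angPart_relabel hf hg 0 (collapse S) e).symm
  · refine Finset.sum_eq_zero fun x hx => ?_
    by_contra h
    obtain ⟨h1, h2⟩ := hne _ _ h
    rw [Finset.mem_filter] at hx
    obtain ⟨e, -, -⟩ := exists_collapse hx.2 h2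
    refine hS ⟨hx.2 ▸ h1, ?_⟩
    have := Fintype.card_congr e
    rw [Fintype.card_fin, Fintype.card_fin] at this
    rw [← this]

/-- The summand for `S` written as in the Jacobi relations. -/
theorem angPart_collapse {n : ℕ} {d : Fin n → ℤ} {f : Fin n → (Cofree C A →ₗ[k] B)}
    (hf : ∀ j, HasDegree (cofree C A) B.toDGData (d j) (f j)) (g : Cofree C B →ₗ[k] B)
    (S : Finset (Fin n)) :
    angPart d f g 0 (collapse S) =
      ksign k (invParity (fun i => if i ∈ S then (0 : Fin 2) else 1) fun i => (d i : ZMod 2)) •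
      ang C A B (Fin (Sᶜ.card + 1))
        (Fin.cons (1 + ∑ i ∈ S, d i) (subword Sᶜ d) : Fin (Sᶜ.card + 1) → ℤ)
        (Fin.cons (g ∘ₗ ang C A B (Fin S.card) (subword S d) (subword S f)) (subword Sᶜ f) :
          Fin (Sᶜ.card + 1) → (Cofree C A →ₗ[k] B)) := by
  have h0 : Finset.univ.filter (fun j => collapse S j = 0) = S := by
    ext j
    simp [collapse_eq_zero]
  have h1 : ∀ t : Fin Sᶜ.card, Finset.univ.filter (fun j => collapse S j = t.succ) =
      {Sᶜ.orderEmbOfFin rfl t} := fun t => by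
    ext j
    simp [collapse_eq_succ]
  have h2 : crossParity (collapse S) (fun l => ((Pi.single 0 1 : Fin (Sᶜ.card + 1) → ℤ) l : ZMod 2))
      (fun j => (d j : ZMod 2)) = 0 := by
    refine Finset.sum_eq_zero fun j _ => Finset.sum_eq_zero fun l _ => ?_
    split_ifs with h
    · have : l ≠ 0 := fun h' => by simp [h'] at h
      simp [this]
    · rfl
  rw [angPart, h2, add_zero, invParity_collapse]
  congr 2
  · funext l
    obtain rfl | ⟨t, rfl⟩ := Fin.eq_zero_or_eq_succ l
    · rw [h0, Pi.single_eq_same, Fin.cons_zero, add_comm]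
    · rw [h1, Pi.single_eq_of_ne (Fin.succ_ne_zero t), Fin.cons_succ, Finset.sum_singleton, add_zero]
      rfl
  · funext l
    obtain rfl | ⟨t, rfl⟩ := Fin.eq_zero_or_eq_succ l
    · rw [h0, Function.update_self, Fin.cons_zero, angS_eq_subword S hf]
    · rw [h1, Function.update_of_ne (Fin.succ_ne_zero t), Fin.cons_succ, proj_angS_singleton _ hf]
      rfl

theorem HoAlg.projQ_deg (A : HoAlg C) :
    HasDegree (cofree C A.A) A.A.toDGData 1 (proj C A.A ∘ₗ A.Q) :=
  ((HoAlgebra.proj_deg C A.A).comp A.Q_hasDegree).of_eq (add_zero 1)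

/-- Expanding `Q` by `HoAlg.Q_eq` and composing each term with `ang` gives a sum over groupings of
the letters. What survives is a nonempty subset of letters fed into `p ∘ Q`, as in the Jacobi
relations. -/
theorem HoAlg.Q_comp_ang (hC : C.IsReduced) (B : HoAlg C) {n : ℕ} {d : Fin n → ℤ}
    {f : Fin n → (Cofree C A →ₗ[k] B.A)}
    (hf : ∀ j, HasDegree (cofree C A) B.A.toDGData (d j) (f j)) :
    B.Q ∘ₗ ang C A B.A (Fin n) d f = ∑ S : Finset (Fin n), if S.Nonempty then
      angPart d f (proj C B.A ∘ₗ B.Q) 0 (collapse S) else 0 := by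
  have h1 : ∀ m (i : Fin m), ang C B.A B.A (Fin m) (Pi.single i 1)
      (Function.update (fun _ => proj C B.A) i (proj C B.A ∘ₗ B.Q)) ∘ₗ ang C A B.A (Fin n) d f =
      ∑ q : Fin n → Fin m, angPart d f (proj C B.A ∘ₗ B.Q) i q := fun m i =>
    ang_comp_ang_finset hf _ _
  have h2 : B.Q ∘ₗ ang C A B.A (Fin n) d f = ∑ m ∈ Finset.range (n + 1), (m.factorial : k)⁻¹ •
      ∑ i : Fin m, ∑ q : Fin n → Fin m, angPart d f (proj C B.A ∘ₗ B.Q) i q := by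
    refine LinearMap.ext fun x => ?_
    have h3 := ang_mem_arLe d f x
    rw [Fintype.card_fin] at h3
    rw [LinearMap.comp_apply, B.Q_eq hC h3, LinearMap.sum_apply]
    refine Finset.sum_congr rfl fun m _ => ?_
    rw [LinearMap.smul_apply, LinearMap.sum_apply]
    congr 1
    refine Finset.sum_congr rfl fun i _ => ?_
    rw [← h1, LinearMap.comp_apply]
  rw [h2]
  simp only [sum_angPart hC hf B.projQ_deg, Finset.smul_sum]
  rw [Finset.sum_comm]
  refine Finset.sum_congr rfl fun S _ => ?_
  split_ifs with hS
  · rw [Finset.sum_eq_single (Sᶜ.card + 1)]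
    · rw [if_pos ⟨hS, rfl⟩, smul_smul, inv_mul_cancel₀, one_smul]
      exact_mod_cast Nat.factorial_ne_zero _
    · intro m _ hm
      rw [if_neg fun h => hm h.2.symm, smul_zero]
    · intro h
      refine absurd (Finset.mem_range.2 ?_) h
      have h4 := Finset.card_add_card_compl S
      rw [Fintype.card_fin] at h4
      have := hS.card_pos
      omega
  · exact Finset.sum_eq_zero fun m _ => by rw [if_neg fun h => hS h.1, smul_zero]

/-- The sum over positions in a word, written as a sum over one-element subwords. -/
theorem ang_update_eq_cons {n : ℕ} {d : Fin n → ℤ} {f : Fin n → (Cofree C A →ₗ[k] B)}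
    (hf : ∀ j, HasDegree (cofree C A) B.toDGData (d j) (f j)) (i : Fin n)
    {g : Cofree C A →ₗ[k] B} (hg : HasDegree (cofree C A) B.toDGData (1 + d i) g) :
    ksign k (∑ a with a < i, (d a : ZMod 2)) •
        ang C A B (Fin n) (d + Pi.single i 1) (Function.update f i g) =
      ksign k (invParity (fun j => if j ∈ ({i} : Finset (Fin n)) then (0 : Fin 2) else 1)
          fun i => (d i : ZMod 2)) •
        ang C A B (Fin (({i} : Finset (Fin n))ᶜ.card + 1))
          (Fin.cons (1 + ∑ j ∈ {i}, d j) (subword ({i} : Finset (Fin n))ᶜ d) :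
            Fin (({i} : Finset (Fin n))ᶜ.card + 1) → ℤ)
          (Fin.cons g (subword ({i} : Finset (Fin n))ᶜ f) :
            Fin (({i} : Finset (Fin n))ᶜ.card + 1) → (Cofree C A →ₗ[k] B)) := by
  obtain ⟨e, he0, he⟩ := exists_collapse (m := n) (i := i) (q := id) (S := {i})
    (by ext; simp) fun l _ => by simp [Finset.filter_eq']
  have hf' : ∀ j, HasDegree (cofree C A) B.toDGData ((d + Pi.single i 1 : Fin n → ℤ) j)
      (Function.update f i g j) := fun j => by
    by_cases h : j = i
    · subst h
      simpa [add_comm] using hg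
    · simpa [h] using hf j
  have hsucc : ∀ t, e (Fin.succ t) = ({i} : Finset (Fin n))ᶜ.orderEmbOfFin rfl t := fun t => by
    rw [← collapse_eq_succ.2 rfl, he]
    rfl
  have hne : ∀ t, ({i} : Finset (Fin n))ᶜ.orderEmbOfFin rfl t ≠ i := fun t h =>
    Finset.mem_compl.1 (Finset.orderEmbOfFin_mem ({i} : Finset (Fin n))ᶜ rfl t)
      (Finset.mem_singleton.2 h)
  have h := ang_reindex e.symm hf'
  have h1 : (fun j => (d + Pi.single i 1 : Fin n → ℤ) (e.symm.symm j)) =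
      Fin.cons (1 + ∑ j ∈ {i}, d j) (subword ({i} : Finset (Fin n))ᶜ d) := by
    funext l
    obtain rfl | ⟨t, rfl⟩ := Fin.eq_zero_or_eq_succ l
    · rw [Equiv.symm_symm, he0]
      simp [add_comm]
    · rw [Equiv.symm_symm, hsucc, Fin.cons_succ, Pi.add_apply, Pi.single_eq_of_ne (hne t), add_zero]
      rfl
  have h2 : (fun j => Function.update f i g (e.symm.symm j)) =
      Fin.cons g (subword ({i} : Finset (Fin n))ᶜ f) := by
    funext l
    obtain rfl | ⟨t, rfl⟩ := Fin.eq_zero_or_eq_succ l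
    · rw [Equiv.symm_symm, he0]
      simp
    · rw [Equiv.symm_symm, hsucc, Fin.cons_succ, Function.update_of_ne (hne t)]
      rfl
  rw [h1, h2] at h
  rw [h, smul_smul, ← ksign_add]
  congr 2
  have h3 : ∀ j, e.symm j = collapse {i} j := fun j => by
    rw [e.symm_apply_eq, he]
    rfl
  -- Bringing the `i`-th letter to the front costs one crossing with each letter before it.
  have h4 : ∀ t : Fin n → ZMod 2, invParity (fun j => e.symm j) t = ∑ a with a < i, t a * t i := by
    intro t
    simp only [h3]
    rw [invParity_collapse, invParity, Finset.sum_filter]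
    refine Finset.sum_congr rfl fun j _ => ?_
    rw [Finset.sum_eq_single i]
    · by_cases hj : j = i <;> simp [hj]
    · intro j' _ hj'
      rw [if_neg]
      simp only [Finset.mem_singleton, hj', if_false]
      split_ifs <;> simp
    · simp
  have h5 := h4 fun i => (d i : ZMod 2)
  simp only [h3] at h5 h4
  rw [← invParity_collapse, h5]
  change _ = _ + invParity (fun j => e.symm j) _
  simp only [h3]
  rw [h4]
  -- The entry at `i` has degree one more than `d i`, so each crossing changes by `d a`; this
  -- accounts for the prefix sign on the left side.
  rw [← Finset.sum_add_distrib]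
  refine Finset.sum_congr rfl fun a ha => ?_
  have ha : a ≠ i := (Finset.mem_filter.1 ha).2.ne
  simp only [Pi.add_apply, Pi.single_eq_of_ne ha, Pi.single_eq_same]
  push_cast
  have := zmod2_add_self ((d a : ZMod 2) * d i)
  linear_combination -this

/-! ### The mapping spaces -/

theorem mapSp_br (A B : HoAlg C) (m : ℕ) (d : Fin m → ℤ) (f : Fin m → mapSp A B) :
    (mapSp A B).br m d f = (if h : m = 1 then
      B.A.d ∘ₗ f ⟨0, by omega⟩ - ksign k (d ⟨0, by omega⟩ : ZMod 2) • f ⟨0, by omega⟩ ∘ₗ A.D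
      else 0) + (proj C B.A ∘ₗ B.Q) ∘ₗ ang C A.A B.A (Fin m) d f := by
  have h : ang C A.A B.A (Fin m) d f =
      cls C B.A m ∘ₗ tensorMaps A.A B.A m d f ∘ₗ comul C A.A m := by
    rw [ang, clsOn_eq_cls, comulOn_fin, koszulMap, tensorMaps]
    congr! with i
    ext
    simp
  rw [h]
  rfl

theorem br_diff_deg {A B : HoAlg C} {d : ℤ} {f : Cofree C A.A →ₗ[k] B.A}
    (hf : HasDegree (cofree C A.A) B.A.toDGData d f) :
    HasDegree (cofree C A.A) B.A.toDGData (1 + d)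
      (B.A.d ∘ₗ f - ksign k (d : ZMod 2) • f ∘ₗ A.D) := by
  intro n x hx
  refine Submodule.sub_mem _ (((DGVect.d_deg B.A).comp hf).of_eq (add_comm _ _) n x hx)
    (Submodule.smul_mem _ _ ((hf.comp A.D_deg) n x hx))

/-- The bracket inserted into `ang` in all possible ways. -/
theorem bracketInside_ang (hC : C.IsReduced) {A B : HoAlg C} {n : ℕ} {d : Fin n → ℤ}
    {f : Fin n → (Cofree C A.A →ₗ[k] B.A)}
    (hf : ∀ j, HasDegree (cofree C A.A) B.A.toDGData (d j) (f j)) :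
    bracketInside (mapSp A B) (fun m e g => ang C A.A B.A (Fin m) e g) n d f =
      B.D ∘ₗ ang C A.A B.A (Fin n) d f -
        ksign k (∑ j, (d j : ZMod 2)) • ang C A.A B.A (Fin n) d f ∘ₗ A.D := by
  -- The bracket of `x_S` has a part from `Q`, present for every nonempty `S`, and a part from the
  -- differential of Hom(C(A), B), present only for singletons. The second is rewritten as an
  -- operation at a position, as it occurs in `d_comp_ang`.
  have key : ∀ S : Finset (Fin n), (if S.Nonempty then
      ksign k (invParity (fun i => if i ∈ S then (0 : Fin 2) else 1) fun i => (d i : ZMod 2)) •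
        ang C A.A B.A (Fin (Sᶜ.card + 1))
        (Fin.cons (1 + ∑ i ∈ S, d i) (subword Sᶜ d) : Fin (Sᶜ.card + 1) → ℤ)
        (Fin.cons ((mapSp A B).br S.card (subword S d) (subword S f)) (subword Sᶜ f) :
          Fin (Sᶜ.card + 1) → (Cofree C A.A →ₗ[k] B.A))
      else 0) = (if S.Nonempty then angPart d f (proj C B.A ∘ₗ B.Q) 0 (collapse S) else 0) +
      ∑ i : Fin n, if {i} = S then ksign k (∑ a with a < i, (d a : ZMod 2)) •
        ang C A.A B.A (Fin n) (d + Pi.single i 1)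
        (Function.update f i (B.A.d ∘ₗ f i - ksign k (d i : ZMod 2) • f i ∘ₗ A.D)) else 0 := by
    intro S
    split_ifs with hS
    · have hu : ∀ g h : Cofree C A.A →ₗ[k] B.A, ang C A.A B.A (Fin (Sᶜ.card + 1))
          (Fin.cons (1 + ∑ i ∈ S, d i) (subword Sᶜ d) : Fin (Sᶜ.card + 1) → ℤ)
          (Fin.cons (g + h) (subword Sᶜ f) : Fin (Sᶜ.card + 1) → (Cofree C A.A →ₗ[k] B.A)) =
        ang C A.A B.A (Fin (Sᶜ.card + 1))
          (Fin.cons (1 + ∑ i ∈ S, d i) (subword Sᶜ d) : Fin (Sᶜ.card + 1) → ℤ)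
          (Fin.cons h (subword Sᶜ f) : Fin (Sᶜ.card + 1) → (Cofree C A.A →ₗ[k] B.A)) +
        ang C A.A B.A (Fin (Sᶜ.card + 1))
          (Fin.cons (1 + ∑ i ∈ S, d i) (subword Sᶜ d) : Fin (Sᶜ.card + 1) → ℤ)
          (Fin.cons g (subword Sᶜ f) : Fin (Sᶜ.card + 1) → (Cofree C A.A →ₗ[k] B.A)) := by
        intro g h
        have h1 := ang_update (C := C) (A := A.A) (B := B.A)
          (Fin.cons (1 + ∑ i ∈ S, d i) (subword Sᶜ d) : Fin (Sᶜ.card + 1) → ℤ)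
          (Fin.cons g (subword Sᶜ f) : Fin (Sᶜ.card + 1) → (Cofree C A.A →ₗ[k] B.A)) 0 1 g h
        rw [one_smul, one_smul, Fin.update_cons_zero, Fin.update_cons_zero,
          Fin.update_cons_zero] at h1
        rw [h1, add_comm]
      rw [mapSp_br, hu, smul_add, angPart_collapse hf]
      congr 1
      split_ifs with h1
      · obtain ⟨i, rfl⟩ := Finset.card_eq_one.1 h1
        refine Eq.trans ?_ (Finset.sum_eq_single i ?_ ?_).symm
        · rw [if_pos rfl, ang_update_eq_cons hf i (br_diff_deg (hf i))]
          have h2 : ∀ h, ({i} : Finset (Fin n)).orderEmbOfFin rfl ⟨0, h⟩ = i := fun h =>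
            Finset.mem_singleton.1 (Finset.orderEmbOfFin_mem ({i} : Finset (Fin n)) rfl ⟨0, h⟩)
          simp only [subword, h2]
        · intro j _ hj
          rw [if_neg fun h => hj (Finset.singleton_injective h)]
        · exact fun h => absurd (Finset.mem_univ i) h
      · rw [Finset.sum_eq_zero fun i _ => if_neg (by rintro rfl; simp at h1), ang_eq_zero _ 0 rfl,
          smul_zero]
    · rw [Finset.sum_eq_zero fun i _ => if_neg (by rintro rfl; simp at hS), add_zero]
  have h1 := d_comp_ang hf
  refine (Finset.sum_congr rfl fun S _ => key S).trans ?_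
  rw [Finset.sum_add_distrib, ← B.Q_comp_ang hC hf, Finset.sum_comm,
    show B.D ∘ₗ ang C A.A B.A (Fin n) d f = (cofree C B.A).d ∘ₗ ang C A.A B.A (Fin n) d f +
      B.Q ∘ₗ ang C A.A B.A (Fin n) d f from LinearMap.add_comp _ _ _, h1]
  simp only [Finset.sum_ite_eq, Finset.mem_univ, if_true]
  abel

end

/-! ### The shifted L-infinity structures -/

section

variable {C : Cooperad k} [CharZero k]

theorem HoAlg.D_comp_D (A : HoAlg C) : A.D ∘ₗ A.D = 0 := A.Q_mc

/-- The identity of a homotopy algebra. -/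
def InftyHom.id (A : HoAlg C) : InftyHom A A where
  F := LinearMap.id
  F_deg _ _ hx := hx
  F_comul m := by rw [PiTensorProduct.map_id, TensorProduct.map_id]; rfl
  F_diff := rfl

/-- The differential of `Hom(C(A), C(B))`, followed by the projection to `B`. -/
def projDiff (A B : HoAlg C) (e : ℤ) :
    (Cofree C A.A →ₗ[k] Cofree C B.A) →ₗ[k] (Cofree C A.A →ₗ[k] B.A) where
  toFun G := proj C B.A ∘ₗ (B.D ∘ₗ G - ksign k (e : ZMod 2) • G ∘ₗ A.D)
  map_add' G G' := by
    refine LinearMap.ext fun x => ?_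
    simp only [LinearMap.comp_apply, LinearMap.sub_apply, LinearMap.add_apply, LinearMap.smul_apply,
      map_sub, map_add, map_smul, smul_add]
    abel
  map_smul' c G := by
    refine LinearMap.ext fun x => ?_
    simp only [LinearMap.comp_apply, LinearMap.sub_apply, LinearMap.smul_apply,
      map_sub, map_smul, smul_sub, smul_comm c, RingHom.id_apply]

theorem projDiff_deg {A B : HoAlg C} {e : ℤ} {G : Cofree C A.A →ₗ[k] Cofree C B.A}
    (hG : HasDegree (cofree C A.A) (cofree C B.A) e G) :
    HasDegree (cofree C A.A) B.A.toDGData (1 + e) (projDiff A B e G) := by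
  refine ((proj_deg C B.A).comp (e := 1 + e) fun n x hx => ?_).of_eq (add_zero _)
  exact Submodule.sub_mem _ ((B.D_deg.comp hG).of_eq (add_comm _ _) n x hx)
    (Submodule.smul_mem _ _ ((hG.comp A.D_deg) n x hx))

/-- All brackets, the unary one included, are the projected commutator of `ang` with D. The terms
coming from ∂ and from D_A contain `p ∘ ang`, which is zero unless there is exactly one map; so they
survive only in the unary bracket. -/
theorem mapSp_br_eq (A B : HoAlg C) (m : ℕ) (d : Fin m → ℤ) (f : Fin m → mapSp A B) :
    (mapSp A B).br m d f = projDiff A B (∑ j, d j) (ang C A.A B.A (Fin m) d f) := by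
  have h : projDiff A B (∑ j, d j) (ang C A.A B.A (Fin m) d f) =
      (B.A.d ∘ₗ proj C B.A ∘ₗ ang C A.A B.A (Fin m) d f + proj C B.A ∘ₗ B.Q ∘ₗ
        ang C A.A B.A (Fin m) d f) - ksign k ((∑ j, d j : ℤ) : ZMod 2) •
          (proj C B.A ∘ₗ ang C A.A B.A (Fin m) d f) ∘ₗ A.D := by
    refine LinearMap.ext fun x => ?_
    have h := LinearMap.congr_fun (proj_comm C B.A) (ang C A.A B.A (Fin m) d f x)
    simp only [LinearMap.comp_apply, LinearMap.sub_apply, LinearMap.add_apply,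
      LinearMap.smul_apply] at h ⊢
    rw [← h, ← map_add, ← map_smul, ← map_sub]
    rfl
  rw [mapSp_br, h]
  split_ifs with hm
  · subst hm
    rw [proj_ang_fin_one, Fin.sum_univ_one]
    change _ - _ + proj C B.A ∘ₗ B.Q ∘ₗ ang C A.A B.A (Fin 1) d f = _
    simp only [Fin.zero_eta]
    abel
  · rw [proj_ang_of_ne (by simpa using hm)]
    simp only [LinearMap.comp_zero, LinearMap.zero_comp, smul_zero, zero_add, sub_zero]
    rfl

/-- The cocycle identity `invParity_trans` for `σ⁻¹` followed by `σ` equates the two signs modulo 2.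
-/
theorem invParity_perm {n : ℕ} (σ : Equiv.Perm (Fin n)) (t : Fin n → ZMod 2) :
    invParity σ (fun i => t (σ i)) = invParity σ.symm t := by
  have h := invParity_trans σ.symm σ t
  rw [invParity_of_monotone (by rw [Equiv.symm_trans_self]; exact fun _ _ h => h)] at h
  simp only [Equiv.symm_symm] at h
  exact (CharTwo.add_eq_zero.1 h.symm).symm

theorem ang_perm {A B : DGVect k} {n : ℕ} {d : Fin n → ℤ} {f : Fin n → (Cofree C A →ₗ[k] B)}
    (hf : ∀ j, HasDegree (cofree C A) B.toDGData (d j) (f j)) (σ : Equiv.Perm (Fin n)) :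
    ang C A B (Fin n) (fun i => d (σ i)) (fun i => f (σ i)) =
      ksign k (invParity σ fun i => (d (σ i) : ZMod 2)) • ang C A B (Fin n) d f := by
  rw [invParity_perm σ fun i => (d i : ZMod 2)]
  exact ang_reindex σ.symm hf

/-- An operation which depends on its arguments only through `ang`, linearly, and through their
total degree inherits multilinearity and graded symmetry from `ang`. -/
theorem isGradedSymmetric_of_ang {A B A' B' : HoAlg C} (e : ℤ)
    {b : ∀ n : ℕ, (Fin n → ℤ) → (Fin n → mapSp A B) → mapSp A' B'}
    (Φ : ℤ → (Cofree C A.A →ₗ[k] Cofree C B.A) →ₗ[k] (Cofree C A'.A →ₗ[k] B'.A))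
    (hb : ∀ n d x, b n d x = Φ (∑ j, d j) (ang C A.A B.A (Fin n) d x))
    (hΦ : ∀ c G, HasDegree (cofree C A.A) (cofree C B.A) c G →
      HasDegree (cofree C A'.A) B'.A.toDGData (e + c) (Φ c G)) :
    IsGradedSymmetric (mapSp A B).gr (mapSp A' B').gr e b := by
  intro n _ d x hx
  refine ⟨?_, fun i y _ c => ?_, fun σ => ?_⟩
  · rw [hb]
    exact hΦ _ _ (ang_deg hx)
  · rw [hb, hb, hb]
    have h := ang_update d x i c (x i) y
    rw [Function.update_eq_self] at h
    exact (congrArg (Φ _) h).trans (by rw [map_add, map_smul])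
  · rw [hb, hb]
    have h := ang_perm hx σ
    rw [Equiv.sum_comp σ d]
    exact (congrArg (Φ _) h).trans (map_smul _ _ _)

/-- The comparison of `f` and `f'` is required only in total degree `1 + ∑ j, d j`, because a
bracket has degree one. This fixes the sign in `projDiff` for all summands at once. -/
theorem bracketInside_map {L : SLieData k} {W W' : Type u} [AddCommGroup W] [Module k W]
    [AddCommGroup W'] [Module k W'] (φ : W →ₗ[k] W') {f : ∀ n : ℕ, (Fin n → ℤ) → (Fin n → L) → W}
    {f' : ∀ n : ℕ, (Fin n → ℤ) → (Fin n → L) → W'} {n : ℕ} (d : Fin n → ℤ) (x : Fin n → L)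
    (h : ∀ m e y, ∑ j, e j = 1 + ∑ j, d j → f' m e y = φ (f m e y)) :
    bracketInside L f' n d x = φ (bracketInside L f n d x) := by
  rw [bracketInside, bracketInside, map_sum]
  refine Finset.sum_congr rfl fun S _ => ?_
  split_ifs
  · rw [map_smul, h]
    rw [Fin.sum_univ_succ, Fin.cons_zero]
    simp only [Fin.cons_succ]
    rw [add_assoc, ← Finset.sum_add_sum_compl S d]
    congr 2
    change ∑ t, d (Sᶜ.orderIsoOfFin rfl t).1 = _
    exact ((Sᶜ.orderIsoOfFin rfl).toEquiv.sum_comp fun j : {j // j ∈ Sᶜ} => d j.1).trans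
      (Finset.sum_coe_sort Sᶜ d)
  · rw [map_zero]

/-- Inserting brackets into `ang` is the commutator with D, and the outer bracket is the projection
of another such commutator. The Jacobi relations hold since the graded commutator with D squares to
zero. -/
theorem mapSp_isSLieInfty (hC : C.IsReduced) (A B : HoAlg C) : (mapSp A B).IsSLieInfty := by
  refine ⟨isGradedSymmetric_of_ang 1 (projDiff A B) (mapSp_br_eq A B) fun _ _ => projDiff_deg,
    fun n _ d x hx => ?_⟩
  rw [bracketInside_map (projDiff A B (1 + ∑ j, d j))
    (f := fun m e g => ang C A.A B.A (Fin m) e g) d x fun m e y h => by rw [mapSp_br_eq, h],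
    bracketInside_ang hC hx]
  have h : B.D ∘ₗ (B.D ∘ₗ ang C A.A B.A (Fin n) d x -
        ksign k (∑ j, (d j : ZMod 2)) • ang C A.A B.A (Fin n) d x ∘ₗ A.D) -
      ksign k ((1 + ∑ j, d j : ℤ) : ZMod 2) • (B.D ∘ₗ ang C A.A B.A (Fin n) d x -
        ksign k (∑ j, (d j : ZMod 2)) • ang C A.A B.A (Fin n) d x ∘ₗ A.D) ∘ₗ A.D = 0 := by
    push_cast
    have hA := LinearMap.congr_fun A.D_comp_D
    have hB := LinearMap.congr_fun B.D_comp_D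
    simp only [LinearMap.comp_apply, LinearMap.zero_apply] at hA hB
    refine LinearMap.ext fun z => ?_
    simp only [LinearMap.comp_apply, LinearMap.sub_apply, LinearMap.smul_apply, map_sub, map_smul,
      ksign_add, ksign_one, hA, hB, map_zero, smul_zero, LinearMap.zero_apply, neg_mul, one_mul,
      neg_smul]
    abel_nf
  exact (congrArg (proj C B.A ∘ₗ ·) h).trans (LinearMap.comp_zero _)

/-! ### Composition with infinity-morphisms -/

theorem InftyHom.hasDegree {A B : HoAlg C} (E : InftyHom A B) :
    HasDegree (cofree C A.A) (cofree C B.A) 0 E.F := fun n x hx => by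
  rw [add_zero]
  exact E.F_deg n x hx

/-- A homomorphism of coalgebras passes through the comultiplication and, being of degree zero,
through the Koszul signs. -/
theorem ang_comp_F {A A' : HoAlg C} {B : DGVect k} (E : InftyHom A' A) {n : ℕ} (d : Fin n → ℤ)
    (f : Fin n → (Cofree C A.A →ₗ[k] B)) :
    ang C A.A B (Fin n) d f ∘ₗ E.F = ang C A'.A B (Fin n) d fun j => f j ∘ₗ E.F := by
  have h := koszulMap_comp_map (X := (C.obj (Fin n)).toDGData) (V := fun _ => cofree C A.A)
    (V' := fun _ => cofree C A'.A) (W := fun _ => B.toDGData) (fun _ => cofree_isGraded C A.A)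
    (fun _ => cofree_isGraded C A'.A) d f (fun _ => E.F) fun _ => E.hasDegree
  refine LinearMap.ext fun x => ?_
  have h1 := LinearMap.congr_fun h (comul C A'.A n x)
  have h2 := LinearMap.congr_fun (E.F_comul n) x
  rw [LinearMap.comp_apply, LinearMap.comp_apply] at h2
  rw [LinearMap.comp_apply, ← h2] at h1
  rw [LinearMap.comp_apply, ang, ang, LinearMap.comp_apply, LinearMap.comp_apply, comulOn_fin, h1,
    LinearMap.comp_apply, LinearMap.comp_apply, comulOn_fin]

/-- The exponential formula `InftyHom.F_eq` is composed with `ang` term by term. Groupings that are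
not surjective drop out since an empty group contributes zero, by C(0) = 0. -/
theorem InftyHom.comp_ang (hC : C.IsReduced) {A : DGVect k} {B B' : HoAlg C} (G : InftyHom B B')
    {n : ℕ} (hn : 1 ≤ n) {d : Fin n → ℤ} {f : Fin n → (Cofree C A →ₗ[k] B.A)}
    (hf : ∀ j, HasDegree (cofree C A) B.A.toDGData (d j) (f j)) :
    G.F ∘ₗ ang C A B.A (Fin n) d f =
      ∑ r ∈ Finset.Icc 1 n, (r.factorial : k)⁻¹ • ∑ p : Fin n → Fin r,
        if Function.Surjective p then ksign k (invParity p fun i => (d i : ZMod 2)) •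
          ang C A B'.A (Fin r) (fun j => ∑ i with p i = j, d i)
            (fun j => G.proj ∘ₗ ang C A B.A (Fin (Finset.univ.filter (p · = j)).card)
              (subword (Finset.univ.filter (p · = j)) d)
              (subword (Finset.univ.filter (p · = j)) f))
        else 0 := by
  have h1 : ∀ r, ang C B.A B'.A (Fin r) (fun _ => 0) (fun _ => G.proj) ∘ₗ ang C A B.A (Fin n) d f =
      ∑ p : Fin n → Fin r, if Function.Surjective p then
        ksign k (invParity p fun i => (d i : ZMod 2)) •
          ang C A B'.A (Fin r) (fun j => ∑ i with p i = j, d i)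
            (fun j => G.proj ∘ₗ ang C A B.A (Fin (Finset.univ.filter (p · = j)).card)
              (subword (Finset.univ.filter (p · = j)) d)
              (subword (Finset.univ.filter (p · = j)) f)) else 0 := by
    intro r
    rw [ang_comp_ang_finset hf]
    refine Finset.sum_congr rfl fun p _ => ?_
    have h2 : crossParity p (fun l => (((fun _ => 0 : Fin r → ℤ) l : ℤ) : ZMod 2))
        (fun j => (d j : ZMod 2)) = 0 := by simp [crossParity]
    split_ifs with hp
    · rw [h2]
      simp only [add_zero, angS_eq_subword _ hf]
    · rw [Function.Surjective] at hp
      push Not at hp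
      obtain ⟨l, hl⟩ := hp
      rw [ang_eq_zero _ l, smul_zero]
      rw [Finset.filter_eq_empty_iff.2 fun j _ => hl j, angS_empty hC, LinearMap.comp_zero]
  refine LinearMap.ext fun x => ?_
  have h3 := ang_mem_arLe d f x
  rw [Fintype.card_fin] at h3
  have h4 : ∀ r, ang C B.A B'.A (Fin r) (fun _ => 0) (fun _ => G.proj)
      (ang C A B.A (Fin n) d f x) = _ := fun r => LinearMap.congr_fun (h1 r) x
  rw [LinearMap.comp_apply, G.F_eq hC h3, LinearMap.sum_apply, Finset.range_eq_Ico,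
    Finset.sum_eq_sum_Ico_succ_bot (Nat.succ_pos n), h4]
  -- The term r = 0 vanishes because a nonempty word has no grouping into zero groups; this is the
  -- use of `hn`.
  have : IsEmpty (Fin n → Fin 0) := ⟨fun p => (p ⟨0, hn⟩).elim0⟩
  rw [Finset.univ_eq_empty, Finset.sum_empty, LinearMap.zero_apply, smul_zero, zero_add]
  refine Finset.sum_congr rfl fun r _ => ?_
  rw [h4, LinearMap.smul_apply]

/-- The morphism of mapping spaces induced by infinity-morphisms of the source and the target. -/
def conj {A A' B B' : HoAlg C} (E : InftyHom A' A) (G : InftyHom B B') (n : ℕ) (d : Fin n → ℤ)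
    (f : Fin n → mapSp A B) : mapSp A' B' :=
  G.proj ∘ₗ ang C A.A B.A (Fin n) d f ∘ₗ E.F

/-- Composition with fixed maps. -/
def sandwich {U V W Z : Type u} [AddCommGroup U] [Module k U] [AddCommGroup V] [Module k V]
    [AddCommGroup W] [Module k W] [AddCommGroup Z] [Module k Z] (g : W →ₗ[k] Z) (e : U →ₗ[k] V) :
    (V →ₗ[k] W) →ₗ[k] (U →ₗ[k] Z) where
  toFun f := g ∘ₗ f ∘ₗ e
  map_add' f f' := by rw [LinearMap.add_comp, LinearMap.comp_add]
  map_smul' c f := by rw [LinearMap.smul_comp, LinearMap.comp_smul]; rfl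

theorem conj_eq_sandwich {A A' B B' : HoAlg C} (E : InftyHom A' A) (G : InftyHom B B') (n : ℕ)
    (d : Fin n → ℤ) (f : Fin n → mapSp A B) :
    conj E G n d f = sandwich G.proj E.F (ang C A.A B.A (Fin n) d f) := rfl

/-- Since E and G commute with the total differentials, a commutator taken inside becomes a
commutator taken outside. -/
theorem sandwich_diff {A A' B B' : HoAlg C} (E : InftyHom A' A) (G : InftyHom B B') (e : ℤ)
    (X : Cofree C A.A →ₗ[k] Cofree C B.A) :
    sandwich G.proj E.F (B.D ∘ₗ X - ksign k (e : ZMod 2) • X ∘ₗ A.D) =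
      projDiff A' B' e (G.F ∘ₗ X ∘ₗ E.F) := by
  have hE := LinearMap.congr_fun E.F_diff
  have hG := LinearMap.congr_fun G.F_diff
  simp only [LinearMap.comp_apply] at hE hG
  refine LinearMap.ext fun z => ?_
  change HoAlgebra.proj C B'.A (G.F ((B.D ∘ₗ X - ksign k (e : ZMod 2) • X ∘ₗ A.D) (E.F z))) =
    HoAlgebra.proj C B'.A ((B'.D ∘ₗ (G.F ∘ₗ X ∘ₗ E.F) -
      ksign k (e : ZMod 2) • (G.F ∘ₗ X ∘ₗ E.F) ∘ₗ A'.D) z)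
  simp only [LinearMap.comp_apply, LinearMap.sub_apply, LinearMap.smul_apply, map_sub, map_smul,
    hE, hG]

theorem conj_deg {A A' B B' : HoAlg C} (E : InftyHom A' A)
    (G : InftyHom B B') (c : ℤ) (X : Cofree C A.A →ₗ[k] Cofree C B.A)
    (hX : HasDegree (cofree C A.A) (cofree C B.A) c X) :
    HasDegree (cofree C A'.A) B'.A.toDGData (0 + c) (sandwich G.proj E.F X) :=
  ((G.proj_deg.comp hX).comp E.hasDegree).of_eq (by ring)

theorem conj_isGradedSymmetric {A A' B B' : HoAlg C} (E : InftyHom A' A)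
    (G : InftyHom B B') : IsGradedSymmetric (mapSp A B).gr (mapSp A' B').gr 0 (conj E G) :=
  isGradedSymmetric_of_ang 0 (fun _ => sandwich G.proj E.F) (conj_eq_sandwich E G) (conj_deg E G)

theorem bracketInside_conj (hC : C.IsReduced) {A A' B B' : HoAlg C} (E : InftyHom A' A)
    (G : InftyHom B B') {n : ℕ} {d : Fin n → ℤ} {x : Fin n → (Cofree C A.A →ₗ[k] B.A)}
    (hx : ∀ j, HasDegree (cofree C A.A) B.A.toDGData (d j) (x j)) :
    bracketInside (mapSp A B) (conj E G) n d x =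
      projDiff A' B' (∑ j, d j) (G.F ∘ₗ ang C A'.A B.A (Fin n) d fun j => x j ∘ₗ E.F) := by
  have h0 : bracketInside (mapSp A B) (conj E G) n d x = sandwich G.proj E.F
      (bracketInside (mapSp A B) (fun m e g => ang C A.A B.A (Fin m) e g) n d x) :=
    bracketInside_map (L := mapSp A B) (sandwich G.proj E.F)
      (f := fun m e g => ang C A.A B.A (Fin m) e g) (f' := conj E G) d x
      fun m e y _ => conj_eq_sandwich E G m e y
  have hs : ksign k ((∑ j, d j : ℤ) : ZMod 2) = ksign k (∑ j, (d j : ZMod 2)) := by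
    rw [Int.cast_sum]
  rw [h0, bracketInside_ang hC hx, ← ang_comp_F, ← sandwich_diff, hs]

/-- Both sides of the relation are the projected commutator of G ∘ ang(x) ∘ E with D. On the left
this is the effect of inserting brackets into `ang`; on the right `InftyHom.comp_ang` expands G ∘
`ang` into the surjections of the definition. -/
theorem conj_isSLieHom (hC : C.IsReduced) {A A' B B' : HoAlg C} (E : InftyHom A' A)
    (G : InftyHom B B') : IsSLieHom (mapSp A B) (mapSp A' B') (conj E G) := by
  refine ⟨mapSp_isSLieInfty hC _ _, mapSp_isSLieInfty hC _ _, conj_isGradedSymmetric E G,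
    fun n hn d x hx => ?_⟩
  have hE : ∀ j, HasDegree (cofree C A'.A) B.A.toDGData (d j) (x j ∘ₗ E.F) := fun j =>
    (HasDegree.comp (hx j) E.hasDegree).of_eq (zero_add _)
  rw [bracketInside_conj hC E G hx, G.comp_ang hC hn hE, map_sum]
  refine Finset.sum_congr rfl fun r _ => ?_
  rw [map_smul, map_sum]
  congr 1
  refine Finset.sum_congr rfl fun p _ => ?_
  split_ifs
  · rw [map_smul, mapSp_br_eq, Finset.sum_fiberwise]
    refine congrArg (fun z => ksign k (invParity p fun i => (d i : ZMod 2)) •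
      projDiff A' B' (∑ j, d j) (ang C A'.A B'.A (Fin r) (fun j => ∑ i with p i = j, d i) z))
      (funext fun j => ?_)
    exact congrArg (G.proj ∘ₗ ·) (ang_comp_F E _ _).symm
  · rw [map_zero]

theorem arLe_vanish {A : DGVect k} {Z : Type*} [AddCommGroup Z] [Module k Z]
    {f : Cofree C A →ₗ[k] Z} {m : ℕ} (hf : ∀ n < m, f ∘ₗ cls C A n = 0) {n : ℕ} (hn : n < m)
    {x : Cofree C A} (hx : x ∈ arLe C A n) : f x = 0 := by
  refine (arLe_induction (f := f) (g := 0) (fun n' hn' y => ?_) hx).trans rfl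
  exact LinearMap.congr_fun (hf n' (hn'.trans_lt hn)) y

/-- `ang` of the maps vanishes in arities below the sum of the `m i`, and `E` does not raise the
arity. -/
theorem conj_mem_ariFil (hC : C.IsReduced) {A A' B B' : HoAlg C} (E : InftyHom A' A)
    (G : InftyHom B B') {n : ℕ} (d : Fin n → ℤ) (m : Fin n → ℕ) (x : Fin n → mapSp A B)
    (hx : ∀ i, x i ∈ ariFil A B (m i)) : conj E G n d x ∈ ariFil A' B' (∑ i, m i) := by
  intro N hN
  refine (cls_eq_arity C A'.A).1 ?_
  refine LinearMap.ext fun y => ?_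
  have h : ang C A.A B.A (Fin n) d x (E.F (cls C A'.A N y)) = 0 :=
    arLe_vanish (fun n' hn' => ang_cls_eq_zero d m
      (fun j n hn => (cls_eq_arity C A.A).2 (hx j n hn)) hn') hN
      (E.F_mem_arLe hC (cls_mem_arLe le_rfl y))
  exact (congrArg G.proj h).trans (map_zero _)

theorem conj_isFiltered (hC : C.IsReduced) {A A' B B' : HoAlg C} (E : InftyHom A' A)
    (G : InftyHom B B') : IsFiltered (conj E G) := fun _ _ d m x hx =>
  conj_mem_ariFil hC E G d m x fun i => (hx i).2

end

/-! ### The twisted composition morphisms -/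

section

variable {C : Cooperad k} [CharZero k]

/-- The casts allow an arity which is only propositionally a successor, such as `1 + n` in the
twist. -/
theorem compU_succ (A₁ A₂ A₃ : HoAlg C) {N n : ℕ} (h : N = n + 1) (d : Fin N → ℤ)
    (x : Fin N → (mapSp A₂ A₃).prod (mapSp A₁ A₂)) :
    compU A₁ A₂ A₃ N d x = ∑ i : Fin (n + 1),
      ksign k ((d (i.cast h.symm) * ∑ j ∈ Finset.Iio i, d (j.cast h.symm) : ℤ) : ZMod 2) •
      ((x (i.cast h.symm)).1 ∘ₗ ang C A₁.A A₂.A (Fin n) (fun j => d ((i.succAbove j).cast h.symm))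
        (fun j => (x ((i.succAbove j).cast h.symm)).2)) := by
  subst h
  refine Finset.sum_congr rfl fun i _ => ?_
  have h1 : ∀ (d : Fin n → ℤ) (f : Fin n → (Cofree C A₁.A →ₗ[k] A₂.A)),
      ang C A₁.A A₂.A (Fin n) d f = cls C A₂.A n ∘ₗ tensorMaps A₁.A A₂.A n d f ∘ₗ
        comul C A₁.A n := fun d f => by
    rw [ang, clsOn_eq_cls, comulOn_fin, koszulMap, tensorMaps]
    congr! with i
    ext
    simp
  rw [h1]
  rfl

theorem compU_eq_zero (A₁ A₂ A₃ : HoAlg C) {n : ℕ} (d : Fin n → ℤ)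
    (x : Fin n → (mapSp A₂ A₃).prod (mapSp A₁ A₂))
    (h : ∀ i, (x i).1 = 0 ∨ ∃ j, j ≠ i ∧ (x j).2 = 0) : compU A₁ A₂ A₃ n d x = 0 := by
  cases n with
  | zero => rfl
  | succ n =>
    rw [compU_succ A₁ A₂ A₃ rfl]
    refine Finset.sum_eq_zero fun i _ => ?_
    obtain hi | ⟨j, hj, hj'⟩ := h i
    · rw [show (x (i.cast rfl)).1 = 0 from hi, LinearMap.zero_comp, smul_zero]
    · obtain ⟨t, rfl⟩ := Fin.exists_succAbove_eq hj
      rw [ang_eq_zero _ t hj', LinearMap.comp_zero, smul_zero]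

theorem toModule_comp_arity {A : DGVect k} {Z : Type u} [AddCommGroup Z] [Module k Z]
    (f : Cofree C A →ₗ[k] Z) : DirectSum.toModule k ℕ Z (fun n => f ∘ₗ arity C A n) = f :=
  DirectSum.linearMap_ext k fun n => LinearMap.ext fun x => by
    rw [LinearMap.comp_apply, DirectSum.toModule_lof]

theorem twist_eq {L : SLieData k} {A B : HoAlg C}
    {U : ∀ n : ℕ, (Fin n → ℤ) → (Fin n → L) → mapSp A B} {α : L} {n : ℕ} {d : Fin n → ℤ}
    {x : Fin n → L} (f : Cofree C A.A →ₗ[k] B.A)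
    (h : ∀ N, ∑ᶠ r : ℕ, (r.factorial : k)⁻¹ •
      ((U (r + n) (Fin.append (fun _ => 0) d) (Fin.append (fun _ => α) x) :
        Cofree C A.A →ₗ[k] B.A) ∘ₗ arity C A.A N) = f ∘ₗ arity C A.A N) :
    twist U α n d x = f :=
  (congrArg (DirectSum.toModule k ℕ B.A) (funext h)).trans (toModule_comp_arity f)

theorem fin_exists_ne {r : ℕ} (hr : r ≠ 1) (i : Fin r) : ∃ j, j ≠ i := by
  have := i.2
  have : Nontrivial (Fin r) := Fin.nontrivial_iff_two_le.2 (by omega)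
  exact exists_ne i

section

variable {A₁ A₂ A₃ : HoAlg C} {α : (mapSp A₂ A₃).prod (mapSp A₁ A₂)} {n : ℕ} (d : Fin n → ℤ)
  {x : Fin n → (mapSp A₂ A₃).prod (mapSp A₁ A₂)}

/-- Every summand of `compU` uses the first component of one argument and the second components of
all others. With α = (F', 0) and arguments (0, g) it must take the first component from α, and any
further copy of α would contribute a zero; so exactly one copy occurs. -/
theorem compU_append_left_eq_zero (hα : α.2 = 0) (hx : ∀ i, (x i).1 = 0) {r : ℕ} (hr : r ≠ 1) :
    compU A₁ A₂ A₃ (r + n) (Fin.append (fun _ => 0) d) (Fin.append (fun _ => α) x) = 0 := by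
  refine compU_eq_zero _ _ _ _ _ fun i => ?_
  refine Fin.addCases (fun i => ?_) (fun i => ?_) i
  · obtain ⟨j, hj⟩ := fin_exists_ne hr i
    refine Or.inr ⟨Fin.castAdd n j, fun h => hj (Fin.castAdd_injective r n h), ?_⟩
    rw [Fin.append_left, hα]
  · rw [Fin.append_right]
    exact Or.inl (hx i)

theorem compU_append_left_one (hx : ∀ i, (x i).1 = 0) :
    compU A₁ A₂ A₃ (1 + n) (Fin.append (fun _ => 0) d) (Fin.append (fun _ => α) x) =
      α.1 ∘ₗ ang C A₁.A A₂.A (Fin n) d fun i => (x i).2 := by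
  rw [compU_succ A₁ A₂ A₃ (add_comm 1 n), Finset.sum_eq_single 0]
  · rw [Fin.append_left_eq_cons, Fin.append_left_eq_cons]
    simp [ksign_zero]
  · intro i _ hi
    obtain ⟨t, rfl⟩ := Fin.exists_succ_eq.2 hi
    rw [Fin.append_left_eq_cons, Fin.append_left_eq_cons]
    simp [hx]
  · exact fun h => absurd (Finset.mem_univ _) h

/-- With α = (0, F') and arguments (h, 0) the first component must come from an argument, and a
second argument would contribute a zero. Hence precomposition has only a linear term, with any
number of copies of α. -/
theorem compU_append_right_eq_zero (hα : α.1 = 0) (hx : ∀ i, (x i).2 = 0) (hn : n ≠ 1) (r : ℕ) :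
    compU A₁ A₂ A₃ (r + n) (Fin.append (fun _ => 0) d) (Fin.append (fun _ => α) x) = 0 := by
  refine compU_eq_zero _ _ _ _ _ fun i => ?_
  refine Fin.addCases (fun i => ?_) (fun i => ?_) i
  · rw [Fin.append_left]
    exact Or.inl hα
  · obtain ⟨j, hj⟩ := fin_exists_ne hn i
    refine Or.inr ⟨Fin.natAdd r j, fun h => hj (Fin.natAdd_injective n r h), ?_⟩
    rw [Fin.append_right, hx]

theorem compU_append_right_one (d : Fin 1 → ℤ) {x : Fin 1 → (mapSp A₂ A₃).prod (mapSp A₁ A₂)}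
    (hα : α.1 = 0) (r : ℕ) :
    compU A₁ A₂ A₃ (r + 1) (Fin.append (fun _ => 0) d) (Fin.append (fun _ => α) x) =
      (x 0).1 ∘ₗ ang C A₁.A A₂.A (Fin r) (fun _ => 0) fun _ => α.2 := by
  have hl : Fin.last r = Fin.natAdd r (0 : Fin 1) := rfl
  have hc : ∀ j : Fin r, j.castSucc = Fin.castAdd 1 j := fun _ => rfl
  rw [compU_succ A₁ A₂ A₃ rfl, Finset.sum_eq_single (Fin.last r)]
  · simp only [Fin.succAbove_last, Fin.cast_refl, id, hc, Fin.append_left]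
    rw [hl, Fin.append_right, Finset.sum_eq_zero, mul_zero, Int.cast_zero, ksign_zero, one_smul]
    · rw [Fin.append_right]
    · intro j hj
      obtain ⟨j, rfl⟩ := Fin.exists_castSucc_eq.2 (Finset.mem_Iio.1 hj).ne
      exact Fin.append_left _ _ j
  · intro i _ hi
    obtain ⟨j, rfl⟩ := Fin.exists_castSucc_eq.2 hi
    rw [show (Fin.append (fun _ => α) x (j.castSucc.cast rfl)).1 = 0 by
      rw [Fin.cast_refl, id, hc, Fin.append_left, hα], LinearMap.zero_comp, smul_zero]
  · exact fun h => absurd (Finset.mem_univ _) h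

theorem twist_compU_left (hα : α.2 = 0) (hx : ∀ i, (x i).1 = 0) :
    twist (compU A₁ A₂ A₃) α n d x = α.1 ∘ₗ ang C A₁.A A₂.A (Fin n) d fun i => (x i).2 := by
  refine twist_eq _ fun N => ?_
  rw [finsum_eq_single _ 1 fun r hr => by
    rw [compU_append_left_eq_zero d hα hx hr]; exact smul_zero _, compU_append_left_one d hx]
  simp only [Nat.factorial_one, Nat.cast_one, inv_one, one_smul]

theorem twist_compU_right_eq_zero (hα : α.1 = 0) (hx : ∀ i, (x i).2 = 0) (hn : n ≠ 1) :
    twist (compU A₁ A₂ A₃) α n d x = 0 := by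
  refine twist_eq _ fun N => ?_
  rw [LinearMap.zero_comp]
  refine finsum_eq_zero_of_forall_eq_zero fun r => ?_
  rw [compU_append_right_eq_zero d hα hx hn]
  exact smul_zero _

/-- The sum over copies of F', with the weights 1/r!, is the exponential formula for F. On the part
of arity N the terms with r > N vanish, so the series is a finite sum there. -/
theorem twist_compU_right_one (hC : C.IsReduced) (F : InftyHom A₁ A₂) (d : Fin 1 → ℤ)
    {x : Fin 1 → (mapSp A₂ A₃).prod (mapSp A₁ A₂)} (hα : α.1 = 0) (hF : α.2 = F.proj) :
    twist (compU A₁ A₂ A₃) α 1 d x = (x 0).1 ∘ₗ F.F := by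
  refine twist_eq _ fun N => ?_
  have h2 : ∀ r, N < r → ang C A₁.A A₂.A (Fin r) (fun _ => 0) (fun _ => F.proj) ∘ₗ
      arity C A₁.A N = 0 := fun r hr =>
    (cls_eq_arity C A₁.A).1 (ang_cls_of_lt_card hC _ _ (by simpa using hr))
  have h5 : ∀ r : ℕ, (r.factorial : k)⁻¹ • ((compU A₁ A₂ A₃ (r + 1) (Fin.append (fun _ => 0) d)
      (Fin.append (fun _ => α) x) : Cofree C A₁.A →ₗ[k] A₃.A) ∘ₗ arity C A₁.A N) =
      (r.factorial : k)⁻¹ • ((x 0).1 ∘ₗ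
          ang C A₁.A A₂.A (Fin r) (fun _ => 0) (fun _ => F.proj) ∘ₗ arity C A₁.A N) := by
    intro r
    rw [compU_append_right_one d hα r, hF]
    rfl
  rw [finsum_congr h5, finsum_eq_sum_of_support_subset (s := Finset.range (N + 1))]
  · refine LinearMap.ext fun z => ?_
    obtain ⟨y, rfl⟩ := Representation.Coinvariants.mk_surjective (act C A₁.A N) z
    have h4 := F.F_eq hC (cls_mem_arLe le_rfl y)
    rw [LinearMap.sum_apply]
    refine Eq.trans ?_ (congrArg (x 0).1 h4).symm
    rw [map_sum]
    refine Finset.sum_congr rfl fun r _ => ?_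
    rw [map_smul]
    rfl
  · intro r hr
    by_contra h
    rw [Finset.coe_range, Set.mem_Iio, not_lt] at h
    refine hr ?_
    beta_reduce
    rw [h2 r h, LinearMap.comp_zero, smul_zero]

end

theorem postcomp_eq_conj {A₁ A₂ : HoAlg C} (F : InftyHom A₁ A₂) (A₃ : HoAlg C) :
    postcomp F A₃ = conj (InftyHom.id A₃) F := by
  funext n d g
  exact twist_compU_left d rfl fun _ => rfl

theorem precomp_eq_conj (hC : C.IsReduced) {A₁ A₂ : HoAlg C} (F : InftyHom A₁ A₂) (A₃ : HoAlg C) :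
    precomp F A₃ = conj F (InftyHom.id A₃) := by
  funext n d g
  change _ = (proj C A₃.A ∘ₗ ang C A₂.A A₃.A (Fin n) d g) ∘ₗ F.F
  by_cases hn : n = 1
  · subst hn
    have h3 : proj C A₃.A ∘ₗ ang C A₂.A A₃.A (Fin 1) d g = g 0 := proj_ang_fin_one d g
    rw [h3]
    exact twist_compU_right_one hC F d rfl rfl
  · have h3 : proj C A₃.A ∘ₗ ang C A₂.A A₃.A (Fin n) d g = 0 :=
      proj_ang_of_ne (by simpa using hn) d g
    rw [h3, LinearMap.zero_comp]
    exact twist_compU_right_eq_zero d rfl (fun _ => rfl) hn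

end

/-! ### Restriction to subspaces -/

theorem IsGradedSymmetric.restrict {V W : Type u} [AddCommGroup V] [Module k V] [AddCommGroup W]
    [Module k W] {gV : ℤ → Submodule k V} {gW : ℤ → Submodule k W} {e : ℤ}
    {b : ∀ n : ℕ, (Fin n → ℤ) → (Fin n → V) → W} (hb : IsGradedSymmetric gV gW e b)
    {S : Submodule k V} {S' : Submodule k W}
    (hS : ∀ n, 1 ≤ n → ∀ d x, (∀ i, x i ∈ gV (d i) ⊓ S) → b n d x ∈ S') :
    IsGradedSymmetric (fun d => gV d ⊓ S) (fun d => gW d ⊓ S') e b := by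
  intro n hn d x hx
  obtain ⟨h1, h2, h3⟩ := hb n hn d x fun i => (hx i).1
  exact ⟨⟨h1, hS n hn d x hx⟩, fun i y hy c => h2 i y hy.1 c, h3⟩

theorem SLieData.IsSLieInfty.restrict {L : SLieData k} (hL : L.IsSLieInfty) {S : Submodule k L}
    (hS : ∀ n, 1 ≤ n → ∀ d x, (∀ i, x i ∈ L.gr (d i) ⊓ S) → L.br n d x ∈ S) :
    (L.restrict S).IsSLieInfty :=
  ⟨hL.1.restrict hS, fun n hn d x hx => hL.2 n hn d x fun i => (hx i).1⟩

theorem IsSLieHom.restrict {L L' : SLieData k} {U : ∀ n : ℕ, (Fin n → ℤ) → (Fin n → L) → L'}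
    (hU : IsSLieHom L L' U) {S : Submodule k L} {S' : Submodule k L'}
    (hS : ∀ n, 1 ≤ n → ∀ d x, (∀ i, x i ∈ L.gr (d i) ⊓ S) → L.br n d x ∈ S)
    (hS' : ∀ n, 1 ≤ n → ∀ d x, (∀ i, x i ∈ L'.gr (d i) ⊓ S') → L'.br n d x ∈ S')
    (hUS : ∀ n, 1 ≤ n → ∀ d x, (∀ i, x i ∈ L.gr (d i) ⊓ S) → U n d x ∈ S') :
    IsSLieHom (L.restrict S) (L'.restrict S') U :=
  ⟨hU.1.restrict hS, hU.2.1.restrict hS', hU.2.2.1.restrict hUS, fun n hn d x hx =>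
    hU.2.2.2 n hn d x fun i => (hx i).1⟩

section

variable {C : Cooperad k} [CharZero k]

theorem HoAlg.Q_mem_arLe (hC : C.IsReduced) (A : HoAlg C) {N : ℕ} {x : Cofree C A.A}
    (hx : x ∈ arLe C A.A N) : A.Q x ∈ arLe C A.A N := by
  rw [A.Q_eq hC hx]
  refine Submodule.sum_mem _ fun m hm => Submodule.smul_mem _ _ (Submodule.sum_mem _ fun i _ => ?_)
  refine arLe_mono ?_ (ang_mem_arLe _ _ x)
  rw [Fintype.card_fin]
  rw [Finset.mem_range] at hm
  omega

theorem HoAlg.D_mem_arLe (hC : C.IsReduced) (A : HoAlg C) {N : ℕ} {x : Cofree C A.A}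
    (hx : x ∈ arLe C A.A N) : A.D x ∈ arLe C A.A N := by
  refine Submodule.add_mem _ ?_ (A.Q_mem_arLe hC hx)
  have h : arLe C A.A N ≤ (arLe C A.A N).comap (cofree C A.A).d := by
    refine iSup_le fun n => ?_
    rintro _ ⟨y, rfl⟩
    rw [Submodule.mem_comap, cofree_d_cls]
    exact cls_mem_arLe n.2 _
  exact h hx

theorem mem_ariFil_iff {A B : HoAlg C} {m : ℕ} {f : Cofree C A.A →ₗ[k] B.A} :
    f ∈ ariFil A B m ↔ ∀ n < m, ∀ x ∈ arLe C A.A n, f x = 0 := by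
  refine ⟨fun h n hn x hx => arLe_vanish (fun n hn => (cls_eq_arity C A.A).2 (h n hn)) hn hx,
    fun h n hn => (cls_eq_arity C A.A).1 (LinearMap.ext fun x => h n hn _ (cls_mem_arLe le_rfl x))⟩

theorem br_mem_ariFil (hC : C.IsReduced) {A B : HoAlg C} (m : ℕ) {n : ℕ} (hn : 1 ≤ n)
    (d : Fin n → ℤ) (x : Fin n → mapSp A B) (hx : ∀ i, x i ∈ ariFil A B m) :
    (mapSp A B).br n d x ∈ ariFil A B m := by
  rw [mapSp_br_eq]
  refine mem_ariFil_iff.2 fun N hN y hy => ?_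
  have h : ∀ y ∈ arLe C A.A N, ang C A.A B.A (Fin n) d x y = 0 := fun y hy => by
    -- The bracket of `n` maps starts in arity `n * m`, which is at least `m` because there is at
    -- least one map.
    refine arLe_vanish (m := n * m) (fun n' hn' => ang_cls_eq_zero d (fun _ => m)
      (fun j n hn => (cls_eq_arity C A.A).2 (hx j n hn)) (by simpa using hn')) ?_ hy
    exact hN.trans_le (Nat.le_mul_of_pos_left m hn)
  change proj C B.A (B.D (ang C A.A B.A (Fin n) d x y) -
    ksign k ((∑ j, d j : ℤ) : ZMod 2) • ang C A.A B.A (Fin n) d x (A.D y)) = 0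
  rw [h y hy, h _ (A.D_mem_arLe hC hy), map_zero, smul_zero, sub_zero, map_zero]

theorem conj_restrict_isSLieHom (hC : C.IsReduced) {A A' B B' : HoAlg C} (E : InftyHom A' A)
    (G : InftyHom B B') (m : ℕ) :
    IsSLieHom ((mapSp A B).restrict (ariFil A B m)) ((mapSp A' B').restrict (ariFil A' B' m))
      (conj E G) := by
  refine (conj_isSLieHom hC E G).restrict
    (fun n hn d x hx => br_mem_ariFil hC m hn d x fun i => (hx i).2)
    (fun n hn d x hx => br_mem_ariFil hC m hn d x fun i => (hx i).2) fun n hn d x hx => ?_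
  intro N hN
  refine conj_mem_ariFil hC E G d (fun _ => m) x (fun i => (hx i).2) N ?_
  rw [Finset.sum_const, Finset.card_univ, Fintype.card_fin, smul_eq_mul]
  exact hN.trans_le (Nat.le_mul_of_pos_left m hn)

/-! ### The linear terms -/

/-- `ang` for a single map. -/
def angOne (A B : DGVect k) (e : ℤ) :
    (Cofree C A →ₗ[k] B) →ₗ[k] (Cofree C A →ₗ[k] Cofree C B) where
  toFun f := ang C A B (Fin 1) (fun _ => e) fun _ => f
  map_add' f g := by
    have h := ang_update (C := C) (fun _ : Fin 1 => e) (fun _ => f) 0 1 f g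
    have hu : ∀ y : Cofree C A →ₗ[k] B, Function.update (fun _ : Fin 1 => f) 0 y = fun _ => y :=
      fun y => funext fun i => by rw [Subsingleton.elim i 0, Function.update_self]
    rw [one_smul, one_smul, hu, hu, hu] at h
    exact h
  map_smul' c f := by
    have h := ang_update (C := C) (fun _ : Fin 1 => e) (fun _ => f) 0 c f 0
    have hu : ∀ y : Cofree C A →ₗ[k] B, Function.update (fun _ : Fin 1 => f) 0 y = fun _ => y :=
      fun y => funext fun i => by rw [Subsingleton.elim i 0, Function.update_self]
    rw [add_zero, hu, hu, hu, ang_eq_zero (f := fun _ => 0) _ 0 rfl, add_zero] at h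
    exact h

theorem angOne_deg {A B : DGVect k} {e : ℤ} {f : Cofree C A →ₗ[k] B}
    (hf : HasDegree (cofree C A) B.toDGData e f) :
    HasDegree (cofree C A) (cofree C B) e (angOne A B e f) :=
  (ang_deg fun _ => hf).of_eq (Fin.sum_univ_one _)

theorem proj_angOne {A B : DGVect k} (e : ℤ) (f : Cofree C A →ₗ[k] B) :
    proj C B ∘ₗ angOne A B e f = f := proj_ang_fin_one _ _

/-- The differential of the mapping space, on elements of degree `e`. -/
def mapDiff (A B : HoAlg C) (e : ℤ) : (Cofree C A.A →ₗ[k] B.A) →ₗ[k] (Cofree C A.A →ₗ[k] B.A) :=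
  projDiff A B e ∘ₗ angOne A.A B.A e

theorem mapSp_br_one (A B : HoAlg C) (e : ℤ) (f : Cofree C A.A →ₗ[k] B.A) :
    (mapSp A B).br 1 (fun _ => e) (fun _ => f) = mapDiff A B e f := by
  rw [mapSp_br_eq, Fin.sum_univ_one]
  rfl

theorem mapDiff_eq (A B : HoAlg C) (e : ℤ) (f : Cofree C A.A →ₗ[k] B.A) :
    mapDiff A B e f = B.A.d ∘ₗ f - ksign k (e : ZMod 2) • f ∘ₗ A.D +
      (proj C B.A ∘ₗ B.Q) ∘ₗ angOne A.A B.A e f := by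
  rw [← mapSp_br_one, mapSp_br, dif_pos rfl]
  rfl

theorem bracketInside_one (L : SLieData k) {W : Type u} [AddCommGroup W] [Module k W]
    (f : ∀ n : ℕ, (Fin n → ℤ) → (Fin n → L) → W) (e : ℤ) (x : L) :
    bracketInside L f 1 (fun _ => e) (fun _ => x) =
      f 1 (fun _ => 1 + e) fun _ => L.br 1 (fun _ => e) fun _ => x := by
  -- The cardinalities of the singleton and of its complement are generalized to variables, so that
  -- the dependent types can be reduced by substitution.
  have hc : ∀ (c c' : ℕ) (e' : ℤ) (y : Fin c' → L) (d : Fin c → ℤ) (z : Fin c → L), c = 0 → c' = 1 →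
      f (c + 1) (Fin.cons e' d : Fin (c + 1) → ℤ) (Fin.cons (L.br c' (fun _ => e) fun _ => x) z :
        Fin (c + 1) → L) =
      f 1 (fun _ => e') fun _ => L.br 1 (fun _ => e) fun _ => x := by
    rintro c c' e' y d z rfl rfl
    congr 1 <;> funext i <;> rw [Subsingleton.elim (α := Fin 1) i 0] <;> rfl
  rw [bracketInside, Finset.sum_eq_single {0}]
  · rw [if_pos (Finset.singleton_nonempty 0), invParity_of_monotone, ksign_zero, one_smul,
      Finset.sum_singleton]
    · exact hc _ _ _ (fun _ => x) _ _ rfl rfl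
    · intro i j _
      rw [Subsingleton.elim i j]
  · intro S _ hS
    rw [if_neg]
    rintro ⟨i, hi⟩
    refine hS (Finset.eq_singleton_iff_unique_mem.2 ⟨?_, fun _ _ => Subsingleton.elim _ _⟩)
    rwa [Subsingleton.elim 0 i]
  · exact fun h => absurd (Finset.mem_univ _) h

/-- This is `bracketInside_ang` for one letter: `angOne` is a map of complexes from the mapping
space to Hom(C(A), C(B)) with the commutator differential. -/
theorem angOne_mapDiff (hC : C.IsReduced) {A B : HoAlg C} {e : ℤ} {f : Cofree C A.A →ₗ[k] B.A}
    (hf : HasDegree (cofree C A.A) B.A.toDGData e f) :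
    angOne A.A B.A (1 + e) (mapDiff A B e f) =
      B.D ∘ₗ angOne A.A B.A e f - ksign k (e : ZMod 2) • angOne A.A B.A e f ∘ₗ A.D := by
  have h := bracketInside_ang hC (d := fun _ : Fin 1 => e) (f := fun _ => f) fun _ => hf
  rw [bracketInside_one (mapSp A B) (fun m e g => ang C A.A B.A (Fin m) e g), Fin.sum_univ_one] at h
  rw [← mapSp_br_one]
  exact h

theorem mapDiff_deg {A B : HoAlg C} {e : ℤ} {f : Cofree C A.A →ₗ[k] B.A}
    (hf : HasDegree (cofree C A.A) B.A.toDGData e f) :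
    HasDegree (cofree C A.A) B.A.toDGData (1 + e) (mapDiff A B e f) :=
  projDiff_deg (angOne_deg hf)

theorem projDiff_projDiff (A B : HoAlg C) (e : ℤ) (X : Cofree C A.A →ₗ[k] Cofree C B.A) :
    projDiff A B (1 + e) (B.D ∘ₗ X - ksign k (e : ZMod 2) • X ∘ₗ A.D) = 0 := by
  have hA := LinearMap.congr_fun A.D_comp_D
  have hB := LinearMap.congr_fun B.D_comp_D
  simp only [LinearMap.comp_apply, LinearMap.zero_apply] at hA hB
  refine LinearMap.ext fun z => ?_
  change proj C B.A (B.D (B.D (X z) - ksign k (e : ZMod 2) • X (A.D z)) -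
    ksign k ((1 + e : ℤ) : ZMod 2) • (B.D (X (A.D z)) - ksign k (e : ZMod 2) • X (A.D (A.D z)))) = 0
  push_cast
  rw [ksign_add, ksign_one, hA, map_sub B.D, hB, map_smul B.D, map_zero, smul_zero, sub_zero, neg_one_mul,
    neg_smul, zero_sub, sub_neg_eq_add, neg_add_cancel, map_zero]

theorem mapDiff_mapDiff (hC : C.IsReduced) {A B : HoAlg C} {e : ℤ} {f : Cofree C A.A →ₗ[k] B.A}
    (hf : HasDegree (cofree C A.A) B.A.toDGData e f) :
    mapDiff A B (1 + e) (mapDiff A B e f) = 0 := by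
  rw [mapDiff, LinearMap.comp_apply, angOne_mapDiff hC hf, projDiff_projDiff]

/-- The linear term of the morphism induced by infinity-morphisms. -/
def conjOne {A A' B B' : HoAlg C} (E : InftyHom A' A) (G : InftyHom B B') (e : ℤ) :
    (Cofree C A.A →ₗ[k] B.A) →ₗ[k] (Cofree C A'.A →ₗ[k] B'.A) :=
  sandwich G.proj E.F ∘ₗ angOne A.A B.A e

/-- For a single letter the only grouping is the trivial one, so composing with G gives again an
`angOne`. -/
theorem F_comp_angOne (hC : C.IsReduced) {A : DGVect k} {B B' : HoAlg C} (G : InftyHom B B') {e : ℤ}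
    {f : Cofree C A →ₗ[k] B.A} (hf : HasDegree (cofree C A) B.A.toDGData e f) :
    G.F ∘ₗ angOne A B.A e f = angOne A B'.A e (G.proj ∘ₗ angOne A B.A e f) := by
  have h := G.comp_ang hC le_rfl (d := fun _ : Fin 1 => e) (f := fun _ => f) fun _ => hf
  refine h.trans ?_
  rw [Finset.Icc_self, Finset.sum_singleton, Nat.factorial_one, Nat.cast_one, inv_one, one_smul,
    Fintype.sum_unique, if_pos (Function.surjective_to_subsingleton _), invParity_of_monotone
      (fun i j _ => by rw [Subsingleton.elim i j]), ksign_zero, one_smul]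
  have h1 : ∀ j : Fin 1, Finset.univ.filter
      (fun i => (default : Fin 1 → Fin 1) i = j) = Finset.univ := fun j =>
    Finset.filter_true_of_mem fun _ _ => Subsingleton.elim _ _
  have h2 : angS Finset.univ (fun _ : Fin 1 => e) (fun _ => f) = angOne A B.A e f :=
    ang_reindex_of_monotone (Equiv.subtypeUnivEquiv Finset.mem_univ).symm (fun _ _ h => h)
      (fun _ => hf) (fun _ => rfl) fun _ => rfl
  simp only [← angS_eq_subword _ (fun _ : Fin 1 => hf), h1, h2]
  rw [Finset.univ_unique, Finset.sum_singleton]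
  rfl

theorem conjOne_mapDiff (hC : C.IsReduced) {A A' B B' : HoAlg C} (E : InftyHom A' A)
    (G : InftyHom B B') {e : ℤ} {f : Cofree C A.A →ₗ[k] B.A}
    (hf : HasDegree (cofree C A.A) B.A.toDGData e f) :
    conjOne E G (1 + e) (mapDiff A B e f) = mapDiff A' B' e (conjOne E G e f) := by
  rw [conjOne, LinearMap.comp_apply, angOne_mapDiff hC hf, sandwich_diff, mapDiff,
    LinearMap.comp_apply]
  congr 1
  have h1 : angOne A.A B.A e f ∘ₗ E.F = angOne A'.A B.A e (f ∘ₗ E.F) := ang_comp_F E _ _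
  have h2 := F_comp_angOne hC G ((HasDegree.comp hf E.hasDegree).of_eq (zero_add e))
  rw [← h1] at h2
  exact h2

theorem conjOne_deg {A A' B B' : HoAlg C} (E : InftyHom A' A) (G : InftyHom B B') {e : ℤ}
    {f : Cofree C A.A →ₗ[k] B.A} (hf : HasDegree (cofree C A.A) B.A.toDGData e f) :
    HasDegree (cofree C A'.A) B'.A.toDGData e (conjOne E G e f) :=
  (conj_deg E G e _ (angOne_deg hf)).of_eq (zero_add e)

end

/-! ### Complete filtered complexes -/

variable (k) in
/-- A cochain complex with a complete descending filtration. The differential on elements of degree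
`n` is `d n`. -/
structure FiltCx where
  carrier : Type u
  [acg : AddCommGroup carrier]
  [mod : Module k carrier]
  g : ℤ → Submodule k carrier
  d : ℤ → carrier →ₗ[k] carrier
  fil : ℕ → Submodule k carrier
  d_mem : ∀ {n n' : ℤ}, n + 1 = n' → ∀ x ∈ g n, d n x ∈ g n'
  d_d : ∀ {n n' : ℤ}, n + 1 = n' → ∀ x ∈ g n, d n' (d n x) = 0
  fil_zero : fil 0 = ⊤
  d_fil : ∀ (p : ℕ) (n : ℤ), ∀ x ∈ g n, x ∈ fil p → d n x ∈ fil p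
  separated : ∀ x, (∀ p, x ∈ fil p) → x = 0
  complete : ∀ (n : ℤ) (x : ℕ → carrier), (∀ i, x i ∈ g n ∧ x i ∈ fil i) →
    ∃ y ∈ g n, ∀ N, y - ∑ i ∈ Finset.range N, x i ∈ fil N

attribute [instance] FiltCx.acg FiltCx.mod

/-- Cone cocycles of a filtered map. -/
structure FiltCx.IsConeCocycle {X Y : FiltCx k} (U : ℤ → X.carrier →ₗ[k] Y.carrier) (m n : ℤ)
    (p : ℕ) (x : X.carrier) (y : Y.carrier) : Prop where
  mem_left : x ∈ X.g n
  mem_right : y ∈ Y.g m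
  fil_left : x ∈ X.fil p
  fil_right : y ∈ Y.fil p
  d_left : X.d n x = 0
  d_right : U n x = Y.d m y

/-- A filtered map of complexes. -/
structure FiltCx.IsFiltMap {X Y : FiltCx k} (U : ℤ → X.carrier →ₗ[k] Y.carrier) : Prop where
  mem : ∀ n, ∀ x ∈ X.g n, U n x ∈ Y.g n
  comm : ∀ {n n' : ℤ}, n + 1 = n' → ∀ x ∈ X.g n, U n' (X.d n x) = Y.d n (U n x)
  filt : ∀ (p : ℕ) (n : ℤ), ∀ x ∈ X.g n, x ∈ X.fil p → U n x ∈ Y.fil p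

/-- If cocycles of the cone can be bounded up to terms in the next step of the filtration then the
map is a quasi-isomorphism. -/
theorem FiltCx.IsFiltMap.isQuasiIso_of_step {X Y : FiltCx k} {U : ℤ → X.carrier →ₗ[k] Y.carrier}
    (hU : FiltCx.IsFiltMap U)
    (step : ∀ {l m n : ℤ}, l + 1 = m → m + 1 = n → ∀ p x y, FiltCx.IsConeCocycle U m n p x y →
      ∃ x' ∈ X.g m, ∃ y' ∈ Y.g l, x' ∈ X.fil p ∧ y' ∈ Y.fil p ∧
        x - X.d m x' ∈ X.fil (p + 1) ∧ y - U m x' - Y.d l y' ∈ Y.fil (p + 1)) :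
    IsQuasiIso X.g (fun n => X.d n) Y.g (fun n => Y.d n) (fun n => U n) := by
  -- Every cone cocycle is a boundary: the step is iterated on the remainders, and the corrections,
  -- which lie in deeper and deeper terms of the filtration, are summed by completeness.
  have main : ∀ {l m n : ℤ}, l + 1 = m → m + 1 = n → ∀ x y, FiltCx.IsConeCocycle U m n 0 x y →
      ∃ x' ∈ X.g m, ∃ y' ∈ Y.g l, x = X.d m x' ∧ y = U m x' + Y.d l y' := by
    intro l m n hl hm x y hxy
    have step' : ∀ (p : ℕ) (z : {z : X.carrier × Y.carrier // FiltCx.IsConeCocycle U m n p z.1 z.2}),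
        ∃ w : X.carrier × Y.carrier, w.1 ∈ X.g m ∧ w.2 ∈ Y.g l ∧ w.1 ∈ X.fil p ∧ w.2 ∈ Y.fil p ∧
          FiltCx.IsConeCocycle U m n (p + 1) (z.1.1 - X.d m w.1) (z.1.2 - U m w.1 - Y.d l w.2) := by
      rintro p ⟨⟨a, b⟩, hz⟩
      obtain ⟨x', hx', y', hy', h1, h2, h3, h4⟩ := step hl hm p a b hz
      refine ⟨(x', y'), hx', hy', h1, h2, ⟨Submodule.sub_mem _ hz.mem_left (X.d_mem hm _ hx'),
        Submodule.sub_mem _ (Submodule.sub_mem _ hz.mem_right (hU.mem _ _ hx'))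
          (Y.d_mem hl _ hy'), h3, h4, ?_, ?_⟩⟩
      · rw [map_sub, hz.d_left, X.d_d hm _ hx', sub_zero]
      · rw [map_sub, map_sub, map_sub, Y.d_d hl _ hy', hz.d_right, hU.comm hm _ hx', sub_zero]
    choose w h1 h2 h3 h4 h5 using step'
    let s : ∀ p : ℕ, {z : X.carrier × Y.carrier // FiltCx.IsConeCocycle U m n p z.1 z.2} :=
      Nat.rec ⟨(x, y), hxy⟩ fun p z =>
        ⟨(z.1.1 - X.d m (w p z).1, z.1.2 - U m (w p z).1 - Y.d l (w p z).2), h5 p z⟩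
    have hs : ∀ p, (s (p + 1)).1 = ((s p).1.1 - X.d m (w p (s p)).1,
      (s p).1.2 - U m (w p (s p)).1 - Y.d l (w p (s p)).2) := fun p => rfl
    obtain ⟨x', hx', hx'N⟩ := X.complete m (fun p => (w p (s p)).1) fun p => ⟨h1 _ _, h3 _ _⟩
    obtain ⟨y', hy', hy'N⟩ := Y.complete l (fun p => (w p (s p)).2) fun p => ⟨h2 _ _, h4 _ _⟩
    -- The N-th remainder is the cocycle minus the boundary of the partial sums. It lies in the N-th
    -- term, so by separatedness the boundary of the full sums is the cocycle itself.
    have hsum : ∀ N, (s N).1 = (x - X.d m (∑ p ∈ Finset.range N, (w p (s p)).1),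
        y - U m (∑ p ∈ Finset.range N, (w p (s p)).1) -
          Y.d l (∑ p ∈ Finset.range N, (w p (s p)).2)) := by
      intro N
      induction N with
      | zero => simp [s]
      | succ N ih =>
        rw [hs, ih, Finset.sum_range_succ, Finset.sum_range_succ, map_add, map_add, map_add]
        refine Prod.ext ?_ ?_
        · exact sub_sub _ _ _
        · dsimp only
          abel
    have hmx : ∀ N, x' - ∑ p ∈ Finset.range N, (w p (s p)).1 ∈ X.g m := fun N =>
      Submodule.sub_mem _ hx' (Submodule.sum_mem _ fun p _ => h1 _ _)
    have hmy : ∀ N, y' - ∑ p ∈ Finset.range N, (w p (s p)).2 ∈ Y.g l := fun N =>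
      Submodule.sub_mem _ hy' (Submodule.sum_mem _ fun p _ => h2 _ _)
    refine ⟨x', hx', y', hy', sub_eq_zero.1 (X.separated _ fun N => ?_),
      sub_eq_zero.1 (Y.separated _ fun N => ?_)⟩
    · have e := (s N).2.fil_left
      rw [hsum] at e
      have e' := Submodule.sub_mem _ e (X.d_fil N m _ (hmx N) (hx'N N))
      rw [map_sub] at e'
      dsimp only at e'
      convert e' using 1
      abel
    · have e := (s N).2.fil_right
      rw [hsum] at e
      have e' := Submodule.sub_mem _ (Submodule.sub_mem _ e (hU.filt N m _ (hmx N) (hx'N N)))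
        (Y.d_fil N l _ (hmy N) (hy'N N))
      rw [map_sub, map_sub] at e'
      dsimp only at e'
      convert e' using 1
      abel
  -- Injectivity on cohomology is exactness of the cone at pairs (x, y) with U x = d y; surjectivity
  -- is exactness at pairs (0, y).
  refine ⟨fun n x hx => ⟨hU.mem n x hx, hU.comm rfl x hx⟩, ?_, ?_⟩
  · rintro n x hx hdx ⟨y, hy, hxy⟩
    obtain ⟨z, hz, -, -, h, -⟩ := main (sub_add_cancel (n - 1) 1) (sub_add_cancel n 1) x y
      ⟨hx, hy, by rw [X.fil_zero]; trivial, by rw [Y.fil_zero]; trivial, hdx, hxy⟩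
    exact ⟨z, hz, h⟩
  · intro n y hy hdy
    obtain ⟨x, hx, z, hz, h, h'⟩ := main (sub_add_cancel n 1) rfl 0 y
      ⟨Submodule.zero_mem _, hy, Submodule.zero_mem _, by rw [Y.fil_zero]; trivial, map_zero _,
        by rw [map_zero]; exact hdy.symm⟩
    exact ⟨x, hx, h.symm, z, hz, h'⟩

/-- A filtered map of complete filtered complexes which is a homotopy equivalence up to terms
raising the filtration is a quasi-isomorphism. -/
theorem FiltCx.IsFiltMap.isQuasiIso_of_homotopy {X Y : FiltCx k}
    {U : ℤ → X.carrier →ₗ[k] Y.carrier} (hU : FiltCx.IsFiltMap U)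
    (V : ℤ → Y.carrier →ₗ[k] X.carrier) (H : ℤ → X.carrier →ₗ[k] X.carrier)
    (H' : ℤ → Y.carrier →ₗ[k] Y.carrier)
    (V_mem : ∀ n, ∀ y ∈ Y.g n, V n y ∈ X.g n)
    (V_fil : ∀ (p : ℕ) (n : ℤ), ∀ y ∈ Y.fil p, V n y ∈ X.fil p)
    (H_mem : ∀ {m n : ℤ}, m + 1 = n → ∀ x ∈ X.g n, H n x ∈ X.g m)
    (H_fil : ∀ (p : ℕ) (n : ℤ), ∀ x ∈ X.fil p, H n x ∈ X.fil p)
    (H'_mem : ∀ {m n : ℤ}, m + 1 = n → ∀ y ∈ Y.g n, H' n y ∈ Y.g m)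
    (H'_fil : ∀ (p : ℕ) (n : ℤ), ∀ y ∈ Y.fil p, H' n y ∈ Y.fil p)
    (hV : ∀ {n n' : ℤ}, n + 1 = n' → ∀ (p : ℕ), ∀ y ∈ Y.g n, y ∈ Y.fil p →
      X.d n (V n y) - V n' (Y.d n y) ∈ X.fil (p + 1))
    (hH : ∀ {m n n' : ℤ}, m + 1 = n → n + 1 = n' → ∀ (p : ℕ), ∀ x ∈ X.g n, x ∈ X.fil p →
      V n (U n x) - x - X.d m (H n x) - H n' (X.d n x) ∈ X.fil (p + 1))
    (hH' : ∀ {m n n' : ℤ}, m + 1 = n → n + 1 = n' → ∀ (p : ℕ), ∀ y ∈ Y.g n, y ∈ Y.fil p →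
      U n (V n y) - y - Y.d m (H' n y) - H' n' (Y.d n y) ∈ Y.fil (p + 1)) :
    IsQuasiIso X.g (fun n => X.d n) Y.g (fun n => Y.d n) (fun n => U n) := by
  refine hU.isQuasiIso_of_step fun {l m n} hl hm p x y hz => ?_
  -- Up to the next step of the filtration, d(V y) is V(d y) = V U x, and V U x - x is d(H x)
  -- because d x = 0. So V y - H x is an approximate primitive of x.
  have hx1 : V m y - H n x ∈ X.g m :=
    Submodule.sub_mem _ (V_mem _ _ hz.mem_right) (H_mem hm _ hz.mem_left)
  have hx1p : V m y - H n x ∈ X.fil p :=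
    Submodule.sub_mem _ (V_fil _ _ _ hz.fil_right) (H_fil _ _ _ hz.fil_left)
  set x1 := V m y - H n x with hx1def
  have hr : x - X.d m x1 ∈ X.fil (p + 1) := by
    have e1 := hV hm p y hz.mem_right hz.fil_right
    have e2 := hH hm rfl p x hz.mem_left hz.fil_left
    rw [hz.d_left, map_zero, sub_zero, hz.d_right] at e2
    have e3 := Submodule.neg_mem _ (Submodule.add_mem _ e1 e2)
    rw [hx1def, map_sub]
    convert e3 using 1
    abel
  have hrm : x - X.d m x1 ∈ X.g n := Submodule.sub_mem _ hz.mem_left (X.d_mem hm _ hx1)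
  -- The remainder w is a cocycle up to the next step, hence w is approximately U(V w) - d(H' w).
  -- Adding V w to x1 therefore absorbs it, and disturbs d x1 only by d(V w), which is approximately
  -- V(d w) and so of higher filtration.
  set w := y - U m x1 with hw
  have hwm : w ∈ Y.g m := Submodule.sub_mem _ hz.mem_right (hU.mem _ _ hx1)
  have hwp : w ∈ Y.fil p := Submodule.sub_mem _ hz.fil_right (hU.filt _ _ _ hx1 hx1p)
  have hdw : Y.d m w ∈ Y.fil (p + 1) := by
    rw [hw, map_sub, ← hz.d_right, ← hU.comm hm _ hx1, ← map_sub]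
    exact hU.filt _ _ _ hrm hr
  refine ⟨x1 + V m w, Submodule.add_mem _ hx1 (V_mem _ _ hwm), -H' m w,
    Submodule.neg_mem _ (H'_mem hl _ hwm), Submodule.add_mem _ hx1p (V_fil _ _ _ hwp),
    Submodule.neg_mem _ (H'_fil _ _ _ hwp), ?_, ?_⟩
  · have e := Submodule.sub_mem _ (Submodule.sub_mem _ hr (hV hm p w hwm hwp)) (V_fil (p + 1) n _ hdw)
    rw [map_add]
    convert e using 1
    abel
  · have e := Submodule.neg_mem _ (Submodule.add_mem _ (hH' hl hm p w hwm hwp)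
      (H'_fil (p + 1) n _ hdw))
    rw [map_add, map_neg]
    convert e using 1
    rw [hw]
    abel

/-! ### The coradical filtration of the cofree coalgebra -/

section

variable {C : Cooperad k} (Fil : C.Filtration)

/-- The filtration of `C`, shifted so that it starts with zero. -/
def Cooperad.Filtration.fl (s : ℕ) (I : Type) [Finite I] : Submodule k (C.obj I) :=
  match s with
  | 0 => ⊥
  | m + 1 => Fil.fil m I

theorem Cooperad.Filtration.fil_le {m n : ℕ} (h : m ≤ n) (I : Type) [Finite I] :
    Fil.fil m I ≤ Fil.fil n I := by
  induction h with
  | refl => exact le_rfl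
  | step _ ih => exact ih.trans (Fil.fil_mono _ I)

theorem Cooperad.Filtration.fl_mono {s t : ℕ} (h : s ≤ t) (I : Type) [Finite I] :
    Fil.fl s I ≤ Fil.fl t I := by
  cases s with
  | zero => exact bot_le
  | succ s => cases t with
    | zero => omega
    | succ t => exact Fil.fil_le (by omega) I

theorem Cooperad.Filtration.par_mem_fl {s : ℕ} {I : Type} [Finite I] {c : C.obj I}
    (hc : c ∈ Fil.fl s I) (b : ZMod 2) : (C.obj I).par b c ∈ Fil.fl s I := by
  cases s with
  | zero =>
    rw [(Submodule.mem_bot k).1 hc, map_zero]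
    exact Submodule.zero_mem _
  | succ m =>
    refine (Fil.fil_graded m I).trans (iSup_le fun n => ?_ :
      _ ≤ (Fil.fil m I).comap ((C.obj I).par b)) hc
    rintro x ⟨hx, hn⟩
    rw [Submodule.mem_comap, (C.obj I).par_apply n x hn]
    split_ifs
    · exact hx
    · exact Submodule.zero_mem _

theorem Cooperad.Filtration.tw_mem_fl {s : ℕ} {I : Type} [Finite I] {c : C.obj I}
    (hc : c ∈ Fil.fl s I) (m : ℤ) : (C.obj I).tw m c ∈ Fil.fl s I :=
  Submodule.add_mem _ (Fil.par_mem_fl hc 0) (Submodule.smul_mem _ _ (Fil.par_mem_fl hc 1))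

theorem Cooperad.Filtration.d_mem_fl {s : ℕ} {I : Type} [Finite I] {c : C.obj I}
    (hc : c ∈ Fil.fl s I) : (C.obj I).d c ∈ Fil.fl s I := by
  cases s with
  | zero =>
    rw [(Submodule.mem_bot k).1 hc, map_zero]
    exact Submodule.zero_mem _
  | succ m => exact Fil.d_mem m I c hc

theorem Cooperad.Filtration.map_mem_fl {s : ℕ} {I J : Type} [Finite I] [Finite J] (e : I ≃ J)
    {c : C.obj I} (hc : c ∈ Fil.fl s I) : C.map e c ∈ Fil.fl s J := by
  cases s with
  | zero =>
    rw [(Submodule.mem_bot k).1 hc, map_zero]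
    exact Submodule.zero_mem _
  | succ m => exact Fil.map_mem m e c hc

/-- The part of `C(I) ⊗ W` given by a term of the filtration of `C(I)`. -/
def Cooperad.Filtration.tens (s : ℕ) (I : Type) [Finite I] (W : Type u) [AddCommGroup W]
    [Module k W] : Submodule k (C.obj I ⊗[k] W) :=
  Submodule.span k {z | ∃ c ∈ Fil.fl s I, ∃ w, z = c ⊗ₜ w}

section

variable {Fil} {s : ℕ} {I : Type} [Finite I] {W : Type u} [AddCommGroup W] [Module k W]

theorem Cooperad.Filtration.tmul_mem_tens {c : C.obj I} (hc : c ∈ Fil.fl s I) (w : W) :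
    c ⊗ₜ w ∈ Fil.tens s I W := Submodule.subset_span ⟨c, hc, w, rfl⟩

theorem Cooperad.Filtration.tens_le {S : Submodule k (C.obj I ⊗[k] W)}
    (h : ∀ c ∈ Fil.fl s I, ∀ w, c ⊗ₜ w ∈ S) : Fil.tens s I W ≤ S := by
  refine Submodule.span_le.2 ?_
  rintro _ ⟨c, hc, w, rfl⟩
  exact h c hc w

theorem Cooperad.Filtration.tens_mono {t : ℕ} (h : s ≤ t) : Fil.tens s I W ≤ Fil.tens t I W :=
  Cooperad.Filtration.tens_le fun _ hc w =>
    Cooperad.Filtration.tmul_mem_tens (Fil.fl_mono h I hc) w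

theorem Cooperad.Filtration.map_mem_tens {J : Type} [Finite J] {W' : Type u} [AddCommGroup W']
    [Module k W'] {f : C.obj I →ₗ[k] C.obj J} (hf : ∀ c ∈ Fil.fl s I, f c ∈ Fil.fl s J)
    (g : W →ₗ[k] W') {x : C.obj I ⊗[k] W} (hx : x ∈ Fil.tens s I W) :
    TensorProduct.map f g x ∈ Fil.tens s J W' :=
  (Cooperad.Filtration.tens_le (S := (Fil.tens s J W').comap (TensorProduct.map f g))
    fun c hc w => by
      rw [Submodule.mem_comap, TensorProduct.map_tmul]
      exact Cooperad.Filtration.tmul_mem_tens (hf c hc) _) hx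

theorem Cooperad.Filtration.exists_mem_tens (x : C.obj I ⊗[k] W) : ∃ s, x ∈ Fil.tens s I W := by
  induction x using TensorProduct.induction_on with
  | zero => exact ⟨0, Submodule.zero_mem _⟩
  | tmul c w =>
    obtain ⟨m, hm⟩ := Fil.cocomplete I c
    exact ⟨m + 1, Cooperad.Filtration.tmul_mem_tens (s := m + 1) hm w⟩
  | add x y hx hy =>
    obtain ⟨s, hs⟩ := hx
    obtain ⟨t, ht⟩ := hy
    exact ⟨max s t, Submodule.add_mem _ (Cooperad.Filtration.tens_mono (le_max_left _ _) hs)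
      (Cooperad.Filtration.tens_mono (le_max_right _ _) ht)⟩

end

variable (A : DGVect k)

/-- The coradical filtration of the cofree coalgebra. Its first term is `A`. -/
def Cooperad.Filtration.lt (s : ℕ) : Submodule k (Cofree C A) :=
  ⨆ n : ℕ, (Fil.tens s (Fin n) (⨂[k] _ : Fin n, A)).map (cls C A n)

variable {Fil A}

theorem Cooperad.Filtration.cls_mem_lt {s n : ℕ} {x}
    (hx : x ∈ Fil.tens s (Fin n) (⨂[k] _ : Fin n, A)) : cls C A n x ∈ Fil.lt A s :=
  Submodule.mem_iSup_of_mem n (Submodule.mem_map_of_mem hx)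

theorem Cooperad.Filtration.lt_le {s : ℕ} {S : Submodule k (Cofree C A)}
    (h : ∀ n, ∀ x ∈ Fil.tens s (Fin n) (⨂[k] _ : Fin n, A), cls C A n x ∈ S) :
    Fil.lt A s ≤ S := by
  refine iSup_le fun n => ?_
  rintro _ ⟨x, hx, rfl⟩
  exact h n x hx

theorem Cooperad.Filtration.lt_le_of_tmul {s : ℕ} {S : Submodule k (Cofree C A)}
    (h : ∀ n, ∀ c ∈ Fil.fl s (Fin n), ∀ a, cls C A n (c ⊗ₜ a) ∈ S) : Fil.lt A s ≤ S :=
  Cooperad.Filtration.lt_le fun n _ hx => (Cooperad.Filtration.tens_le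
    (S := S.comap (cls C A n)) fun c hc a => h n c hc a) hx

theorem Cooperad.Filtration.lt_mono {s t : ℕ} (h : s ≤ t) : Fil.lt A s ≤ Fil.lt A t :=
  Cooperad.Filtration.lt_le fun _ _ hx =>
    Cooperad.Filtration.cls_mem_lt (Cooperad.Filtration.tens_mono h hx)

theorem Cooperad.Filtration.lt_zero : Fil.lt A 0 = ⊥ := by
  refine le_bot_iff.1 (Cooperad.Filtration.lt_le_of_tmul fun n c hc a => ?_)
  rw [(Submodule.mem_bot k).1 hc, TensorProduct.zero_tmul, map_zero]
  exact Submodule.zero_mem _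

theorem Cooperad.Filtration.exists_mem_lt (x : Cofree C A) : ∃ s, x ∈ Fil.lt A s := by
  refine Cofree.induction (P := fun x => ∃ s, x ∈ Fil.lt A s) (fun n x => ?_)
    ⟨0, Submodule.zero_mem _⟩ ?_ x
  · obtain ⟨s, hs⟩ := Cooperad.Filtration.exists_mem_tens (Fil := Fil) x
    exact ⟨s, Cooperad.Filtration.cls_mem_lt hs⟩
  · rintro x y ⟨s, hs⟩ ⟨t, ht⟩
    exact ⟨max s t, Submodule.add_mem _ (Cooperad.Filtration.lt_mono (le_max_left _ _) hs)
      (Cooperad.Filtration.lt_mono (le_max_right _ _) ht)⟩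

theorem Cooperad.Filtration.clsOn_mem_lt {s : ℕ} {I : Type} [Fintype I] [LinearOrder I] {x}
    (hx : x ∈ Fil.tens s I (⨂[k] _ : I, A)) : clsOn C A I x ∈ Fil.lt A s :=
  Cooperad.Filtration.cls_mem_lt
    (Cooperad.Filtration.map_mem_tens (fun _ hc => Fil.map_mem_fl _ hc) _ hx)

/-- The compatibility of the filtration with decompositions gives pure tensors without homogeneity,
so the formula is needed on arbitrary tensors, with the parity projections spelled out; these
preserve the filtration. -/
theorem collect_tmul (X : Type u) [AddCommGroup X] [Module k X] {I J : Type} [Fintype I]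
    [LinearOrder I] [Fintype J] [LinearOrder J] (p : I → J) (c : X) (y : ∀ j, C.obj {i // p i = j})
    (a : I → A) :
    collect C A X p ((c ⊗ₜ PiTensorProduct.tprod k y) ⊗ₜ PiTensorProduct.tprod k a) =
      ∑ s : J → ZMod 2, ∑ t : I → ZMod 2, ksign k (invParity p t + crossParity p s t) •
        (c ⊗ₜ PiTensorProduct.tprod k fun j => clsOn C A {i // p i = j}
          ((C.obj {i // p i = j}).par (s j) (y j) ⊗ₜ
            PiTensorProduct.tprod k fun i => A.par (t i.1) (a i.1))) := by
  rw [collect, LinearMap.comp_apply, LinearEquiv.coe_coe, TensorProduct.assoc_tmul,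
    TensorProduct.map_tmul, LinearMap.comp_apply, regroup, LinearMap.comp_apply,
    LinearMap.comp_apply, LinearMap.sum_apply]
  simp only [LinearMap.sum_apply, map_sum, TensorProduct.tmul_sum, LinearMap.smul_apply, map_smul,
    TensorProduct.tmul_smul]
  refine Finset.sum_congr rfl fun s _ => Finset.sum_congr rfl fun t _ => ?_
  rw [TensorProduct.map_tmul, TensorProduct.map_tmul, PiTensorProduct.map_tprod,
    PiTensorProduct.map_tprod, nest_tprod, TensorProduct.lift.tmul, LinearMap.id_apply,
    LinearMap.id_apply, PiTensorProduct.map₂_tprod_tprod, PiTensorProduct.map_tprod]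
  rfl

variable [CharZero k]

theorem Cooperad.Filtration.tw_mem_lt {s : ℕ} {x : Cofree C A} (hx : x ∈ Fil.lt A s) (m : ℤ) :
    (cofree C A).tw m x ∈ Fil.lt A s := by
  have hpar : ∀ (b : ZMod 2) (n : ℕ) (c : C.obj (Fin n)), c ∈ Fil.fl s (Fin n) →
      ∀ a : ⨂[k] _ : Fin n, A, (tensorPower C A n).par b (c ⊗ₜ a) ∈
        Fil.tens s (Fin n) (⨂[k] _ : Fin n, A) := by
    intro b n c hc a
    change (∑ b', TensorProduct.map ((C.obj (Fin n)).par b')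
      ((DGData.pi fun _ : Fin n => A.toDGData).par (b - b')) : _ →ₗ[k] _) (c ⊗ₜ[k] a) ∈ _
    rw [LinearMap.sum_apply]
    exact Submodule.sum_mem _ fun b' _ =>
      Cooperad.Filtration.tmul_mem_tens (Fil.par_mem_fl hc b') _
  refine (Cooperad.Filtration.lt_le_of_tmul (S := (Fil.lt A s).comap ((cofree C A).tw m))
    fun n c hc a => ?_) hx
  rw [Submodule.mem_comap, tw_cls]
  exact Cooperad.Filtration.cls_mem_lt (Submodule.add_mem _ (hpar 0 n c hc a)
    (Submodule.smul_mem _ _ (hpar 1 n c hc a)))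

theorem Cooperad.Filtration.d_mem_lt {s : ℕ} {x : Cofree C A} (hx : x ∈ Fil.lt A s) :
    (cofree C A).d x ∈ Fil.lt A s := by
  refine (Cooperad.Filtration.lt_le_of_tmul (S := (Fil.lt A s).comap (cofree C A).d)
    fun n c hc a => ?_) hx
  rw [Submodule.mem_comap, cofree_d_cls, DGData.tensor_d_tmul]
  exact Cooperad.Filtration.cls_mem_lt (Submodule.add_mem _
    (Cooperad.Filtration.tmul_mem_tens (Fil.d_mem_fl hc) _)
    (Cooperad.Filtration.tmul_mem_tens (Fil.tw_mem_fl hc 1) _))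

end

/-! ### Effect of `ang`, of coderivations and of infinity-morphisms on the coradical filtration. -/

section

variable {C : Cooperad k} {Fil : C.Filtration} {A B : DGVect k} [CharZero k]

/-- The contribution of a homogeneous summand of the comultiplication along `p`. -/
theorem koszulMap_collect_mem_tens {n : ℕ} {J : Type} [Fintype J] [LinearOrder J] (d : J → ℤ)
    {f : J → (Cofree C A →ₗ[k] B)} {r : J → ℕ} (hf : ∀ j, ∀ x ∈ Fil.lt A (r j), f j x = 0)
    {t : ℕ} {p : Fin n → J} {m₀ : ℕ} {m' : J → ℕ} (hm : m₀ + 1 + ∑ j, m' j ≤ t + ∑ j, r j)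
    {y : C.obj J} (hy : y ∈ Fil.fil m₀ J) {y' : ∀ j, C.obj {i // p i = j}}
    (hy' : ∀ j, y' j ∈ Fil.fil (m' j) {i // p i = j}) (a : ⨂[k] _ : Fin n, A) :
    koszulMap (C.obj J).toDGData (fun _ => cofree C A) (fun _ => B.toDGData) d f
      (collect C A (C.obj J) p ((y ⊗ₜ PiTensorProduct.tprod k y') ⊗ₜ a)) ∈
      Fil.tens t J (⨂[k] _ : J, B) := by
  have ha : a ∈ Submodule.span k (Set.range (PiTensorProduct.tprod k)) := by
    rw [PiTensorProduct.span_tprod_eq_top]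
    trivial
  induction ha using Submodule.span_induction with
  | zero =>
    rw [TensorProduct.tmul_zero, map_zero, map_zero]
    exact Submodule.zero_mem _
  | add a b _ _ ha hb =>
    rw [TensorProduct.tmul_add, map_add, map_add]
    exact Submodule.add_mem _ ha hb
  | smul c a _ ha =>
    rw [TensorProduct.tmul_smul, map_smul, map_smul]
    exact Submodule.smul_mem _ _ ha
  | mem a ha =>
    obtain ⟨a, rfl⟩ := ha
    rw [collect_tmul, map_sum]
    refine Submodule.sum_mem _ fun s _ => ?_
    rw [map_sum]
    refine Submodule.sum_mem _ fun u _ => ?_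
    rw [map_smul, koszulMap, TensorProduct.map_tmul, PiTensorProduct.map_tprod]
    refine Submodule.smul_mem _ _ ?_
    -- Because of the shift by one, `fil (m' j)` is `fl (m' j + 1)`. If `m' j < r j` for some j the
    -- tensor is killed by `f j`; otherwise the inequality `hm` leaves `m₀ + 1 ≤ t` for the root
    -- decoration.
    by_cases h : ∃ j, m' j < r j
    · obtain ⟨j, hj⟩ := h
      rw [(PiTensorProduct.tprod k).map_coord_zero j, TensorProduct.tmul_zero]
      · exact Submodule.zero_mem _
      · refine hf j _ (Fil.tw_mem_lt ?_ _)
        refine Fil.lt_mono (Nat.succ_le_of_lt hj) (Fil.clsOn_mem_lt (Fil.tmul_mem_tens ?_ _))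
        exact Fil.par_mem_fl (s := m' j + 1) (hy' j) _
    · simp only [not_exists, not_lt] at h
      refine Fil.tmul_mem_tens (Fil.tw_mem_fl (Fil.fl_mono ?_ J (?_ : y ∈ Fil.fl (m₀ + 1) J)) _) _
      · have := Finset.sum_le_sum fun j (_ : j ∈ Finset.univ) => h j
        omega
      · exact hy

/-- Each map `f j` needs an input of filtration beyond `r j`. Along a decomposition the filtrations
add up, so what remains for the root decoration is lowered by the sum of the `r j`. -/
theorem ang_mem_lt {J : Type} [Fintype J] [LinearOrder J] (d : J → ℤ)
    {f : J → (Cofree C A →ₗ[k] B)} {r : J → ℕ} (hf : ∀ j, ∀ x ∈ Fil.lt A (r j), f j x = 0)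
    {s t : ℕ} (hs : s ≤ t + ∑ j, r j) {x : Cofree C A} (hx : x ∈ Fil.lt A s) :
    ang C A B J d f x ∈ Fil.lt B t := by
  cases s with
  | zero =>
    rw [Fil.lt_zero, Submodule.mem_bot] at hx
    rw [hx, map_zero]
    exact Submodule.zero_mem _
  | succ s =>
    refine (Fil.lt_le_of_tmul (S := (Fil.lt B t).comap (ang C A B J d f)) fun n c hc a => ?_) hx
    rw [Submodule.mem_comap, ang, LinearMap.comp_apply, LinearMap.comp_apply, comulOn_cls, map_sum,
      map_sum]
    refine Submodule.sum_mem _ fun p _ => Fil.clsOn_mem_lt ?_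
    rw [comulTree, LinearMap.comp_apply, TensorProduct.map_tmul, LinearMap.id_apply]
    have h := Fil.decomp_mem s p c hc
    refine (Submodule.span_le (p := (Fil.tens t J (⨂[k] _ : J, B)).comap
      ((koszulMap (C.obj J).toDGData (fun _ => cofree C A) (fun _ => B.toDGData) d f) ∘ₗ
        collect C A (C.obj J) p ∘ₗ (TensorProduct.mk k _ _).flip a))).2 ?_ h
    rintro _ ⟨m₀, m', y, y', hm, hy, hy', rfl⟩
    exact koszulMap_collect_mem_tens d hf (by omega) hy hy' a

theorem ang_mem_lt_self {J : Type} [Fintype J] [LinearOrder J] (d : J → ℤ)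
    (f : J → (Cofree C A →ₗ[k] B)) {s : ℕ} {x : Cofree C A} (hx : x ∈ Fil.lt A s) :
    ang C A B J d f x ∈ Fil.lt B s :=
  ang_mem_lt d (r := fun _ => 0) (fun j x hx => by
    rw [Fil.lt_zero, Submodule.mem_bot] at hx
    rw [hx, map_zero]) (by simp) hx

/-- `ang` lowers the filtration if one of the maps vanishes on cogenerators. -/
theorem ang_mem_lt_sub {J : Type} [Fintype J] [LinearOrder J] (d : J → ℤ)
    {f : J → (Cofree C A →ₗ[k] B)} {p t : ℕ} (j : J) (hf : ∀ x ∈ Fil.lt A p, f j x = 0)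
    {x : Cofree C A} (hx : x ∈ Fil.lt A (t + p)) : ang C A B J d f x ∈ Fil.lt B t :=
  ang_mem_lt d (r := Pi.single j p) (fun i x hx => by
    by_cases h : i = j
    · subst h
      rw [Pi.single_eq_same] at hx
      exact hf x hx
    · rw [Pi.single_eq_of_ne h, Fil.lt_zero, Submodule.mem_bot] at hx
      rw [hx, map_zero]) (by simp) hx

theorem angOne_mem_lt {e : ℤ} {f : Cofree C A →ₗ[k] B} {p t : ℕ} (hf : ∀ x ∈ Fil.lt A p, f x = 0)
    {x : Cofree C A} (hx : x ∈ Fil.lt A (t + p)) : angOne A B e f x ∈ Fil.lt B t :=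
  ang_mem_lt_sub _ (0 : Fin 1) hf hx

theorem proj_incl (a : A) : proj C A (incl C A a) = a := by
  rw [incl, LinearMap.comp_apply, LinearMap.comp_apply, proj_cls_one, TensorProduct.mk_apply,
    TensorProduct.map_tmul, C.counit_unit, TensorProduct.lid_tmul, one_smul]
  exact LinearEquiv.apply_symm_apply _ _

theorem cls_unit_mem_range_incl (b : ⨂[k] _ : Fin 1, A) :
    cls C A 1 (C.unit ⊗ₜ b) ∈ LinearMap.range (incl C A) :=
  ⟨PiTensorProduct.subsingletonEquiv (R := k) (s := fun _ : Fin 1 => A.carrier) 0 b, by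
    rw [incl, LinearMap.comp_apply, LinearMap.comp_apply, LinearEquiv.coe_coe,
      LinearEquiv.symm_apply_apply, TensorProduct.mk_apply]⟩

/-- The term `fil 0` is the coaugmentation, which is nonzero only in arity one, and there its class
with a letter is the image of that letter in C(A). -/
theorem lt_one_eq : Fil.lt A 1 = LinearMap.range (incl C A) := by
  refine le_antisymm (Fil.lt_le_of_tmul fun n c hc a => ?_) ?_
  · have hc : c ∈ C.coaug (Fin n) := by rw [← Fil.fil_zero]; exact hc
    refine (Submodule.span_le (p := (LinearMap.range (incl C A)).comap
      (cls C A n ∘ₗ (TensorProduct.mk k _ _).flip a))).2 ?_ hc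
    rintro _ ⟨e, rfl⟩
    obtain rfl : n = 1 := by simpa using (Fintype.card_congr e).symm
    obtain rfl : e = Equiv.refl _ := Subsingleton.elim _ _
    rw [C.map_refl]
    exact cls_unit_mem_range_incl a
  · rintro _ ⟨a, rfl⟩
    refine Fil.cls_mem_lt (Fil.tmul_mem_tens ?_ _)
    change C.unit ∈ Fil.fil 0 (Fin 1)
    rw [Fil.fil_zero]
    refine Submodule.subset_span ⟨Equiv.refl _, ?_⟩
    rw [C.map_refl]
    rfl

theorem incl_proj {x : Cofree C A} (hx : x ∈ Fil.lt A 1) : incl C A (proj C A x) = x := by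
  rw [lt_one_eq] at hx
  obtain ⟨a, rfl⟩ := hx
  rw [proj_incl]

/-- On the first term where `f` can be nonzero, `angOne` already lands in the cogenerators and is
therefore determined by its projection, which is `f`. -/
theorem angOne_eq_incl {e : ℤ} {f : Cofree C A →ₗ[k] B} {p : ℕ} (hf : ∀ x ∈ Fil.lt A p, f x = 0)
    {x : Cofree C A} (hx : x ∈ Fil.lt A (p + 1)) : angOne A B e f x = incl C B (f x) := by
  rw [← LinearMap.congr_fun (proj_angOne e f) x, LinearMap.comp_apply,
    incl_proj (angOne_mem_lt (t := 1) hf (by rwa [add_comm]))]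

theorem HoAlg.Q_lt_one (A : HoAlg C) {x : Cofree C A.A} (hx : x ∈ Fil.lt A.A 1) : A.Q x = 0 := by
  rw [lt_one_eq] at hx
  obtain ⟨a, rfl⟩ := hx
  exact LinearMap.congr_fun A.Q_incl a

/-- Every term of `HoAlg.Q_eq` contains `p ∘ Q`, which vanishes on A, the first term of the
filtration; so each term lowers the filtration by one. -/
theorem HoAlg.Q_mem_lt (hC : C.IsReduced) (A : HoAlg C) {s : ℕ} {x : Cofree C A.A}
    (hx : x ∈ Fil.lt A.A (s + 1)) : A.Q x ∈ Fil.lt A.A s := by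
  obtain ⟨N, hN⟩ := exists_mem_arLe x
  rw [A.Q_eq hC hN]
  refine Submodule.sum_mem _ fun m _ => Submodule.smul_mem _ _ ?_
  refine Submodule.sum_mem _ fun i _ => ang_mem_lt_sub _ i (fun y hy => ?_) hx
  rw [Function.update_self, LinearMap.comp_apply, A.Q_lt_one hy, map_zero]

theorem InftyHom.F_mem_lt (hC : C.IsReduced) {A B : HoAlg C} (F : InftyHom A B) {s : ℕ}
    {x : Cofree C A.A} (hx : x ∈ Fil.lt A.A s) : F.F x ∈ Fil.lt B.A s := by
  obtain ⟨N, hN⟩ := exists_mem_arLe x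
  rw [F.F_eq hC hN]
  exact Submodule.sum_mem _ fun m _ => Submodule.smul_mem _ _ (ang_mem_lt_self _ _ hx)

theorem HoAlg.D_mem_lt (hC : C.IsReduced) (A : HoAlg C) {s : ℕ} {x : Cofree C A.A}
    (hx : x ∈ Fil.lt A.A s) : A.D x ∈ Fil.lt A.A s :=
  Submodule.add_mem _ (Fil.d_mem_lt hx)
    (A.Q_mem_lt hC (Fil.lt_mono (Nat.le_succ s) hx))

/-- The differential of the mapping space respects the coradical filtration. -/
theorem mapDiff_vanish (hC : C.IsReduced) {A B : HoAlg C} {e : ℤ} {f : Cofree C A.A →ₗ[k] B.A}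
    {p : ℕ} (hf : ∀ x ∈ Fil.lt A.A p, f x = 0) {x : Cofree C A.A} (hx : x ∈ Fil.lt A.A p) :
    mapDiff A B e f x = 0 := by
  have h : angOne A.A B.A e f x = 0 := by
    rw [← Submodule.mem_bot k, ← Fil.lt_zero]
    exact angOne_mem_lt (t := 0) hf (by rwa [zero_add])
  rw [mapDiff_eq, LinearMap.add_apply, LinearMap.sub_apply, LinearMap.smul_apply,
    LinearMap.comp_apply, LinearMap.comp_apply, LinearMap.comp_apply, hf x hx,
    hf _ (A.D_mem_lt hC hx), h]
  simp

/-- The leading term of the differential of the mapping space. -/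
theorem mapDiff_lt_succ (hC : C.IsReduced) {A B : HoAlg C} {e : ℤ} {f : Cofree C A.A →ₗ[k] B.A}
    {p : ℕ} (hf : ∀ x ∈ Fil.lt A.A p, f x = 0) {x : Cofree C A.A} (hx : x ∈ Fil.lt A.A (p + 1)) :
    mapDiff A B e f x = B.A.d (f x) - ksign k (e : ZMod 2) • f ((cofree C A.A).d x) := by
  -- The image of `x` lies in the cogenerators of C(B), where Q_B vanishes. The other correction, f
  -- ∘ Q_A, vanishes because Q_A sends `x` into the term killed by `f`.
  have h : B.Q (angOne A.A B.A e f x) = 0 :=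
    B.Q_lt_one (angOne_mem_lt (t := 1) hf (by rwa [add_comm]))
  rw [mapDiff_eq, LinearMap.add_apply, LinearMap.sub_apply, LinearMap.smul_apply,
    LinearMap.comp_apply, LinearMap.comp_apply, LinearMap.comp_apply, LinearMap.comp_apply, h,
    map_zero, add_zero, HoAlg.D, LinearMap.add_apply, map_add f, hf _ (A.Q_mem_lt hC hx), add_zero]

end

/-! ### Functoriality of the cofree coalgebra -/

section

variable {C : Cooperad k} {Fil : C.Filtration} {A B : DGVect k}

theorem koszulMap_zero {J : Type} [Fintype J] [LinearOrder J] {X : DGData k} (hX : X.IsGraded)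
    {V W : J → DGData k} (hV : ∀ j, (V j).IsGraded) (f : ∀ j, V j →ₗ[k] W j) :
    koszulMap X V W (fun _ => 0) f = TensorProduct.map LinearMap.id (PiTensorProduct.map f) := by
  have h : ∀ s : Finset J, (((∑ _j ∈ s, (0 : ℤ)) : ℤ) : ZMod 2) = 0 := fun s => by simp
  rw [koszulMap, hX.tw_eq_id (h _)]
  congr 2
  funext i
  rw [(hV i).tw_eq_id (h _), LinearMap.comp_id]

/-- A telescoping sum which replaces `g` by `f` in one tensor factor at a time, from the left. -/
theorem map_pi_sub {J : Type} [Fintype J] [LinearOrder J] (X : Type u) [AddCommGroup X] [Module k X]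
    {V W : J → Type u} [∀ j, AddCommGroup (V j)] [∀ j, Module k (V j)] [∀ j, AddCommGroup (W j)]
    [∀ j, Module k (W j)] (f g : ∀ j, V j →ₗ[k] W j) :
    (TensorProduct.map LinearMap.id (PiTensorProduct.map f) -
      TensorProduct.map LinearMap.id (PiTensorProduct.map g) :
        X ⊗[k] (⨂[k] j, V j) →ₗ[k] X ⊗[k] (⨂[k] j, W j)) =
      ∑ i, TensorProduct.map LinearMap.id (PiTensorProduct.map fun j =>
        if j < i then f j else if j = i then f j - g j else g j) := by
  have h := ((LinearMap.lTensorHom X).compMultilinearMap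
    (PiTensorProduct.mapMultilinear k V W)).map_piecewise_sub_map_piecewise f g g Finset.univ
  simp only [Finset.mem_univ, if_true, Finset.piecewise_univ] at h
  exact h

variable [CharZero k]

theorem ang_zero {J : Type} [Fintype J] [LinearOrder J] (f : J → (Cofree C A →ₗ[k] B)) :
    ang C A B J (fun _ => 0) f =
      clsOn C B J ∘ₗ TensorProduct.map LinearMap.id (PiTensorProduct.map f) ∘ₗ comulOn C A J := by
  rw [ang]
  congr 2
  exact koszulMap_zero (C.obj J).isGraded (V := fun _ => cofree C A)
    (W := fun _ => B.toDGData) (fun _ => cofree_isGraded C A) f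

theorem ang_sub_ang {J : Type} [Fintype J] [LinearOrder J] (f g : J → (Cofree C A →ₗ[k] B)) :
    ang C A B J (fun _ => 0) f - ang C A B J (fun _ => 0) g =
      ∑ i, ang C A B J (fun _ => 0)
        fun j => if j < i then f j else if j = i then f j - g j else g j := by
  simp only [ang_zero]
  rw [← LinearMap.comp_sub, ← LinearMap.sub_comp, map_pi_sub, sum_linearMap_comp,
    linearMap_comp_sum]

/-- If two families of maps agree on cogenerators then their `ang` agree up to the filtration. -/
theorem ang_sub_ang_mem_lt {J : Type} [Fintype J] [LinearOrder J] {f g : J → (Cofree C A →ₗ[k] B)}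
    (h : ∀ j, ∀ x ∈ Fil.lt A 1, f j x = g j x) {s : ℕ} {x : Cofree C A} (hx : x ∈ Fil.lt A (s + 1)) :
    ang C A B J (fun _ => 0) f x - ang C A B J (fun _ => 0) g x ∈ Fil.lt B s := by
  rw [← LinearMap.sub_apply, ang_sub_ang, LinearMap.sum_apply]
  refine Submodule.sum_mem _ fun i _ => ang_mem_lt_sub _ i (fun y hy => ?_) hx
  rw [if_neg (lt_irrefl i), if_pos rfl, LinearMap.sub_apply, h i y hy, sub_self]

variable (C) in
/-- The map `C(A) → C(B)` induced by a map `A → B` of degree zero. -/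
def Cofree.map (φ : A →ₗ[k] B) : Cofree C A →ₗ[k] Cofree C B :=
  descend fun n => cls C B n ∘ₗ TensorProduct.map LinearMap.id (PiTensorProduct.map fun _ => φ)

theorem Cofree.map_cls {φ : A →ₗ[k] B} (hφ : HasDegree A.toDGData B.toDGData 0 φ) (n : ℕ) (x) :
    Cofree.map C φ (cls C A n x) =
      cls C B n (TensorProduct.map LinearMap.id (PiTensorProduct.map fun _ => φ) x) := by
  rw [Cofree.map, descend_cls, LinearMap.comp_apply]
  intro e x
  have h : TensorProduct.map LinearMap.id (PiTensorProduct.map fun _ : Fin n => φ) ∘ₗ act C A n e =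
      act C B n e ∘ₗ TensorProduct.map LinearMap.id (PiTensorProduct.map fun _ : Fin n => φ) := by
    change TensorProduct.map _ _ ∘ₗ TensorProduct.map _ _ =
      TensorProduct.map _ _ ∘ₗ TensorProduct.map _ _
    rw [← TensorProduct.map_comp, ← TensorProduct.map_comp, LinearMap.id_comp, LinearMap.comp_id]
    congr 1
    exact reorder_natural e A.isGraded B.isGraded hφ
  rw [LinearMap.comp_apply, ← LinearMap.comp_apply _ (act C A n e), h, LinearMap.comp_apply, cls_act,
    LinearMap.comp_apply]

theorem Cofree.map_comp {D : DGVect k} {φ : A →ₗ[k] B} {ψ : B →ₗ[k] D}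
    (hφ : HasDegree A.toDGData B.toDGData 0 φ) (hψ : HasDegree B.toDGData D.toDGData 0 ψ) :
    Cofree.map C (ψ ∘ₗ φ) = Cofree.map C ψ ∘ₗ Cofree.map C φ := by
  refine Cofree.ext fun n x => ?_
  rw [LinearMap.comp_apply, Cofree.map_cls hφ, Cofree.map_cls hψ,
    Cofree.map_cls ((hψ.comp hφ).of_eq (add_zero 0)), ← LinearMap.comp_apply (TensorProduct.map _ _),
    ← TensorProduct.map_comp, ← PiTensorProduct.map_comp, LinearMap.id_comp]

theorem Cofree.map_deg {φ : A →ₗ[k] B} (hφ : HasDegree A.toDGData B.toDGData 0 φ) :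
    HasDegree (cofree C A) (cofree C B) 0 (Cofree.map C φ) := by
  intro i x hx
  refine (?_ : (cofree C A).gr i ≤ ((cofree C B).gr (i + 0)).comap (Cofree.map C φ)) hx
  refine iSup_le fun n => ?_
  rintro _ ⟨x, hx, rfl⟩
  rw [Submodule.mem_comap, Cofree.map_cls hφ]
  exact cls_mem_gr C B (((HasDegree.id (C.obj (Fin n)).toDGData).tensor
    (HasDegree.pi fun _ : Fin n => hφ)).of_eq (by simp) i x hx)

theorem Cofree.map_d {φ : A →ₗ[k] B} (hφ : IsChain A.toDGData B.toDGData φ) :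
    Cofree.map C φ ∘ₗ (cofree C A).d = (cofree C B).d ∘ₗ Cofree.map C φ := by
  refine Cofree.ext fun n x => ?_
  rw [LinearMap.comp_apply, LinearMap.comp_apply, cofree_d_cls, Cofree.map_cls hφ.deg,
    Cofree.map_cls hφ.deg, cofree_d_cls]
  exact congrArg _ (LinearMap.congr_fun ((IsChain.id (C.obj (Fin n)).toDGData).tensor
    (C.obj _).isGraded (C.obj _).isGraded (IsChain.pi (fun _ : Fin n => A.isGraded)
      (fun _ => B.isGraded) fun _ => hφ)).comm x)

theorem Cofree.map_mem_lt {φ : A →ₗ[k] B} (hφ : HasDegree A.toDGData B.toDGData 0 φ) {s : ℕ}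
    {x : Cofree C A} (hx : x ∈ Fil.lt A s) : Cofree.map C φ x ∈ Fil.lt B s := by
  refine (Fil.lt_le (S := (Fil.lt B s).comap (Cofree.map C φ)) fun n y hy => ?_) hx
  rw [Submodule.mem_comap, Cofree.map_cls hφ]
  exact Fil.cls_mem_lt (Fil.map_mem_tens (fun _ h => h) _ hy)

theorem Cofree.map_mem_arLe {φ : A →ₗ[k] B} (hφ : HasDegree A.toDGData B.toDGData 0 φ) {N : ℕ}
    {x : Cofree C A} (hx : x ∈ arLe C A N) : Cofree.map C φ x ∈ arLe C B N := by
  refine (iSup_le fun n => ?_ : arLe C A N ≤ (arLe C B N).comap (Cofree.map C φ)) hx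
  rintro _ ⟨y, rfl⟩
  rw [Submodule.mem_comap, Cofree.map_cls hφ]
  exact cls_mem_arLe n.2 _

/-- This is the exponential formula of `InftyHom.F_eq` with `φ ∘ p` in place of F', which allows a
comparison term by term. -/
theorem Cofree.map_eq {φ : A →ₗ[k] B} (hφ : HasDegree A.toDGData B.toDGData 0 φ) {N : ℕ}
    {x : Cofree C A} (hx : x ∈ arLe C A N) :
    Cofree.map C φ x = ∑ m ∈ Finset.range (N + 1), (m.factorial : k)⁻¹ •
      ang C A B (Fin m) (fun _ => 0) (fun _ => φ ∘ₗ proj C A) x := by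
  conv_lhs => rw [← reconstruct hx, map_sum]
  refine Finset.sum_congr rfl fun m _ => ?_
  rw [map_smul, Cofree.map_cls hφ, ang_zero, clsOn_eq_cls, comulOn_fin, LinearMap.comp_apply,
    LinearMap.comp_apply, PiTensorProduct.map_comp, ← LinearMap.comp_apply (TensorProduct.map _ _),
    ← TensorProduct.map_comp, LinearMap.id_comp]

/-- An infinity-morphism agrees with the map induced by its linear term up to the filtration. -/
theorem InftyHom.F_sub_map_mem_lt (hC : C.IsReduced) {A B : HoAlg C} (F : InftyHom A B)
    (hF : HasDegree A.A.toDGData B.A.toDGData 0 F.linearTerm) {s : ℕ} {x : Cofree C A.A}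
    (hx : x ∈ Fil.lt A.A (s + 1)) : F.F x - Cofree.map C F.linearTerm x ∈ Fil.lt B.A s := by
  obtain ⟨N, hN⟩ := exists_mem_arLe x
  rw [F.F_eq hC hN, Cofree.map_eq hF hN, ← Finset.sum_sub_distrib]
  refine Submodule.sum_mem _ fun m _ => ?_
  rw [← smul_sub]
  -- On A, the first term of the filtration, both F' and the linear term composed with the
  -- projection are the linear term.
  refine Submodule.smul_mem _ _ (ang_sub_ang_mem_lt (fun _ y hy => ?_) hx)
  rw [InftyHom.linearTerm, LinearMap.comp_apply, LinearMap.comp_apply, incl_proj hy]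

/-! ### Functoriality for homotopies -/

/-- The homotopy induced by a homotopy `h` between `φ` and the identity on `C(n) ⊗ A^{⊗ n}`. -/
def tensHtp (C : Cooperad k) (φ h : A →ₗ[k] A) (n : ℕ) :
    tensorPower C A n →ₗ[k] tensorPower C A n :=
  ∑ i, koszulMap (C.obj (Fin n)).toDGData (fun _ => A.toDGData) (fun _ => A.toDGData)
    (Pi.single i (-1)) fun j => if j < i then φ else if j = i then h else LinearMap.id

variable {φ h : A →ₗ[k] A}

theorem htp_deg (hφ : HasDegree A.toDGData A.toDGData 0 φ)
    (hh : HasDegree A.toDGData A.toDGData (-1) h) {n : ℕ} (i j : Fin n) :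
    HasDegree A.toDGData A.toDGData ((Pi.single i (-1) : Fin n → ℤ) j)
      (if j < i then φ else if j = i then h else LinearMap.id) := by
  by_cases h1 : j < i
  · rw [if_pos h1, Pi.single_eq_of_ne h1.ne]
    exact hφ
  · rw [if_neg h1]
    by_cases h2 : j = i
    · subst h2
      rw [if_pos rfl, Pi.single_eq_same]
      exact hh
    · rw [if_neg h2, Pi.single_eq_of_ne h2]
      exact HasDegree.id _

theorem tensHtp_deg (hφ : HasDegree A.toDGData A.toDGData 0 φ)
    (hh : HasDegree A.toDGData A.toDGData (-1) h) (n : ℕ) :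
    HasDegree (tensorPower C A n) (tensorPower C A n) (-1) (tensHtp C φ h n) := by
  intro m x hx
  rw [tensHtp, LinearMap.sum_apply]
  exact Submodule.sum_mem _ fun i _ => (koszulMap_deg (C.obj _).isGraded
    (V := fun _ : Fin n => A.toDGData) (W := fun _ => A.toDGData) (fun _ => A.isGraded)
      (htp_deg hφ hh i)).of_eq (by simp) m x hx

/-- In the graded commutator with the differential the factors `φ` and the identities are chain maps
and contribute nothing. Only the `i`-th factor does, where the commutator of `h` is `φ - id`. -/
theorem koszulMap_htp_d (hφ : IsChain A.toDGData A.toDGData φ)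
    (hh : HasDegree A.toDGData A.toDGData (-1) h)
    (hd : φ - LinearMap.id = A.d ∘ₗ h + h ∘ₗ A.d) {n : ℕ} (i : Fin n) :
    (tensorPower C A n).d ∘ₗ
        koszulMap (C.obj (Fin n)).toDGData (fun _ => A.toDGData) (fun _ => A.toDGData)
          (Pi.single i (-1)) (fun j => if j < i then φ else if j = i then h else LinearMap.id) =
      -(koszulMap (C.obj (Fin n)).toDGData (fun _ => A.toDGData) (fun _ => A.toDGData)
          (Pi.single i (-1)) (fun j => if j < i then φ else if j = i then h else LinearMap.id) ∘ₗ
        (tensorPower C A n).d) +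
      TensorProduct.map LinearMap.id (PiTensorProduct.map fun j =>
        if j < i then φ else if j = i then φ - LinearMap.id else LinearMap.id) := by
  refine (koszulMap_commutator (C.obj (Fin n)).isGraded (V := fun _ : Fin n => A.toDGData)
    (W := fun _ => A.toDGData) (fun _ => A.isGraded) (fun _ => A.isGraded)
    (htp_deg hφ.deg hh i) (C.obj (Fin n)).d_deg (D := fun _ => A.d) (fun _ => A.d_deg)
    fun _ => A.d).trans ?_
  congr 1
  · have : (∑ j, ((Pi.single i (-1) : Fin n → ℤ) j : ZMod 2)) = 1 := by
      rw [← Int.cast_sum]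
      simp
    rw [this, ksign_one]
    exact neg_one_smul k (koszulMap (C.obj (Fin n)).toDGData (fun _ => A.toDGData)
      (fun _ => A.toDGData) (Pi.single i (-1))
      (fun j => if j < i then φ else if j = i then h else LinearMap.id) ∘ₗ (tensorPower C A n).d)
  · rw [Finset.sum_eq_single i]
    · have h0 : (∑ a with a < i, ((Pi.single i (-1) : Fin n → ℤ) a : ZMod 2)) = 0 :=
        Finset.sum_eq_zero fun a ha => by
          rw [Pi.single_eq_of_ne (Finset.mem_filter.1 ha).2.ne, Int.cast_zero]
      have h1 : (Pi.single i (-1) + Pi.single i 1 : Fin n → ℤ) = fun _ => 0 := by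
        rw [← Pi.single_add, neg_add_cancel, Pi.single_zero]
        rfl
      rw [h0, h1, ksign_zero, one_smul, koszulMap_zero (C.obj _).isGraded
        (V := fun _ : Fin n => A.toDGData) (W := fun _ => A.toDGData) fun _ => A.isGraded]
      congr 2
      funext j
      by_cases hj : j = i
      · subst hj
        rw [Function.update_self, if_neg (lt_irrefl j), if_pos rfl, if_neg (lt_irrefl j),
          if_pos rfl, hd, Pi.single_eq_same, Int.cast_neg, Int.cast_one]
        have : ksign k (-1) = -1 := ksign_one
        rw [this, neg_one_smul, sub_neg_eq_add]
      · rw [Function.update_of_ne hj, if_neg hj, if_neg hj]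
    · intro j _ hj
      have h0 : (A.d ∘ₗ (if j < i then φ else if j = i then h else LinearMap.id) -
          ksign k (((Pi.single i (-1) : Fin n → ℤ) j : ℤ) : ZMod 2) •
            (if j < i then φ else if j = i then h else LinearMap.id) ∘ₗ A.d :
              A →ₗ[k] A) = 0 := by
        rw [Pi.single_eq_of_ne hj, Int.cast_zero, ksign_zero, one_smul, if_neg hj]
        split_ifs
        · exact sub_eq_zero.2 hφ.comm.symm
        · exact sub_self _
      refine (congrArg (ksign k _ • ·) ?_).trans (smul_zero _)
      rw [koszulMap, pi_map_eq_zero _ j, TensorProduct.map_zero_right]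
      rw [Function.update_self]
      exact (congrArg (· ∘ₗ _) h0).trans (LinearMap.zero_comp _)
    · exact fun h => absurd (Finset.mem_univ _) h

/-- The contributions of the positions `i` are the terms of the telescoping sum for the difference
between the tensor power of `φ` and the identity. -/
theorem tensHtp_d (hφ : IsChain A.toDGData A.toDGData φ)
    (hh : HasDegree A.toDGData A.toDGData (-1) h)
    (hd : φ - LinearMap.id = A.d ∘ₗ h + h ∘ₗ A.d) (n : ℕ) (x : tensorPower C A n) :
    (tensorPower C A n).d (tensHtp C φ h n x) + tensHtp C φ h n ((tensorPower C A n).d x) =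
      TensorProduct.map LinearMap.id (PiTensorProduct.map fun _ => φ) x - x := by
  have e1 := map_pi_sub (k := k) (C.obj (Fin n)) (V := fun _ : Fin n => A.carrier) (W := fun _ => A.carrier)
    (fun _ => φ) fun _ => LinearMap.id
  rw [PiTensorProduct.map_id, TensorProduct.map_id] at e1
  refine Eq.trans ?_ (LinearMap.congr_fun e1 x).symm
  rw [tensHtp, LinearMap.sum_apply, LinearMap.sum_apply, map_sum, ← Finset.sum_add_distrib,
    LinearMap.sum_apply]
  refine Finset.sum_congr rfl fun i _ => ?_
  have e2 := LinearMap.congr_fun (koszulMap_htp_d (C := C) hφ hh hd i) x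
  refine (congrArg (· + _) e2).trans ?_
  rw [LinearMap.add_apply, LinearMap.neg_apply, LinearMap.comp_apply, neg_add_eq_sub]
  exact sub_add_cancel _ _

variable (C) in
/-- The homotopy on `C(A)` induced by a homotopy between `φ` and the identity. -/
def Cofree.htp (φ h : A →ₗ[k] A) : Cofree C A →ₗ[k] Cofree C A :=
  descend fun n => cls C A n ∘ₗ tensHtp C φ h n

/-- The average over the symmetric group. -/
def average (C : Cooperad k) (A : DGVect k) (n : ℕ) : tensorPower C A n →ₗ[k] tensorPower C A n :=
  (n.factorial : k)⁻¹ • ∑ e : Equiv.Perm (Fin n), act C A n e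

/-- The homotopy treats the positions before and after `i` differently and is not assumed
equivariant, so `descend_cls` is not available and the average remains. -/
theorem Cofree.htp_cls (n : ℕ) (x) : Cofree.htp C φ h (cls C A n x) =
    cls C A n (tensHtp C φ h n (average C A n x)) := by
  rw [Cofree.htp, descend_cls_eq, LinearMap.comp_apply, average, LinearMap.smul_apply,
    LinearMap.sum_apply]

theorem cls_average (n : ℕ) (x) : cls C A n (average C A n x) = cls C A n x := by
  have h := descend_cls (φ := fun n => cls C A n) (fun e x => cls_act C A n e x) x
  rw [descend_cls_eq] at h
  rw [average, LinearMap.smul_apply, LinearMap.sum_apply]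
  exact h

/-- Averaging commutes with the differential and does not change classes, so the homotopy identity
on tensor powers descends to C(A). -/
theorem average_d (n : ℕ) (x) :
    average C A n ((tensorPower C A n).d x) = (tensorPower C A n).d (average C A n x) := by
  rw [average, LinearMap.smul_apply, LinearMap.sum_apply, LinearMap.smul_apply, LinearMap.sum_apply,
    map_smul, map_sum]
  congr 1
  exact Finset.sum_congr rfl fun e _ => LinearMap.congr_fun (map_reorder_comm e
    (C.obj (Fin n)).isGraded (C.obj (Fin n)).isGraded (fun _ : Fin n => A.isGraded)
      (fun _ => A.d_deg) (C.map_chain e).isChain) x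

theorem Cofree.htp_d (hφ : IsChain A.toDGData A.toDGData φ)
    (hh : HasDegree A.toDGData A.toDGData (-1) h)
    (hd : φ - LinearMap.id = A.d ∘ₗ h + h ∘ₗ A.d) (x : Cofree C A) :
    (cofree C A).d (Cofree.htp C φ h x) + Cofree.htp C φ h ((cofree C A).d x) =
      Cofree.map C φ x - x := by
  refine LinearMap.congr_fun (f := (cofree C A).d ∘ₗ Cofree.htp C φ h +
    Cofree.htp C φ h ∘ₗ (cofree C A).d) (g := Cofree.map C φ - LinearMap.id)
    (Cofree.ext fun n x => ?_) x
  rw [LinearMap.add_apply, LinearMap.comp_apply, LinearMap.comp_apply, cofree_d_cls,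
    Cofree.htp_cls, Cofree.htp_cls, cofree_d_cls, average_d, ← map_add, tensHtp_d hφ hh hd, map_sub,
    cls_average, ← Cofree.map_cls hφ.deg, cls_average]
  rfl

theorem Cofree.htp_deg (hφ : HasDegree A.toDGData A.toDGData 0 φ)
    (hh : HasDegree A.toDGData A.toDGData (-1) h) :
    HasDegree (cofree C A) (cofree C A) (-1) (Cofree.htp C φ h) := by
  intro i x hx
  refine (?_ : (cofree C A).gr i ≤ ((cofree C A).gr (i + -1)).comap (Cofree.htp C φ h)) hx
  refine iSup_le fun n => ?_
  rintro _ ⟨x, hx, rfl⟩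
  rw [Submodule.mem_comap, Cofree.htp_cls]
  refine cls_mem_gr C A (tensHtp_deg hφ hh n i _ ?_)
  rw [average, LinearMap.smul_apply, LinearMap.sum_apply]
  refine Submodule.smul_mem _ _ (Submodule.sum_mem _ fun e _ => ?_)
  have := act_deg C A n e i x hx
  rwa [add_zero] at this

theorem Cofree.htp_mem_lt {s : ℕ} {x : Cofree C A} (hx : x ∈ Fil.lt A s) :
    Cofree.htp C φ h x ∈ Fil.lt A s := by
  refine (Fil.lt_le (S := (Fil.lt A s).comap (Cofree.htp C φ h)) fun n y hy => ?_) hx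
  rw [Submodule.mem_comap, Cofree.htp_cls]
  refine Fil.cls_mem_lt ?_
  rw [tensHtp, LinearMap.sum_apply]
  refine Submodule.sum_mem _ fun i _ => Fil.map_mem_tens (fun _ h => Fil.tw_mem_fl h _) _ ?_
  rw [average, LinearMap.smul_apply, LinearMap.sum_apply]
  exact Submodule.smul_mem _ _ (Submodule.sum_mem _ fun e _ =>
    Fil.map_mem_tens (fun _ h => Fil.map_mem_fl e h) _ hy)

theorem Cofree.htp_mem_arLe {N : ℕ} {x : Cofree C A} (hx : x ∈ arLe C A N) :
    Cofree.htp C φ h x ∈ arLe C A N := by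
  refine (iSup_le fun n => ?_ : arLe C A N ≤ (arLe C A N).comap (Cofree.htp C φ h)) hx
  rintro _ ⟨y, rfl⟩
  rw [Submodule.mem_comap, Cofree.htp_cls]
  exact cls_mem_arLe n.2 _

end

/-! ### Homotopy inverses -/

/-- An exact complex of vector spaces has a contraction. -/
theorem exists_contraction {K : Type u} [AddCommGroup K] [Module k K] (g : ℤ → Submodule k K)
    (D : K →ₗ[k] K) (hD : ∀ n, ∀ x ∈ g n, D x ∈ g (n + 1)) (hDD : ∀ x, D (D x) = 0)
    (hex : ∀ m n : ℤ, m + 1 = n → ∀ x ∈ g n, D x = 0 → ∃ y ∈ g m, D y = x) :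
    ∃ s : ℤ → K →ₗ[k] K, (∀ m n : ℤ, m + 1 = n → ∀ x ∈ g n, s n x ∈ g m) ∧
      ∀ n, ∀ x ∈ g n, D (s n x) + s (n + 1) (D x) = x := by
  -- Over a field the surjection of D onto the cocycles has a linear section, which is then extended
  -- to the whole space.
  have hσ : ∀ n : ℤ, ∃ σ : K →ₗ[k] K, ∀ m, m + 1 = n → ∀ x ∈ g n, D x = 0 →
      σ x ∈ g m ∧ D (σ x) = x := by
    intro n
    let Z : Submodule k K := g n ⊓ LinearMap.ker D
    let E : g (n - 1) →ₗ[k] Z := (D ∘ₗ (g (n - 1)).subtype).codRestrict Z fun x =>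
      ⟨by simpa using hD _ _ x.2, hDD _⟩
    have hE : LinearMap.range E = ⊤ := by
      refine LinearMap.range_eq_top.2 fun z => ?_
      obtain ⟨y, hy, h⟩ := hex _ _ (sub_add_cancel n 1) z.1 z.2.1 z.2.2
      exact ⟨⟨y, hy⟩, Subtype.ext h⟩
    obtain ⟨ρ, hρ⟩ := E.exists_rightInverse_of_surjective hE
    obtain ⟨σ, hs⟩ := LinearMap.exists_extend ((g (n - 1)).subtype ∘ₗ ρ)
    refine ⟨σ, fun m hm x hx hx0 => ?_⟩
    obtain rfl : m = n - 1 := by omega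
    have h1 : σ x = (ρ ⟨x, hx, hx0⟩).1 := LinearMap.congr_fun hs ⟨x, hx, hx0⟩
    rw [h1]
    exact ⟨(ρ _).2, congrArg Subtype.val (LinearMap.congr_fun hρ ⟨x, hx, hx0⟩)⟩
  choose σ hσ using hσ
  have key : ∀ n, ∀ x ∈ g n, σ (n + 1) (D x) ∈ g n ∧ D (σ (n + 1) (D x)) = D x := fun n x hx =>
    hσ (n + 1) n rfl _ (hD n x hx) (hDD x)
  -- The operator 1 - σ D projects to the cocycles, where σ is a section of D. On a boundary D x the
  -- correction vanishes, since D D = 0.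
  refine ⟨fun n => σ n ∘ₗ (LinearMap.id - σ (n + 1) ∘ₗ D), fun m n hm x hx => ?_, fun n x hx => ?_⟩
  · refine (hσ n m hm _ (Submodule.sub_mem _ hx (key n x hx).1) ?_).1
    exact (map_sub D _ _).trans (sub_eq_zero.2 (key n x hx).2.symm)
  · have h1 := (hσ n (n - 1) (sub_add_cancel n 1) (x - σ (n + 1) (D x))
      (Submodule.sub_mem _ hx (key n x hx).1)
      ((map_sub D _ _).trans (sub_eq_zero.2 (key n x hx).2.symm))).2
    simp only [LinearMap.comp_apply, LinearMap.sub_apply, LinearMap.id_apply]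
    rw [h1, hDD, map_zero, sub_zero, sub_add_cancel]

theorem DGVect.exists_glue (V : DGVect k) {W : Type u} [AddCommGroup W] [Module k W]
    (f : ℤ → V →ₗ[k] W) : ∃ F : V →ₗ[k] W, ∀ n, ∀ x ∈ V.gr n, F x = f n x := by
  let e := LinearEquiv.ofBijective (DirectSum.coeLinearMap V.gr) V.isInternal
  refine ⟨DirectSum.toModule k ℤ W (fun n => f n ∘ₗ (V.gr n).subtype) ∘ₗ e.symm.toLinearMap,
    fun n x hx => ?_⟩
  have h : e.symm x = DirectSum.lof k ℤ (fun n => V.gr n) n ⟨x, hx⟩ := by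
    rw [LinearEquiv.symm_apply_eq]
    exact (DirectSum.coeLinearMap_lof V.gr n ⟨x, hx⟩).symm
  rw [LinearMap.comp_apply, LinearEquiv.coe_coe, h, DirectSum.toModule_lof]
  rfl

theorem isChain_of_isQuasiIso {A B : DGVect k} {φ : A →ₗ[k] B}
    (hφ : IsQuasiIso A.gr (fun _ => A.d) B.gr (fun _ => B.d) fun _ => φ) :
    IsChain A.toDGData B.toDGData φ where
  deg n x hx := by
    rw [add_zero]
    exact (hφ.1 n x hx).1
  comm := A.isGraded.ext fun n x hx => (hφ.1 n x hx).2

/-- The cone of a quasi-isomorphism is exact. -/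
theorem cone_exact {A B : DGVect k} {φ : A →ₗ[k] B}
    (hφ : IsQuasiIso A.gr (fun _ => A.d) B.gr (fun _ => B.d) fun _ => φ) {m n : ℤ} (hm : m + 1 = n)
    {x : A} {y : B} (hx : x ∈ A.gr (n + 1)) (hy : y ∈ B.gr n) (hdx : A.d x = 0)
    (hxy : φ x + B.d y = 0) :
    ∃ x' ∈ A.gr n, ∃ y' ∈ B.gr m, x = -A.d x' ∧ y = φ x' + B.d y' := by
  obtain ⟨z, hz, hxz⟩ := hφ.2.1 (n + 1) x hx hdx ⟨-y, by
    rw [add_sub_cancel_right]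
    exact Submodule.neg_mem _ hy, by
    change φ x = B.d (-y)
    rw [map_neg]
    exact eq_neg_of_add_eq_zero_left hxy⟩
  rw [add_sub_cancel_right] at hz
  have hzφ : φ z ∈ B.gr n ∧ φ (A.d z) = B.d (φ z) := hφ.1 n z hz
  dsimp only at hxz
  -- With x = d z the element y + φ z is a cocycle, because φ x + d y = 0; a representative x' of
  -- its class in A corrects the primitive z.
  obtain ⟨x', hx', hdx', w, hw, h⟩ := hφ.2.2 n (y + φ z) (Submodule.add_mem _ hy hzφ.1) (by
    change B.d (y + φ z) = 0
    rw [map_add, ← hzφ.2, ← hxz, add_comm]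
    exact hxy)
  obtain rfl : m = n - 1 := by omega
  dsimp only at hdx' h
  refine ⟨x' - z, Submodule.sub_mem _ hx' hz, w, hw, ?_, ?_⟩
  · rw [map_sub, hdx', zero_sub, neg_neg]
    exact hxz
  · rw [map_sub, sub_add_eq_add_sub, ← h, add_sub_cancel_right]

/-- A quasi-isomorphism of complexes of vector spaces is a homotopy equivalence. -/
theorem exists_homotopy_inverse {A B : DGVect k} {φ : A →ₗ[k] B}
    (hφ : IsQuasiIso A.gr (fun _ => A.d) B.gr (fun _ => B.d) fun _ => φ) :
    ∃ (ψ : B →ₗ[k] A) (h : A →ₗ[k] A) (h' : B →ₗ[k] B), IsChain B.toDGData A.toDGData ψ ∧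
      HasDegree A.toDGData A.toDGData (-1) h ∧ HasDegree B.toDGData B.toDGData (-1) h' ∧
      ψ ∘ₗ φ - LinearMap.id = A.d ∘ₗ h + h ∘ₗ A.d ∧
      φ ∘ₗ ψ - LinearMap.id = B.d ∘ₗ h' + h' ∘ₗ B.d := by
  have hc := isChain_of_isQuasiIso hφ
  have hcd : ∀ x, φ (A.d x) = B.d (φ x) := LinearMap.congr_fun hc.comm
  let D : (A × B) →ₗ[k] (A × B) := LinearMap.prod (-(A.d ∘ₗ LinearMap.fst k A B))
    (φ ∘ₗ LinearMap.fst k A B + B.d ∘ₗ LinearMap.snd k A B)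
  have hD : ∀ x y, D (x, y) = (-A.d x, φ x + B.d y) := fun x y => rfl
  -- The cone, with Aⁿ⁺¹ ⊕ Bⁿ in degree n, is exact. Its contraction has the homotopy inverse and
  -- both homotopies among its matrix entries: B → A is ψ, A → A is h, and B → B is -h'.
  obtain ⟨s, hs, hDs⟩ := exists_contraction (fun n => (A.gr (n + 1)).prod (B.gr n)) D
    (by
      rintro n ⟨x, y⟩ ⟨hx, hy⟩
      rw [hD]
      exact ⟨Submodule.neg_mem _ (A.d_mem _ _ hx),
        Submodule.add_mem _ (hφ.1 _ _ hx).1 (B.d_mem _ _ hy)⟩)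
    (by
      rintro ⟨x, y⟩
      rw [hD, hD, map_neg, map_neg, A.d_d, map_add, B.d_d, hcd, add_zero, neg_add_cancel, neg_neg]
      rfl)
    (by
      rintro m n hm ⟨x, y⟩ ⟨hx, hy⟩ h
      rw [hD] at h
      obtain ⟨h1, h2⟩ := Prod.mk.inj h
      obtain ⟨x', hx', y', hy', e1, e2⟩ := cone_exact hφ hm hx hy (neg_eq_zero.1 h1) h2
      refine ⟨(x', y'), ⟨by rw [hm]; exact hx', hy'⟩, ?_⟩
      rw [hD, ← e1, ← e2])
  obtain ⟨ψ, hψ⟩ := B.exists_glue fun n => LinearMap.fst k A B ∘ₗ s n ∘ₗ LinearMap.inr k A B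
  obtain ⟨b, hb⟩ := B.exists_glue fun n => LinearMap.snd k A B ∘ₗ s n ∘ₗ LinearMap.inr k A B
  obtain ⟨h, hh⟩ := A.exists_glue fun n => LinearMap.fst k A B ∘ₗ s (n - 1) ∘ₗ LinearMap.inl k A B
  have e1 : ∀ n, ∀ y ∈ B.gr n, s n (0, y) = (ψ y, b y) := fun n y hy =>
    Prod.ext (hψ n y hy).symm (hb n y hy).symm
  have e2 : ∀ n, ∀ x ∈ A.gr (n + 1), (s n (x, 0)).1 = h x := fun n x hx => by
    rw [hh _ x hx, add_sub_cancel_right]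
    rfl
  have m1 : ∀ n, ∀ y ∈ B.gr n, ((0, y) : A × B) ∈ (A.gr (n + 1)).prod (B.gr n) := fun n y hy =>
    ⟨Submodule.zero_mem _, hy⟩
  have m2 : ∀ n, ∀ x ∈ A.gr (n + 1), ((x, 0) : A × B) ∈ (A.gr (n + 1)).prod (B.gr n) :=
    fun n x hx => ⟨hx, Submodule.zero_mem _⟩
  have c1 : ∀ n, ∀ y ∈ B.gr n, ψ (B.d y) = A.d (ψ y) ∧ φ (ψ y) + B.d (b y) + b (B.d y) = y := by
    intro n y hy
    have e := hDs n _ (m1 n y hy)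
    rw [e1 n y hy, hD, hD, neg_eq_zero.2 (map_zero A.d), map_zero φ, zero_add,
      e1 _ _ (B.d_mem n y hy)] at e
    obtain ⟨e3, e4⟩ := Prod.mk.inj e
    exact ⟨(neg_add_eq_zero.1 e3).symm, e4⟩
  have c2 : ∀ n, ∀ x ∈ A.gr (n + 1), ψ (φ x) = x + A.d (h x) + h (A.d x) := by
    intro n x hx
    have e := congrArg Prod.fst (hDs n _ (m2 n x hx))
    have e3 : ((-A.d x, φ x + B.d 0) : A × B) = (0, φ x) - (A.d x, 0) := by
      rw [map_zero, add_zero, Prod.mk_sub_mk, zero_sub, sub_zero]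
    rw [hD x 0, e3, map_sub, e1 _ _ (hφ.1 _ _ hx).1, Prod.fst_add, Prod.fst_sub,
      e2 _ _ (A.d_mem _ _ hx)] at e
    have e4 : (D (s n (x, 0))).1 = -A.d (h x) := by rw [← e2 n x hx]; rfl
    rw [e4] at e
    change -A.d (h x) + (ψ (φ x) - h (A.d x)) = x at e
    refine sub_eq_zero.1 (Eq.trans ?_ (sub_eq_zero.2 e))
    abel
  refine ⟨ψ, h, -b, ⟨fun n y hy => ?_, B.isGraded.ext fun n y hy => (c1 n y hy).1⟩, fun n x hx => ?_,
    fun n y hy => ?_, A.isGraded.ext fun n x hx => ?_, B.isGraded.ext fun n y hy => ?_⟩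
  · have e := (hs (n - 1) n (sub_add_cancel n 1) _ (m1 n y hy)).1
    rw [e1 n y hy, sub_add_cancel] at e
    rwa [add_zero]
  · have hx' : x ∈ A.gr (n - 1 + 1) := by rwa [sub_add_cancel]
    have e := (hs (n - 1 - 1) (n - 1) (sub_add_cancel _ 1) _ (m2 (n - 1) x hx')).1
    rw [sub_add_cancel] at e
    rw [← e2 _ x hx', ← sub_eq_add_neg]
    exact e
  · have e := (hs (n - 1) n (sub_add_cancel n 1) _ (m1 n y hy)).2
    rw [e1 n y hy] at e
    rw [← sub_eq_add_neg]
    exact Submodule.neg_mem _ e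
  · have hx' : x ∈ A.gr (n - 1 + 1) := by rwa [sub_add_cancel]
    simp only [LinearMap.sub_apply, LinearMap.comp_apply, LinearMap.add_apply, LinearMap.id_apply]
    rw [c2 (n - 1) x hx']
    abel
  · simp only [LinearMap.sub_apply, LinearMap.comp_apply, LinearMap.add_apply, LinearMap.id_apply,
      LinearMap.neg_apply, map_neg]
    refine sub_eq_zero.1 (Eq.trans ?_ (sub_eq_zero.2 (c1 n y hy).2))
    abel

/-! ### The mapping spaces as complete filtered complexes -/

/-- A series of linear maps with only finitely many non-zero values at each point. -/
theorem exists_sum_of_vanish {V W : Type u} [AddCommGroup V] [Module k V] [AddCommGroup W]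
    [Module k W] (S : ℕ → Submodule k V) (hS : ∀ x, ∃ s, x ∈ S s) (f : ℕ → V →ₗ[k] W)
    (hf : ∀ i, ∀ j ≤ i, ∀ x ∈ S j, f i x = 0) :
    ∃ F : V →ₗ[k] W, ∀ N, ∀ x ∈ S N, F x = ∑ i ∈ Finset.range N, f i x := by
  have h : ∀ x N, x ∈ S N → (Function.support fun i => f i x) ⊆ Finset.range N := by
    intro x N hx i hi
    by_contra h
    exact hi (hf i N (by simpa using h) x hx)
  have hfin : ∀ x, (Function.support fun i => f i x).Finite := fun x => by
    obtain ⟨N, hN⟩ := hS x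
    exact (Finset.finite_toSet _).subset (h x N hN)
  refine ⟨{ toFun := fun x => ∑ᶠ i, f i x, map_add' := fun x y => ?_, map_smul' := fun c x => ?_ },
    fun N x hx => finsum_eq_sum_of_support_subset _ (h x N hx)⟩
  · simp only [map_add]
    exact finsum_add_distrib (hfin x) (hfin y)
  · simp only [map_smul]
    exact (smul_finsum' c (hfin x)).symm

section

variable {C : Cooperad k} [CharZero k]

/-- The maps which vanish on a term of the coradical filtration. -/
def vanishing (Fil : C.Filtration) (A B : DGVect k) (p : ℕ) : Submodule k (Cofree C A →ₗ[k] B) where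
  carrier := {f | ∀ x ∈ Fil.lt A p, f x = 0}
  add_mem' hf hg x hx := by rw [LinearMap.add_apply, hf x hx, hg x hx, add_zero]
  zero_mem' _ _ := rfl
  smul_mem' c f hf x hx := by rw [LinearMap.smul_apply, hf x hx, smul_zero]

theorem mapDiff_mem_ariFil (hC : C.IsReduced) {A B : HoAlg C} (m : ℕ) {e : ℤ}
    {f : Cofree C A.A →ₗ[k] B.A} (hf : f ∈ ariFil A B m) : mapDiff A B e f ∈ ariFil A B m := by
  rw [← mapSp_br_one]
  exact br_mem_ariFil hC m le_rfl (fun _ => e) (fun _ => f) fun _ => hf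

/-- A term of the arity filtration of a mapping space, as a complete filtered complex. -/
def mapCx (hC : C.IsReduced) (Fil : C.Filtration) (A B : HoAlg C) (m : ℕ) : FiltCx k where
  carrier := Cofree C A.A →ₗ[k] B.A
  g n := (mapSp A B).gr n ⊓ ariFil A B m
  d := mapDiff A B
  fil := vanishing Fil A.A B.A
  d_mem {n n'} h f hf := by
    refine ⟨?_, mapDiff_mem_ariFil hC m hf.2⟩
    rw [← h, add_comm n 1]
    exact mapDiff_deg hf.1
  d_d {n n'} h f hf := by
    rw [← h, add_comm n 1]
    exact mapDiff_mapDiff hC hf.1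
  fil_zero := by
    refine eq_top_iff.2 fun f _ x hx => ?_
    rw [Fil.lt_zero, Submodule.mem_bot] at hx
    rw [hx, map_zero]
  d_fil p n f _ hf x hx := mapDiff_vanish hC hf hx
  -- Separatedness and completeness both rest on the exhaustiveness of the coradical filtration of
  -- the source: at each element only finitely many terms of a series of maps matter.
  separated f hf := LinearMap.ext fun x => by
    obtain ⟨p, hp⟩ := Fil.exists_mem_lt x
    exact hf p x hp
  complete n f hf := by
    obtain ⟨F, hF⟩ := exists_sum_of_vanish (Fil.lt A.A) Fil.exists_mem_lt f
      fun i j hj x hx => (hf i).2 x (Fil.lt_mono hj hx)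
    refine ⟨F, ⟨fun i x hx => ?_, mem_ariFil_iff.2 fun i hi x hx => ?_⟩, fun N x hx => ?_⟩
    · obtain ⟨N, hN⟩ := Fil.exists_mem_lt x
      rw [hF N x hN]
      exact Submodule.sum_mem _ fun j _ => (hf j).1.1 i x hx
    · obtain ⟨N, hN⟩ := Fil.exists_mem_lt x
      rw [hF N x hN]
      exact Finset.sum_eq_zero fun j _ => mem_ariFil_iff.1 (hf j).1.2 i hi x hx
    · rw [LinearMap.sub_apply, hF N x hx, LinearMap.sum_apply, sub_self]

end

/-! ### Invariance of the mapping spaces under quasi-isomorphisms -/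

theorem ksign_succ {m n : ℤ} (h : m + 1 = n) : ksign k (n : ZMod 2) = -ksign k (m : ZMod 2) := by
  rw [← h, Int.cast_add, ksign_add, Int.cast_one, ksign_one, mul_neg_one]

section

variable {C : Cooperad k} [CharZero k] {Fil : C.Filtration}

theorem conjOne_isFiltMap (hC : C.IsReduced) {A A' B B' : HoAlg C} (E : InftyHom A' A)
    (G : InftyHom B B') (m : ℕ) :
    FiltCx.IsFiltMap (X := mapCx hC Fil A B m) (Y := mapCx hC Fil A' B' m) (conjOne E G) where
  mem n f hf := by
    refine ⟨conjOne_deg E G hf.1, ?_⟩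
    have h := conj_mem_ariFil hC E G (fun _ : Fin 1 => n) (fun _ => m) (fun _ => f) fun _ => hf.2
    rw [Fin.sum_univ_one] at h
    exact h
  comm {n n'} h f hf := by
    rw [← h, add_comm n 1]
    exact conjOne_mapDiff hC E G hf.1
  filt p n f _ hf x hx := by
    have h : angOne A.A B.A n f (E.F x) = 0 := by
      rw [← Submodule.mem_bot k, ← Fil.lt_zero]
      exact angOne_mem_lt (t := 0) hf (by rw [zero_add]; exact E.F_mem_lt hC hx)
    exact (congrArg G.proj h).trans (map_zero _)

theorem conjOne_id_right {A A' B : HoAlg C} (E : InftyHom A' A) (e : ℤ)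
    (f : Cofree C A.A →ₗ[k] B.A) : conjOne E (InftyHom.id B) e f = f ∘ₗ E.F := by
  change proj C B.A ∘ₗ angOne A.A B.A e f ∘ₗ E.F = f ∘ₗ E.F
  rw [← LinearMap.comp_assoc, proj_angOne]

/-- To leading order `angOne f` takes values in the cogenerators, where G' is the linear term of G.
-/
theorem conjOne_id_left_apply {A B B' : HoAlg C} (G : InftyHom B B') (e : ℤ) {p : ℕ}
    {f : Cofree C A.A →ₗ[k] B.A} (hf : f ∈ vanishing Fil A.A B.A p) {x : Cofree C A.A}
    (hx : x ∈ Fil.lt A.A (p + 1)) :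
    conjOne (InftyHom.id A) G e f x = G.linearTerm (f x) :=
  congrArg G.proj (angOne_eq_incl hf hx)

theorem comp_mem_ariFil {A A' B B' : HoAlg C} {m : ℕ} {f : Cofree C A.A →ₗ[k] B.A}
    (hf : f ∈ ariFil A B m) (g : B.A →ₗ[k] B'.A) {T : Cofree C A'.A →ₗ[k] Cofree C A.A}
    (hT : ∀ N, ∀ x ∈ arLe C A'.A N, T x ∈ arLe C A.A N) : g ∘ₗ f ∘ₗ T ∈ ariFil A' B' m :=
  mem_ariFil_iff.2 fun n hn x hx => by
    rw [LinearMap.comp_apply, LinearMap.comp_apply, mem_ariFil_iff.1 hf n hn _ (hT n x hx), map_zero]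

theorem comp_mem_vanishing {A A' B B' : DGVect k} {p : ℕ} {f : Cofree C A →ₗ[k] B}
    (hf : f ∈ vanishing Fil A B p) (g : B →ₗ[k] B') {T : Cofree C A' →ₗ[k] Cofree C A}
    (hT : ∀ x ∈ Fil.lt A' p, T x ∈ Fil.lt A p) : g ∘ₗ f ∘ₗ T ∈ vanishing Fil A' B' p :=
  fun x hx => by rw [LinearMap.comp_apply, LinearMap.comp_apply, hf _ (hT x hx), map_zero]

/-- The leading term of the homotopy given by composition with a homotopy of the target. -/
theorem post_homotopy (hC : C.IsReduced) {A B : HoAlg C} {θ h : B.A →ₗ[k] B.A}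
    (hh : θ - LinearMap.id = B.A.d ∘ₗ h + h ∘ₗ B.A.d) {m n : ℤ} (hm : m + 1 = n) {p : ℕ}
    {f : Cofree C A.A →ₗ[k] B.A} (hf : f ∈ vanishing Fil A.A B.A p) {x : Cofree C A.A}
    (hx : x ∈ Fil.lt A.A (p + 1)) :
    θ (f x) - f x - mapDiff A B m (h ∘ₗ f) x - h (mapDiff A B n f x) = 0 := by
  have h1 : θ (f x) - f x = B.A.d (h (f x)) + h (B.A.d (f x)) := LinearMap.congr_fun hh (f x)
  have hhf : ∀ x ∈ Fil.lt A.A p, (h ∘ₗ f) x = 0 := fun x hx => by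
    rw [LinearMap.comp_apply, hf x hx, map_zero]
  rw [h1, mapDiff_lt_succ hC hf hx, mapDiff_lt_succ hC hhf hx, ksign_succ hm, map_sub, map_smul,
    LinearMap.comp_apply, LinearMap.comp_apply, neg_smul]
  abel

/-- The leading term of the homotopy given by composition with a homotopy of the source. -/
theorem pre_homotopy (hC : C.IsReduced) {A B : HoAlg C} {θ h : A.A →ₗ[k] A.A}
    (hθ : IsChain A.A.toDGData A.A.toDGData θ) (hd : HasDegree A.A.toDGData A.A.toDGData (-1) h)
    (hh : θ - LinearMap.id = A.A.d ∘ₗ h + h ∘ₗ A.A.d) {m n n' : ℤ} (hm : m + 1 = n)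
    (hn : n + 1 = n') {p : ℕ}
    {f : Cofree C A.A →ₗ[k] B.A} (hf : f ∈ vanishing Fil A.A B.A p) {x : Cofree C A.A}
    (hx : x ∈ Fil.lt A.A (p + 1)) :
    f (Cofree.map C θ x) - f x -
      mapDiff A B m (ksign k (n : ZMod 2) • (f ∘ₗ Cofree.htp C θ h)) x -
      ksign k (n' : ZMod 2) • mapDiff A B n f (Cofree.htp C θ h x) = 0 := by
  have h1 := congrArg f (Cofree.htp_d hθ hd hh x)
  rw [map_sub, map_add] at h1
  have hfh : ∀ x ∈ Fil.lt A.A p, (f ∘ₗ Cofree.htp C θ h) x = 0 := fun x hx =>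
    hf _ (Cofree.htp_mem_lt hx)
  -- The sign `(-1)ⁿ` in the homotopy makes the two terms with the differential of `B` cancel, while
  -- the terms with the differential of C(A) add up to f applied to the homotopy identity.
  have hs := ksign_mul_self (k := k) (n : ZMod 2)
  have hm' : ksign k (m : ZMod 2) = -ksign k (n : ZMod 2) := by rw [ksign_succ hm, neg_neg]
  rw [← h1, map_smul, LinearMap.smul_apply, mapDiff_lt_succ hC hf (Cofree.htp_mem_lt hx),
    mapDiff_lt_succ hC hfh hx, ksign_succ hn, hm', smul_sub, smul_sub, neg_smul, neg_smul,
    neg_smul, smul_neg, smul_smul, smul_smul, hs, one_smul, one_smul, LinearMap.comp_apply,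
    LinearMap.comp_apply]
  abel

/-- The approximate inverse and homotopies are compositions on the left with ψ, h and h'. To leading
order the differential involves only the ∂'s, and the linear term of the induced morphism is
composition with φ. -/
theorem conjOne_id_left_isQuasiIso (hC : C.IsReduced) (Fil : C.Filtration) (A : HoAlg C)
    {B B' : HoAlg C} (G : InftyHom B B') (hG : G.IsInftyQuasiIso) (m : ℕ) :
    IsQuasiIso (fun n => (mapSp A B).gr n ⊓ ariFil A B m) (fun n => mapDiff A B n)
      (fun n => (mapSp A B').gr n ⊓ ariFil A B' m) (fun n => mapDiff A B' n)
      (fun n => conjOne (InftyHom.id A) G n) := by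
  obtain ⟨ψ, h, h', hψ, hh, hh', e, e'⟩ := exists_homotopy_inverse hG
  have hψd : ∀ y, ψ (B'.A.d y) = B.A.d (ψ y) := LinearMap.congr_fun hψ.comm
  have hψf : ∀ (p : ℕ) (f : Cofree C A.A →ₗ[k] B'.A), f ∈ vanishing Fil A.A B'.A p →
      ψ ∘ₗ f ∈ vanishing Fil A.A B.A p := fun p f hf => comp_mem_vanishing hf ψ (T := .id) fun _ h => h
  refine (conjOne_isFiltMap (Fil := Fil) hC (InftyHom.id A) G m).isQuasiIso_of_homotopy
    (fun _ => sandwich ψ LinearMap.id) (fun _ => sandwich h LinearMap.id)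
    (fun _ => sandwich h' LinearMap.id) ?_ ?_ ?_ ?_ ?_ ?_ ?_ ?_ ?_
  · exact fun n f hf => ⟨(HasDegree.comp hψ.deg hf.1).of_eq (add_zero n),
      comp_mem_ariFil hf.2 ψ (T := .id) fun _ _ h => h⟩
  · exact fun p n f hf => hψf p f hf
  · exact fun {m n} hm f hf => ⟨(HasDegree.comp hh hf.1).of_eq (by omega),
      comp_mem_ariFil hf.2 h (T := .id) fun _ _ h => h⟩
  · exact fun p n f hf => comp_mem_vanishing hf h (T := .id) fun _ h => h
  · exact fun {m n} hm f hf => ⟨(HasDegree.comp hh' hf.1).of_eq (by omega),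
      comp_mem_ariFil hf.2 h' (T := .id) fun _ _ h => h⟩
  · exact fun p n f hf => comp_mem_vanishing hf h' (T := .id) fun _ h => h
  · intro n n' hn p (f : Cofree C A.A →ₗ[k] B'.A) _ (hf : f ∈ vanishing Fil A.A B'.A p) x hx
    change mapDiff A B n (ψ ∘ₗ f) x - ψ (mapDiff A B' n f x) = 0
    rw [mapDiff_lt_succ hC (hψf p f hf) hx, mapDiff_lt_succ hC hf hx, map_sub, map_smul, hψd]
    exact sub_self _
  · intro l n n' hm _ p (f : Cofree C A.A →ₗ[k] B.A) _ (hf : f ∈ vanishing Fil A.A B.A p) x hx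
    refine Eq.trans ?_ (post_homotopy hC e hm hf hx)
    change ψ (conjOne (InftyHom.id A) G n f x) - f x - mapDiff A B l (h ∘ₗ f) x -
      h (mapDiff A B n f x) = _
    rw [conjOne_id_left_apply G n hf hx]
    rfl
  · intro l n n' hm _ p (f : Cofree C A.A →ₗ[k] B'.A) _
      (hf : f ∈ vanishing Fil A.A B'.A p) x hx
    refine Eq.trans ?_ (post_homotopy hC e' hm hf hx)
    change conjOne (InftyHom.id A) G n (ψ ∘ₗ f) x - f x - mapDiff A B' l (h' ∘ₗ f) x -
      h' (mapDiff A B' n f x) = _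
    rw [conjOne_id_left_apply G n (hψf p f hf) hx]
    rfl

/-- The approximate inverse is composition on the right with the map of cofree coalgebras induced by
ψ, and the homotopies are compositions on the right with the induced homotopies of C(A) and C(A').
-/
theorem conjOne_id_right_isQuasiIso (hC : C.IsReduced) (Fil : C.Filtration) {A A' : HoAlg C}
    (B : HoAlg C) (E : InftyHom A' A) (hE : E.IsInftyQuasiIso) (m : ℕ) :
    IsQuasiIso (fun n => (mapSp A B).gr n ⊓ ariFil A B m) (fun n => mapDiff A B n)
      (fun n => (mapSp A' B).gr n ⊓ ariFil A' B m) (fun n => mapDiff A' B n)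
      (fun n => conjOne E (InftyHom.id B) n) := by
  obtain ⟨ψ, h, h', hψ, hh, hh', e, e'⟩ := exists_homotopy_inverse hE
  have hφ := isChain_of_isQuasiIso hE
  set φ := E.linearTerm with hφdef
  have hψφ : IsChain A'.A.toDGData A'.A.toDGData (ψ ∘ₗ φ) :=
    ⟨(hψ.deg.comp hφ.deg).of_eq (add_zero 0), by
      rw [LinearMap.comp_assoc, hφ.comm, ← LinearMap.comp_assoc, hψ.comm, LinearMap.comp_assoc]⟩
  have hφψ : IsChain A.A.toDGData A.A.toDGData (φ ∘ₗ ψ) :=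
    ⟨(hφ.deg.comp hψ.deg).of_eq (add_zero 0), by
      rw [LinearMap.comp_assoc, hψ.comm, ← LinearMap.comp_assoc, hφ.comm, LinearMap.comp_assoc]⟩
  have hTd : ∀ x, Cofree.map C ψ ((cofree C A.A).d x) = (cofree C A'.A).d (Cofree.map C ψ x) :=
    LinearMap.congr_fun (Cofree.map_d hψ)
  -- To leading order E may be replaced by the map induced by its linear term: their difference
  -- lowers the filtration into the term on which `f` vanishes.
  have hF : ∀ (p : ℕ) (f : Cofree C A.A →ₗ[k] B.A), f ∈ vanishing Fil A.A B.A p →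
      ∀ x ∈ Fil.lt A'.A (p + 1), f (E.F x) = f (Cofree.map C φ x) := fun p f hf x hx => by
    rw [← sub_eq_zero, ← map_sub]
    exact hf _ (E.F_sub_map_mem_lt hC hφ.deg hx)
  have hfT : ∀ (p : ℕ) (f : Cofree C A'.A →ₗ[k] B.A), f ∈ vanishing Fil A'.A B.A p →
      f ∘ₗ Cofree.map C ψ ∈ vanishing Fil A.A B.A p := fun p f hf =>
    comp_mem_vanishing hf LinearMap.id fun _ hx => Cofree.map_mem_lt hψ.deg hx
  have hmap : ∀ x, Cofree.map C φ (Cofree.map C ψ x) = Cofree.map C (φ ∘ₗ ψ) x := fun x => by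
    rw [Cofree.map_comp hψ.deg hφ.deg, LinearMap.comp_apply]
  have hmap' : ∀ x, Cofree.map C ψ (Cofree.map C φ x) = Cofree.map C (ψ ∘ₗ φ) x := fun x => by
    rw [Cofree.map_comp hφ.deg hψ.deg, LinearMap.comp_apply]
  refine (conjOne_isFiltMap (Fil := Fil) hC E (InftyHom.id B) m).isQuasiIso_of_homotopy
    (fun _ => sandwich LinearMap.id (Cofree.map C ψ))
    (fun n => ksign k (n : ZMod 2) • sandwich LinearMap.id (Cofree.htp C (φ ∘ₗ ψ) h'))
    (fun n => ksign k (n : ZMod 2) • sandwich LinearMap.id (Cofree.htp C (ψ ∘ₗ φ) h))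
    ?_ ?_ ?_ ?_ ?_ ?_ ?_ ?_ ?_
  · exact fun n f hf => ⟨(HasDegree.comp hf.1 (Cofree.map_deg hψ.deg)).of_eq (zero_add n),
      comp_mem_ariFil (B' := B) hf.2 LinearMap.id fun _ _ hx => Cofree.map_mem_arLe hψ.deg hx⟩
  · exact fun p n f hf => hfT p f hf
  · exact fun {m n} hm f hf => Submodule.smul_mem _ _
      ⟨(HasDegree.comp hf.1 (Cofree.htp_deg hφψ.deg hh')).of_eq (by omega),
        comp_mem_ariFil (B' := B) hf.2 LinearMap.id fun _ _ hx => Cofree.htp_mem_arLe hx⟩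
  · exact fun p n f hf => Submodule.smul_mem _ _
      (comp_mem_vanishing hf LinearMap.id fun _ hx => Cofree.htp_mem_lt hx)
  · exact fun {m n} hm f hf => Submodule.smul_mem _ _
      ⟨(HasDegree.comp hf.1 (Cofree.htp_deg hψφ.deg hh)).of_eq (by omega),
        comp_mem_ariFil (B' := B) hf.2 LinearMap.id fun _ _ hx => Cofree.htp_mem_arLe hx⟩
  · exact fun p n f hf => Submodule.smul_mem _ _
      (comp_mem_vanishing hf LinearMap.id fun _ hx => Cofree.htp_mem_lt hx)
  · intro n n' hn p (f : Cofree C A'.A →ₗ[k] B.A) _ (hf : f ∈ vanishing Fil A'.A B.A p) x hx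
    change mapDiff A B n (f ∘ₗ Cofree.map C ψ) x - mapDiff A' B n f (Cofree.map C ψ x) = 0
    rw [mapDiff_lt_succ hC (hfT p f hf) hx, mapDiff_lt_succ hC hf (Cofree.map_mem_lt hψ.deg hx),
      LinearMap.comp_apply, LinearMap.comp_apply, hTd]
    exact sub_self _
  · intro l n n' hm hn p (f : Cofree C A.A →ₗ[k] B.A) _
      (hf : f ∈ vanishing Fil A.A B.A p) x hx
    refine Eq.trans ?_ (pre_homotopy hC hφψ hh' e' hm hn hf hx)
    change conjOne E (InftyHom.id B) n f (Cofree.map C ψ x) - f x -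
      mapDiff A B l (ksign k (n : ZMod 2) • (f ∘ₗ Cofree.htp C (φ ∘ₗ ψ) h')) x -
      ksign k (n' : ZMod 2) • mapDiff A B n f (Cofree.htp C (φ ∘ₗ ψ) h' x) = _
    rw [conjOne_id_right, LinearMap.comp_apply, hF p f hf _ (Cofree.map_mem_lt hψ.deg hx), hmap]
  · intro l n n' hm hn p (f : Cofree C A'.A →ₗ[k] B.A) _
      (hf : f ∈ vanishing Fil A'.A B.A p) x hx
    refine Eq.trans ?_ (pre_homotopy hC hψφ hh e hm hn hf hx)
    change conjOne E (InftyHom.id B) n (f ∘ₗ Cofree.map C ψ) x - f x -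
      mapDiff A' B l (ksign k (n : ZMod 2) • (f ∘ₗ Cofree.htp C (ψ ∘ₗ φ) h)) x -
      ksign k (n' : ZMod 2) • mapDiff A' B n f (Cofree.htp C (ψ ∘ₗ φ) h x) = _
    rw [conjOne_id_right, LinearMap.comp_apply, hF p _ (hfT p f hf) _ hx, LinearMap.comp_apply,
      hmap']

theorem conj_restrict_isSLieQuasiIso (hC : C.IsReduced) {A A' B B' : HoAlg C} (E : InftyHom A' A)
    (G : InftyHom B B') (m : ℕ)
    (h : IsQuasiIso (fun n => (mapSp A B).gr n ⊓ ariFil A B m) (fun n => mapDiff A B n)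
      (fun n => (mapSp A' B').gr n ⊓ ariFil A' B' m) (fun n => mapDiff A' B' n)
      (fun n => conjOne E G n)) :
    IsSLieQuasiIso ((mapSp A B).restrict (ariFil A B m)) ((mapSp A' B').restrict (ariFil A' B' m))
      (conj E G) := by
  refine ⟨conj_restrict_isSLieHom hC E G m, ?_⟩
  have e : ∀ (A B : HoAlg C), (fun (n : ℤ) (f : mapSp A B) => (mapSp A B).br 1 (fun _ => n) fun _ => f) =
      fun n f => mapDiff A B n f := fun A B => funext fun n => funext fun f => mapSp_br_one A B n f
  have h' := h
  rw [← e A B, ← e A' B'] at h'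
  exact h'

end

end HoAlgebra

end

/-! ### The theorem, from the two cases of `conj`. -/

theorem mainTheorem7 {k : Type*} [Field k] [CharZero k] (C : HoAlgebra.Cooperad k)
    (hC : C.IsReduced) (Fil : C.Filtration) (A₁ A₂ A₃ : HoAlgebra.HoAlg C)
    (F : HoAlgebra.InftyHom A₁ A₂) :
    (HoAlgebra.IsSLieHom (HoAlgebra.mapSp A₃ A₁) (HoAlgebra.mapSp A₃ A₂)
        (HoAlgebra.postcomp F A₃) ∧
      HoAlgebra.IsFiltered (HoAlgebra.postcomp F A₃)) ∧
    (HoAlgebra.IsSLieHom (HoAlgebra.mapSp A₂ A₃) (HoAlgebra.mapSp A₁ A₃)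
        (HoAlgebra.precomp F A₃) ∧
      HoAlgebra.IsFiltered (HoAlgebra.precomp F A₃)) ∧
    (F.IsInftyQuasiIso → ∀ m : ℕ, 1 ≤ m →
      HoAlgebra.IsSLieQuasiIso
        ((HoAlgebra.mapSp A₃ A₁).restrict (HoAlgebra.ariFil A₃ A₁ m))
        ((HoAlgebra.mapSp A₃ A₂).restrict (HoAlgebra.ariFil A₃ A₂ m))
        (HoAlgebra.postcomp F A₃) ∧
      HoAlgebra.IsSLieQuasiIso
        ((HoAlgebra.mapSp A₂ A₃).restrict (HoAlgebra.ariFil A₂ A₃ m))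
        ((HoAlgebra.mapSp A₁ A₃).restrict (HoAlgebra.ariFil A₁ A₃ m))
        (HoAlgebra.precomp F A₃)) := by
  refine ⟨?_, ?_, fun hF m _ => ⟨?_, ?_⟩⟩
  · rw [HoAlgebra.postcomp_eq_conj]
    exact ⟨HoAlgebra.conj_isSLieHom hC _ F, HoAlgebra.conj_isFiltered hC _ F⟩
  · rw [HoAlgebra.precomp_eq_conj hC]
    exact ⟨HoAlgebra.conj_isSLieHom hC F _, HoAlgebra.conj_isFiltered hC F _⟩
  · rw [HoAlgebra.postcomp_eq_conj]
    exact HoAlgebra.conj_restrict_isSLieQuasiIso hC _ F m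
      (HoAlgebra.conjOne_id_left_isQuasiIso hC Fil A₃ F hF m)
  · rw [HoAlgebra.precomp_eq_conj hC]
    exact HoAlgebra.conj_restrict_isSLieQuasiIso hC F _ m
      (HoAlgebra.conjOne_id_right_isQuasiIso hC Fil A₃ F hF m)
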